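/- Let $\mathbb T^2=\mathbb R^2/(2\pi\mathbb Z)^2$ and let $(\Omega,\mathcal F,\mathbb P)$ be a probability space. Let $\mathscr W=(\mathscr W_1,\mathscr W_2,\mathscr W_3)$ be a 3D white noise on $\mathbb T^2$ whose third component has zero mean, that is, $$\mathscr W_j=\eta_j+\operatorname{Re}\Big[\sum_{k\in\mathbb Z^2\setminus\{0\}}\eta_{kj}\,e^{i(k,x)}\Big]\quad\text{in }\mathcal D'(\mathbb T^2)\text{ almost surely},\qquad j=1,2,3,$$ where $\eta_3=0$; each of $\eta_1,\eta_2$ is a standard real Gaussian variable, or is $0$ if the corresponding component also has zero mean; the $\eta_{kj}$ are identically distributed centred complex Gaussian variables whose real and imaginary parts are independent with a common variance $s>0$ (a standard complex Gaussian has $s=\frac12$, or $s=1$, according to the convention); and all these variables are independent. Let $\rho\ge 0$ be a smooth function on $\mathbb R^2$ supported in the closed unit ball with $\int\rho=1$ (for instance the standard mollifier), $\rho_\varepsilon(x)=\varepsilon^{-2}\rho(x/\varepsilon)$ and $\mathscr W_j^\varepsilon=\rho_\varepsilon*\mathscr W_j$. Let $\kappa\in(0,\frac12)$ and $\partial_{\bar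 z}=\frac12(\partial_x+i\partial_y)$. For $\alpha<0$, let $\mathcal C^{\alpha}(\mathbb T^2)$ be the space of distributions $f$ on $\mathbb T^2$ with finite norm $$\sup\big\{\lambda^{-\alpha}\,|f(\varphi^\lambda_y)|\;:\; y\in\mathbb T^2,\ \lambda\in(0,1],\ \varphi\in C_c^\infty(B_1(0)),\ \|\partial^k\varphi\|_\infty\le 1\text{ for }|k|\le r\big\},$$ where $r$ is the smallest positive integer larger than $-\alpha$ and $\varphi^\lambda_y(z)=\lambda^{-2}\varphi((z-y)/\lambda)$ is extended periodically; for $\mathbb C^3$-valued $f$ let $\|f\|_{\mathcal C^\alpha}^2$ be the sum of the squared norms of the real and imaginary parts of the components. Then for every $\delta>0$ there are $\sigma>0$, an event $\Omega_\delta\in\mathcal F$ with $\mathbb P(\Omega_\delta)>1-\delta$ and a constant $C$ such that for every $\gamma=(\gamma_1,\gamma_2,\gamma_3)\in\mathbb R^3$ with $|\gamma|<\sigma$ and every $\omega\in\Omega_\delta$ the following holds. For every $\varepsilon>0$ the system $$\begin{aligned} \partial_{\bar z} r_1^\varepsilon&=r_2^\varepsilon\overline{r_3^\varepsilon}-\overline{r_2^\varepsilon}\,r_3^\varepsilon+\gamma_1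 i\,\mathscr W_1^\varepsilon,\\ \partial_{\bar z} r_2^\varepsilon&=\overline{r_1^\varepsilon}\,r_3^\varepsilon-r_1^\varepsilon\overline{r_3^\varepsilon}+\gamma_2 i\,\mathscr W_2^\varepsilon,\\ \partial_{\bar z} r_3^\varepsilon&=r_1^\varepsilon\overline{r_2^\varepsilon}-\overline{r_1^\varepsilon}\,r_2^\varepsilon+\gamma_3 i\,\mathscr W_3^\varepsilon \end{aligned}$$ has a classical solution $r^\varepsilon=(r_1^\varepsilon,r_2^\varepsilon,r_3^\varepsilon)\in C^\infty(\mathbb T^2,\mathbb C^3)$ such that the limit $r=\lim_{\varepsilon\to0}r^\varepsilon$ exists in $\mathcal C^{-\kappa}(\mathbb T^2)$, and $$\|r^\varepsilon-r\|_{\mathcal C^{-\kappa}(\mathbb T^2)}\le C\,\varepsilon^{\kappa/8}\qquad\text{for all }\varepsilon>0,$$ where $C$ does not depend on $\varepsilon$, $\omega\in\Omega_\delta$ or $\gamma$. (Such a limit $r$ is, by definition, a solution of $\partial_{\bar z}r=r\times\overline r+i\gamma\mathscr W$, where $\gamma\mathscr W=(\gamma_1\mathscr W_1,\gamma_2\mathscr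 W_2,\gamma_3\mathscr W_3)$.) -/

import Mathlib

open MeasureTheory ProbabilityTheory Filter Topology Distributions
open scoped NNReal ENNReal

/-! ## The torus `𝕋² = ℝ² / (2πℤ)²`

Functions on the torus are `2π`-periodic functions on the plane. -/

/-- The Euclidean plane `ℝ²`. -/
abbrev Plane : Type := EuclideanSpace ℝ (Fin 2)

/-- The lattice vector `2πn`. -/
noncomputable def latticePt (n : Fin 2 → ℤ) : Plane :=
  WithLp.toLp 2 fun i => 2 * Real.pi * (n i : ℝ)

/-- The fundamental cell `(-π, π]²`. -/
def cell : Set Plane := {x | ∀ i, x i ∈ Set.Ioc (-Real.pi) Real.pi}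

/-- `C^∞(𝕋², ℂ) = 𝓓(𝕋²)`: smooth functions on the plane which are `2π`-periodic in each variable. -/
def TorusTest : Submodule ℂ (Plane → ℂ) where
  carrier := {f | ContDiff ℝ (⊤ : ℕ∞) f ∧ ∀ x n, f (x + latticePt n) = f x}
  add_mem' := by
    rintro f g ⟨hf, hf'⟩ ⟨hg, hg'⟩
    exact ⟨hf.add hg, fun x n => by simp [hf', hg']⟩
  zero_mem' := ⟨contDiff_const, fun _ _ => rfl⟩
  smul_mem' := by
    rintro c f ⟨hf, hf'⟩
    exact ⟨contDiff_const.smul hf, fun x n => by simp [hf']⟩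

/-- `𝓓'(𝕋²)`: linear functionals on `𝓓(𝕋²)` which are continuous for the Fréchet topology given by
the sup norms of the derivatives, i.e. bounded by finitely many of these seminorms. -/
def TorusDistribution : Submodule ℂ (Module.Dual ℂ TorusTest) where
  carrier := {T | ∃ (N : ℕ) (C : ℝ), ∀ (φ : TorusTest) (B : ℝ),
    (∀ m ≤ N, ∀ x, ‖iteratedFDeriv ℝ m (φ : Plane → ℂ) x‖ ≤ B) → ‖T φ‖ ≤ C * B}
  add_mem' := by
    rintro S T ⟨N, C, hS⟩ ⟨M, D, hT⟩
    refine ⟨max N M, C + D, fun φ B h => ?_⟩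
    have h1 := hS φ B fun m hm => h m (hm.trans (le_max_left _ _))
    have h2 := hT φ B fun m hm => h m (hm.trans (le_max_right _ _))
    calc ‖(S + T) φ‖ ≤ ‖S φ‖ + ‖T φ‖ := norm_add_le _ _
      _ ≤ (C + D) * B := by linarith
  zero_mem' := ⟨0, 0, fun φ B _ => by simp⟩
  smul_mem' := by
    rintro c T ⟨N, C, hT⟩
    refine ⟨N, ‖c‖ * C, fun φ B h => ?_⟩
    have h1 := hT φ B h
    calc ‖(c • T) φ‖ = ‖c‖ * ‖T φ‖ := norm_mul _ _
      _ ≤ ‖c‖ * (C * B) := by gcongr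
      _ = ‖c‖ * C * B := by ring

/-- The value `T(φ)` of a distribution on a test function. -/
def pairing (T : TorusDistribution) (φ : TorusTest) : ℂ :=
  (T : Module.Dual ℂ TorusTest) φ

theorem isBounded_cell : Bornology.IsBounded cell := by
  refine (Metric.isBounded_closedBall (x := (0 : Plane)) (r := Real.sqrt 2 * Real.pi)).subset ?_
  intro x hx
  rw [mem_closedBall_zero_iff, EuclideanSpace.norm_eq]
  have hpi : 0 ≤ Real.pi := Real.pi_pos.le
  have h : ∀ i, ‖x i‖ ^ 2 ≤ Real.pi ^ 2 := by
    intro i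
    have := hx i
    rw [Real.norm_eq_abs, sq_abs]
    nlinarith [this.1, this.2]
  calc Real.sqrt (∑ i, ‖x i‖ ^ 2) ≤ Real.sqrt (2 * Real.pi ^ 2) := by
        apply Real.sqrt_le_sqrt
        rw [Fin.sum_univ_two]
        linarith [h 0, h 1]
    _ = Real.sqrt 2 * Real.pi := by
        rw [Real.sqrt_mul (by norm_num), Real.sqrt_sq hpi]

theorem measurableSet_cell : MeasurableSet cell := by
  have : cell = ⋂ i, (fun x : Plane => x i) ⁻¹' Set.Ioc (-Real.pi) Real.pi := by
    ext x; simp [cell]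
  rw [this]
  exact MeasurableSet.iInter fun i =>
    (measurable_pi_apply i |>.comp (WithLp.measurable_ofLp 2 _)) measurableSet_Ioc

theorem Continuous.integrableOn_cell {f : Plane → ℂ} (hf : Continuous f) :
    IntegrableOn f cell := by
  have hc : IsCompact (closure cell) := isBounded_cell.isCompact_closure
  exact (hf.continuousOn.integrableOn_compact hc).mono_set subset_closure

/-- A smooth function `f` on the torus as the distribution `φ ↦ ∫_{𝕋²} f φ`. -/
noncomputable def toDistribution (f : TorusTest) : TorusDistribution :=
  ⟨{ toFun := fun φ => ∫ x in cell, (f : Plane → ℂ) x * (φ : Plane → ℂ) x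
     map_add' := by
      intro φ ψ
      rw [← integral_add]
      · simp [mul_add]
      · exact (f.2.1.continuous.mul φ.2.1.continuous).integrableOn_cell
      · exact (f.2.1.continuous.mul ψ.2.1.continuous).integrableOn_cell
     map_smul' := by
      intro c φ
      rw [RingHom.id_apply, smul_eq_mul, ← integral_const_mul]
      simp [mul_left_comm] },
   by
    refine ⟨0, ∫ x in cell, ‖(f : Plane → ℂ) x‖, fun φ B h => ?_⟩
    have hB : ∀ x, ‖(φ : Plane → ℂ) x‖ ≤ B := fun x => by simpa using h 0 le_rfl x
    rw [← integral_mul_const]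
    refine norm_integral_le_of_norm_le (f.2.1.continuous.integrableOn_cell.norm.mul_const B) ?_
    refine Eventually.of_forall fun x => ?_
    rw [norm_mul]
    exact mul_le_mul_of_nonneg_left (hB x) (norm_nonneg _)⟩

/-! ## Periodisation of compactly supported functions -/

theorem norm_latticePt_ge (n : Fin 2 → ℤ) (i : Fin 2) : |(n i : ℝ)| ≤ ‖latticePt n‖ := by
  have h1 : ‖latticePt n i‖ ≤ ‖latticePt n‖ := PiLp.norm_apply_le _ _
  have h2 : ‖latticePt n i‖ = 2 * Real.pi * |(n i : ℝ)| := by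
    simp [latticePt, abs_of_pos Real.pi_pos]
  have h3 : (1 : ℝ) ≤ 2 * Real.pi := by linarith [Real.pi_gt_three]
  nlinarith [abs_nonneg (n i : ℝ)]

theorem locallyFinite_translates {f : Plane → ℝ} (hc : HasCompactSupport f) :
    LocallyFinite fun n : Fin 2 → ℤ =>
      Function.support fun x => ((f (x + latticePt n) : ℝ) : ℂ) := by
  obtain ⟨R, hR⟩ := hc.isCompact.isBounded.subset_closedBall (0 : Plane)
  intro x
  refine ⟨Metric.ball x 1, Metric.ball_mem_nhds x one_pos, ?_⟩
  set M : ℝ := R + ‖x‖ + 1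
  refine (Set.Finite.pi' (fun _ : Fin 2 => Set.finite_Icc (-⌈M⌉) ⌈M⌉)).subset ?_
  rintro n ⟨y, hy, hyx⟩ i
  have h1 : f (y + latticePt n) ≠ 0 := by simpa using hy
  have h2 := hR (subset_tsupport f h1)
  rw [mem_closedBall_zero_iff] at h2
  have h3 : ‖y‖ ≤ ‖x‖ + 1 := by
    have := norm_sub_norm_le y x
    rw [Metric.mem_ball, dist_eq_norm] at hyx
    linarith
  have h4 : ‖latticePt n‖ ≤ ‖y + latticePt n‖ + ‖y‖ := by
    simpa using norm_sub_le (y + latticePt n) y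
  have h5 : |(n i : ℝ)| ≤ ⌈M⌉ :=
    (norm_latticePt_ge n i).trans (le_trans (by simp only [M]; linarith) (Int.le_ceil M))
  rw [Set.mem_Icc, ← abs_le]
  exact_mod_cast h5

theorem latticePt_add (m n : Fin 2 → ℤ) : latticePt (m + n) = latticePt m + latticePt n := by
  ext i
  simp [latticePt, mul_add]

/-- The periodisation `x ↦ ∑_{n ∈ ℤ²} f (x + 2πn)` of a smooth compactly supported function on the
plane, as a smooth function on the torus. -/
noncomputable def periodize (f : 𝓓((⊤ : TopologicalSpace.Opens Plane), ℝ)) : TorusTest :=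
  ⟨fun x => ∑ᶠ n : Fin 2 → ℤ, ((f (x + latticePt n) : ℝ) : ℂ), by
    constructor
    · rw [← contMDiff_iff_contDiff]
      refine contMDiff_finsum (fun n => ?_) (locallyFinite_translates f.hasCompactSupport)
      rw [contMDiff_iff_contDiff]
      exact Complex.ofRealCLM.contDiff.comp
        (f.contDiff.comp (contDiff_id.add contDiff_const))
    · intro x m
      have := finsum_comp_equiv (Equiv.addLeft m)
        (f := fun n : Fin 2 → ℤ => ((f (x + latticePt n) : ℝ) : ℂ))
      simpa [latticePt_add, add_assoc] using this⟩

/-- The function `z ↦ c² f (c (z - y))`, for `c ≠ 0`. -/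
noncomputable def dilate (f : Plane → ℝ) (hf : ContDiff ℝ (⊤ : ℕ∞) f) (hc : HasCompactSupport f)
    (c : ℝ) (hc0 : c ≠ 0) (y : Plane) : 𝓓((⊤ : TopologicalSpace.Opens Plane), ℝ) where
  toFun z := c ^ 2 * f (c • (z - y))
  contDiff' := contDiff_const.mul (hf.comp ((contDiff_id.sub contDiff_const).const_smul c))
  hasCompactSupport' := by
    have h : HasCompactSupport fun z : Plane => f (c • (z - y)) :=
      hc.comp_homeomorph ((Homeomorph.subRight y).trans (Homeomorph.smulOfNeZero c hc0))
    exact h.mul_left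
  tsupport_subset' := fun _ _ => trivial

/-! ## Hölder spaces of negative order -/

/-- The open unit ball of the plane. -/
def unitBall : TopologicalSpace.Opens Plane := ⟨Metric.ball 0 1, Metric.isOpen_ball⟩

/-- The rescaled centred test function `φ^l_y (z) = l⁻² φ ((z - y) / l)`, `l > 0`, extended
periodically to the torus. -/
noncomputable def rescaled (φ : 𝓓(unitBall, ℝ)) (l : ℝ) (hl : 0 < l) (y : Plane) : TorusTest :=
  periodize (dilate φ φ.contDiff φ.hasCompactSupport l⁻¹ (inv_ne_zero hl.ne') y)

/-- Test functions supported in the unit ball all of whose partial derivatives of order at most `r`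
are bounded by `1`. -/
def unitTests (r : ℕ) : Set 𝓓(unitBall, ℝ) :=
  {φ | ∀ m ≤ r, ∀ (i : Fin m → Fin 2) (x : Plane),
    |iteratedFDeriv ℝ m (φ : Plane → ℝ) x fun j => EuclideanSpace.single (i j) 1| ≤ 1}

/-- The norm of `C^α(𝕋²)`, `α < 0`, of a real-valued functional `g`: the supremum of
`|g (φ^l_y)| / l^α` over `y ∈ 𝕋²`, `l ∈ (0, 1]` and the test functions `φ` supported in the unit ball
whose derivatives of order at most `r` are bounded by `1`, where `r = ⌊-α + 1⌋` is the smallest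
positive integer larger than `-α`. -/
noncomputable def holderNormReal (α : ℝ) (g : TorusTest → ℝ) : ℝ≥0∞ :=
  ⨆ (φ ∈ unitTests ⌊-α + 1⌋₊) (y : Plane) (l : ℝ) (hl : 0 < l) (_ : l ≤ 1),
    ENNReal.ofReal (|g (rescaled φ l hl y)| / l ^ α)

/-- The norm of `C^α(𝕋², ℂ³)`, `α < 0`: `‖T‖² = ∑ₖ (|Re Tₖ|² + |Im Tₖ|²)`. It is `∞` exactly when
`T` does not belong to this space. -/
noncomputable def holderNorm (α : ℝ) (T : Fin 3 → TorusDistribution) : ℝ≥0∞ :=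
  (∑ k, (holderNormReal α (fun φ => (pairing (T k) φ).re) ^ 2 +
    holderNormReal α (fun φ => (pairing (T k) φ).im) ^ 2)) ^ (1 / 2 : ℝ)

/-! ## White noise and its mollification -/

/-- The non-zero frequencies. -/
abbrev Freq : Type := {k : Fin 2 → ℤ // k ≠ 0}

/-- `e^{i (k, x)}`. -/
noncomputable def character (k : Fin 2 → ℤ) (x : Plane) : ℂ :=
  Complex.exp (Complex.I * ∑ i, (k i : ℂ) * (x i : ℂ))

/-- `W` is a 3D white noise on `𝕋²` whose components with index in `Z` have zero mean:
`W_j = η₀_j + Re ∑_{k ≠ 0} η_{kj} e^{i (k, x)}`, the series converging in `𝓓'(𝕋²)` almost surely.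
The `η₀_j` are real standard Gaussian for `j ∉ Z` and vanish for `j ∈ Z`; the `η_{kj}` are complex
Gaussian, with independent centred real and imaginary parts of variance `s`; all these random
variables are independent. (A standard complex Gaussian has `s = 1 / 2`, or `s = 1` if its real and
imaginary parts are normalised.) -/
def IsWhiteNoise3D {Ω : Type*} [MeasurableSpace Ω] (P : Measure Ω) (s : ℝ≥0) (Z : Set (Fin 3))
    (W : Ω → Fin 3 → TorusDistribution) : Prop :=
  ∃ (η₀ : Fin 3 → Ω → ℝ) (η : Freq × Fin 3 → Ω → ℂ),
    (∀ j ∉ Z, HasLaw (η₀ j) (gaussianReal 0 1) P) ∧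
    (∀ j ∈ Z, η₀ j =ᵐ[P] 0) ∧
    (∀ p, HasLaw (fun ω => (η p ω).re) (gaussianReal 0 s) P) ∧
    (∀ p, HasLaw (fun ω => (η p ω).im) (gaussianReal 0 s) P) ∧
    iIndepFun (Sum.elim η₀ (Sum.elim (fun p ω => (η p ω).re) (fun p ω => (η p ω).im))) P ∧
    ∀ᵐ ω ∂P, ∀ (j : Fin 3) (φ : TorusTest),
      HasSum (fun k : Freq => ∫ x in cell,
          (((η (k, j) ω * character k x).re : ℝ) : ℂ) * (φ : Plane → ℂ) x)
        (pairing (W ω j) φ - ∫ x in cell, ((η₀ j ω : ℝ) : ℂ) * (φ : Plane → ℂ) x)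

/-- A mollifier on the plane: a non-negative smooth function of integral one supported in the closed
unit ball. -/
structure IsMollifier (ρ : 𝓓((⊤ : TopologicalSpace.Opens Plane), ℝ)) : Prop where
  nonneg : ∀ x, 0 ≤ ρ x
  integral_eq_one : ∫ x, ρ x = 1
  support_subset : tsupport ρ ⊆ Metric.closedBall 0 1

/-- The smooth function `y ↦ ρ_ε (x - y) = ε⁻² ρ ((x - y) / ε)`, extended periodically to the
torus. -/
noncomputable def mollifierKernel (ρ : 𝓓((⊤ : TopologicalSpace.Opens Plane), ℝ)) (ε : ℝ)
    (hε : 0 < ε) (x : Plane) : TorusTest :=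
  periodize (dilate (fun z => ρ (-z)) (ρ.contDiff.comp contDiff_neg)
    (ρ.hasCompactSupport.comp_homeomorph (Homeomorph.neg Plane)) ε⁻¹ (inv_ne_zero hε.ne') x)

/-- The mollification `(ρ_ε * T)(x) = T (ρ_ε (x - ·))`. -/
noncomputable def mollify (ρ : 𝓓((⊤ : TopologicalSpace.Opens Plane), ℝ)) (ε : ℝ) (hε : 0 < ε)
    (T : TorusDistribution) (x : Plane) : ℂ :=
  pairing T (mollifierKernel ρ ε hε x)

/-! ## The mollified system -/

/-- The Cauchy-Riemann operator `∂_{z̄} = (∂_x + i ∂_y) / 2`. -/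
noncomputable def dbar (f : Plane → ℂ) (x : Plane) : ℂ :=
  (1 / 2) * (fderiv ℝ f x (EuclideanSpace.single 0 1) +
    Complex.I * fderiv ℝ f x (EuclideanSpace.single 1 1))

/-- `r` is a classical solution of `∂_{z̄} r = r × r̄ + i γ w` on the torus, written in
components. -/
def SolvesMollifiedCR (γ : EuclideanSpace ℝ (Fin 3)) (w : Fin 3 → Plane → ℂ)
    (r : Fin 3 → TorusTest) : Prop :=
  let r₁ : Plane → ℂ := r 0
  let r₂ : Plane → ℂ := r 1
  let r₃ : Plane → ℂ := r 2
  ∀ x : Plane,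
    dbar r₁ x = r₂ x * star (r₃ x) - star (r₂ x) * r₃ x + (γ 0 : ℂ) * Complex.I * w 0 x ∧
    dbar r₂ x = star (r₁ x) * r₃ x - r₁ x * star (r₃ x) + (γ 1 : ℂ) * Complex.I * w 1 x ∧
    dbar r₃ x = r₁ x * star (r₂ x) - star (r₁ x) * r₂ x + (γ 2 : ℂ) * Complex.I * w 2 x

/-! ## Weights on the frequency lattice -/

/-! The solution is sought as r = c + γ z + u. Here z is the mollification of ∂_{z̄}⁻¹(iξ) for the
noise ξ, c is a constant vector and u a remainder in H^p with p = 1 - κ/2. Multiplication of Fourier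
coefficients by `(dbarSymbol k)⁻¹`, which is 0 at k = 0, inverts ∂_{z̄} up to means and gains one
derivative. The non-zero modes of the system become u = A + L u + Q(u, u): A collects the products
of c and z, L is multiplication by y = c + γ z followed by the inverse, and Q is bounded on H^p
because p > 1/2. For small c and γ this is a contraction (`exists_quadratic_fixedPoint`), and its
solution is Lipschitz in A and L (`norm_sub_le_of_quadratic_fixedPoint`), so their rates of
convergence pass to u. This is `IsKernel.exists_solution`. A bootstrap makes the mollified solution
smooth (`wtSummable_of_fixedPoint`).

The zero mode needs an argument of its own. The right-hand side of the system is purely imaginary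
and the symbol is odd, so the frequencies k and -k contribute opposite amounts to the mean of r × r̄
(`wedge_zero_eq`). What remains is the algebraic condition c × c̄ + i γ ξ(0) = 0. As the third noise
has zero mean, `meanVec` solves it, with the fixed third mean 1/128 and two others proportional to
γ.

The deterministic part uses bounds on the noise, collected in `RoughNoise`: z lies in H^{-3κ/8};
multiplication by z maps H^{1-5κ/8} to H^{-3κ/8}; the products of mollified z_{j+1} and conjugated
z_{j+2} are Cauchy in H^{-κ/2}; and the mollification of z converges in C^{-κ}. The last two hold at
the rate ε^{κ/8}. In the first two, the margin of κ/8 towards the exponents p and 1 - p is what pays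
for the rate. Only different, hence independent, components are multiplied with each other, so no
renormalisation occurs.

The multiplier bound comes from the expectation of a Schatten norm
(`NoiseFamily.integral_schattenSum_le`). For products and for the Hölder norm, the difference of two
scales is written as an integral of the derivative in the scale; a bound on one integral over (0, 1]
then controls all scales at once (`hsBound_conv_mollSeq_sub`, `pairBound_mollSeq_sub`). Fatou and
Markov turn bounds in mean into bounds on an event of large probability
(`BoundedInProb.of_frequently`). Since the coefficients of a real noise at k and -k are dependent, ξ
is split as ζ + ζ̄ with independent coefficients in each half (`roughNoise_of_halves`). -/

/-- The weight `1 + |k|_∞` of a frequency. -/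
noncomputable def wt (k : Fin 2 → ℤ) : ℝ := 1 + ‖k‖

theorem one_le_wt (k : Fin 2 → ℤ) : 1 ≤ wt k := by
  simp [wt]

theorem wt_pos (k : Fin 2 → ℤ) : 0 < wt k := zero_lt_one.trans_le (one_le_wt k)

theorem wt_neg (k : Fin 2 → ℤ) : wt (-k) = wt k := by simp [wt]

theorem wt_sub_comm (k l : Fin 2 → ℤ) : wt (k - l) = wt (l - k) := by
  rw [← wt_neg, neg_sub]

theorem wt_add_le_mul (k l : Fin 2 → ℤ) : wt (k + l) ≤ wt k * wt l := by
  unfold wt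
  nlinarith [norm_add_le k l, norm_nonneg k, norm_nonneg l]

theorem wt_le_mul_sub (k l : Fin 2 → ℤ) : wt k ≤ wt (k - l) * wt l := by
  simpa using wt_add_le_mul (k - l) l

theorem wt_le_add_sub (k l : Fin 2 → ℤ) : wt k ≤ wt l + wt (k - l) := by
  have := norm_add_le l (k - l)
  rw [add_sub_cancel] at this
  unfold wt
  linarith

theorem one_le_norm_of_ne_zero {k : Fin 2 → ℤ} (hk : k ≠ 0) : 1 ≤ ‖k‖ := by
  obtain ⟨i, hi⟩ := Function.ne_iff.mp hk
  refine le_trans ?_ (norm_le_pi_norm k i)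
  rw [Int.norm_eq_abs]
  exact_mod_cast Int.one_le_abs hi

theorem wt_le_two_mul_norm {k : Fin 2 → ℤ} (hk : k ≠ 0) : wt k ≤ 2 * ‖k‖ := by
  unfold wt
  linarith [one_le_norm_of_ne_zero hk]

theorem summable_wt_rpow {a : ℝ} (ha : 2 < a) : Summable fun k => wt k ^ (-a) := by
  refine Summable.of_norm_bounded_eventually
    (EisensteinSeries.summable_one_div_norm_rpow ha) ?_
  have : ∀ᶠ k : Fin 2 → ℤ in cofinite, k ≠ 0 := by
    simp [Filter.eventually_cofinite]
  filter_upwards [this] with k hk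
  rw [Real.norm_of_nonneg (Real.rpow_nonneg (wt_pos k).le _)]
  refine Real.rpow_le_rpow_of_nonpos ?_ ?_ (by linarith)
  · linarith [one_le_norm_of_ne_zero hk]
  · simp [wt]

/-- Of the two frequencies l and k - l, the one of larger weight has weight at least `wt k / 2`. A
power c of its decay is traded for `wt k ^ (-c)` and the rest is handed to the smaller weight; the
two terms on the right are the two cases. -/
theorem wt_rpow_conv_le {a b c : ℝ} (hca : c ≤ a) (hcb : c ≤ b) (hc : 0 ≤ c)
    (k l : Fin 2 → ℤ) :
    wt l ^ (-a) * wt (k - l) ^ (-b) ≤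
      2 ^ c * wt k ^ (-c) * (wt l ^ (-(a + b - c)) + wt (k - l) ^ (-(a + b - c))) := by
  have hx := wt_pos l
  have hy := wt_pos (k - l)
  have hk := wt_pos k
  have key : ∀ x y p q : ℝ, 0 < x → x ≤ y → wt k ≤ x + y → c ≤ q →
      x ^ (-p) * y ^ (-q) ≤ 2 ^ c * wt k ^ (-c) * x ^ (-(p + q - c)) := by
    intro x y p q hx hxy hkxy hcq
    have hy : 0 < y := hx.trans_le hxy
    have h1 : wt k ^ c ≤ 2 ^ c * y ^ c := by
      rw [← Real.mul_rpow (by norm_num) hy.le]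
      exact Real.rpow_le_rpow hk.le (by linarith) hc
    have h2 : y ^ (c - q) ≤ x ^ (c - q) := Real.rpow_le_rpow_of_nonpos hx hxy (by linarith)
    have h3 : y ^ (-q) = y ^ (-c) * y ^ (c - q) := by
      rw [← Real.rpow_add hy]; ring_nf
    have h4 : x ^ (-(p + q - c)) = x ^ (-p) * x ^ (c - q) := by
      rw [← Real.rpow_add hx]; ring_nf
    have h5 : y ^ (-c) ≤ 2 ^ c * wt k ^ (-c) := by
      rw [Real.rpow_neg hy.le, Real.rpow_neg hk.le, ← div_eq_mul_inv, inv_eq_one_div,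
        div_le_div_iff₀ (by positivity) (by positivity)]
      linarith
    rw [h3, h4]
    calc x ^ (-p) * (y ^ (-c) * y ^ (c - q))
        ≤ x ^ (-p) * ((2 ^ c * wt k ^ (-c)) * x ^ (c - q)) := by gcongr
      _ = _ := by ring
  have hP : 0 ≤ 2 ^ c * wt k ^ (-c) := by positivity
  rcases le_total (wt l) (wt (k - l)) with h | h
  · refine (key _ _ a b hx h (wt_le_add_sub k l) hcb).trans ?_
    gcongr
    exact le_add_of_nonneg_right (by positivity)
  · rw [mul_comm]
    refine (key _ _ b a hy h (by linarith [wt_le_add_sub k l]) hca).trans ?_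
    rw [add_comm b a]
    gcongr
    exact le_add_of_nonneg_left (by positivity)

/-- The lattice sum `∑ₖ wt k ^ (-a)`. -/
noncomputable def wtSum (a : ℝ) : ℝ := ∑' k, wt k ^ (-a)

theorem wtSum_nonneg (a : ℝ) : 0 ≤ wtSum a :=
  tsum_nonneg fun k => (Real.rpow_nonneg (wt_pos k).le _)

theorem summable_wt_sub_rpow {a : ℝ} (ha : 2 < a) (k : Fin 2 → ℤ) :
    Summable fun l => wt (k - l) ^ (-a) :=
  (Equiv.subLeft k).summable_iff.mpr (summable_wt_rpow ha)

theorem tsum_wt_sub_rpow (a : ℝ) (k : Fin 2 → ℤ) :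
    ∑' l, wt (k - l) ^ (-a) = wtSum a :=
  (Equiv.subLeft k).tsum_eq fun l => wt l ^ (-a)

theorem summable_wt_conv {a b c : ℝ} (hca : c ≤ a) (hcb : c ≤ b) (hc : 0 ≤ c)
    (h : 2 < a + b - c) (k : Fin 2 → ℤ) :
    Summable fun l => wt l ^ (-a) * wt (k - l) ^ (-b) := by
  refine Summable.of_nonneg_of_le (fun l => ?_) (fun l => wt_rpow_conv_le hca hcb hc k l)
    (((summable_wt_rpow h).add (summable_wt_sub_rpow h k)).mul_left _)
  have := wt_pos l
  have := wt_pos (k - l)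
  positivity

theorem tsum_wt_conv_le {a b c : ℝ} (hca : c ≤ a) (hcb : c ≤ b) (hc : 0 ≤ c)
    (h : 2 < a + b - c) (k : Fin 2 → ℤ) :
    ∑' l, wt l ^ (-a) * wt (k - l) ^ (-b) ≤ 2 ^ c * 2 * wtSum (a + b - c) * wt k ^ (-c) := by
  refine ((summable_wt_conv hca hcb hc h k).tsum_le_tsum
    (fun l => wt_rpow_conv_le hca hcb hc k l)
    (((summable_wt_rpow h).add (summable_wt_sub_rpow h k)).mul_left _)).trans ?_
  rw [tsum_mul_left, (summable_wt_rpow h).tsum_add (summable_wt_sub_rpow h k),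
    tsum_wt_sub_rpow, ← wtSum]
  apply le_of_eq
  ring

theorem sum_wt_conv_le {a b c : ℝ} (hca : c ≤ a) (hcb : c ≤ b) (hc : 0 ≤ c)
    (h : 2 < a + b - c) (k : Fin 2 → ℤ) (S : Finset (Fin 2 → ℤ)) :
    ∑ l ∈ S, wt l ^ (-a) * wt (k - l) ^ (-b) ≤ 2 ^ c * 2 * wtSum (a + b - c) * wt k ^ (-c) := by
  refine ((summable_wt_conv hca hcb hc h k).sum_le_tsum S fun l _ => ?_).trans
    (tsum_wt_conv_le hca hcb hc h k)
  have := wt_pos l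
  have := wt_pos (k - l)
  positivity

/-! ## The symbol of the Cauchy-Riemann operator -/

/-- The Fourier multiplier `(i / 2) (k₀ + i k₁)` of `∂_{z̄}`. -/
noncomputable def dbarSymbol (k : Fin 2 → ℤ) : ℂ :=
  Complex.I / 2 * ((k 0 : ℂ) + Complex.I * (k 1 : ℂ))

theorem dbarSymbol_zero : dbarSymbol 0 = 0 := by simp [dbarSymbol]

theorem dbarSymbol_neg (k : Fin 2 → ℤ) : dbarSymbol (-k) = -dbarSymbol k := by
  simp [dbarSymbol]; ring

theorem norm_le_two_mul_norm_dbarSymbol (k : Fin 2 → ℤ) : ‖k‖ ≤ 2 * ‖dbarSymbol k‖ := by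
  have h : 2 * ‖dbarSymbol k‖ = ‖(k 0 : ℂ) + Complex.I * (k 1 : ℂ)‖ := by
    simp [dbarSymbol]
  rw [h]
  refine (pi_norm_le_iff_of_nonneg (norm_nonneg _)).mpr fun i => ?_
  fin_cases i
  · have := Complex.abs_re_le_norm ((k 0 : ℂ) + Complex.I * (k 1 : ℂ))
    simpa [Int.norm_eq_abs] using this
  · have := Complex.abs_im_le_norm ((k 0 : ℂ) + Complex.I * (k 1 : ℂ))
    simpa [Int.norm_eq_abs] using this

theorem dbarSymbol_ne_zero {k : Fin 2 → ℤ} (hk : k ≠ 0) : dbarSymbol k ≠ 0 := by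
  intro h
  have := norm_le_two_mul_norm_dbarSymbol k
  rw [h, norm_zero] at this
  linarith [one_le_norm_of_ne_zero hk]

/-- Ellipticity of ∂_{z̄}: the inverse gains one derivative. At k = 0 the convention `0⁻¹ = 0` makes
it drop the mean, which is why zero modes are treated separately below. -/
theorem norm_inv_dbarSymbol_le (k : Fin 2 → ℤ) : ‖(dbarSymbol k)⁻¹‖ ≤ 4 * (wt k)⁻¹ := by
  by_cases hk : k = 0
  · subst hk
    rw [dbarSymbol_zero]
    simp only [inv_zero, norm_zero]
    have := wt_pos 0
    positivity
  · rw [norm_inv, ← div_eq_mul_inv, inv_eq_one_div,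
      div_le_div_iff₀ (norm_pos_iff.mpr (dbarSymbol_ne_zero hk)) (wt_pos k)]
    linarith [norm_le_two_mul_norm_dbarSymbol k, wt_le_two_mul_norm hk]

/-! ## Characters of the torus -/

/-- The phase `(k, x)`, as a linear functional of `x`. -/
noncomputable def phase (k : Fin 2 → ℤ) : Plane →L[ℝ] ℝ :=
  ∑ i, (k i : ℝ) • (EuclideanSpace.proj i : Plane →L[ℝ] ℝ)

theorem phase_apply (k : Fin 2 → ℤ) (x : Plane) : phase k x = ∑ i, (k i : ℝ) * x i := by
  simp [phase]

theorem character_eq (k : Fin 2 → ℤ) (x : Plane) :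
    character k x = Complex.exp ((phase k x : ℝ) * Complex.I) := by
  rw [character, phase_apply]
  push_cast
  ring_nf

theorem norm_character (k : Fin 2 → ℤ) (x : Plane) : ‖character k x‖ = 1 := by
  rw [character_eq, Complex.norm_exp_ofReal_mul_I]

theorem character_add_left (k l : Fin 2 → ℤ) (x : Plane) :
    character (k + l) x = character k x * character l x := by
  simp only [character_eq, phase_apply, ← Complex.exp_add, Pi.add_apply, Int.cast_add, add_mul,
    Finset.sum_add_distrib, Complex.ofReal_add]

theorem character_add (k : Fin 2 → ℤ) (x y : Plane) :
    character k (x + y) = character k x * character k y := by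
  simp only [character_eq, map_add, ← Complex.exp_add, add_mul, Complex.ofReal_add]

theorem character_zero_left (x : Plane) : character 0 x = 1 := by
  simp [character]

theorem character_zero (k : Fin 2 → ℤ) : character k 0 = 1 := by
  simp [character]

theorem star_character (k : Fin 2 → ℤ) (x : Plane) :
    star (character k x) = character (-k) x := by
  simp only [character_eq, phase_apply, Complex.star_def, ← Complex.exp_conj]
  congr 1
  simp
  ring

theorem character_latticePt (k n : Fin 2 → ℤ) : character k (latticePt n) = 1 := by
  rw [character_eq, phase_apply, Complex.exp_eq_one_iff]
  refine ⟨k 0 * n 0 + k 1 * n 1, ?_⟩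
  simp [latticePt, Fin.sum_univ_two]
  ring

theorem contDiff_character (k : Fin 2 → ℤ) : ContDiff ℝ (⊤ : ℕ∞) (character k) := by
  have : character k = fun x => Complex.exp ((phase k x : ℝ) * Complex.I) :=
    funext (character_eq k)
  rw [this]
  exact ((Complex.ofRealCLM.contDiff.comp (phase k).contDiff).mul contDiff_const).cexp

theorem continuous_character (k : Fin 2 → ℤ) : Continuous (character k) :=
  (contDiff_character k).continuous

theorem hasFDerivAt_character (k : Fin 2 → ℤ) (x : Plane) :
    HasFDerivAt (character k)
      ((character k x * Complex.I) • (Complex.ofRealCLM.comp (phase k))) x := by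
  have h1 : HasFDerivAt (fun x : Plane => ((phase k x : ℝ) : ℂ) * Complex.I)
      (Complex.I • (Complex.ofRealCLM.comp (phase k))) x :=
    ((Complex.ofRealCLM.comp (phase k)).hasFDerivAt (x := x)).mul_const Complex.I
  have h2 := h1.cexp
  rw [← character_eq, smul_smul] at h2
  exact h2.congr_of_eventuallyEq (Eventually.of_forall (character_eq k))

theorem phase_single (k : Fin 2 → ℤ) (i : Fin 2) :
    phase k (EuclideanSpace.single i 1) = k i := by
  rw [phase_apply]
  fin_cases i <;> simp

/-- A character as a function on the torus. -/
noncomputable def characterTest (k : Fin 2 → ℤ) : TorusTest :=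
  ⟨character k, contDiff_character k, fun x n => by
    rw [character_add, character_latticePt, mul_one]⟩

/-! ## Integration over the fundamental cell -/

/-- The lattice embedding `n ↦ 2πn`. -/
noncomputable def latticeHom : (Fin 2 → ℤ) →+ Plane where
  toFun := latticePt
  map_zero' := by ext i; simp [latticePt]
  map_add' := latticePt_add

theorem latticePt_injective : Function.Injective latticePt := by
  intro m n h
  funext i
  have := congrArg (fun x : Plane => x i) h
  simpa [latticePt, Real.pi_ne_zero] using this

/-- The lattice `(2πℤ)²`. -/
noncomputable def torusLattice : AddSubgroup Plane := latticeHom.range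

instance : Countable torusLattice :=
  (Set.countable_range latticePt).to_subtype

/-- The lattice `(2πℤ)²` is in bijection with `ℤ²`. -/
noncomputable def latticeEquiv : (Fin 2 → ℤ) ≃ torusLattice :=
  Equiv.ofInjective latticePt latticePt_injective

/-- The fundamental cell centred at `y`. -/
def cellAt (y : Plane) : Set Plane := {x | x - y ∈ cell}

theorem cellAt_zero : cellAt 0 = cell := by simp [cellAt]

theorem measurableSet_cellAt (y : Plane) : MeasurableSet (cellAt y) :=
  (measurable_id.sub_const y) measurableSet_cell

theorem isAddFundamentalDomain_cellAt (y : Plane) :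
    IsAddFundamentalDomain torusLattice (cellAt y) volume := by
  refine IsAddFundamentalDomain.mk' (measurableSet_cellAt y).nullMeasurableSet fun x => ?_
  have h : ∀ i : Fin 2, ∃! m : ℤ, (x - y) i + m • (2 * Real.pi) ∈
      Set.Ioc (-Real.pi) (-Real.pi + 2 * Real.pi) := fun i =>
    existsUnique_add_zsmul_mem_Ioc Real.two_pi_pos _ _
  have hpi : -Real.pi + 2 * Real.pi = Real.pi := by ring
  rw [hpi] at h
  have key : ∀ n : Fin 2 → ℤ, latticePt n + x ∈ cellAt y ↔
      ∀ i, (x - y) i + n i • (2 * Real.pi) ∈ Set.Ioc (-Real.pi) Real.pi := by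
    intro n
    simp only [cellAt, cell, Set.mem_ofPred_eq]
    refine forall_congr' fun i => ?_
    have : (latticePt n + x - y) i = (x - y) i + n i • (2 * Real.pi) := by
      simp [latticePt]; ring
    rw [this]
  choose n hn hn' using h
  refine ⟨latticeEquiv n, (key n).mpr hn, ?_⟩
  rintro ⟨_, m, rfl⟩ hg
  have : m = n := funext fun i => hn' i _ ((key m).mp hg i)
  subst this
  rfl

theorem setIntegral_cellAt {E : Type*} [NormedAddCommGroup E] [NormedSpace ℝ E] {F : Plane → E}
    (hF : ∀ x n, F (x + latticePt n) = F x) (y : Plane) :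
    ∫ x in cellAt y, F x = ∫ x in cell, F x := by
  rw [← cellAt_zero]
  refine (isAddFundamentalDomain_cellAt y).setIntegral_eq (isAddFundamentalDomain_cellAt 0) ?_
  rintro ⟨_, m, rfl⟩ x
  change F (latticePt m + x) = F x
  rw [add_comm, hF]

theorem setIntegral_cell_comp_add {E : Type*} [NormedAddCommGroup E] [NormedSpace ℝ E]
    {F : Plane → E} (hF : ∀ x n, F (x + latticePt n) = F x) (h : Plane) :
    ∫ x in cell, F (x + h) = ∫ x in cell, F x := by
  rw [← setIntegral_cellAt hF h]
  have := (measurePreserving_add_right (volume : Measure Plane) h).setIntegral_preimage_emb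
    (measurableEmbedding_addRight h) F (cellAt h)
  rw [← this]
  congr 2
  ext x
  simp [cellAt]

theorem volume_cell_lt_top : volume cell < ∞ :=
  isBounded_cell.measure_lt_top

/-- Unfolding: the integral over the plane splits over the translates of the cell, F is periodic,
and compact support leaves finitely many translates that matter. -/
theorem setIntegral_cell_mul_periodize {F : Plane → ℂ} (hF : Continuous F)
    (hFp : ∀ x n, F (x + latticePt n) = F x)
    (f : 𝓓((⊤ : TopologicalSpace.Opens Plane), ℝ)) :
    ∫ x in cell, F x * (periodize f : Plane → ℂ) x = ∫ x, F x * (f x : ℂ) := by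
  have hfc : Continuous fun x => (f x : ℂ) := Complex.continuous_ofReal.comp f.contDiff.continuous
  have hfs : HasCompactSupport fun x => (f x : ℂ) :=
    f.hasCompactSupport.comp_left (g := fun r : ℝ => (r : ℂ)) Complex.ofReal_zero
  have hint : Integrable fun x => F x * (f x : ℂ) :=
    (hF.mul hfc).integrable_of_hasCompactSupport hfs.mul_left
  have hD : IsAddFundamentalDomain torusLattice cell volume := by
    simpa [cellAt_zero] using isAddFundamentalDomain_cellAt 0
  rw [hD.integral_eq_tsum'' _ hint, ← latticeEquiv.tsum_eq]
  have hterm : ∀ n, ∫ x in cell, F (latticeEquiv n +ᵥ x) * (f (latticeEquiv n +ᵥ x) : ℂ) =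
      ∫ x in cell, F x * (f (x + latticePt n) : ℂ) := by
    intro n
    refine integral_congr_ae (Eventually.of_forall fun x => ?_)
    change F (latticePt n + x) * (f (latticePt n + x) : ℂ) = _
    rw [add_comm, hFp]
  simp_rw [hterm]
  have hfin := (locallyFinite_translates (f := f) f.hasCompactSupport).finite_nonempty_inter_compact
    isBounded_cell.isCompact_closure
  have hz : ∀ n ∉ hfin.toFinset, ∀ x ∈ cell, (f (x + latticePt n) : ℂ) = 0 := by
    intro n hn x hx
    by_contra h
    exact hn (hfin.mem_toFinset.mpr ⟨x, h, subset_closure hx⟩)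
  rw [tsum_eq_sum (s := hfin.toFinset)]
  · rw [← integral_finsetSum]
    · refine setIntegral_congr_fun measurableSet_cell fun x hx => ?_
      change F x * (∑ᶠ n : Fin 2 → ℤ, (f (x + latticePt n) : ℂ)) = _
      rw [finsum_eq_sum_of_support_subset _ (s := hfin.toFinset), Finset.mul_sum]
      intro n hn
      by_contra h
      exact hn (hz n h x hx)
    · intro n _
      exact (hF.mul (hfc.comp (continuous_id.add continuous_const))).integrableOn_cell
  · intro n hn
    rw [setIntegral_congr_fun (g := fun _ => (0 : ℂ)) measurableSet_cell]
    · simp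
    · intro x hx
      simp [hz n hn x hx]

/-! ## Fourier transforms of functions on the plane -/

/-- `∫ f(w) e^{i t (k, w)} dw`. -/
noncomputable def waveFT (f : Plane → ℝ) (k : Fin 2 → ℤ) (t : ℝ) : ℂ :=
  ∫ w, (f w : ℂ) * character k (t • w)

theorem norm_waveFT_le (f : Plane → ℝ) (k : Fin 2 → ℤ) (t : ℝ) :
    ‖waveFT f k t‖ ≤ ∫ w, |f w| := by
  refine (norm_integral_le_integral_norm _).trans (le_of_eq ?_)
  simp [norm_character]

theorem waveFT_neg_left (f : Plane → ℝ) (k : Fin 2 → ℤ) (t : ℝ) :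
    waveFT f (-k) t = star (waveFT f k t) := by
  rw [waveFT, waveFT, Complex.star_def, ← integral_conj]
  congr 1
  funext w
  rw [map_mul, Complex.conj_ofReal, ← Complex.star_def, star_character]

theorem waveFT_zero_left (f : Plane → ℝ) (t : ℝ) : waveFT f 0 t = ((∫ w, f w : ℝ) : ℂ) := by
  simp [waveFT, character_zero_left, integral_complex_ofReal]

theorem integral_mul_dilate (k : Fin 2 → ℤ) (f : Plane → ℝ) (hf : ContDiff ℝ (⊤ : ℕ∞) f)
    (hc : HasCompactSupport f) (t : ℝ) (ht : 0 < t) (y : Plane) :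
    ∫ x, character k x * ((dilate f hf hc t⁻¹ (inv_ne_zero ht.ne') y x : ℝ) : ℂ) =
      character k y * waveFT f k t := by
  have h1 : ∀ x, character k x * ((dilate f hf hc t⁻¹ (inv_ne_zero ht.ne') y x : ℝ) : ℂ) =
      (fun z => character k (z + y) * (((t⁻¹ ^ 2 * f (t⁻¹ • z) : ℝ)) : ℂ)) (x - y) := by
    intro x
    simp [dilate]
  simp_rw [h1]
  rw [integral_sub_right_eq_self (μ := (volume : Measure Plane))
    (fun z => character k (z + y) * (((t⁻¹ ^ 2 * f (t⁻¹ • z) : ℝ)) : ℂ))]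
  have h2 : ∀ z : Plane, character k (z + y) * (((t⁻¹ ^ 2 * f (t⁻¹ • z) : ℝ)) : ℂ) =
      (fun w => character k y * ((t⁻¹ ^ 2 : ℝ) : ℂ) * ((f w : ℂ) * character k (t • w)))
        (t⁻¹ • z) := by
    intro z
    simp only [character_add, smul_smul, mul_inv_cancel₀ ht.ne', one_smul, Complex.ofReal_mul]
    ring
  rw [integral_congr_ae (Eventually.of_forall h2),
    Measure.integral_comp_smul volume
      (fun w => character k y * ((t⁻¹ ^ 2 : ℝ) : ℂ) * ((f w : ℂ) * character k (t • w))), integral_const_mul, waveFT]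
  simp only [finrank_euclideanSpace_fin, Complex.real_smul]
  have ht' : (t : ℂ) ≠ 0 := by exact_mod_cast ht.ne'
  rw [abs_of_pos (by positivity)]
  push_cast
  field_simp

theorem integrable_mul_character {f : Plane → ℝ} (hf : Continuous f) (hc : HasCompactSupport f)
    (k : Fin 2 → ℤ) (t : ℝ) : Integrable fun w => (f w : ℂ) * character k (t • w) := by
  have hcs : HasCompactSupport fun x => (f x : ℂ) :=
    hc.comp_left (g := fun r : ℝ => (r : ℂ)) Complex.ofReal_zero
  exact ((Complex.continuous_ofReal.comp hf).mul
    ((continuous_character k).comp (continuous_const_smul t))).integrable_of_hasCompactSupport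
      hcs.mul_right

/-- The partial derivative `∂ᵢ f`. -/
noncomputable def partialDeriv (i : Fin 2) (f : Plane → ℝ) (x : Plane) : ℝ :=
  fderiv ℝ f x (EuclideanSpace.single i 1)

theorem ContDiff.partialDeriv {f : Plane → ℝ} (hf : ContDiff ℝ (⊤ : ℕ∞) f) (i : Fin 2) :
    ContDiff ℝ (⊤ : ℕ∞) (partialDeriv i f) :=
  (hf.fderiv_right (m := (⊤ : ℕ∞)) (by simp)).clm_apply contDiff_const

theorem HasCompactSupport.partialDeriv {f : Plane → ℝ} (hf : HasCompactSupport f) (i : Fin 2) :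
    HasCompactSupport (partialDeriv i f) :=
  hf.fderiv_apply (𝕜 := ℝ) _

/-- Integration by parts; the derivative of the character in w supplies the factor i t k_i. -/
theorem waveFT_partialDeriv {f : Plane → ℝ} (hf : ContDiff ℝ (⊤ : ℕ∞) f)
    (hc : HasCompactSupport f) (i : Fin 2) (k : Fin 2 → ℤ) (t : ℝ) :
    waveFT (partialDeriv i f) k t = -(Complex.I * (t * k i) * waveFT f k t) := by
  set g : Plane → ℂ := fun w => character k (t • w) with hg
  set F : Plane → ℂ := fun w => (f w : ℂ) with hF
  set v : Plane := EuclideanSpace.single i 1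
  have hgd : ∀ x, HasFDerivAt g (t • ((character k (t • x) * Complex.I) •
      (Complex.ofRealCLM.comp (phase k)))) x := by
    intro x
    have := (hasFDerivAt_character k (t • x)).comp x ((hasFDerivAt_id x).const_smul t)
    refine this.congr_fderiv ?_
    ext w
    simp
  have hFd : ∀ x, HasFDerivAt F (Complex.ofRealCLM.comp (fderiv ℝ f x)) x := fun x =>
    Complex.ofRealCLM.hasFDerivAt.comp x ((hf.differentiable (by simp)) x).hasFDerivAt
  have e1 : ∀ x, fderiv ℝ g x v = Complex.I * (t * k i) * g x := by
    intro x
    rw [(hgd x).fderiv]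
    simp [v, phase_single, hg]
    ring
  have e2 : ∀ x, fderiv ℝ F x v = (partialDeriv i f x : ℂ) := by
    intro x
    rw [(hFd x).fderiv]
    simp [v, _root_.partialDeriv]
  have i1 : Integrable fun x => fderiv ℝ F x v * g x := by
    simp_rw [e2]
    exact integrable_mul_character (hf.partialDeriv i).continuous (hc.partialDeriv i) k t
  have i0 : Integrable fun x => F x * g x :=
    integrable_mul_character hf.continuous hc k t
  have i2 : Integrable fun x => F x * fderiv ℝ g x v := by
    simp_rw [e1]
    refine (i0.const_mul (Complex.I * (t * k i))).congr (Eventually.of_forall fun x => ?_)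
    simp only
    ring
  have h := integral_mul_fderiv_eq_neg_fderiv_mul_of_integrable i1 i2 i0
    (fun x _ => (hFd x).differentiableAt) (fun x _ => (hgd x).differentiableAt)
  simp_rw [e1, e2] at h
  rw [waveFT, waveFT, ← integral_const_mul]
  rw [← neg_eq_iff_eq_neg] at h
  rw [← h]
  congr 2
  funext w
  ring

theorem exists_norm_eq_norm_apply (k : Fin 2 → ℤ) : ∃ i, ‖k‖ = ‖k i‖ := by
  by_contra! h
  have h' : ∀ i, ‖k i‖ < ‖k‖ := fun i => lt_of_le_of_ne (norm_le_pi_norm k i) (h i).symm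
  have hk : 0 < ‖k‖ := (norm_nonneg _).trans_lt (h' 0)
  exact lt_irrefl _ ((pi_norm_lt_iff hk).mpr h')

theorem norm_mul_waveFT_le {f : Plane → ℝ} (hf : ContDiff ℝ (⊤ : ℕ∞) f)
    (hc : HasCompactSupport f) (k : Fin 2 → ℤ) {t M : ℝ} (ht : 0 ≤ t)
    (hM : ∀ i, ‖waveFT (partialDeriv i f) k t‖ ≤ M) :
    t * ‖k‖ * ‖waveFT f k t‖ ≤ M := by
  have h : ∀ i, t * ‖k i‖ * ‖waveFT f k t‖ ≤ M := by
    intro i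
    refine le_trans (le_of_eq ?_) (hM i)
    rw [waveFT_partialDeriv hf hc]
    simp [abs_of_nonneg ht, Int.norm_eq_abs]
  obtain ⟨i, hi⟩ := exists_norm_eq_norm_apply k
  rw [hi]
  exact h i

/-- Each derivative moved onto f gains a factor `t * ‖k‖` (`norm_mul_waveFT_le`), so the induction
runs over all smooth compactly supported f. -/
theorem exists_pow_mul_norm_waveFT_le (N : ℕ) : ∀ {f : Plane → ℝ}, ContDiff ℝ (⊤ : ℕ∞) f →
    HasCompactSupport f → ∃ C, 0 ≤ C ∧ ∀ (k : Fin 2 → ℤ) (t : ℝ), 0 ≤ t →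
      (t * ‖k‖) ^ N * ‖waveFT f k t‖ ≤ C := by
  induction N with
  | zero =>
    intro f _ _
    exact ⟨∫ w, |f w|, integral_nonneg fun _ => abs_nonneg _, fun k t _ => by
      simpa using norm_waveFT_le f k t⟩
  | succ N ih =>
    intro f hf hc
    choose C hC0 hC using fun i => ih (hf.partialDeriv i) (hc.partialDeriv i)
    refine ⟨C 0 + C 1, add_nonneg (hC0 0) (hC0 1), fun k t ht => ?_⟩
    by_cases hk : t * ‖k‖ = 0
    · simp [hk]; exact add_nonneg (hC0 0) (hC0 1)
    have hpos : 0 < t * ‖k‖ := lt_of_le_of_ne (by positivity) (Ne.symm hk)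
    have h := norm_mul_waveFT_le hf hc k ht (M := (C 0 + C 1) / (t * ‖k‖) ^ N) (fun i => by
      rw [le_div_iff₀ (by positivity), mul_comm]
      refine (hC i k t ht).trans ?_
      fin_cases i
      · simpa using hC0 1
      · simpa using hC0 0)
    rw [le_div_iff₀ (by positivity)] at h
    calc _ = t * ‖k‖ * ‖waveFT f k t‖ * (t * ‖k‖) ^ N := by ring
      _ ≤ _ := h

/-- Differentiation under the integral: the factor i (k, w) is absorbed in f, which leaves
transforms of `w i * f w`. The scale t will be a variable of integration in the estimates that have
to hold for all mollification scales at once. -/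
theorem hasDerivAt_waveFT {f : Plane → ℝ} (hf : Continuous f) (hc : HasCompactSupport f)
    (k : Fin 2 → ℤ) (t : ℝ) :
    HasDerivAt (waveFT f k) (Complex.I * ∑ i, (k i : ℂ) * waveFT (fun w => w i * f w) k t) t := by
  have hcoord : ∀ i : Fin 2, Continuous fun w : Plane => w i := fun i =>
    (EuclideanSpace.proj i : Plane →L[ℝ] ℝ).continuous
  have hcs : ∀ i, HasCompactSupport fun w : Plane => w i * f w := fun i => hc.mul_left
  have hcont : ∀ i, Continuous fun w : Plane => w i * f w := fun i => (hcoord i).mul hf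
  have hphase : Continuous fun w => phase k w * f w := (phase k).continuous.mul hf
  have hphs : HasCompactSupport fun w => phase k w * f w := hc.mul_left
  have key := hasDerivAt_integral_of_dominated_loc_of_deriv_le (μ := (volume : Measure Plane))
    (F := fun s w => (f w : ℂ) * character k (s • w)) (x₀ := t) (s := Set.univ)
    (F' := fun s w => Complex.I * (((phase k w * f w : ℝ) : ℂ) * character k (s • w)))
    (bound := fun w => |phase k w * f w|) Filter.univ_mem
    (Eventually.of_forall fun s => (integrable_mul_character hf hc k s).aestronglyMeasurable)
    (integrable_mul_character hf hc k t)
    ((integrable_mul_character hphase hphs k t).const_mul Complex.I).aestronglyMeasurable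
    (Eventually.of_forall fun w s _ => by
      simp [norm_character])
    ((hphase.integrable_of_hasCompactSupport hphs).norm) ?_
  · refine key.2.congr_deriv ?_
    rw [integral_const_mul]
    congr 1
    simp_rw [waveFT, ← integral_const_mul]
    rw [← integral_finsetSum]
    · refine integral_congr_ae (Eventually.of_forall fun w => ?_)
      simp only [phase_apply, Fin.sum_univ_two]
      push_cast
      ring
    · intro i _
      exact (integrable_mul_character (hcont i) (hcs i) k t).const_mul _
  · refine Eventually.of_forall fun w s _ => ?_
    have h1 : HasDerivAt (fun s : ℝ => character k (s • w))
        (character k (s • w) * Complex.I * phase k w) s := by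
      have h2 : HasDerivAt (fun s : ℝ => s • w) w s := by
        simpa using (hasDerivAt_id s).smul_const w
      refine ((hasFDerivAt_character k (s • w)).comp_hasDerivAt s h2).congr_deriv ?_
      simp
    refine (h1.const_mul (f w : ℂ)).congr_deriv ?_
    push_cast
    ring

theorem exists_pow_mul_norm_deriv_waveFT_le (N : ℕ) {f : Plane → ℝ}
    (hf : ContDiff ℝ (⊤ : ℕ∞) f) (hc : HasCompactSupport f) :
    ∃ C, 0 ≤ C ∧ ∀ (k : Fin 2 → ℤ) (t : ℝ), 0 ≤ t →
      (t * ‖k‖) ^ N * ‖deriv (waveFT f k) t‖ ≤ C * ‖k‖ := by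
  have hs : ∀ i : Fin 2, ContDiff ℝ (⊤ : ℕ∞) fun w : Plane => w i * f w := fun i =>
    (EuclideanSpace.proj i : Plane →L[ℝ] ℝ).contDiff.mul hf
  choose C hC0 hC using fun i : Fin 2 => exists_pow_mul_norm_waveFT_le N (hs i) hc.mul_left
  refine ⟨C 0 + C 1, add_nonneg (hC0 0) (hC0 1), fun k t ht => ?_⟩
  rw [(hasDerivAt_waveFT hf.continuous hc k t).deriv, norm_mul, Complex.norm_I, one_mul,
    Fin.sum_univ_two]
  have hk : ∀ i, ‖(k i : ℂ)‖ ≤ ‖k‖ := fun i => by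
    have := norm_le_pi_norm k i
    simpa [Int.norm_eq_abs] using this
  have h0 : 0 ≤ (t * ‖k‖) ^ N := by positivity
  calc _ ≤ (t * ‖k‖) ^ N * (‖(k 0 : ℂ)‖ * ‖waveFT (fun w => w 0 * f w) k t‖ +
        ‖(k 1 : ℂ)‖ * ‖waveFT (fun w => w 1 * f w) k t‖) := by
        gcongr
        refine (norm_add_le _ _).trans (le_of_eq ?_)
        simp only [norm_mul]
    _ ≤ (t * ‖k‖) ^ N * (‖k‖ * ‖waveFT (fun w => w 0 * f w) k t‖ +
        ‖k‖ * ‖waveFT (fun w => w 1 * f w) k t‖) := by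
        gcongr
        · exact hk 0
        · exact hk 1
    _ = ‖k‖ * ((t * ‖k‖) ^ N * ‖waveFT (fun w => w 0 * f w) k t‖) +
        ‖k‖ * ((t * ‖k‖) ^ N * ‖waveFT (fun w => w 1 * f w) k t‖) := by ring
    _ ≤ ‖k‖ * C 0 + ‖k‖ * C 1 := by
        gcongr
        · exact hC 0 k t ht
        · exact hC 1 k t ht
    _ = _ := by ring

theorem continuous_deriv_waveFT {f : Plane → ℝ} (hf : Continuous f) (hc : HasCompactSupport f)
    (k : Fin 2 → ℤ) : Continuous (deriv (waveFT f k)) := by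
  have h : deriv (waveFT f k) = fun t =>
      Complex.I * ∑ i, (k i : ℂ) * waveFT (fun w => w i * f w) k t :=
    funext fun t => (hasDerivAt_waveFT hf hc k t).deriv
  rw [h]
  refine continuous_const.mul (continuous_finsetSum _ fun i _ => continuous_const.mul ?_)
  have hcont : Continuous fun w : Plane => w i * f w :=
    (EuclideanSpace.proj i : Plane →L[ℝ] ℝ).continuous.mul hf
  exact continuous_iff_continuousAt.mpr fun t =>
    (hasDerivAt_waveFT hcont hc.mul_left k t).continuousAt

/-! ## Fourier coefficients of functions on the torus -/

/-- `∫_{𝕋²} e^{i (k, x)} φ(x) dx`. -/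
noncomputable def torusFT (φ : TorusTest) (k : Fin 2 → ℤ) : ℂ :=
  ∫ x in cell, character k x * (φ : Plane → ℂ) x

theorem torusFT_periodize_dilate (k : Fin 2 → ℤ) (f : Plane → ℝ) (hf : ContDiff ℝ (⊤ : ℕ∞) f)
    (hc : HasCompactSupport f) (t : ℝ) (ht : 0 < t) (y : Plane) :
    torusFT (periodize (dilate f hf hc t⁻¹ (inv_ne_zero ht.ne') y)) k =
      character k y * waveFT f k t := by
  rw [torusFT, setIntegral_cell_mul_periodize (continuous_character k) (characterTest k).2.2,
    integral_mul_dilate _ _ _ _ _ ht]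

theorem norm_torusFT_le (φ : TorusTest) {B : ℝ} (hB : ∀ x, ‖(φ : Plane → ℂ) x‖ ≤ B)
    (k : Fin 2 → ℤ) : ‖torusFT φ k‖ ≤ B * volume.real cell := by
  refine norm_setIntegral_le_of_norm_le_const volume_cell_lt_top fun x _ => ?_
  rw [norm_mul, norm_character, one_mul]
  exact hB x

/-- The difference `x ↦ φ(x + h) - φ(x)`. -/
noncomputable def shiftDiff (h : Plane) (φ : TorusTest) : TorusTest :=
  ⟨fun x => (φ : Plane → ℂ) (x + h) - (φ : Plane → ℂ) x,
    (φ.2.1.comp (contDiff_id.add contDiff_const)).sub φ.2.1, fun x n => by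
      beta_reduce
      rw [add_right_comm, φ.2.2, φ.2.2]⟩

theorem torusFT_shiftDiff (h : Plane) (φ : TorusTest) (k : Fin 2 → ℤ) :
    torusFT (shiftDiff h φ) k = (character k (-h) - 1) * torusFT φ k := by
  have h1 : torusFT (shiftDiff h φ) k =
      (∫ x in cell, character k x * (φ : Plane → ℂ) (x + h)) - torusFT φ k := by
    rw [torusFT, torusFT, ← integral_sub]
    · refine integral_congr_ae (Eventually.of_forall fun x => ?_)
      simp only [shiftDiff]
      ring
    · exact ((continuous_character k).mul (φ.2.1.continuous.comp
        (continuous_id.add continuous_const))).integrableOn_cell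
    · exact ((continuous_character k).mul φ.2.1.continuous).integrableOn_cell
  have h2 : ∫ x in cell, character k x * (φ : Plane → ℂ) (x + h) =
      character k (-h) * torusFT φ k := by
    have := setIntegral_cell_comp_add
      (F := fun x => character k (-h) * (character k x * (φ : Plane → ℂ) x)) (fun x n => by
        rw [φ.2.2, character_add, character_latticePt, mul_one]) h
    rw [torusFT, ← integral_const_mul, ← this]
    refine integral_congr_ae (Eventually.of_forall fun x => ?_)
    simp only
    have hch : character k (-h) * character k (x + h) = character k x := by
      rw [← character_add]
      congr 1
      abel
    rw [← mul_assoc, hch]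
  rw [h1, h2]
  ring

theorem norm_shiftDiff_shiftDiff_le (h : Plane) (φ : TorusTest) {B : ℝ}
    (hB : ∀ x, ‖iteratedFDeriv ℝ 2 (φ : Plane → ℂ) x‖ ≤ B) (x : Plane) :
    ‖(shiftDiff h (shiftDiff h φ) : Plane → ℂ) x‖ ≤ B * ‖h‖ ^ 2 := by
  have hd : Differentiable ℝ (φ : Plane → ℂ) := φ.2.1.differentiable (by simp)
  have hd' : Differentiable ℝ (fderiv ℝ (φ : Plane → ℂ)) :=
    (φ.2.1.fderiv_right (m := (⊤ : ℕ∞)) (by simp)).differentiable (by simp)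
  have h1 : ∀ y, ‖fderiv ℝ (fderiv ℝ (φ : Plane → ℂ)) y‖ ≤ B := by
    intro y
    rw [← norm_iteratedFDeriv_one, norm_iteratedFDeriv_fderiv]
    exact hB y
  have h2 : ∀ y, ‖fderiv ℝ (shiftDiff h φ : Plane → ℂ) y‖ ≤ B * ‖h‖ := by
    intro y
    have e : fderiv ℝ (shiftDiff h φ : Plane → ℂ) y =
        fderiv ℝ (φ : Plane → ℂ) (y + h) - fderiv ℝ (φ : Plane → ℂ) y := by
      change fderiv ℝ (fun x => (φ : Plane → ℂ) (x + h) - (φ : Plane → ℂ) x) y = _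
      rw [fderiv_fun_sub (by fun_prop) (hd y), fderiv_comp_add_right]
    rw [e]
    have := Convex.norm_image_sub_le_of_norm_fderiv_le (𝕜 := ℝ) (fun z _ => hd' z)
      (fun z _ => h1 z) convex_univ (Set.mem_univ y) (Set.mem_univ (y + h))
    simpa using this
  have := Convex.norm_image_sub_le_of_norm_fderiv_le (𝕜 := ℝ)
    (fun z _ => ((shiftDiff h φ).2.1.differentiable (by simp)) z)
    (fun z _ => h2 z) convex_univ (Set.mem_univ x) (Set.mem_univ (x + h))
  rw [pow_two, ← mul_assoc]
  simpa [shiftDiff] using this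

/-- The second derivative controls second differences. The shift is chosen to flip the sign of the
character, so that a second difference multiplies `torusFT φ k` by 4; no boundary terms of the cell
appear. -/
theorem norm_torusFT_mul_wt_sq_le (φ : TorusTest) {B : ℝ}
    (hB : ∀ m ≤ 2, ∀ x, ‖iteratedFDeriv ℝ m (φ : Plane → ℂ) x‖ ≤ B) (k : Fin 2 → ℤ) :
    ‖torusFT φ k‖ ≤ 16 * volume.real cell * B * wt k ^ (-2 : ℝ) := by
  have hB0 : 0 ≤ B := (norm_nonneg _).trans (hB 0 (by norm_num) 0)
  have hV : 0 ≤ volume.real cell := measureReal_nonneg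
  have hw : wt k ^ (-2 : ℝ) = (wt k ^ 2)⁻¹ := by
    rw [Real.rpow_neg (wt_pos k).le]; norm_num
  rw [hw]
  by_cases hk : k = 0
  · have := norm_torusFT_le φ (B := B) (fun x => by simpa using hB 0 (by norm_num) x) k
    refine this.trans ?_
    subst hk
    simp only [wt, norm_zero, add_zero, one_pow, inv_one, mul_one]
    nlinarith [mul_nonneg hB0 hV]
  · obtain ⟨i, hi⟩ := exists_norm_eq_norm_apply k
    have hk1 := one_le_norm_of_ne_zero hk
    have hki : (k i : ℝ) ≠ 0 := by
      intro h
      rw [Int.norm_eq_abs, h] at hi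
      simp at hi
      exact hk hi
    -- Half a period of the character in the direction of the largest coordinate of k, so that `‖h‖
    -- = π / ‖k‖`.
    set h : Plane := (Real.pi / (k i : ℝ)) • EuclideanSpace.single i 1 with hh
    have hnorm : ‖h‖ = Real.pi / ‖k‖ := by
      rw [hh, norm_smul, hi, Int.norm_eq_abs]
      simp [abs_of_pos Real.pi_pos]
    have hch : character k (-h) = -1 := by
      rw [character_eq, map_neg, hh, map_smul, phase_single, smul_eq_mul, div_mul_cancel₀ _ hki]
      push_cast
      rw [neg_mul, Complex.exp_neg, Complex.exp_pi_mul_I]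
      norm_num
    have h1 := norm_torusFT_le _ (norm_shiftDiff_shiftDiff_le h φ (hB 2 le_rfl)) k
    rw [torusFT_shiftDiff, torusFT_shiftDiff, hch, hnorm, ← mul_assoc, norm_mul] at h1
    norm_num at h1
    have hpi : Real.pi ^ 2 ≤ 16 := by nlinarith [Real.pi_lt_four, Real.pi_pos]
    have hwk : wt k ^ 2 ≤ 4 * ‖k‖ ^ 2 := by
      nlinarith [wt_le_two_mul_norm hk, wt_pos k]
    have h2 : (Real.pi / ‖k‖) ^ 2 ≤ 16 * (4 * (wt k ^ 2)⁻¹) := by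
      rw [div_pow, ← div_eq_mul_inv, mul_div_assoc', div_le_div_iff₀ (by positivity)
        (pow_pos (wt_pos k) 2)]
      nlinarith [mul_le_mul hpi hwk (by positivity) (by norm_num)]
    have h3 : B * (Real.pi / ‖k‖) ^ 2 * volume.real cell ≤
        B * (16 * (4 * (wt k ^ 2)⁻¹)) * volume.real cell := by gcongr
    linarith

/-! ## Trigonometric series -/

/-- The coefficients `c` satisfy `∑ₖ wt k ^ N |c k| < ∞`. -/
def WtSummable (N : ℕ) (c : (Fin 2 → ℤ) → ℂ) : Prop := Summable fun k => wt k ^ N * ‖c k‖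

theorem WtSummable.mono {N : ℕ} {c c' : (Fin 2 → ℤ) → ℂ} (h : WtSummable N c)
    (hc : ∀ k, ‖c' k‖ ≤ ‖c k‖) : WtSummable N c' :=
  h.of_nonneg_of_le (fun k => mul_nonneg (pow_nonneg (wt_pos k).le _) (norm_nonneg _))
    fun k => mul_le_mul_of_nonneg_left (hc k) (pow_nonneg (wt_pos k).le _)

theorem WtSummable.summable_norm {N : ℕ} {c : (Fin 2 → ℤ) → ℂ} (h : WtSummable N c) :
    Summable fun k => ‖c k‖ :=
  Summable.of_nonneg_of_le (fun _ => norm_nonneg _)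
    (fun k => le_mul_of_one_le_left (norm_nonneg _) (one_le_pow₀ (one_le_wt k))) h

theorem WtSummable.add {N : ℕ} {c c' : (Fin 2 → ℤ) → ℂ} (h : WtSummable N c)
    (h' : WtSummable N c') : WtSummable N fun k => c k + c' k := by
  refine Summable.of_nonneg_of_le
    (fun k => mul_nonneg (pow_nonneg (wt_pos k).le _) (norm_nonneg _)) (fun k => ?_)
    (Summable.add h h')
  rw [← mul_add]
  exact mul_le_mul_of_nonneg_left (norm_add_le _ _) (pow_nonneg (wt_pos k).le _)

theorem WtSummable.sub {N : ℕ} {c c' : (Fin 2 → ℤ) → ℂ} (h : WtSummable N c)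
    (h' : WtSummable N c') : WtSummable N fun k => c k - c' k := by
  simpa [sub_eq_add_neg] using h.add (h'.mono (c' := fun k => -c' k) fun k => by simp)

theorem WtSummable.const_mul {N : ℕ} {c : (Fin 2 → ℤ) → ℂ} (h : WtSummable N c) (a : ℂ) :
    WtSummable N fun k => a * c k := by
  refine (Summable.mul_left ‖a‖ h).congr fun k => ?_
  rw [norm_mul]; ring

theorem wtSummable_single (N : ℕ) (a : ℂ) : WtSummable N (Pi.single 0 a) := by
  refine summable_of_ne_finset_zero (s := {0}) fun k hk => ?_
  simp [Pi.single_eq_of_ne (by simpa using hk : k ≠ 0)]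

/-- The coefficients of the complex conjugate of a trigonometric series. -/
def starSeq (c : (Fin 2 → ℤ) → ℂ) (k : Fin 2 → ℤ) : ℂ := star (c (-k))

theorem starSeq_starSeq (c : (Fin 2 → ℤ) → ℂ) : starSeq (starSeq c) = c := by
  funext k; simp [starSeq]

theorem WtSummable.starSeq {N : ℕ} {c : (Fin 2 → ℤ) → ℂ} (h : WtSummable N c) :
    WtSummable N (starSeq c) := by
  have := (Equiv.neg (Fin 2 → ℤ)).summable_iff.mpr h
  refine this.congr fun k => ?_
  simp [_root_.starSeq, wt_neg]

/-- Convolution of sequences: the coefficients of a product of trigonometric series. -/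
noncomputable def conv (c c' : (Fin 2 → ℤ) → ℂ) (k : Fin 2 → ℤ) : ℂ :=
  ∑' l, c (k - l) * c' l

/-- The equivalence `(k, l) ↦ (k - l, l)`. -/
def convEquiv : (Fin 2 → ℤ) × (Fin 2 → ℤ) ≃ (Fin 2 → ℤ) × (Fin 2 → ℤ) where
  toFun p := (p.1 - p.2, p.2)
  invFun p := (p.1 + p.2, p.2)
  left_inv p := by simp
  right_inv p := by simp

theorem WtSummable.summable_conv {N : ℕ} {c c' : (Fin 2 → ℤ) → ℂ} (h : WtSummable N c)
    (h' : WtSummable N c') :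
    Summable fun p : (Fin 2 → ℤ) × (Fin 2 → ℤ) => wt p.1 ^ N * (‖c (p.1 - p.2)‖ * ‖c' p.2‖) := by
  have h1 := Summable.mul_of_nonneg h h'
    (fun k => mul_nonneg (pow_nonneg (wt_pos k).le _) (norm_nonneg _))
    (fun k => mul_nonneg (pow_nonneg (wt_pos k).le _) (norm_nonneg _))
  refine Summable.of_nonneg_of_le (fun p => ?_) (fun p => ?_) (convEquiv.summable_iff.mpr h1)
  · have := wt_pos p.1
    positivity
  · simp only [convEquiv, Equiv.coe_fn_mk, Function.comp]
    have := pow_le_pow_left₀ (wt_pos p.1).le (wt_le_mul_sub p.1 p.2) N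
    calc wt p.1 ^ N * (‖c (p.1 - p.2)‖ * ‖c' p.2‖)
        ≤ (wt (p.1 - p.2) * wt p.2) ^ N * (‖c (p.1 - p.2)‖ * ‖c' p.2‖) := by gcongr
      _ = _ := by rw [mul_pow]; ring

/-- Weighted ℓ¹ is an algebra under convolution because the weight is submultiplicative
(`wt_le_mul_sub`). This carries smoothness through the quadratic nonlinearity. -/
theorem WtSummable.conv {N : ℕ} {c c' : (Fin 2 → ℤ) → ℂ} (h : WtSummable N c)
    (h' : WtSummable N c') : WtSummable N (conv c c') := by
  have h1 := h.summable_conv h'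
  refine Summable.of_nonneg_of_le
    (fun k => mul_nonneg (pow_nonneg (wt_pos k).le _) (norm_nonneg _)) (fun k => ?_) h1.prod
  have h2 : Summable fun l => ‖c (k - l)‖ * ‖c' l‖ := by
    have := (h1.prod_factor k).mul_left (wt k ^ N)⁻¹
    refine this.congr fun l => ?_
    have := wt_pos k
    field_simp
  simp only
  rw [tsum_mul_left]
  refine mul_le_mul_of_nonneg_left ?_ (pow_nonneg (wt_pos k).le _)
  have : ∀ l, ‖c (k - l) * c' l‖ = ‖c (k - l)‖ * ‖c' l‖ := fun l => norm_mul _ _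
  simp_rw [← this]
  refine norm_tsum_le_tsum_norm ?_
  simpa only [this] using h2

/-- The trigonometric series with coefficients `c`. -/
noncomputable def trigSeries (c : (Fin 2 → ℤ) → ℂ) (x : Plane) : ℂ := ∑' k, c k * character k x

theorem summable_trigSeries {c : (Fin 2 → ℤ) → ℂ} (h : Summable fun k => ‖c k‖) (x : Plane) :
    Summable fun k => c k * character k x := by
  refine Summable.of_norm ?_
  simpa [norm_character] using h

theorem star_trigSeries (c : (Fin 2 → ℤ) → ℂ) (x : Plane) :
    star (trigSeries c x) = trigSeries (starSeq c) x := by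
  rw [trigSeries, tsum_star, trigSeries, ← (Equiv.neg (Fin 2 → ℤ)).tsum_eq]
  refine tsum_congr fun k => ?_
  simp [starSeq, ← star_character]

theorem trigSeries_mul {c c' : (Fin 2 → ℤ) → ℂ} (h : WtSummable 0 c) (h' : WtSummable 0 c')
    (x : Plane) : trigSeries c x * trigSeries c' x = trigSeries (conv c c') x := by
  have hn : Summable fun k => ‖c k * character k x‖ := by
    simpa [norm_character] using h.summable_norm
  have hn' : Summable fun k => ‖c' k * character k x‖ := by
    simpa [norm_character] using h'.summable_norm
  have hs := summable_mul_of_summable_norm hn hn'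
  rw [trigSeries, trigSeries, tsum_mul_tsum_of_summable_norm hn hn', ← convEquiv.tsum_eq]
  refine (convEquiv.summable_iff.mpr hs).tsum_prod.trans ?_
  refine tsum_congr fun k => ?_
  rw [conv, ← tsum_mul_right]
  refine tsum_congr fun l => ?_
  simp only [convEquiv, Equiv.coe_fn_mk, Function.comp]
  have : character k x = character (k - l) x * character l x := by
    rw [← character_add_left, sub_add_cancel]
  rw [this]
  ring

theorem trigSeries_add {c c' : (Fin 2 → ℤ) → ℂ} (h : WtSummable 0 c) (h' : WtSummable 0 c')
    (x : Plane) : trigSeries (fun k => c k + c' k) x = trigSeries c x + trigSeries c' x := by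
  simp only [trigSeries, add_mul]
  exact (summable_trigSeries h.summable_norm x).tsum_add (summable_trigSeries h'.summable_norm x)

theorem trigSeries_sub {c c' : (Fin 2 → ℤ) → ℂ} (h : WtSummable 0 c) (h' : WtSummable 0 c')
    (x : Plane) : trigSeries (fun k => c k - c' k) x = trigSeries c x - trigSeries c' x := by
  simp only [trigSeries, sub_mul]
  exact (summable_trigSeries h.summable_norm x).tsum_sub (summable_trigSeries h'.summable_norm x)

theorem trigSeries_const_mul (a : ℂ) (c : (Fin 2 → ℤ) → ℂ) (x : Plane) :
    trigSeries (fun k => a * c k) x = a * trigSeries c x := by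
  simp only [trigSeries, mul_assoc, tsum_mul_left]

theorem norm_phase_le (k : Fin 2 → ℤ) : ‖phase k‖ ≤ 2 * ‖k‖ := by
  refine ContinuousLinearMap.opNorm_le_bound _ (by positivity) fun x => ?_
  rw [phase_apply, Fin.sum_univ_two]
  have hk : ∀ i, |(k i : ℝ)| ≤ ‖k‖ := fun i => by
    simpa [Int.norm_eq_abs] using norm_le_pi_norm k i
  have hx : ∀ i, |x i| ≤ ‖x‖ := fun i => by simpa using PiLp.norm_apply_le x i
  rw [Real.norm_eq_abs]
  calc |(k 0 : ℝ) * x 0 + (k 1 : ℝ) * x 1| ≤ |(k 0 : ℝ)| * |x 0| + |(k 1 : ℝ)| * |x 1| := by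
        rw [← abs_mul, ← abs_mul]; exact abs_add_le _ _
    _ ≤ ‖k‖ * ‖x‖ + ‖k‖ * ‖x‖ := by
        gcongr
        · exact hk 0
        · exact hx 0
        · exact hk 1
        · exact hx 1
    _ = 2 * ‖k‖ * ‖x‖ := by ring

theorem WtSummable.coord_mul {N : ℕ} {c : (Fin 2 → ℤ) → ℂ} (h : WtSummable (N + 1) c)
    (i : Fin 2) : WtSummable N fun k => Complex.I * (k i : ℂ) * c k := by
  refine Summable.of_nonneg_of_le
    (fun k => mul_nonneg (pow_nonneg (wt_pos k).le _) (norm_nonneg _)) (fun k => ?_) h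
  have hk : |(k i : ℝ)| ≤ wt k := by
    have : |(k i : ℝ)| ≤ ‖k‖ := by simpa [Int.norm_eq_abs] using norm_le_pi_norm k i
    unfold wt; linarith
  have := wt_pos k
  rw [norm_mul, norm_mul, Complex.norm_I, one_mul, Complex.norm_intCast, pow_succ, mul_assoc]
  gcongr

theorem hasFDerivAt_trigSeries {c : (Fin 2 → ℤ) → ℂ} (h : WtSummable 1 c) (x : Plane) :
    HasFDerivAt (trigSeries c) (∑ i, trigSeries (fun k => Complex.I * (k i : ℂ) * c k) x •
      (Complex.ofRealCLM.comp (EuclideanSpace.proj i : Plane →L[ℝ] ℝ))) x := by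
  have hs : ∀ i, Summable fun k => Complex.I * (k i : ℂ) * c k * character k x := fun i =>
    summable_trigSeries (h.coord_mul i).summable_norm x
  have key := hasFDerivAt_tsum (𝕜 := ℝ) (f := fun k x => c k * character k x)
    (f' := fun k x => c k • ((character k x * Complex.I) • (Complex.ofRealCLM.comp (phase k))))
    (u := fun k => 2 * (wt k ^ 1 * ‖c k‖)) (x₀ := x) (Summable.mul_left 2 h)
    (fun k x => (hasFDerivAt_character k x).const_mul (c k))
    (fun k x => by
      rw [norm_smul, norm_smul, norm_mul, norm_character, Complex.norm_I, one_mul, one_mul]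
      have h1 : ‖Complex.ofRealCLM.comp (phase k)‖ ≤ 2 * wt k := by
        refine (ContinuousLinearMap.opNorm_comp_le _ _).trans ?_
        rw [Complex.ofRealCLM_norm, one_mul]
        refine (norm_phase_le k).trans ?_
        unfold wt; linarith
      calc ‖c k‖ * _ ≤ ‖c k‖ * (2 * wt k) := by gcongr
        _ = _ := by ring)
    (summable_trigSeries h.summable_norm x) x
  refine key.congr_fderiv ?_
  have hs' : ∀ i : Fin 2, HasSum (fun k => (Complex.I * (k i : ℂ) * c k * character k x) •
      (Complex.ofRealCLM.comp (EuclideanSpace.proj i : Plane →L[ℝ] ℝ)))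
      (trigSeries (fun k => Complex.I * (k i : ℂ) * c k) x •
      (Complex.ofRealCLM.comp (EuclideanSpace.proj i : Plane →L[ℝ] ℝ))) := fun i =>
    (hs i).hasSum.smul_const _
  have := hasSum_sum (s := Finset.univ) fun i _ => hs' i
  rw [← this.tsum_eq]
  refine tsum_congr fun k => ?_
  ext v
  simp [phase_apply, Fin.sum_univ_two]
  ring

/-- Termwise differentiation multiplies the coefficients by i k_i and costs one power of the weight;
hence the induction over all coefficient sequences. -/
theorem contDiff_trigSeries_nat (n : ℕ) : ∀ {c : (Fin 2 → ℤ) → ℂ}, WtSummable n c →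
    ContDiff ℝ n (trigSeries c) := by
  induction n with
  | zero =>
    intro c hc
    rw [Nat.cast_zero, contDiff_zero]
    refine continuous_tsum (u := fun k => ‖c k‖)
      (fun k => continuous_const.mul (continuous_character k)) hc.summable_norm fun k x => ?_
    rw [norm_mul, norm_character, mul_one]
  | succ n ih =>
    intro c hc
    have h1 : WtSummable 1 c := Summable.of_nonneg_of_le
      (fun k => mul_nonneg (pow_nonneg (wt_pos k).le _) (norm_nonneg _))
      (fun k => mul_le_mul_of_nonneg_right
        (pow_le_pow_right₀ (one_le_wt k) (by omega)) (norm_nonneg _)) hc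
    rw [Nat.cast_succ, contDiff_succ_iff_hasFDerivAt]
    refine ⟨_, ?_, fun x => hasFDerivAt_trigSeries h1 x⟩
    exact ContDiff.sum fun i _ => (ih (hc.coord_mul i)).smul contDiff_const

theorem contDiff_trigSeries {c : (Fin 2 → ℤ) → ℂ} (h : ∀ N, WtSummable N c) :
    ContDiff ℝ (⊤ : ℕ∞) (trigSeries c) :=
  contDiff_infty.mpr fun n => contDiff_trigSeries_nat n (h n)

/-- A rapidly convergent trigonometric series as a smooth function on the torus. -/
noncomputable def trigTest (c : (Fin 2 → ℤ) → ℂ) (h : ∀ N, WtSummable N c) : TorusTest :=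
  ⟨trigSeries c, contDiff_trigSeries h, fun x n => by
    simp only [trigSeries, character_add, character_latticePt, mul_one]⟩

theorem dbar_trigSeries {c : (Fin 2 → ℤ) → ℂ} (h : WtSummable 1 c) (x : Plane) :
    dbar (trigSeries c) x = trigSeries (fun k => dbarSymbol k * c k) x := by
  have h0 := summable_trigSeries (h.coord_mul 0).summable_norm x
  have h1 := summable_trigSeries (h.coord_mul 1).summable_norm x
  rw [dbar, (hasFDerivAt_trigSeries h x).fderiv]
  have e : ∀ j, (∑ i, trigSeries (fun k => Complex.I * (k i : ℂ) * c k) x •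
      (Complex.ofRealCLM.comp (EuclideanSpace.proj i : Plane →L[ℝ] ℝ)))
      (EuclideanSpace.single j 1) = trigSeries (fun k => Complex.I * (k j : ℂ) * c k) x := by
    intro j
    fin_cases j <;> simp
  rw [e, e]
  simp only [trigSeries]
  rw [← tsum_mul_left, ← h0.tsum_add (h1.mul_left _), ← tsum_mul_left]
  refine tsum_congr fun k => ?_
  rw [dbarSymbol]
  ring

theorem pairing_toDistribution_trigTest {c : (Fin 2 → ℤ) → ℂ} (h : ∀ N, WtSummable N c)
    (φ : TorusTest) :
    pairing (toDistribution (trigTest c h)) φ = ∑' k, c k * torusFT φ k := by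
  change ∫ x in cell, trigSeries c x * (φ : Plane → ℂ) x = _
  have hint : ∀ k, IntegrableOn (fun x => character k x * (φ : Plane → ℂ) x) cell := fun k =>
    ((continuous_character k).mul φ.2.1.continuous).integrableOn_cell
  have hnorm : ∀ k, ∫ x in cell, ‖c k * (character k x * (φ : Plane → ℂ) x)‖ =
      ‖c k‖ * ∫ x in cell, ‖(φ : Plane → ℂ) x‖ := by
    intro k
    simp only [norm_mul, norm_character, one_mul]
    rw [integral_const_mul]
  have key := (hasSum_integral_of_summable_integral_norm
    (F := fun k x => c k * (character k x * (φ : Plane → ℂ) x)) (fun k => (hint k).const_mul _)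
    (by
      simp_rw [hnorm]
      exact (h 0).summable_norm.mul_right _)).tsum_eq
  simp only [integral_const_mul] at key
  rw [show (∑' k, c k * torusFT φ k) = _ from key]
  · refine integral_congr_ae (Eventually.of_forall fun x => ?_)
    simp only
    rw [trigSeries, ← tsum_mul_right]
    refine tsum_congr fun k => ?_
    ring

/-! ## Small solutions of quadratic equations in Banach spaces -/

section Quadratic

variable {E : Type*} [NormedAddCommGroup E] [NormedSpace ℝ E]

/-- The factor 1/2 is 1/4 from L plus 1/8 from each of Q(u - v, u) and Q(v, u - v). -/
theorem norm_quadratic_sub_le (Q : E →L[ℝ] E →L[ℝ] E) (L : E →L[ℝ] E) {α : ℝ}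
    (hL : ‖L‖ ≤ 1 / 4) (hQ : ‖Q‖ * α ≤ 1 / 16) {u v : E} (hu : ‖u‖ ≤ 2 * α) (hv : ‖v‖ ≤ 2 * α) :
    ‖L (u - v) + (Q u u - Q v v)‖ ≤ 1 / 2 * ‖u - v‖ := by
  have e : Q u u - Q v v = Q (u - v) u + Q v (u - v) := by simp
  have h1 : ‖L (u - v)‖ ≤ 1 / 4 * ‖u - v‖ :=
    (L.le_opNorm _).trans (by gcongr)
  have h2 : ‖Q (u - v) u‖ ≤ 1 / 8 * ‖u - v‖ := by
    calc ‖Q (u - v) u‖ ≤ ‖Q‖ * ‖u - v‖ * ‖u‖ := Q.le_opNorm₂ _ _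
      _ ≤ ‖Q‖ * ‖u - v‖ * (2 * α) := by gcongr
      _ = 2 * (‖Q‖ * α) * ‖u - v‖ := by ring
      _ ≤ 2 * (1 / 16) * ‖u - v‖ := by gcongr
      _ = _ := by ring
  have h3 : ‖Q v (u - v)‖ ≤ 1 / 8 * ‖u - v‖ := by
    calc ‖Q v (u - v)‖ ≤ ‖Q‖ * ‖v‖ * ‖u - v‖ := Q.le_opNorm₂ _ _
      _ ≤ ‖Q‖ * (2 * α) * ‖u - v‖ := by gcongr
      _ = 2 * (‖Q‖ * α) * ‖u - v‖ := by ring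
      _ ≤ 2 * (1 / 16) * ‖u - v‖ := by gcongr
      _ = _ := by ring
  rw [e]
  calc _ ≤ ‖L (u - v)‖ + (‖Q (u - v) u‖ + ‖Q v (u - v)‖) :=
        (norm_add_le _ _).trans (by gcongr; exact norm_add_le _ _)
    _ ≤ _ := by linarith

/-- Banach's fixed point theorem on the ball of radius 2α: the map halves distances there and sends
0 to A, which lies in the ball of radius α. -/
theorem exists_quadratic_fixedPoint [CompleteSpace E] (Q : E →L[ℝ] E →L[ℝ] E) (L : E →L[ℝ] E)
    (A : E) {α : ℝ} (hA : ‖A‖ ≤ α) (hL : ‖L‖ ≤ 1 / 4) (hQ : ‖Q‖ * α ≤ 1 / 16) :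
    ∃ u, ‖u‖ ≤ 2 * α ∧ u = A + L u + Q u u := by
  have hα : 0 ≤ α := (norm_nonneg _).trans hA
  set s : Set E := Metric.closedBall 0 (2 * α)
  set T : E → E := fun u => A + L u + Q u u
  have hdiff : ∀ u ∈ s, ∀ v ∈ s, ‖T u - T v‖ ≤ 1 / 2 * ‖u - v‖ := by
    intro u hu v hv
    rw [mem_closedBall_zero_iff] at hu hv
    have e : T u - T v = L (u - v) + (Q u u - Q v v) := by
      simp only [T, map_sub]; abel
    rw [e]
    exact norm_quadratic_sub_le Q L hL hQ hu hv
  have h0 : (0 : E) ∈ s := by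
    rw [mem_closedBall_zero_iff, norm_zero]; positivity
  have hmaps : Set.MapsTo T s s := by
    intro u hu
    have h1 := hdiff u hu 0 h0
    have h2 : T 0 = A := by simp [T]
    rw [mem_closedBall_zero_iff] at hu ⊢
    rw [h2, sub_zero] at h1
    calc ‖T u‖ = ‖(T u - A) + A‖ := by simp
      _ ≤ ‖T u - A‖ + ‖A‖ := norm_add_le _ _
      _ ≤ _ := by linarith
  have hc : ContractingWith (1 / 2 : ℝ≥0) (hmaps.restrict T s s) := by
    refine ⟨by rw [← NNReal.coe_lt_coe]; norm_num, LipschitzWith.of_dist_le_mul fun u v => ?_⟩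
    have := hdiff u u.2 v v.2
    simpa [Subtype.dist_eq, dist_eq_norm] using this
  obtain ⟨u, hu, hfix, -⟩ := hc.exists_fixedPoint' Metric.isClosed_closedBall.isComplete hmaps h0
    (edist_ne_top _ _)
  exact ⟨u, by simpa [s] using hu, hfix.symm⟩

/-- Subtracting the equations leaves, besides the differences of the data, a term bounded by half of
`‖u - v‖`, which is absorbed on the left. Rates of convergence of the data thus pass to the
solutions. -/
theorem norm_sub_le_of_quadratic_fixedPoint (Q : E →L[ℝ] E →L[ℝ] E) (L L' : E →L[ℝ] E)
    (A A' : E) {α : ℝ} (hL : ‖L‖ ≤ 1 / 4) (hQ : ‖Q‖ * α ≤ 1 / 16) {u v : E}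
    (hu : ‖u‖ ≤ 2 * α) (hv : ‖v‖ ≤ 2 * α) (hu' : u = A + L u + Q u u)
    (hv' : v = A' + L' v + Q v v) :
    ‖u - v‖ ≤ 2 * ‖A - A'‖ + 4 * α * ‖L - L'‖ := by
  have e : u - v = (A - A') + (L - L') v + (L (u - v) + (Q u u - Q v v)) := by
    conv_lhs => rw [hu', hv']
    simp only [map_sub, sub_apply]
    abel
  have h1 := norm_quadratic_sub_le Q L hL hQ hu hv
  have h2 : ‖(L - L') v‖ ≤ ‖L - L'‖ * (2 * α) :=
    ((L - L').le_opNorm _).trans (by gcongr)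
  have h3 : ‖u - v‖ ≤ ‖A - A'‖ + ‖(L - L') v‖ + ‖L (u - v) + (Q u u - Q v v)‖ := by
    conv_lhs => rw [e]
    exact (norm_add_le _ _).trans (by gcongr; exact norm_add_le _ _)
  linarith

end Quadratic

/-! ## Matrices acting on `ℓ²` -/

/-- The Hilbert space `ℓ²(ℤ²)`. -/
abbrev SeqL2 : Type := lp (fun _ : Fin 2 → ℤ => ℂ) 2

theorem SeqL2.summable_sq (a : SeqL2) : Summable fun k => ‖a k‖ ^ 2 := by
  have := (lp.memℓp a).summable (by norm_num)
  simpa using this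

theorem SeqL2.norm_sq (a : SeqL2) : ‖a‖ ^ 2 = ∑' k, ‖a k‖ ^ 2 := by
  have := lp.norm_rpow_eq_tsum (p := 2) (by norm_num) a
  simpa using this

theorem SeqL2.sum_sq_le (a : SeqL2) (S : Finset (Fin 2 → ℤ)) : ∑ k ∈ S, ‖a k‖ ^ 2 ≤ ‖a‖ ^ 2 := by
  rw [SeqL2.norm_sq]
  exact a.summable_sq.sum_le_tsum S fun _ _ => sq_nonneg _

theorem memℓp_two_of_summable {f : (Fin 2 → ℤ) → ℂ} (h : Summable fun k => ‖f k‖ ^ 2) :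
    Memℓp f 2 :=
  memℓp_gen (by simpa using h)

/-- A square summable sequence as an element of `ℓ²`. -/
def SeqL2.mk (f : (Fin 2 → ℤ) → ℂ) (h : Summable fun k => ‖f k‖ ^ 2) : SeqL2 :=
  ⟨f, memℓp_two_of_summable h⟩

theorem SeqL2.mk_apply (f : (Fin 2 → ℤ) → ℂ) (h : Summable fun k => ‖f k‖ ^ 2) (k : Fin 2 → ℤ) :
    SeqL2.mk f h k = f k := rfl

theorem SeqL2.norm_le_of_sum_le {a : SeqL2} {C : ℝ} (hC : 0 ≤ C)
    (h : ∀ S : Finset (Fin 2 → ℤ), ∑ k ∈ S, ‖a k‖ ^ 2 ≤ C ^ 2) : ‖a‖ ≤ C := by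
  refine le_of_sq_le_sq ?_ hC
  rw [SeqL2.norm_sq]
  exact a.summable_sq.tsum_le_of_sum_le h

/-- The quadratic form of the matrix `A` is bounded by `C` on finitely supported sequences. -/
def MatrixBound (A : (Fin 2 → ℤ) → (Fin 2 → ℤ) → ℂ) (C : ℝ) : Prop :=
  ∀ (S : Finset (Fin 2 → ℤ)) (f g : (Fin 2 → ℤ) → ℂ),
    ‖∑ k ∈ S, ∑ l ∈ S, A k l * f l * g k‖ ≤
      C * √(∑ l ∈ S, ‖f l‖ ^ 2) * √(∑ k ∈ S, ‖g k‖ ^ 2)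

/-- Duality: g is the conjugate of A f, so the bilinear form becomes the squared norm that is to be
bounded. -/
theorem MatrixBound.sum_sq_le {A : (Fin 2 → ℤ) → (Fin 2 → ℤ) → ℂ} {C : ℝ} (h : MatrixBound A C)
    (S : Finset (Fin 2 → ℤ)) (f : (Fin 2 → ℤ) → ℂ) :
    ∑ k ∈ S, ‖∑ l ∈ S, A k l * f l‖ ^ 2 ≤ C ^ 2 * ∑ l ∈ S, ‖f l‖ ^ 2 := by
  set X := ∑ k ∈ S, ‖∑ l ∈ S, A k l * f l‖ ^ 2
  have hX : 0 ≤ X := Finset.sum_nonneg fun _ _ => sq_nonneg _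
  have hF : 0 ≤ ∑ l ∈ S, ‖f l‖ ^ 2 := Finset.sum_nonneg fun _ _ => sq_nonneg _
  have h1 := h S f fun k => star (∑ l ∈ S, A k l * f l)
  have e : ∑ k ∈ S, ∑ l ∈ S, A k l * f l * star (∑ l ∈ S, A k l * f l) = ((X : ℝ) : ℂ) := by
    simp only [X]
    push_cast
    refine Finset.sum_congr rfl fun k _ => ?_
    rw [← Finset.sum_mul, Complex.star_def, Complex.mul_conj, Complex.normSq_eq_norm_sq]
    push_cast
    rfl
  rw [e] at h1
  simp only [norm_star] at h1
  change _ ≤ C * √(∑ l ∈ S, ‖f l‖ ^ 2) * √X at h1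
  rw [Complex.norm_real, Real.norm_of_nonneg hX] at h1
  rcases hX.eq_or_lt with h0 | h0
  · rw [← h0]; positivity
  · have h2 : √X ≤ C * √(∑ l ∈ S, ‖f l‖ ^ 2) := by
      have : √X * √X ≤ C * √(∑ l ∈ S, ‖f l‖ ^ 2) * √X := by rwa [Real.mul_self_sqrt hX]
      exact le_of_mul_le_mul_right this (Real.sqrt_pos.mpr h0)
    have h3 := pow_le_pow_left₀ (Real.sqrt_nonneg X) h2 2
    rwa [mul_pow, Real.sq_sqrt hX, Real.sq_sqrt hF] at h3

/-- Testing with the conjugate of the row itself. The hypothesis concerns finite sections only, so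
the convergence of the series that define the operator must be deduced from it. -/
theorem MatrixBound.row_summable {A : (Fin 2 → ℤ) → (Fin 2 → ℤ) → ℂ} {C : ℝ}
    (h : MatrixBound A C) (k : Fin 2 → ℤ) : Summable fun l => ‖A k l‖ ^ 2 := by
  classical
  refine summable_of_sum_le (c := C ^ 2) (fun l => sq_nonneg _) fun S' => ?_
  set S := insert k S'
  refine (Finset.sum_le_sum_of_subset_of_nonneg (Finset.subset_insert k S')
    fun _ _ _ => sq_nonneg _).trans ?_
  set X := ∑ l ∈ S, ‖A k l‖ ^ 2
  have hX : 0 ≤ X := Finset.sum_nonneg fun _ _ => sq_nonneg _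
  have h1 := h.sum_sq_le S fun l => star (A k l)
  have h2 : ‖∑ l ∈ S, A k l * star (A k l)‖ ^ 2 ≤ C ^ 2 * X := by
    refine (Finset.single_le_sum (f := fun k' => ‖∑ l ∈ S, A k' l * star (A k l)‖ ^ 2)
      (fun _ _ => sq_nonneg _) (Finset.mem_insert_self k S')).trans ?_
    simpa only [norm_star] using h1
  have e : ∑ l ∈ S, A k l * star (A k l) = ((X : ℝ) : ℂ) := by
    simp only [X]
    push_cast
    refine Finset.sum_congr rfl fun l _ => ?_
    rw [Complex.star_def, Complex.mul_conj, Complex.normSq_eq_norm_sq]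
    push_cast
    rfl
  rw [e, Complex.norm_real, Real.norm_of_nonneg hX] at h2
  rcases hX.eq_or_lt with h0 | h0
  · rw [← h0]; positivity
  · have : X * X ≤ C ^ 2 * X := by rwa [← pow_two]
    exact le_of_mul_le_mul_right this h0

theorem Summable.mul_of_sq {f g : (Fin 2 → ℤ) → ℂ} (hf : Summable fun k => ‖f k‖ ^ 2)
    (hg : Summable fun k => ‖g k‖ ^ 2) : Summable fun k => ‖f k * g k‖ := by
  refine Summable.of_nonneg_of_le (fun _ => norm_nonneg _) (fun k => ?_) (hf.add hg)
  rw [norm_mul]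
  nlinarith [sq_nonneg (‖f k‖ - ‖g k‖), norm_nonneg (f k), norm_nonneg (g k)]

theorem MatrixBound.summable {A : (Fin 2 → ℤ) → (Fin 2 → ℤ) → ℂ} {C : ℝ}
    (h : MatrixBound A C) (a : SeqL2) (k : Fin 2 → ℤ) : Summable fun l => ‖A k l * a l‖ :=
  (h.row_summable k).mul_of_sq a.summable_sq

theorem MatrixBound.sum_tsum_sq_le {A : (Fin 2 → ℤ) → (Fin 2 → ℤ) → ℂ} {C : ℝ}
    (h : MatrixBound A C) (a : SeqL2) (K : Finset (Fin 2 → ℤ)) :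
    ∑ k ∈ K, ‖∑' l, A k l * a l‖ ^ 2 ≤ (C * ‖a‖) ^ 2 := by
  have hlim : Tendsto (fun S : Finset (Fin 2 → ℤ) => ∑ k ∈ K, ‖∑ l ∈ S, A k l * a l‖ ^ 2) atTop
      (𝓝 (∑ k ∈ K, ‖∑' l, A k l * a l‖ ^ 2)) :=
    tendsto_finsetSum _ fun k _ => ((h.summable a k).of_norm.hasSum.norm).pow 2
  refine le_of_tendsto hlim ?_
  filter_upwards [Filter.eventually_ge_atTop K] with S hS
  calc _ ≤ ∑ k ∈ S, ‖∑ l ∈ S, A k l * a l‖ ^ 2 :=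
        Finset.sum_le_sum_of_subset_of_nonneg hS fun _ _ _ => sq_nonneg _
    _ ≤ C ^ 2 * ∑ l ∈ S, ‖a l‖ ^ 2 := h.sum_sq_le S _
    _ ≤ C ^ 2 * ‖a‖ ^ 2 := by gcongr; exact a.sum_sq_le S
    _ = _ := by ring

/-- The bounded operator on `ℓ²` with matrix `A`. -/
noncomputable def MatrixBound.toCLM {A : (Fin 2 → ℤ) → (Fin 2 → ℤ) → ℂ} {C : ℝ}
    (h : MatrixBound A C) (hC : 0 ≤ C) : SeqL2 →L[ℂ] SeqL2 :=
  LinearMap.mkContinuous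
    { toFun := fun a => SeqL2.mk (fun k => ∑' l, A k l * a l)
        (summable_of_sum_le (fun _ => sq_nonneg _) fun K => h.sum_tsum_sq_le a K)
      map_add' := by
        intro a a'
        ext k
        simp only [SeqL2.mk_apply, lp.coeFn_add, Pi.add_apply, mul_add]
        exact (h.summable a k).of_norm.tsum_add (h.summable a' k).of_norm
      map_smul' := by
        intro c a
        ext k
        simp only [SeqL2.mk_apply, lp.coeFn_smul, Pi.smul_apply, smul_eq_mul, RingHom.id_apply]
        rw [← tsum_mul_left]
        exact tsum_congr fun l => by ring } C fun a =>
    SeqL2.norm_le_of_sum_le (by positivity) fun K => h.sum_tsum_sq_le a K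

theorem MatrixBound.norm_toCLM_le {A : (Fin 2 → ℤ) → (Fin 2 → ℤ) → ℂ} {C : ℝ}
    (h : MatrixBound A C) (hC : 0 ≤ C) : ‖h.toCLM hC‖ ≤ C :=
  LinearMap.mkContinuous_norm_le _ hC _

/-! ## Weighted `ℓ²` bounds -/

/-- The sequence `f` has norm at most `M` in the Sobolev space `H^s`. -/
def HsBound (s : ℝ) (f : (Fin 2 → ℤ) → ℂ) (M : ℝ) : Prop :=
  0 ≤ M ∧ ∀ S : Finset (Fin 2 → ℤ), ∑ k ∈ S, (wt k ^ s * ‖f k‖) ^ 2 ≤ M ^ 2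

theorem HsBound.mono {s : ℝ} {f : (Fin 2 → ℤ) → ℂ} {M M' : ℝ} (h : HsBound s f M) (hM : M ≤ M') :
    HsBound s f M' :=
  ⟨h.1.trans hM, fun S => (h.2 S).trans (pow_le_pow_left₀ h.1 hM 2)⟩

theorem HsBound.of_le {s s' a : ℝ} {f g : (Fin 2 → ℤ) → ℂ} {M : ℝ} (h : HsBound s f M) (ha : 0 ≤ a)
    (hle : ∀ k, wt k ^ s' * ‖g k‖ ≤ a * (wt k ^ s * ‖f k‖)) : HsBound s' g (a * M) := by
  refine ⟨mul_nonneg ha h.1, fun S => ?_⟩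
  calc _ ≤ ∑ k ∈ S, (a * (wt k ^ s * ‖f k‖)) ^ 2 := by
        refine Finset.sum_le_sum fun k _ => pow_le_pow_left₀ ?_ (hle k) 2
        have := wt_pos k
        positivity
    _ = a ^ 2 * ∑ k ∈ S, (wt k ^ s * ‖f k‖) ^ 2 := by
        rw [Finset.mul_sum]; exact Finset.sum_congr rfl fun k _ => by ring
    _ ≤ a ^ 2 * M ^ 2 := by gcongr; exact h.2 S
    _ = _ := by ring

theorem HsBound.add {s : ℝ} {f g : (Fin 2 → ℤ) → ℂ} {M M' : ℝ} (h : HsBound s f M)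
    (h' : HsBound s g M') : HsBound s (fun k => f k + g k) (M + M') := by
  refine ⟨add_nonneg h.1 h'.1, fun S => ?_⟩
  have h1 := h.2 S
  have h2 := h'.2 S
  have h3 : ∑ k ∈ S, (wt k ^ s * ‖f k‖) * (wt k ^ s * ‖g k‖) ≤ M * M' := by
    refine (Real.sum_mul_le_sqrt_mul_sqrt _ _ _).trans ?_
    gcongr
    · exact h.1
    · exact Real.sqrt_le_iff.mpr ⟨h.1, h1⟩
    · exact Real.sqrt_le_iff.mpr ⟨h'.1, h2⟩
  calc _ ≤ ∑ k ∈ S, ((wt k ^ s * ‖f k‖) ^ 2 + 2 * ((wt k ^ s * ‖f k‖) * (wt k ^ s * ‖g k‖)) +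
        (wt k ^ s * ‖g k‖) ^ 2) := by
        refine Finset.sum_le_sum fun k _ => ?_
        have hw : 0 ≤ wt k ^ s := Real.rpow_nonneg (wt_pos k).le _
        have := pow_le_pow_left₀ (by positivity)
          (mul_le_mul_of_nonneg_left (norm_add_le (f k) (g k)) hw) 2
        refine this.trans (le_of_eq ?_)
        ring
    _ ≤ _ := by
        rw [Finset.sum_add_distrib, Finset.sum_add_distrib, ← Finset.mul_sum]
        nlinarith

theorem HsBound.const_mul {s : ℝ} {f : (Fin 2 → ℤ) → ℂ} {M : ℝ} (h : HsBound s f M) (a : ℂ) :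
    HsBound s (fun k => a * f k) (‖a‖ * M) :=
  h.of_le (norm_nonneg a) fun k => by rw [norm_mul]; apply le_of_eq; ring

theorem HsBound.neg {s : ℝ} {f : (Fin 2 → ℤ) → ℂ} {M : ℝ} (h : HsBound s f M) :
    HsBound s (fun k => -f k) M := by
  simpa using h.const_mul (-1)

theorem HsBound.sub {s : ℝ} {f g : (Fin 2 → ℤ) → ℂ} {M M' : ℝ} (h : HsBound s f M)
    (h' : HsBound s g M') : HsBound s (fun k => f k - g k) (M + M') := by
  simpa [sub_eq_add_neg] using h.add h'.neg

theorem HsBound.starSeq {s : ℝ} {f : (Fin 2 → ℤ) → ℂ} {M : ℝ} (h : HsBound s f M) :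
    HsBound s (starSeq f) M := by
  refine ⟨h.1, fun S => ?_⟩
  have := h.2 (S.map (Equiv.neg _).toEmbedding)
  simpa [_root_.starSeq, wt_neg, Finset.sum_map] using this

theorem HsBound.summable {s : ℝ} {f : (Fin 2 → ℤ) → ℂ} {M : ℝ} (h : HsBound s f M) :
    Summable fun k => (wt k ^ s * ‖f k‖) ^ 2 :=
  summable_of_sum_le (fun _ => sq_nonneg _) h.2

theorem HsBound.inv_dbarSymbol_mul {p : ℝ} {f : (Fin 2 → ℤ) → ℂ} {M : ℝ}
    (h : HsBound (p - 1) f M) : HsBound p (fun k => (dbarSymbol k)⁻¹ * f k) (4 * M) := by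
  refine h.of_le (by norm_num) fun k => ?_
  have hw := wt_pos k
  rw [norm_mul, Real.rpow_sub hw, Real.rpow_one]
  calc wt k ^ p * (‖(dbarSymbol k)⁻¹‖ * ‖f k‖) ≤ wt k ^ p * (4 * (wt k)⁻¹ * ‖f k‖) := by
        gcongr; exact norm_inv_dbarSymbol_le k
    _ = _ := by ring

theorem HsBound.norm_le {s : ℝ} {f : (Fin 2 → ℤ) → ℂ} {M : ℝ} (h : HsBound s f M)
    (k : Fin 2 → ℤ) : ‖f k‖ ≤ M * wt k ^ (-s) := by
  have h1 := h.2 {k}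
  rw [Finset.sum_singleton] at h1
  have hw := wt_pos k
  have h2 := abs_le_of_sq_le_sq' h1 h.1
  rw [Real.rpow_neg hw.le, ← div_eq_mul_inv, le_div_iff₀ (by positivity), mul_comm]
  exact h2.2

/-- The sequence `wt ^ (-p) a` in `H^p` determined by `a ∈ ℓ²`. -/
noncomputable def unweight (p : ℝ) (a : SeqL2) (k : Fin 2 → ℤ) : ℂ :=
  ((wt k ^ (-p) : ℝ) : ℂ) * a k

theorem wt_rpow_mul_norm_unweight (p : ℝ) (a : SeqL2) (k : Fin 2 → ℤ) :
    wt k ^ p * ‖unweight p a k‖ = ‖a k‖ := by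
  have hw := wt_pos k
  rw [unweight, norm_mul, Complex.norm_real, Real.norm_of_nonneg (by positivity), ← mul_assoc,
    ← Real.rpow_add hw]
  simp

theorem hsBound_unweight (p : ℝ) (a : SeqL2) : HsBound p (unweight p a) ‖a‖ := by
  refine ⟨norm_nonneg _, fun S => ?_⟩
  simp only [wt_rpow_mul_norm_unweight]
  exact a.sum_sq_le S

theorem unweight_injective (p : ℝ) {a a' : SeqL2} (h : unweight p a = unweight p a') : a = a' := by
  ext k
  have := congrFun h k
  have hw : ((wt k ^ (-p) : ℝ) : ℂ) ≠ 0 := by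
    exact_mod_cast (Real.rpow_pos_of_pos (wt_pos k) _).ne'
  exact mul_left_cancel₀ hw this

theorem unweight_add (p : ℝ) (a a' : SeqL2) (k : Fin 2 → ℤ) :
    unweight p (a + a') k = unweight p a k + unweight p a' k := by
  simp [unweight, mul_add]

theorem unweight_sub (p : ℝ) (a a' : SeqL2) (k : Fin 2 → ℤ) :
    unweight p (a - a') k = unweight p a k - unweight p a' k := by
  simp [unweight, mul_sub]

theorem unweight_smul (p : ℝ) (c : ℝ) (a : SeqL2) (k : Fin 2 → ℤ) :
    unweight p (c • a) k = c * unweight p a k := by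
  simp [unweight]; ring

/-- The element `wt ^ p f` of `ℓ²`, for `f ∈ H^p`. -/
noncomputable def HsBound.weight {p : ℝ} {f : (Fin 2 → ℤ) → ℂ} {M : ℝ} (h : HsBound p f M) :
    SeqL2 :=
  SeqL2.mk (fun k => ((wt k ^ p : ℝ) : ℂ) * f k) <| h.summable.congr fun k => by
    rw [norm_mul, Complex.norm_real, Real.norm_of_nonneg (Real.rpow_nonneg (wt_pos k).le _)]

theorem HsBound.unweight_weight {p : ℝ} {f : (Fin 2 → ℤ) → ℂ} {M : ℝ} (h : HsBound p f M) :
    unweight p h.weight = f := by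
  funext k
  have hw := wt_pos k
  simp only [unweight, HsBound.weight, SeqL2.mk_apply]
  rw [← mul_assoc, ← Complex.ofReal_mul, ← Real.rpow_add hw]
  simp

theorem norm_le_of_hsBound_unweight {p : ℝ} {a : SeqL2} {M : ℝ} (h : HsBound p (unweight p a) M) :
    ‖a‖ ≤ M := by
  refine SeqL2.norm_le_of_sum_le h.1 fun S => ?_
  simpa only [wt_rpow_mul_norm_unweight] using h.2 S

/-! ## Multiplication operators -/

/-- Multiplication by the distribution with Fourier coefficients `z` maps `H^s` to `H^{-t}`, with
norm at most `K`. -/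
def OpBound (z : (Fin 2 → ℤ) → ℂ) (s t K : ℝ) : Prop :=
  ∀ (S : Finset (Fin 2 → ℤ)) (f g : (Fin 2 → ℤ) → ℂ),
    ‖∑ k ∈ S, ∑ l ∈ S, z (k - l) * f l * g k‖ ≤
      K * √(∑ l ∈ S, (wt l ^ s * ‖f l‖) ^ 2) * √(∑ k ∈ S, (wt k ^ t * ‖g k‖) ^ 2)

theorem OpBound.mono {z : (Fin 2 → ℤ) → ℂ} {s t K K' : ℝ} (h : OpBound z s t K) (hK : K ≤ K') :
    OpBound z s t K' := fun S f g => (h S f g).trans (by gcongr)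

theorem OpBound.add {z z' : (Fin 2 → ℤ) → ℂ} {s t K K' : ℝ} (h : OpBound z s t K)
    (h' : OpBound z' s t K') : OpBound (fun k => z k + z' k) s t (K + K') := by
  intro S f g
  simp only [add_mul, Finset.sum_add_distrib]
  exact (norm_add_le _ _).trans (add_le_add (h S f g) (h' S f g))

theorem OpBound.const_mul {z : (Fin 2 → ℤ) → ℂ} {s t K : ℝ} (h : OpBound z s t K) (a : ℂ) :
    OpBound (fun k => a * z k) s t (‖a‖ * K) := by
  intro S f g
  simp only [mul_assoc, ← Finset.mul_sum]
  rw [norm_mul]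
  gcongr
  simpa only [mul_assoc] using h S f g

theorem OpBound.sub {z z' : (Fin 2 → ℤ) → ℂ} {s t K K' : ℝ} (h : OpBound z s t K)
    (h' : OpBound z' s t K') : OpBound (fun k => z k - z' k) s t (K + K') := by
  simpa [sub_eq_add_neg] using h.add (h'.const_mul (-1))

theorem OpBound.starSeq {z : (Fin 2 → ℤ) → ℂ} {s t K : ℝ} (h : OpBound z s t K) :
    OpBound (starSeq z) s t K := by
  intro S f g
  have := h (S.map (Equiv.neg _).toEmbedding) (fun k => star (f (-k))) (fun k => star (g (-k)))
  simp only [Finset.sum_map, Equiv.coe_toEmbedding, Equiv.neg_apply, neg_neg, norm_star,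
    wt_neg] at this
  refine le_trans (le_of_eq ?_) this
  rw [← norm_star]
  congr 1
  simp only [star_sum, star_mul', _root_.starSeq, star_star]
  refine Finset.sum_congr rfl fun k _ => Finset.sum_congr rfl fun l _ => ?_
  congr 3
  abel_nf

theorem opBound_single {s t : ℝ} (hs : 0 ≤ s) (ht : 0 ≤ t) (c : ℂ) :
    OpBound (Pi.single 0 c) s t ‖c‖ := by
  intro S f g
  have e : ∀ k ∈ S, ∑ l ∈ S, (Pi.single 0 c : (Fin 2 → ℤ) → ℂ) (k - l) * f l * g k =
      c * (f k * g k) := by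
    intro k hk
    rw [Finset.sum_eq_single_of_mem k hk]
    · simp [mul_assoc]
    · intro l _ hl
      rw [Pi.single_eq_of_ne (sub_ne_zero.mpr hl.symm)]
      simp
  rw [Finset.sum_congr rfl e, ← Finset.mul_sum, norm_mul, mul_assoc]
  gcongr
  refine (norm_sum_le _ _).trans ?_
  refine le_trans ?_ (Real.sum_mul_le_sqrt_mul_sqrt _ _ _)
  refine Finset.sum_le_sum fun k _ => ?_
  rw [norm_mul]
  have h1 : ∀ r : ℝ, 0 ≤ r → 1 ≤ wt k ^ r := fun r hr => Real.one_le_rpow (one_le_wt k) hr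
  have := h1 s hs
  have := h1 t ht
  gcongr
  · exact le_mul_of_one_le_left (norm_nonneg _) (h1 s hs)
  · exact le_mul_of_one_le_left (norm_nonneg _) (h1 t ht)

/-- Cauchy–Schwarz over the pairs (k, l). One factor is the sum over l of `wt l ^ (-2p) * wt (k - l)
^ (-2p)`, bounded uniformly in k because 4p > 2. The product of two elements of H^p therefore lies
in L², hence in H^{p-1} as p ≤ 1. -/
theorem HsBound.opBound {p : ℝ} (hp : 1 / 2 < p) (hp1 : p ≤ 1) {f : (Fin 2 → ℤ) → ℂ} {M : ℝ}
    (h : HsBound p f M) : OpBound f p (1 - p) (√(2 * wtSum (4 * p)) * M) := by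
  intro S u g
  set X := ∑ l ∈ S, (wt l ^ p * ‖u l‖) ^ 2
  set Y := ∑ k ∈ S, (wt k ^ (1 - p) * ‖g k‖) ^ 2
  have hX : 0 ≤ X := Finset.sum_nonneg fun _ _ => sq_nonneg _
  have hY : 0 ≤ Y := Finset.sum_nonneg fun _ _ => sq_nonneg _
  have hW : 0 ≤ 2 * wtSum (4 * p) := mul_nonneg (by norm_num) (wtSum_nonneg _)
  have h1 : ‖∑ k ∈ S, ∑ l ∈ S, f (k - l) * u l * g k‖ ≤
      ∑ q ∈ S ×ˢ S, (wt q.2 ^ (-p) * wt (q.1 - q.2) ^ (-p) * ‖g q.1‖) *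
        ((wt (q.1 - q.2) ^ p * ‖f (q.1 - q.2)‖) * (wt q.2 ^ p * ‖u q.2‖)) := by
    rw [← Finset.sum_product']
    refine (norm_sum_le _ _).trans (Finset.sum_le_sum fun q _ => le_of_eq ?_)
    have h2 : ∀ k : Fin 2 → ℤ, wt k ^ (-p) * wt k ^ p = 1 := fun k => by
      rw [← Real.rpow_add (wt_pos k)]; simp
    rw [norm_mul, norm_mul]
    calc ‖f (q.1 - q.2)‖ * ‖u q.2‖ * ‖g q.1‖ = (wt q.2 ^ (-p) * wt q.2 ^ p) *
          (wt (q.1 - q.2) ^ (-p) * wt (q.1 - q.2) ^ p) *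
          (‖f (q.1 - q.2)‖ * ‖u q.2‖ * ‖g q.1‖) := by rw [h2, h2]; ring
      _ = _ := by ring
  refine h1.trans ((Real.sum_mul_le_sqrt_mul_sqrt _ _ _).trans ?_)
  have h3 : ∑ q ∈ S ×ˢ S, (wt q.2 ^ (-p) * wt (q.1 - q.2) ^ (-p) * ‖g q.1‖) ^ 2 ≤
      2 * wtSum (4 * p) * Y := by
    rw [Finset.sum_product, Finset.mul_sum]
    refine Finset.sum_le_sum fun k _ => ?_
    have h4 := sum_wt_conv_le (a := 2 * p) (b := 2 * p) (c := 0) (by linarith) (by linarith)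
      le_rfl (by linarith) k S
    have h5 : ∑ l ∈ S, (wt l ^ (-p) * wt (k - l) ^ (-p) * ‖g k‖) ^ 2 =
        (∑ l ∈ S, wt l ^ (-(2 * p)) * wt (k - l) ^ (-(2 * p))) * ‖g k‖ ^ 2 := by
      rw [Finset.sum_mul]
      refine Finset.sum_congr rfl fun l _ => ?_
      have : ∀ m : Fin 2 → ℤ, wt m ^ (-(2 * p)) = (wt m ^ (-p)) ^ 2 := fun m => by
        rw [← Real.rpow_natCast, ← Real.rpow_mul (wt_pos m).le]; congr 1; push_cast; ring
      rw [this, this]; ring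
    rw [h5]
    have h6 : ‖g k‖ ≤ wt k ^ (1 - p) * ‖g k‖ :=
      le_mul_of_one_le_left (norm_nonneg _) (Real.one_le_rpow (one_le_wt k) (by linarith))
    have h7 : 2 ^ (0 : ℝ) * 2 * wtSum (2 * p + 2 * p - 0) * wt k ^ (-(0 : ℝ)) =
        2 * wtSum (4 * p) := by
      rw [neg_zero, Real.rpow_zero, Real.rpow_zero, one_mul, mul_one]; ring_nf
    rw [h7] at h4
    gcongr
  have h4 : ∑ q ∈ S ×ˢ S, ((wt (q.1 - q.2) ^ p * ‖f (q.1 - q.2)‖) * (wt q.2 ^ p * ‖u q.2‖)) ^ 2 ≤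
      M ^ 2 * X := by
    rw [Finset.sum_product_right, Finset.mul_sum]
    refine Finset.sum_le_sum fun l _ => ?_
    simp only [mul_pow _ (wt l ^ p * ‖u l‖), ← Finset.sum_mul]
    gcongr
    have := h.2 (S.map (Equiv.subRight l).toEmbedding)
    simpa [Finset.sum_map] using this
  calc _ ≤ √(2 * wtSum (4 * p) * Y) * √(M ^ 2 * X) := by
        gcongr
    _ = _ := by
        rw [Real.sqrt_mul hW, Real.sqrt_mul (sq_nonneg M), Real.sqrt_sq h.1]
        ring

/-- The matrix of `f ↦ ∂_{z̄}⁻¹ (z f)` on `H^p`. -/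
noncomputable def mulMatrix (p : ℝ) (z : (Fin 2 → ℤ) → ℂ) (k l : Fin 2 → ℤ) : ℂ :=
  ((wt k ^ p : ℝ) : ℂ) * (dbarSymbol k)⁻¹ * z (k - l) * ((wt l ^ (-p) : ℝ) : ℂ)

/-- The weights and ∂_{z̄}⁻¹ are moved onto the test sequences. On the output side the weights
multiply to `wt k`, which is the derivative that the inverse gains; this leaves the factor 4. -/
theorem OpBound.matrixBound {z : (Fin 2 → ℤ) → ℂ} {p K : ℝ} (hK : 0 ≤ K)
    (h : OpBound z p (1 - p) K) : MatrixBound (mulMatrix p z) (4 * K) := by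
  intro S f g
  have h1 := h S (fun l => ((wt l ^ (-p) : ℝ) : ℂ) * f l)
    (fun k => ((wt k ^ p : ℝ) : ℂ) * (dbarSymbol k)⁻¹ * g k)
  have e : ∑ k ∈ S, ∑ l ∈ S, mulMatrix p z k l * f l * g k =
      ∑ k ∈ S, ∑ l ∈ S, z (k - l) * (((wt l ^ (-p) : ℝ) : ℂ) * f l) *
        (((wt k ^ p : ℝ) : ℂ) * (dbarSymbol k)⁻¹ * g k) :=
    Finset.sum_congr rfl fun k _ => Finset.sum_congr rfl fun l _ => by
      rw [mulMatrix]; ring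
  rw [e]
  refine h1.trans ?_
  have hpos : ∀ (k : Fin 2 → ℤ) (r : ℝ), 0 ≤ wt k ^ r := fun k r =>
    Real.rpow_nonneg (wt_pos k).le r
  have e1 : ∀ l, wt l ^ p * ‖((wt l ^ (-p) : ℝ) : ℂ) * f l‖ = ‖f l‖ := fun l => by
    rw [norm_mul, Complex.norm_real, Real.norm_of_nonneg (hpos l _), ← mul_assoc,
      ← Real.rpow_add (wt_pos l)]
    simp
  have e2 : ∀ k, wt k ^ (1 - p) * ‖((wt k ^ p : ℝ) : ℂ) * (dbarSymbol k)⁻¹ * g k‖ ≤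
      4 * ‖g k‖ := fun k => by
    have hw := wt_pos k
    rw [norm_mul, norm_mul, Complex.norm_real, Real.norm_of_nonneg (hpos k _), ← mul_assoc,
      ← mul_assoc, ← Real.rpow_add hw]
    calc wt k ^ (1 - p + p) * ‖(dbarSymbol k)⁻¹‖ * ‖g k‖
        ≤ wt k ^ (1 - p + p) * (4 * (wt k)⁻¹) * ‖g k‖ := by
          gcongr; exact norm_inv_dbarSymbol_le k
      _ = 4 * ‖g k‖ := by
          rw [sub_add_cancel, Real.rpow_one]; field_simp
  simp only [e1]
  have h2 : √(∑ k ∈ S, (wt k ^ (1 - p) * ‖((wt k ^ p : ℝ) : ℂ) * (dbarSymbol k)⁻¹ * g k‖) ^ 2) ≤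
      4 * √(∑ k ∈ S, ‖g k‖ ^ 2) := by
    rw [show (4 : ℝ) = √(4 ^ 2) by rw [Real.sqrt_sq]; norm_num, ← Real.sqrt_mul (by norm_num),
      Finset.mul_sum]
    refine Real.sqrt_le_sqrt (Finset.sum_le_sum fun k _ => ?_)
    rw [← mul_pow]
    exact pow_le_pow_left₀ (mul_nonneg (hpos k _) (norm_nonneg _)) (e2 k) 2
  calc _ ≤ K * √(∑ l ∈ S, ‖f l‖ ^ 2) * (4 * √(∑ k ∈ S, ‖g k‖ ^ 2)) := by gcongr
    _ = _ := by ring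

/-- `z` is a multiplier from `H^p` to `H^{p-1}`. -/
def IsMultiplier (p : ℝ) (z : (Fin 2 → ℤ) → ℂ) : Prop := ∃ K, 0 ≤ K ∧ OpBound z p (1 - p) K

open scoped Classical in
/-- The operator `f ↦ ∂_{z̄}⁻¹ (z f)` on `H^p`, in terms of weighted sequences. -/
noncomputable def mulOp (p : ℝ) (z : (Fin 2 → ℤ) → ℂ) : SeqL2 →L[ℂ] SeqL2 :=
  if h : IsMultiplier p z then
    (h.choose_spec.2.matrixBound h.choose_spec.1).toCLM (by have := h.choose_spec.1; positivity)
  else 0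

theorem mulOp_apply {p : ℝ} {z : (Fin 2 → ℤ) → ℂ} (h : IsMultiplier p z) (a : SeqL2)
    (k : Fin 2 → ℤ) : mulOp p z a k = ∑' l, mulMatrix p z k l * a l := by
  rw [mulOp, dif_pos h]; rfl

theorem norm_mulOp_le {p K : ℝ} {z : (Fin 2 → ℤ) → ℂ} (hK : 0 ≤ K) (h : OpBound z p (1 - p) K) :
    ‖mulOp p z‖ ≤ 4 * K := by
  have : mulOp p z = (h.matrixBound hK).toCLM (by positivity) := by
    ext a k
    rw [mulOp_apply ⟨K, hK, h⟩]; rfl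
  rw [this]
  exact MatrixBound.norm_toCLM_le _ _

theorem mulMatrix_mul_eq (p : ℝ) (z : (Fin 2 → ℤ) → ℂ) (a : SeqL2) (k l : Fin 2 → ℤ) :
    mulMatrix p z k l * a l = ((wt k ^ p : ℝ) : ℂ) * (dbarSymbol k)⁻¹ *
      (z (k - l) * unweight p a l) := by
  rw [mulMatrix, unweight]; ring

theorem unweight_mulOp {p : ℝ} {z : (Fin 2 → ℤ) → ℂ} (h : IsMultiplier p z) (a : SeqL2)
    (k : Fin 2 → ℤ) :
    unweight p (mulOp p z a) k = (dbarSymbol k)⁻¹ * conv z (unweight p a) k := by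
  rw [unweight, mulOp_apply h]
  simp only [mulMatrix_mul_eq]
  rw [tsum_mul_left, ← mul_assoc, ← mul_assoc, ← Complex.ofReal_mul, ← Real.rpow_add (wt_pos k)]
  simp [conv]

/-- Row 0 of `mulMatrix` vanishes together with `(dbarSymbol 0)⁻¹`, so the operator bound says
nothing about the convolution at k = 0. -/
theorem IsMultiplier.summable {p : ℝ} {z : (Fin 2 → ℤ) → ℂ} (h : IsMultiplier p z) (a : SeqL2)
    {k : Fin 2 → ℤ} (hk : k ≠ 0) : Summable fun l => ‖z (k - l) * unweight p a l‖ := by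
  obtain ⟨K, hK, hz⟩ := h
  have h1 := (hz.matrixBound hK).summable a k
  simp only [mulMatrix_mul_eq] at h1
  have hc : ((wt k ^ p : ℝ) : ℂ) * (dbarSymbol k)⁻¹ ≠ 0 := by
    refine mul_ne_zero ?_ (inv_ne_zero (dbarSymbol_ne_zero hk))
    exact_mod_cast (Real.rpow_pos_of_pos (wt_pos k) _).ne'
  simp only [norm_mul _ (z _ * _)] at h1
  exact (summable_mul_left_iff (norm_ne_zero_iff.mpr hc)).mp h1

/-! ## Convolutions -/

theorem conv_comm (f g : (Fin 2 → ℤ) → ℂ) : conv f g = conv g f := by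
  funext k
  rw [conv, conv, ← (Equiv.subLeft k).tsum_eq]
  refine tsum_congr fun l => ?_
  simp [mul_comm]

theorem starSeq_conv (f g : (Fin 2 → ℤ) → ℂ) : starSeq (conv f g) = conv (starSeq f) (starSeq g) := by
  funext k
  rw [starSeq, conv, tsum_star, conv, ← (Equiv.neg (Fin 2 → ℤ)).tsum_eq]
  refine tsum_congr fun l => ?_
  simp only [starSeq, Equiv.neg_apply, star_mul', neg_sub, sub_neg_eq_add]
  congr 3
  abel

/-- The convolution of `f` and `g` converges absolutely at `k`. -/
def ConvSummable (f g : (Fin 2 → ℤ) → ℂ) (k : Fin 2 → ℤ) : Prop :=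
  Summable fun l => ‖f (k - l) * g l‖

theorem ConvSummable.symm {f g : (Fin 2 → ℤ) → ℂ} {k : Fin 2 → ℤ} (h : ConvSummable f g k) :
    ConvSummable g f k := by
  refine ((Equiv.subLeft k).summable_iff.mpr h).congr fun l => ?_
  simp [mul_comm]

theorem WtSummable.convSummable {f g : (Fin 2 → ℤ) → ℂ} (hf : WtSummable 0 f)
    (hg : WtSummable 0 g) (k : Fin 2 → ℤ) : ConvSummable f g k := by
  have := (hf.summable_conv hg).prod_factor k
  refine this.congr fun l => ?_
  simp

theorem conv_add_left {f f' g : (Fin 2 → ℤ) → ℂ} {k : Fin 2 → ℤ} (h : ConvSummable f g k)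
    (h' : ConvSummable f' g k) :
    conv (fun l => f l + f' l) g k = conv f g k + conv f' g k := by
  simp only [conv, add_mul]
  exact (Summable.of_norm h).tsum_add (Summable.of_norm h')

theorem conv_add_right {f g g' : (Fin 2 → ℤ) → ℂ} {k : Fin 2 → ℤ} (h : ConvSummable f g k)
    (h' : ConvSummable f g' k) :
    conv f (fun l => g l + g' l) k = conv f g k + conv f g' k := by
  simp only [conv, mul_add]
  exact (Summable.of_norm h).tsum_add (Summable.of_norm h')

theorem starSeq_add (f g : (Fin 2 → ℤ) → ℂ) :
    starSeq (fun l => f l + g l) = fun l => starSeq f l + starSeq g l := by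
  funext k; simp [starSeq]

theorem starSeq_sub (f g : (Fin 2 → ℤ) → ℂ) :
    starSeq (fun l => f l - g l) = fun l => starSeq f l - starSeq g l := by
  funext k; simp [starSeq]

theorem starSeq_real_mul (c : ℝ) (f : (Fin 2 → ℤ) → ℂ) :
    starSeq (fun l => (c : ℂ) * f l) = fun l => (c : ℂ) * starSeq f l := by
  funext k; simp [starSeq]

/-- The coefficients of `f ḡ - f̄ g`. -/
noncomputable def wedge (f g : (Fin 2 → ℤ) → ℂ) (k : Fin 2 → ℤ) : ℂ :=
  conv f (starSeq g) k - conv (starSeq f) g k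

theorem wedge_swap (f g : (Fin 2 → ℤ) → ℂ) (k : Fin 2 → ℤ) : wedge f g k = -wedge g f k := by
  rw [wedge, wedge, conv_comm f, conv_comm (starSeq f)]
  ring

/-- The function f ḡ - f̄ g is purely imaginary. This symmetry makes the mean of the system
solvable. -/
theorem starSeq_wedge (f g : (Fin 2 → ℤ) → ℂ) (k : Fin 2 → ℤ) :
    starSeq (wedge f g) k = -wedge f g k := by
  have : starSeq (wedge f g) = fun k => starSeq (conv f (starSeq g)) k -
      starSeq (conv (starSeq f) g) k := by
    rw [← starSeq_sub]; rfl
  rw [this, starSeq_conv, starSeq_conv, starSeq_starSeq, starSeq_starSeq, wedge]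
  ring

/-- The two convolutions in `wedge f g k` converge absolutely. -/
def WedgeSummable (f g : (Fin 2 → ℤ) → ℂ) (k : Fin 2 → ℤ) : Prop :=
  ConvSummable f (starSeq g) k ∧ ConvSummable (starSeq f) g k

theorem WedgeSummable.symm {f g : (Fin 2 → ℤ) → ℂ} {k : Fin 2 → ℤ} (h : WedgeSummable f g k) :
    WedgeSummable g f k := ⟨h.2.symm, h.1.symm⟩

theorem WtSummable.wedgeSummable {f g : (Fin 2 → ℤ) → ℂ} (hf : WtSummable 0 f)
    (hg : WtSummable 0 g) (k : Fin 2 → ℤ) : WedgeSummable f g k :=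
  ⟨hf.convSummable hg.starSeq k, hf.starSeq.convSummable hg k⟩

theorem wedge_add_left {f f' g : (Fin 2 → ℤ) → ℂ} {k : Fin 2 → ℤ} (h : WedgeSummable f g k)
    (h' : WedgeSummable f' g k) :
    wedge (fun l => f l + f' l) g k = wedge f g k + wedge f' g k := by
  rw [wedge, starSeq_add, conv_add_left h.1 h'.1, conv_add_left h.2 h'.2, wedge, wedge]
  ring

theorem wedge_add_right {f g g' : (Fin 2 → ℤ) → ℂ} {k : Fin 2 → ℤ} (h : WedgeSummable f g k)
    (h' : WedgeSummable f g' k) :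
    wedge f (fun l => g l + g' l) k = wedge f g k + wedge f g' k := by
  rw [wedge_swap, wedge_add_left h.symm h'.symm, wedge_swap f g, wedge_swap f g']
  ring

theorem wedge_real_mul_left (c : ℝ) (f g : (Fin 2 → ℤ) → ℂ) (k : Fin 2 → ℤ) :
    wedge (fun l => (c : ℂ) * f l) g k = c * wedge f g k := by
  rw [wedge, starSeq_real_mul, wedge, conv, conv, conv, conv]
  simp only [mul_assoc, tsum_mul_left]
  ring

theorem WedgeSummable.add_left {f f' g : (Fin 2 → ℤ) → ℂ} {k : Fin 2 → ℤ}
    (h : WedgeSummable f g k) (h' : WedgeSummable f' g k) :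
    WedgeSummable (fun l => f l + f' l) g k := by
  refine ⟨?_, ?_⟩
  · refine Summable.of_nonneg_of_le (fun _ => norm_nonneg _) (fun l => ?_) (Summable.add h.1 h'.1)
    rw [add_mul]; exact norm_add_le _ _
  · rw [starSeq_add]
    refine Summable.of_nonneg_of_le (fun _ => norm_nonneg _) (fun l => ?_) (Summable.add h.2 h'.2)
    rw [add_mul]; exact norm_add_le _ _

/-! ## The operators of the fixed point equation -/

/-- Complex conjugation of functions, on the level of weighted Fourier coefficients. -/
noncomputable def starL2 : SeqL2 →L[ℝ] SeqL2 :=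
  LinearMap.mkContinuous
    { toFun := fun a => SeqL2.mk (fun k => star (a (-k))) (by
        refine ((Equiv.neg (Fin 2 → ℤ)).summable_iff.mpr a.summable_sq).congr fun k => ?_
        simp)
      map_add' := by
        intro a a'
        ext k
        simp [SeqL2.mk_apply]
      map_smul' := by
        intro c a
        ext k
        simp [SeqL2.mk_apply] } 1 fun a => by
    refine SeqL2.norm_le_of_sum_le (by positivity) fun S => ?_
    have := a.sum_sq_le (S.map (Equiv.neg _).toEmbedding)
    simpa [SeqL2.mk_apply, Finset.sum_map] using this

theorem unweight_starL2 (p : ℝ) (a : SeqL2) :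
    unweight p (starL2 a) = starSeq (unweight p a) := by
  funext k
  simp only [unweight, starSeq, starL2, LinearMap.mkContinuous_apply, LinearMap.coe_mk,
    AddHom.coe_mk, SeqL2.mk_apply, wt_neg, star_mul', Complex.star_def, Complex.conj_ofReal]

theorem norm_starL2_le : ‖starL2‖ ≤ 1 := LinearMap.mkContinuous_norm_le _ zero_le_one _

/-- The operator `f ↦ ∂_{z̄}⁻¹ (z f̄ - z̄ f)` on `H^p`, in terms of weighted sequences. -/
noncomputable def wedgeOp (p : ℝ) (z : (Fin 2 → ℤ) → ℂ) : SeqL2 →L[ℝ] SeqL2 :=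
  ((mulOp p z).restrictScalars ℝ).comp starL2 - (mulOp p (starSeq z)).restrictScalars ℝ

theorem IsMultiplier.starSeq {p : ℝ} {z : (Fin 2 → ℤ) → ℂ} (h : IsMultiplier p z) :
    IsMultiplier p (starSeq z) := by
  obtain ⟨K, hK, h⟩ := h
  exact ⟨K, hK, h.starSeq⟩

theorem IsMultiplier.add {p : ℝ} {z z' : (Fin 2 → ℤ) → ℂ} (h : IsMultiplier p z)
    (h' : IsMultiplier p z') : IsMultiplier p fun k => z k + z' k := by
  obtain ⟨K, hK, h⟩ := h
  obtain ⟨K', hK', h'⟩ := h'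
  exact ⟨K + K', add_nonneg hK hK', h.add h'⟩

theorem IsMultiplier.const_mul {p : ℝ} {z : (Fin 2 → ℤ) → ℂ} (h : IsMultiplier p z) (a : ℂ) :
    IsMultiplier p fun k => a * z k := by
  obtain ⟨K, hK, h⟩ := h
  exact ⟨‖a‖ * K, mul_nonneg (norm_nonneg a) hK, h.const_mul a⟩

theorem unweight_wedgeOp {p : ℝ} {z : (Fin 2 → ℤ) → ℂ} (h : IsMultiplier p z) (a : SeqL2)
    (k : Fin 2 → ℤ) :
    unweight p (wedgeOp p z a) k = (dbarSymbol k)⁻¹ * wedge z (unweight p a) k := by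
  have : wedgeOp p z a = mulOp p z (starL2 a) - mulOp p (starSeq z) a := rfl
  rw [this, unweight_sub, unweight_mulOp h, unweight_mulOp h.starSeq, unweight_starL2, wedge]
  ring

theorem norm_wedgeOp_le {p K : ℝ} {z : (Fin 2 → ℤ) → ℂ} (hK : 0 ≤ K)
    (h : OpBound z p (1 - p) K) : ‖wedgeOp p z‖ ≤ 8 * K := by
  have h1 := norm_mulOp_le hK h
  have h2 := norm_mulOp_le hK h.starSeq
  calc ‖wedgeOp p z‖ ≤ ‖((mulOp p z).restrictScalars ℝ).comp starL2‖ +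
        ‖(mulOp p (starSeq z)).restrictScalars ℝ‖ := norm_sub_le _ _
    _ ≤ ‖mulOp p z‖ * 1 + ‖mulOp p (starSeq z)‖ := by
        gcongr
        · refine (ContinuousLinearMap.opNorm_comp_le _ _).trans ?_
          rw [ContinuousLinearMap.norm_restrictScalars]
          gcongr
          exact norm_starL2_le
        · rw [ContinuousLinearMap.norm_restrictScalars]
    _ ≤ _ := by linarith

theorem IsMultiplier.wedgeSummable {p : ℝ} {z : (Fin 2 → ℤ) → ℂ} (h : IsMultiplier p z)
    (a : SeqL2) {k : Fin 2 → ℤ} (hk : k ≠ 0) : WedgeSummable z (unweight p a) k := by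
  refine ⟨?_, h.starSeq.summable a hk⟩
  rw [← unweight_starL2]
  exact h.summable _ hk

theorem wedgeOp_add {p : ℝ} {z z' : (Fin 2 → ℤ) → ℂ} (h : IsMultiplier p z)
    (h' : IsMultiplier p z') : wedgeOp p (fun k => z k + z' k) = wedgeOp p z + wedgeOp p z' := by
  ext1 a
  refine unweight_injective p ?_
  funext k
  rw [add_apply, unweight_add, unweight_wedgeOp (h.add h'), unweight_wedgeOp h,
    unweight_wedgeOp h']
  -- At k = 0 the convolutions need not converge, but the inverse symbol kills both sides.
  by_cases hk : k = 0
  · simp [hk, dbarSymbol_zero]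
  · rw [wedge_add_left (h.wedgeSummable a hk) (h'.wedgeSummable a hk)]
    ring

theorem wedgeOp_real_mul {p : ℝ} {z : (Fin 2 → ℤ) → ℂ} (h : IsMultiplier p z) (c : ℝ) :
    wedgeOp p (fun k => (c : ℂ) * z k) = c • wedgeOp p z := by
  ext1 a
  refine unweight_injective p ?_
  funext k
  rw [smul_apply, unweight_smul, unweight_wedgeOp (h.const_mul c), unweight_wedgeOp h,
    wedge_real_mul_left]
  ring

theorem wedgeOp_sub {p : ℝ} {z z' : (Fin 2 → ℤ) → ℂ} (h : IsMultiplier p z)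
    (h' : IsMultiplier p z') : wedgeOp p (fun k => z k - z' k) = wedgeOp p z - wedgeOp p z' := by
  have h1 := wedgeOp_add h (h'.const_mul ((-1 : ℝ) : ℂ))
  rw [wedgeOp_real_mul h'] at h1
  have e : (fun k => z k - z' k) = fun k => z k + ((-1 : ℝ) : ℂ) * z' k := by
    funext k; push_cast; ring
  rw [e, h1]
  simp [sub_eq_add_neg]

/-- Triples of weighted sequences. -/
abbrev SeqL2Triple : Type := Fin 3 → SeqL2

theorem isMultiplier_unweight {p : ℝ} (hp : 1 / 2 < p) (hp1 : p ≤ 1) (a : SeqL2) :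
    IsMultiplier p (unweight p a) :=
  ⟨_, by positivity, (hsBound_unweight p a).opBound hp hp1⟩

/-- The quadratic part of the fixed point equation. -/
noncomputable def quadOp (p : ℝ) (hp : 1 / 2 < p) (hp1 : p ≤ 1) :
    SeqL2Triple →L[ℝ] SeqL2Triple →L[ℝ] SeqL2Triple :=
  LinearMap.mkContinuous₂
    (LinearMap.mk₂ ℝ (fun u v j => wedgeOp p (unweight p (u (j + 1))) (v (j + 2)))
      (by
        intro u u' v
        funext j
        have e : unweight p ((u + u') (j + 1)) =
            fun k => unweight p (u (j + 1)) k + unweight p (u' (j + 1)) k :=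
          funext fun k => unweight_add p _ _ k
        simp only [Pi.add_apply] at e ⊢
        rw [e, wedgeOp_add (isMultiplier_unweight hp hp1 _) (isMultiplier_unweight hp hp1 _)]
        rfl)
      (by
        intro c u v
        funext j
        have e : unweight p ((c • u) (j + 1)) = fun k => (c : ℂ) * unweight p (u (j + 1)) k :=
          funext fun k => unweight_smul p c _ k
        simp only [Pi.smul_apply] at e ⊢
        rw [e, wedgeOp_real_mul (isMultiplier_unweight hp hp1 _)]
        rfl)
      (by intro u v v'; funext j; simp)
      (by intro c u v; funext j; simp)) (8 * √(2 * wtSum (4 * p))) fun u v => by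
    refine (pi_norm_le_iff_of_nonneg (by positivity)).mpr fun j => ?_
    simp only [LinearMap.mk₂_apply]
    have h1 := norm_wedgeOp_le (by positivity)
      ((hsBound_unweight p (u (j + 1))).opBound hp hp1)
    calc ‖wedgeOp p (unweight p (u (j + 1))) (v (j + 2))‖
        ≤ ‖wedgeOp p (unweight p (u (j + 1)))‖ * ‖v (j + 2)‖ := ContinuousLinearMap.le_opNorm _ _
      _ ≤ (8 * (√(2 * wtSum (4 * p)) * ‖u (j + 1)‖)) * ‖v (j + 2)‖ := by gcongr
      _ ≤ (8 * (√(2 * wtSum (4 * p)) * ‖u‖)) * ‖v‖ := by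
          gcongr
          · exact norm_le_pi_norm u _
          · exact norm_le_pi_norm v _
      _ = _ := by ring

theorem quadOp_apply (p : ℝ) (hp : 1 / 2 < p) (hp1 : p ≤ 1) (u v : SeqL2Triple) (j : Fin 3) :
    quadOp p hp hp1 u v j = wedgeOp p (unweight p (u (j + 1))) (v (j + 2)) := rfl

/-- The linear part of the fixed point equation. -/
noncomputable def linOp (p : ℝ) (y : Fin 3 → (Fin 2 → ℤ) → ℂ) : SeqL2Triple →L[ℝ] SeqL2Triple :=
  ContinuousLinearMap.pi fun j =>
    (wedgeOp p (y (j + 1))).comp (ContinuousLinearMap.proj (j + 2)) -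
      (wedgeOp p (y (j + 2))).comp (ContinuousLinearMap.proj (j + 1))

theorem linOp_apply (p : ℝ) (y : Fin 3 → (Fin 2 → ℤ) → ℂ) (u : SeqL2Triple) (j : Fin 3) :
    linOp p y u j = wedgeOp p (y (j + 1)) (u (j + 2)) - wedgeOp p (y (j + 2)) (u (j + 1)) := rfl

theorem norm_linOp_le {p K : ℝ} {y : Fin 3 → (Fin 2 → ℤ) → ℂ} (hK : 0 ≤ K)
    (h : ∀ j, OpBound (y j) p (1 - p) K) : ‖linOp p y‖ ≤ 16 * K := by
  refine ContinuousLinearMap.opNorm_le_bound _ (by positivity) fun u => ?_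
  refine (pi_norm_le_iff_of_nonneg (by positivity)).mpr fun j => ?_
  rw [linOp_apply]
  have h1 : ∀ i i', ‖wedgeOp p (y i) (u i')‖ ≤ 8 * K * ‖u‖ := fun i i' =>
    (ContinuousLinearMap.le_opNorm _ _).trans (by
      gcongr
      · exact norm_wedgeOp_le hK (h i)
      · exact norm_le_pi_norm u i')
  exact (norm_sub_le _ _).trans (by linarith [h1 (j + 1) (j + 2), h1 (j + 2) (j + 1)])

theorem norm_linOp_sub_le {p K : ℝ} {y y' : Fin 3 → (Fin 2 → ℤ) → ℂ} (hK : 0 ≤ K)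
    (hy : ∀ j, IsMultiplier p (y j)) (hy' : ∀ j, IsMultiplier p (y' j))
    (h : ∀ j, OpBound (fun k => y j k - y' j k) p (1 - p) K) :
    ‖linOp p y - linOp p y'‖ ≤ 16 * K := by
  have e : linOp p y - linOp p y' = linOp p fun j k => y j k - y' j k := by
    ext1 u
    funext j
    simp only [sub_apply, Pi.sub_apply, linOp_apply, wedgeOp_sub (hy _) (hy' _)]
    abel
  rw [e]
  exact norm_linOp_le hK h

/-! ## Regularity and the classical equation -/

theorem WtSummable.inv_dbarSymbol_mul {N : ℕ} {f : (Fin 2 → ℤ) → ℂ} (h : WtSummable N f) :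
    WtSummable (N + 1) fun k => (dbarSymbol k)⁻¹ * f k := by
  refine Summable.of_nonneg_of_le
    (fun k => mul_nonneg (pow_nonneg (wt_pos k).le _) (norm_nonneg _)) (fun k => ?_)
    (Summable.mul_left 4 h)
  have hw := wt_pos k
  rw [norm_mul, pow_succ]
  calc wt k ^ N * wt k * (‖(dbarSymbol k)⁻¹‖ * ‖f k‖)
      ≤ wt k ^ N * wt k * (4 * (wt k)⁻¹ * ‖f k‖) := by
        gcongr; exact norm_inv_dbarSymbol_le k
    _ = _ := by field_simp

theorem WtSummable.of_succ {N : ℕ} {f : (Fin 2 → ℤ) → ℂ} (h : WtSummable (N + 1) f) :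
    WtSummable N f :=
  Summable.of_nonneg_of_le (fun k => mul_nonneg (pow_nonneg (wt_pos k).le _) (norm_nonneg _))
    (fun k => mul_le_mul_of_nonneg_right (pow_le_pow_right₀ (one_le_wt k) (Nat.le_succ N))
      (norm_nonneg _)) h

theorem WtSummable.wedge {N : ℕ} {f g : (Fin 2 → ℤ) → ℂ} (hf : WtSummable N f)
    (hg : WtSummable N g) : WtSummable N (wedge f g) :=
  (hf.conv hg.starSeq).sub (hf.starSeq.conv hg)

theorem WtSummable.exists_hsBound {s : ℝ} {N : ℕ} (hs : s ≤ N) {f : (Fin 2 → ℤ) → ℂ}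
    (h : WtSummable N f) : ∃ M, HsBound s f M := by
  refine ⟨∑' k, wt k ^ N * ‖f k‖, tsum_nonneg fun k =>
    mul_nonneg (pow_nonneg (wt_pos k).le _) (norm_nonneg _), fun S => ?_⟩
  have h0 : ∀ k, 0 ≤ wt k ^ N * ‖f k‖ := fun k =>
    mul_nonneg (pow_nonneg (wt_pos k).le _) (norm_nonneg _)
  have h1 : ∀ k, wt k ^ s * ‖f k‖ ≤ wt k ^ N * ‖f k‖ := fun k => by
    gcongr
    rw [← Real.rpow_natCast]
    exact Real.rpow_le_rpow_of_exponent_le (one_le_wt k) hs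
  calc _ ≤ ∑ k ∈ S, (wt k ^ N * ‖f k‖) ^ 2 := by
        refine Finset.sum_le_sum fun k _ => pow_le_pow_left₀ ?_ (h1 k) 2
        have := wt_pos k
        positivity
    _ ≤ (∑ k ∈ S, wt k ^ N * ‖f k‖) ^ 2 := Finset.sum_sq_le_sq_sum_of_nonneg fun k _ => h0 k
    _ ≤ _ := by
        gcongr
        · exact Finset.sum_nonneg fun k _ => h0 k
        · exact h.sum_le_tsum S fun k _ => h0 k

/-- Summation over the second frequency leaves `wt k ^ (-(2p - 1))`. Together with `wt k ^ (-2)` the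
exponent is 2p + 1, which exceeds 2 because p > 1/2. -/
theorem summable_wt_triple {p : ℝ} (hp : 1 / 2 < p) :
    Summable fun q : (Fin 2 → ℤ) × (Fin 2 → ℤ) =>
      wt q.1 ^ (-2 : ℝ) * (wt q.2 ^ (-(2 * p)) * wt (q.1 - q.2) ^ (-(2 * p))) := by
  have hpos : ∀ (k : Fin 2 → ℤ) (r : ℝ), 0 ≤ wt k ^ r := fun k r =>
    Real.rpow_nonneg (wt_pos k).le r
  have hc := fun k => summable_wt_conv (a := 2 * p) (b := 2 * p) (c := 2 * p - 1)
      (by linarith) (by linarith) (by linarith) (by linarith) k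
  have hb := fun k => tsum_wt_conv_le (a := 2 * p) (b := 2 * p) (c := 2 * p - 1)
      (by linarith) (by linarith) (by linarith) (by linarith) k
  generalize hC : 2 ^ (2 * p - 1) * 2 * wtSum (2 * p + 2 * p - (2 * p - 1)) = C at hb
  have hs : Summable fun k => C * wt k ^ (-(2 * p + 1)) :=
    (summable_wt_rpow (a := 2 * p + 1) (by linarith)).mul_left C
  have hnn : ∀ q : (Fin 2 → ℤ) × (Fin 2 → ℤ),
      0 ≤ wt q.1 ^ (-2 : ℝ) * (wt q.2 ^ (-(2 * p)) * wt (q.1 - q.2) ^ (-(2 * p))) := fun q =>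
    mul_nonneg (hpos _ _) (mul_nonneg (hpos _ _) (hpos _ _))
  refine (summable_prod_of_nonneg hnn).mpr ⟨fun k => (hc k).mul_left (wt k ^ (-2 : ℝ)), ?_⟩
  refine Summable.of_nonneg_of_le (fun k => tsum_nonneg fun l => hnn (k, l)) (fun k => ?_) hs
  have e : ∑' l, wt k ^ (-2 : ℝ) * (wt l ^ (-(2 * p)) * wt (k - l) ^ (-(2 * p))) =
      wt k ^ (-2 : ℝ) * ∑' l, wt l ^ (-(2 * p)) * wt (k - l) ^ (-(2 * p)) := tsum_mul_left
  refine e.le.trans ((mul_le_mul_of_nonneg_left (hb k) (hpos k (-2))).trans (le_of_eq ?_))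
  have e2 : wt k ^ (-(2 * p + 1)) = wt k ^ (-2 : ℝ) * wt k ^ (-(2 * p - 1)) := by
    rw [← Real.rpow_add (wt_pos k)]; ring_nf
  rw [e2]
  ring

/-- The first gain of regularity: ∂_{z̄}⁻¹ of a product of two elements of H^p has an absolutely
convergent Fourier series. The inequality 2ab ≤ a² + b² splits the double series into the product of
the two squared H^p series and the series of `summable_wt_triple`. -/
theorem HsBound.wtSummable_inv_mul_conv {p : ℝ} (hp : 1 / 2 < p) {f g : (Fin 2 → ℤ) → ℂ}
    {M M' : ℝ} (hf : HsBound p f M) (hg : HsBound p g M') :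
    WtSummable 0 fun k => (dbarSymbol k)⁻¹ * conv f g k := by
  have hw := summable_wt_triple hp
  have h1 := Summable.mul_of_nonneg hf.summable hg.summable (fun _ => sq_nonneg _)
    fun _ => sq_nonneg _
  have h2 := (convEquiv.summable_iff.mpr h1).add hw
  have h3 : Summable fun q : (Fin 2 → ℤ) × (Fin 2 → ℤ) =>
      4 * (wt q.1)⁻¹ * (‖f (q.1 - q.2)‖ * ‖g q.2‖) := by
    refine Summable.of_nonneg_of_le (fun q => ?_) (fun q => ?_) (h2.mul_left 4)
    · have := wt_pos q.1
      positivity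
    · simp only [convEquiv, Equiv.coe_fn_mk, Function.comp]
      have e1 : wt q.1 ^ (-2 : ℝ) = ((wt q.1)⁻¹) ^ 2 := by
        rw [Real.rpow_neg (wt_pos _).le]; norm_num
      have e2 : ∀ k : Fin 2 → ℤ, wt k ^ (-(2 * p)) = (wt k ^ (-p)) ^ 2 := fun k => by
        rw [← Real.rpow_natCast, ← Real.rpow_mul (wt_pos k).le]; congr 1; push_cast; ring
      have e3 : ∀ k : Fin 2 → ℤ, wt k ^ p * wt k ^ (-p) = 1 := fun k => by
        rw [← Real.rpow_add (wt_pos k)]; simp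
      rw [e1, e2, e2]
      have hh := two_mul_le_add_sq (wt (q.1 - q.2) ^ p * ‖f (q.1 - q.2)‖ * (wt q.2 ^ p * ‖g q.2‖))
        ((wt q.1)⁻¹ * (wt q.2 ^ (-p) * wt (q.1 - q.2) ^ (-p)))
      have e4 : (wt (q.1 - q.2) ^ p * ‖f (q.1 - q.2)‖ * (wt q.2 ^ p * ‖g q.2‖)) *
        ((wt q.1)⁻¹ * (wt q.2 ^ (-p) * wt (q.1 - q.2) ^ (-p))) =
        (wt q.1)⁻¹ * (‖f (q.1 - q.2)‖ * ‖g q.2‖) := by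
        calc _ = (wt (q.1 - q.2) ^ p * wt (q.1 - q.2) ^ (-p)) * (wt q.2 ^ p * wt q.2 ^ (-p)) *
            ((wt q.1)⁻¹ * (‖f (q.1 - q.2)‖ * ‖g q.2‖)) := by ring
          _ = _ := by rw [e3, e3]; ring
      have hpos2 : 0 ≤ (wt q.1)⁻¹ * (‖f (q.1 - q.2)‖ * ‖g q.2‖) := by
        have := wt_pos q.1
        positivity
      rw [mul_assoc 2, e4] at hh
      calc 4 * (wt q.1)⁻¹ * (‖f (q.1 - q.2)‖ * ‖g q.2‖)
          = 4 * ((wt q.1)⁻¹ * (‖f (q.1 - q.2)‖ * ‖g q.2‖)) := by ring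
        _ ≤ 4 * (2 * ((wt q.1)⁻¹ * (‖f (q.1 - q.2)‖ * ‖g q.2‖))) := by linarith
        _ ≤ _ := by
            refine mul_le_mul_of_nonneg_left (hh.trans (le_of_eq ?_)) (by norm_num)
            ring
  refine Summable.of_nonneg_of_le (fun k => mul_nonneg (pow_nonneg (wt_pos k).le _) (norm_nonneg _))
    (fun k => ?_) h3.prod
  have hk := wt_pos k
  have h4 : Summable fun l => ‖f (k - l) * g l‖ := by
    refine ((h3.prod_factor k).mul_left (4 * (wt k)⁻¹)⁻¹).congr fun l => ?_
    rw [norm_mul]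
    field_simp
  simp only
  rw [pow_zero, one_mul, norm_mul, tsum_mul_left]
  gcongr
  · exact norm_inv_dbarSymbol_le k
  · have h5 := norm_tsum_le_tsum_norm h4
    simp only [norm_mul] at h5
    exact h5

theorem HsBound.wtSummable_inv_mul_wedge {p : ℝ} (hp : 1 / 2 < p) {f g : (Fin 2 → ℤ) → ℂ}
    {M M' : ℝ} (hf : HsBound p f M) (hg : HsBound p g M') :
    WtSummable 0 fun k => (dbarSymbol k)⁻¹ * wedge f g k := by
  refine ((hf.wtSummable_inv_mul_conv hp hg.starSeq).sub
    (hf.starSeq.wtSummable_inv_mul_conv hp hg)).mono fun k => le_of_eq ?_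
  rw [wedge, mul_sub]

/-- Bootstrap. The start uses only that y + u lies in H^p with p > 1/2; afterwards products stay in
weighted ℓ¹ and every ∂_{z̄}⁻¹ gains one weight. -/
theorem wtSummable_of_fixedPoint {p : ℝ} (hp : 1 / 2 < p) (hp1 : p ≤ 1)
    {y u : Fin 3 → (Fin 2 → ℤ) → ℂ} (hy : ∀ j N, WtSummable N (y j))
    (hu : ∀ j, ∃ M, HsBound p (u j) M)
    (h : ∀ j k, u j k = (dbarSymbol k)⁻¹ *
      wedge (fun l => y (j + 1) l + u (j + 1) l) (fun l => y (j + 2) l + u (j + 2) l) k)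
    (N : ℕ) : ∀ j, WtSummable N (u j) := by
  induction N with
  | zero =>
    have hr : ∀ j, ∃ M, HsBound p (fun l => y j l + u j l) M := fun j => by
      obtain ⟨M, hM⟩ := hu j
      obtain ⟨M', hM'⟩ := (hy j 1).exists_hsBound (s := p) (by simpa using hp1)
      exact ⟨_, hM'.add hM⟩
    intro j
    obtain ⟨M, hM⟩ := hr (j + 1)
    obtain ⟨M', hM'⟩ := hr (j + 2)
    exact (hM.wtSummable_inv_mul_wedge hp hM').mono fun k => by rw [h j k]
  | succ N ih =>
    intro j
    exact ((((hy (j + 1) N).add (ih (j + 1))).wedge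
      ((hy (j + 2) N).add (ih (j + 2)))).inv_dbarSymbol_mul).mono fun k => by rw [h j k]

/-- The zero mode of f ḡ - f̄ g is a sum over all k of expressions that are odd in k away from 0.
Only the means of f and g survive. -/
theorem wedge_zero_eq {f g : (Fin 2 → ℤ) → ℂ} (hf : WtSummable 0 f) (hg : WtSummable 0 g)
    (hodd : ∀ k ≠ 0, f (-k) * star (g (-k)) - star (f (-k)) * g (-k) =
      -(f k * star (g k) - star (f k) * g k)) :
    wedge f g 0 = f 0 * star (g 0) - star (f 0) * g 0 := by
  have h1 := (hf.convSummable hg.starSeq 0).of_norm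
  have h2 := (hf.starSeq.convSummable hg 0).of_norm
  set T : (Fin 2 → ℤ) → ℂ := fun k => f k * star (g k) - star (f k) * g k
  have e1 : wedge f g 0 = ∑' k, T k := by
    have e2 : conv f (starSeq g) 0 = ∑' k, f k * star (g k) := by
      rw [conv, ← (Equiv.neg (Fin 2 → ℤ)).tsum_eq]
      simp [starSeq]
    have e3 : conv (starSeq f) g 0 = ∑' k, star (f k) * g k := by
      rw [conv]; simp [starSeq]
    have s2 : Summable fun k => f k * star (g k) := by
      refine ((Equiv.neg (Fin 2 → ℤ)).summable_iff.mpr h1).congr fun k => ?_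
      simp [starSeq]
    have s3 : Summable fun k => star (f k) * g k := by
      refine h2.congr fun k => ?_
      simp [starSeq]
    rw [wedge, e2, e3, ← s2.tsum_sub s3]
  have hs : Summable T := by
    have s2 : Summable fun k => f k * star (g k) := by
      refine ((Equiv.neg (Fin 2 → ℤ)).summable_iff.mpr h1).congr fun k => ?_
      simp [starSeq]
    have s3 : Summable fun k => star (f k) * g k := by
      refine h2.congr fun k => ?_
      simp [starSeq]
    exact s2.sub s3
  have hodd' : ∑' k, (if k = 0 then 0 else T k) = 0 := by
    have h3 : ∑' k, (if k = 0 then 0 else T k) = -∑' k, (if k = 0 then 0 else T k) := by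
      conv_lhs => rw [← (Equiv.neg (Fin 2 → ℤ)).tsum_eq]
      rw [← tsum_neg]
      refine tsum_congr fun k => ?_
      by_cases hk : k = 0
      · simp [hk]
      · simp only [Equiv.neg_apply, neg_eq_zero, hk, if_false]
        exact hodd k hk
    exact self_eq_neg.mp h3
  rw [e1, hs.tsum_eq_add_tsum_ite 0, hodd', add_zero]

/-- For k ≠ 0 the fixed point equation is the system divided by the symbol. For k = 0 the left side
of the system vanishes, and `wedge_zero_eq` reduces the right side to `hmean`. The oddness required
there holds because the right side is purely imaginary and the symbol is odd. -/
theorem dbar_trigSeries_of_fixedPoint {p : ℝ} (hp : 1 / 2 < p) (hp1 : p ≤ 1) {c : Fin 3 → ℂ}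
    {γ : Fin 3 → ℝ} {w y u : Fin 3 → (Fin 2 → ℤ) → ℂ} (hw : ∀ j N, WtSummable N (w j))
    (hherm : ∀ j k, w j (-k) = star (w j k))
    (hmean : ∀ j, c (j + 1) * star (c (j + 2)) - star (c (j + 1)) * c (j + 2) +
      Complex.I * γ j * w j 0 = 0)
    (hy : ∀ j k, y j k = (Pi.single 0 (c j) : (Fin 2 → ℤ) → ℂ) k +
      (γ j : ℂ) * ((dbarSymbol k)⁻¹ * (Complex.I * w j k)))
    (hu : ∀ j, ∃ M, HsBound p (u j) M)
    (h : ∀ j k, u j k = (dbarSymbol k)⁻¹ *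
      wedge (fun l => y (j + 1) l + u (j + 1) l) (fun l => y (j + 2) l + u (j + 2) l) k) :
    (∀ j N, WtSummable N fun l => y j l + u j l) ∧
    ∀ j x, dbar (trigSeries fun l => y j l + u j l) x =
      trigSeries (fun l => y (j + 1) l + u (j + 1) l) x *
        star (trigSeries (fun l => y (j + 2) l + u (j + 2) l) x) -
      star (trigSeries (fun l => y (j + 1) l + u (j + 1) l) x) *
        trigSeries (fun l => y (j + 2) l + u (j + 2) l) x +
      (γ j : ℂ) * Complex.I * trigSeries (w j) x := by
  have hys : ∀ j N, WtSummable N (y j) := by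
    intro j N
    have h1 := (wtSummable_single N (c j)).add
      ((((hw j N).const_mul Complex.I).inv_dbarSymbol_mul).of_succ.const_mul (γ j))
    exact h1.mono fun k => by rw [hy j k]
  have hus := fun N => wtSummable_of_fixedPoint hp hp1 hys hu h N
  set r : Fin 3 → (Fin 2 → ℤ) → ℂ := fun j l => y j l + u j l with hr
  have hrs : ∀ j N, WtSummable N (r j) := fun j N => (hys j N).add (hus N j)
  refine ⟨hrs, fun j x => ?_⟩
  have hG : ∀ j k, k ≠ 0 → dbarSymbol k * r j k =
      wedge (r (j + 1)) (r (j + 2)) k + γ j * Complex.I * w j k := by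
    intro j k hk
    have hd := dbarSymbol_ne_zero hk
    simp only [hr]
    rw [hy j k, h j k, Pi.single_eq_of_ne hk]
    field_simp
    ring
  have hr0 : ∀ j, r j 0 = c j := by
    intro j
    simp only [hr]
    rw [hy j 0, h j 0, dbarSymbol_zero]
    simp
  have hGodd : ∀ j k, k ≠ 0 → dbarSymbol (-k) * r j (-k) = -star (dbarSymbol k * r j k) := by
    intro j k hk
    rw [hG j k hk, hG j (-k) (neg_ne_zero.mpr hk), hherm, star_add]
    have := starSeq_wedge (r (j + 1)) (r (j + 2)) (-k)
    rw [starSeq, neg_neg] at this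
    rw [this]
    simp
    ring
  have hodd : ∀ i j : Fin 3, ∀ k ≠ 0, r i (-k) * star (r j (-k)) - star (r i (-k)) * r j (-k) =
      -(r i k * star (r j k) - star (r i k) * r j k) := by
    intro i j k hk
    have hd := dbarSymbol_ne_zero hk
    -- Thus r_i(-k) times the conjugate of r_j(-k) equals the conjugate of r_i(k) times r_j(k): the
    -- passage from k to -k exchanges the two terms of the difference.
    have e : ∀ i, r i (-k) = star (dbarSymbol k * r i k) / dbarSymbol k := by
      intro i
      have := hGodd i k hk
      rw [dbarSymbol_neg] at this
      rw [eq_div_iff hd]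
      linear_combination -this
    have hds : star (dbarSymbol k) ≠ 0 := star_ne_zero.mpr hd
    rw [e, e]
    simp only [star_div₀, star_star, star_mul']
    field_simp
    ring
  have hzero : ∀ j, wedge (r (j + 1)) (r (j + 2)) 0 + γ j * Complex.I * w j 0 = 0 := by
    intro j
    rw [wedge_zero_eq (hrs _ 0) (hrs _ 0) (hodd _ _), hr0, hr0, ← hmean j]
    ring
  have hcoef : (fun k => dbarSymbol k * r j k) =
      fun k => wedge (r (j + 1)) (r (j + 2)) k + γ j * Complex.I * w j k := by
    funext k
    by_cases hk : k = 0
    · rw [hk, hzero, dbarSymbol_zero, zero_mul]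
    · exact hG j k hk
  rw [dbar_trigSeries (hrs j 1), hcoef,
    trigSeries_add ((hrs _ 0).wedge (hrs _ 0)) ((hw j 0).const_mul _), trigSeries_const_mul]
  congr 1
  have hwedge : wedge (r (j + 1)) (r (j + 2)) =
      fun k => conv (r (j + 1)) (starSeq (r (j + 2))) k -
        conv (starSeq (r (j + 1))) (r (j + 2)) k := rfl
  rw [hwedge, trigSeries_sub ((hrs _ 0).conv (hrs _ 0).starSeq) ((hrs _ 0).starSeq.conv (hrs _ 0)),
    ← trigSeries_mul (hrs _ 0) (hrs _ 0).starSeq, ← trigSeries_mul (hrs _ 0).starSeq (hrs _ 0),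
    star_trigSeries, star_trigSeries]

/-! ## The multiplier of a mollifier -/

/-- A smooth probability density supported in the closed unit ball. -/
structure IsKernel (f : Plane → ℝ) : Prop where
  contDiff : ContDiff ℝ (⊤ : ℕ∞) f
  hasCompactSupport : HasCompactSupport f
  nonneg : ∀ x, 0 ≤ f x
  integral_eq_one : ∫ x, f x = 1
  norm_le : ∀ x, f x ≠ 0 → ‖x‖ ≤ 1

theorem IsMollifier.isKernel {ρ : 𝓓((⊤ : TopologicalSpace.Opens Plane), ℝ)} (h : IsMollifier ρ) :
    IsKernel fun z => ρ (-z) where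
  contDiff := ρ.contDiff.comp contDiff_neg
  hasCompactSupport := ρ.hasCompactSupport.comp_homeomorph (Homeomorph.neg Plane)
  nonneg x := h.nonneg _
  integral_eq_one := by
    rw [integral_neg_eq_self (fun z => ρ z), h.integral_eq_one]
  norm_le x hx := by
    have := h.support_subset (subset_tsupport _ hx)
    simpa using this

namespace IsKernel

variable {f : Plane → ℝ}

theorem integrable (h : IsKernel f) : Integrable f :=
  h.contDiff.continuous.integrable_of_hasCompactSupport h.hasCompactSupport

theorem norm_waveFT_le_one (h : IsKernel f) (k : Fin 2 → ℤ) (ε : ℝ) : ‖waveFT f k ε‖ ≤ 1 := by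
  refine (norm_waveFT_le f k ε).trans (le_of_eq ?_)
  rw [← h.integral_eq_one]
  exact integral_congr_ae (Eventually.of_forall fun x => abs_of_nonneg (h.nonneg x))

theorem waveFT_zero (h : IsKernel f) (ε : ℝ) : waveFT f 0 ε = 1 := by
  rw [waveFT_zero_left, h.integral_eq_one, Complex.ofReal_one]

theorem norm_integral_mul_le (h : IsKernel f) {F : Plane → ℂ} {M : ℝ}
    (hF : ∀ w, ‖w‖ ≤ 1 → ‖F w‖ ≤ M) : ‖∫ w, (f w : ℂ) * F w‖ ≤ M := by
  calc ‖∫ w, (f w : ℂ) * F w‖ ≤ ∫ w, f w * M := by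
        refine norm_integral_le_of_norm_le (h.integrable.mul_const M)
          (Eventually.of_forall fun w => ?_)
        rw [norm_mul, Complex.norm_real, Real.norm_of_nonneg (h.nonneg w)]
        by_cases hw : f w = 0
        · simp [hw]
        · exact mul_le_mul_of_nonneg_left (hF w (h.norm_le w hw)) (h.nonneg w)
    _ = M := by rw [integral_mul_const, h.integral_eq_one, one_mul]

/-- Interpolation between the trivial bound 2 and the Lipschitz bound `2 * (ε * wt k)`, according to
whether `ε * wt k` exceeds 1. -/
theorem norm_character_sub_one_le {β : ℝ} (hβ : 0 ≤ β) (hβ1 : β ≤ 1) (k : Fin 2 → ℤ) {ε : ℝ}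
    (hε : 0 ≤ ε) {w : Plane} (hw : ‖w‖ ≤ 1) :
    ‖character k (ε • w) - 1‖ ≤ 2 * (ε ^ β * wt k ^ β) := by
  have hk := wt_pos k
  have hx : 0 ≤ ε * wt k := by positivity
  rw [← Real.mul_rpow hε hk.le]
  rcases le_total (ε * wt k) 1 with h | h
  · have h1 : ‖character k (ε • w) - 1‖ ≤ 2 * (ε * wt k) := by
      rw [character_eq]
      have := Real.norm_exp_I_mul_ofReal_sub_one_le (x := phase k (ε • w))
      rw [mul_comm] at this
      refine this.trans ?_
      rw [map_smul, norm_smul, Real.norm_of_nonneg hε]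
      calc ε * ‖phase k w‖ ≤ ε * (‖phase k‖ * ‖w‖) := by
            gcongr; exact (phase k).le_opNorm w
        _ ≤ ε * (2 * ‖k‖ * 1) := by
            gcongr; exact norm_phase_le k
        _ ≤ ε * (2 * wt k * 1) := by
            gcongr; unfold wt; linarith
        _ = _ := by ring
    refine h1.trans ?_
    gcongr
    calc ε * wt k = (ε * wt k) ^ (1 : ℝ) := (Real.rpow_one _).symm
      _ ≤ _ := Real.rpow_le_rpow_of_exponent_ge_of_imp hx h hβ1 (by norm_num)
  · have h1 : ‖character k (ε • w) - 1‖ ≤ 2 := by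
      refine (norm_sub_le _ _).trans ?_
      rw [norm_character]; norm_num
    have h2 : 1 ≤ (ε * wt k) ^ β := Real.one_le_rpow h hβ
    linarith

theorem waveFT_sub_one (h : IsKernel f) (k : Fin 2 → ℤ) (ε : ℝ) :
    waveFT f k ε - 1 = ∫ w, (f w : ℂ) * (character k (ε • w) - 1) := by
  have h1 : (1 : ℂ) = ∫ w, (f w : ℂ) := by
    rw [integral_complex_ofReal, h.integral_eq_one, Complex.ofReal_one]
  have hi : Integrable fun w => (f w : ℂ) := h.integrable.ofReal
  conv_lhs => rw [h1]
  rw [waveFT, ← integral_sub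
    (integrable_mul_character h.contDiff.continuous h.hasCompactSupport k ε) hi]
  refine integral_congr_ae (Eventually.of_forall fun w => ?_)
  simp only
  ring

theorem norm_waveFT_sub_one_le (h : IsKernel f) {β : ℝ} (hβ : 0 ≤ β) (hβ1 : β ≤ 1)
    (k : Fin 2 → ℤ) {ε : ℝ} (hε : 0 ≤ ε) : ‖waveFT f k ε - 1‖ ≤ 2 * (ε ^ β * wt k ^ β) := by
  rw [h.waveFT_sub_one]
  exact h.norm_integral_mul_le fun w hw => norm_character_sub_one_le hβ hβ1 k hε hw

theorem norm_waveFT_sub_le (h : IsKernel f) {β : ℝ} (hβ : 0 ≤ β) (hβ1 : β ≤ 1)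
    (k : Fin 2 → ℤ) {ε ε' : ℝ} (hε' : 0 ≤ ε') (hle : ε' ≤ ε) :
    ‖waveFT f k ε - waveFT f k ε'‖ ≤ 4 * ε ^ β * wt k ^ β := by
  have h1 := h.norm_waveFT_sub_one_le hβ hβ1 k (hε'.trans hle)
  have h2 := h.norm_waveFT_sub_one_le hβ hβ1 k hε'
  have h3 : ε' ^ β ≤ ε ^ β := Real.rpow_le_rpow hε' hle hβ
  have h4 : 0 ≤ wt k ^ β := Real.rpow_nonneg (wt_pos k).le _
  have e : waveFT f k ε - waveFT f k ε' = (waveFT f k ε - 1) - (waveFT f k ε' - 1) := by ring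
  rw [e]
  refine (norm_sub_le _ _).trans ?_
  nlinarith [mul_le_mul_of_nonneg_right h3 h4]

/-- The growth as ε → 0 is harmless: the bound serves qualitative smoothness at fixed ε, and uniform
bounds for ε ≥ 1. -/
theorem exists_norm_waveFT_le (h : IsKernel f) (N : ℕ) : ∃ C, 0 ≤ C ∧
    ∀ (k : Fin 2 → ℤ) (ε : ℝ), 0 < ε → ‖waveFT f k ε‖ ≤ C * (1 + (ε ^ N)⁻¹) * (wt k ^ N)⁻¹ := by
  obtain ⟨C, hC, hk⟩ := exists_pow_mul_norm_waveFT_le N h.contDiff h.hasCompactSupport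
  refine ⟨1 + 2 ^ N * C, by positivity, fun k ε hε => ?_⟩
  have hw := wt_pos k
  have hεN : 0 < ε ^ N := pow_pos hε N
  by_cases h0 : k = 0
  · subst h0
    rw [h.waveFT_zero, norm_one]
    simp only [wt, norm_zero, add_zero, one_pow, inv_one, mul_one]
    have : 0 < (ε ^ N)⁻¹ := by positivity
    have h2 : 0 ≤ 2 ^ N * C := by positivity
    nlinarith [mul_nonneg h2 this.le]
  · have h1 := hk k ε hε.le
    have h2 := one_le_norm_of_ne_zero h0
    have h3 : wt k ^ N ≤ 2 ^ N * ‖k‖ ^ N := by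
      rw [← mul_pow]; exact pow_le_pow_left₀ hw.le (wt_le_two_mul_norm h0) N
    rw [mul_pow] at h1
    have h4 : wt k ^ N * ‖waveFT f k ε‖ ≤ 2 ^ N * C * (ε ^ N)⁻¹ := by
      rw [← div_eq_mul_inv, le_div_iff₀ hεN]
      calc wt k ^ N * ‖waveFT f k ε‖ * ε ^ N ≤ (2 ^ N * ‖k‖ ^ N) * ‖waveFT f k ε‖ * ε ^ N := by
            gcongr
        _ = 2 ^ N * (ε ^ N * ‖k‖ ^ N * ‖waveFT f k ε‖) := by ring
        _ ≤ _ := by gcongr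
    rw [← div_eq_mul_inv _ (wt k ^ N), le_div_iff₀ (by positivity), mul_comm]
    refine h4.trans ?_
    have : 0 < (ε ^ N)⁻¹ := by positivity
    have h2 : 0 ≤ 2 ^ N * C := by positivity
    nlinarith

/-- The coefficients of the mollification of the series with coefficients `z`. -/
noncomputable def _root_.mollSeq (f : Plane → ℝ) (ε : ℝ) (z : (Fin 2 → ℤ) → ℂ) (k : Fin 2 → ℤ) : ℂ :=
  waveFT f k ε * z k

theorem _root_.starSeq_mollSeq (f : Plane → ℝ) (ε : ℝ) (z : (Fin 2 → ℤ) → ℂ) :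
    starSeq (mollSeq f ε z) = mollSeq f ε (starSeq z) := by
  funext k
  simp only [starSeq, mollSeq, waveFT_neg_left, star_mul', star_star]

theorem hsBound_mollSeq (h : IsKernel f) {s M : ℝ} {z : (Fin 2 → ℤ) → ℂ} (hz : HsBound s z M)
    (ε : ℝ) : HsBound s (mollSeq f ε z) M := by
  have := hz.of_le (s' := s) (g := mollSeq f ε z) zero_le_one fun k => by
    rw [one_mul, mollSeq, norm_mul]
    have := h.norm_waveFT_le_one k ε
    have hw : 0 ≤ wt k ^ s := Real.rpow_nonneg (wt_pos k).le _
    gcongr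
    exact mul_le_of_le_one_left (norm_nonneg _) this
  simpa using this

theorem hsBound_mollSeq_sub (h : IsKernel f) {s M β : ℝ} (hβ : 0 ≤ β) (hβ1 : β ≤ 1)
    {z : (Fin 2 → ℤ) → ℂ} (hz : HsBound (s + β) z M) {ε ε' : ℝ} (hε' : 0 ≤ ε') (hle : ε' ≤ ε) :
    HsBound s (fun k => mollSeq f ε z k - mollSeq f ε' z k) (4 * ε ^ β * M) := by
  have hε : 0 ≤ ε := hε'.trans hle
  refine hz.of_le (by positivity) fun k => ?_
  have hw := wt_pos k
  rw [mollSeq, mollSeq, ← sub_mul, norm_mul, Real.rpow_add hw]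
  calc _ ≤ wt k ^ s * ((4 * ε ^ β * wt k ^ β) * ‖z k‖) := by
        gcongr; exact h.norm_waveFT_sub_le hβ hβ1 k hε' hle
    _ = _ := by ring

theorem wtSummable_mollSeq (h : IsKernel f) {s M : ℝ} {z : (Fin 2 → ℤ) → ℂ} (hz : HsBound s z M)
    {ε : ℝ} (hε : 0 < ε) (N : ℕ) : WtSummable N (mollSeq f ε z) := by
  -- The n powers of decay absorb N weights, the growth of z, and the exponent 3 that makes the
  -- weights summable.
  obtain ⟨n, hn⟩ := exists_nat_gt (N + 3 - s)
  obtain ⟨C, hC, hk⟩ := h.exists_norm_waveFT_le n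
  refine Summable.of_nonneg_of_le
    (fun k => mul_nonneg (pow_nonneg (wt_pos k).le _) (norm_nonneg _)) (fun k => ?_)
    ((summable_wt_rpow (a := 3) (by norm_num)).mul_left (C * (1 + (ε ^ n)⁻¹) * M))
  have hw := wt_pos k
  have hM := hz.1
  have h1 := hz.norm_le k
  have h2 := hk k ε hε
  rw [mollSeq, norm_mul]
  calc wt k ^ N * (‖waveFT f k ε‖ * ‖z k‖)
      ≤ wt k ^ N * ((C * (1 + (ε ^ n)⁻¹) * (wt k ^ n)⁻¹) * (M * wt k ^ (-s))) := by gcongr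
    _ = C * (1 + (ε ^ n)⁻¹) * M * (wt k ^ N * (wt k ^ n)⁻¹ * wt k ^ (-s)) := by ring
    _ ≤ _ := by
        gcongr
        rw [← Real.rpow_natCast, ← Real.rpow_natCast, ← Real.rpow_neg hw.le, ← Real.rpow_add hw,
          ← Real.rpow_add hw]
        exact Real.rpow_le_rpow_of_exponent_le (one_le_wt k) (by linarith)

theorem sum_waveFT_mul (h : IsKernel f) (S : Finset (Fin 2 → ℤ)) (ε : ℝ)
    (a : (Fin 2 → ℤ) → (Fin 2 → ℤ) → ℂ) :
    ∑ k ∈ S, ∑ l ∈ S, waveFT f (k - l) ε * a k l =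
      ∫ w, (f w : ℂ) * ∑ k ∈ S, ∑ l ∈ S, character (k - l) (ε • w) * a k l := by
  have hi := fun k => integrable_mul_character h.contDiff.continuous h.hasCompactSupport k ε
  simp only [Finset.mul_sum, ← mul_assoc]
  rw [integral_finsetSum _ fun k _ => integrable_finsetSum _ fun l _ => (hi _).mul_const _]
  refine Finset.sum_congr rfl fun k _ => ?_
  rw [integral_finsetSum _ fun l _ => (hi _).mul_const _]
  exact Finset.sum_congr rfl fun l _ => by rw [integral_mul_const, waveFT]

/-- Mollification averages translates of z against a probability density. A translation multiplies
the coefficients by characters of k - l, and these split into unimodular factors on the two test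
sequences, which do not change the bound. -/
theorem opBound_mollSeq (h : IsKernel f) {z : (Fin 2 → ℤ) → ℂ} {s t K : ℝ}
    (hz : OpBound z s t K) (ε : ℝ) : OpBound (mollSeq f ε z) s t K := by
  intro S u g
  simp only [mollSeq, mul_assoc]
  rw [h.sum_waveFT_mul]
  refine h.norm_integral_mul_le fun w _ => ?_
  have := hz S (fun l => character (-l) (ε • w) * u l) (fun k => character k (ε • w) * g k)
  simp only [norm_mul, norm_character, one_mul] at this
  refine le_trans (le_of_eq ?_) (this.trans (le_of_eq (mul_assoc _ _ _)))
  congr 1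
  refine Finset.sum_congr rfl fun k _ => Finset.sum_congr rfl fun l _ => ?_
  rw [sub_eq_add_neg, character_add_left]
  ring

/-- With χ the character at `ε • w`, χ_{k-l} - 1 = (χ_{-l} - 1) χ_k + (χ_k - 1). In each term the
small factor falls on one test sequence and is paid for with β derivatives. Hence both exponents
grow by β and the bound gains ε^β. -/
theorem opBound_mollSeq_sub_self (h : IsKernel f) {z : (Fin 2 → ℤ) → ℂ} {s t K β : ℝ} (hK : 0 ≤ K)
    (hβ : 0 ≤ β) (hβ1 : β ≤ 1) (hz : OpBound z s t K) {ε : ℝ} (hε : 0 ≤ ε) :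
    OpBound (fun k => mollSeq f ε z k - z k) (s + β) (t + β) (4 * ε ^ β * K) := by
  intro S u g
  have hpos : ∀ (k : Fin 2 → ℤ) (r : ℝ), 0 ≤ wt k ^ r := fun k r =>
    Real.rpow_nonneg (wt_pos k).le r
  set X := √(∑ l ∈ S, (wt l ^ (s + β) * ‖u l‖) ^ 2)
  set Y := √(∑ k ∈ S, (wt k ^ (t + β) * ‖g k‖) ^ 2)
  have hXs : ∀ {s : ℝ} {v : (Fin 2 → ℤ) → ℂ} {c : ℝ}, 0 ≤ c →
      ∀ {r : ℝ} {u : (Fin 2 → ℤ) → ℂ}, (∀ k, wt k ^ s * ‖v k‖ ≤ c * (wt k ^ r * ‖u k‖)) →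
      √(∑ l ∈ S, (wt l ^ s * ‖v l‖) ^ 2) ≤ c * √(∑ l ∈ S, (wt l ^ r * ‖u l‖) ^ 2) := by
    intro s v c hc r u hle
    rw [← Real.sqrt_sq hc, ← Real.sqrt_mul (sq_nonneg c), Finset.mul_sum]
    refine Real.sqrt_le_sqrt (Finset.sum_le_sum fun k _ => ?_)
    rw [← mul_pow]
    exact pow_le_pow_left₀ (mul_nonneg (hpos _ _) (norm_nonneg _)) (hle k) 2
  have e0 : ∑ k ∈ S, ∑ l ∈ S, (mollSeq f ε z (k - l) - z (k - l)) * u l * g k =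
      ∫ w, (f w : ℂ) * ∑ k ∈ S, ∑ l ∈ S, (character (k - l) (ε • w) - 1) *
        (z (k - l) * u l * g k) := by
    have h1 := h.sum_waveFT_mul S ε fun k l => z (k - l) * u l * g k
    have h2 := h.sum_waveFT_mul S 0 fun k l => z (k - l) * u l * g k
    have h3 : ∀ k, waveFT f k 0 = 1 := fun k => by
      have := h.waveFT_sub_one k 0
      simp only [zero_smul, character_zero, sub_self, mul_zero, integral_zero] at this
      exact sub_eq_zero.mp this
    have hi : ∀ ε, Integrable fun w => (f w : ℂ) *
        ∑ k ∈ S, ∑ l ∈ S, character (k - l) (ε • w) * (z (k - l) * u l * g k) := fun ε => by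
      simp only [Finset.mul_sum, ← mul_assoc]
      exact integrable_finsetSum _ fun k _ => integrable_finsetSum _ fun l _ =>
        (((integrable_mul_character h.contDiff.continuous h.hasCompactSupport _ ε).mul_const
          _).mul_const _).mul_const _
    simp only [sub_mul, Finset.sum_sub_distrib, mul_sub, one_mul]
    have h4 := integral_sub (hi ε) (hi 0)
    simp only [zero_smul, character_zero, one_mul] at h4
    rw [h4, ← h1]
    simp only [h3, zero_smul, character_zero, one_mul] at h2
    rw [← h2]
    simp only [mollSeq, mul_assoc]
  rw [e0]
  refine h.norm_integral_mul_le fun w hw => ?_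
  have e1 : ∑ k ∈ S, ∑ l ∈ S, (character (k - l) (ε • w) - 1) * (z (k - l) * u l * g k) =
      (∑ k ∈ S, ∑ l ∈ S, z (k - l) * ((character (-l) (ε • w) - 1) * u l) *
        (character k (ε • w) * g k)) +
      ∑ k ∈ S, ∑ l ∈ S, z (k - l) * u l * ((character k (ε • w) - 1) * g k) := by
    rw [← Finset.sum_add_distrib]
    refine Finset.sum_congr rfl fun k _ => ?_
    rw [← Finset.sum_add_distrib]
    refine Finset.sum_congr rfl fun l _ => ?_
    rw [sub_eq_add_neg k l, character_add_left]
    ring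
  rw [e1]
  have b1 := hz S (fun l => (character (-l) (ε • w) - 1) * u l) fun k => character k (ε • w) * g k
  have b2 := hz S u fun k => (character k (ε • w) - 1) * g k
  have hgen : ∀ (r : ℝ) (k k' : Fin 2 → ℤ) (a : ℂ), wt k' = wt k →
      wt k ^ r * ‖(character k' (ε • w) - 1) * a‖ ≤ 2 * ε ^ β * (wt k ^ (r + β) * ‖a‖) := by
    intro r k k' a hk'
    rw [norm_mul, Real.rpow_add (wt_pos k)]
    have := norm_character_sub_one_le hβ hβ1 k' hε hw
    rw [hk'] at this
    calc _ ≤ wt k ^ r * ((2 * (ε ^ β * wt k ^ β)) * ‖a‖) := by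
          have := hpos k r
          gcongr
      _ = _ := by ring
  have hmono : ∀ (r : ℝ) (k : Fin 2 → ℤ) (a b : ℂ), ‖b‖ = ‖a‖ →
      wt k ^ r * ‖b‖ ≤ 1 * (wt k ^ (r + β) * ‖a‖) := by
    intro r k a b hab
    rw [one_mul, hab]
    gcongr
    · exact one_le_wt k
    · linarith
  have hε0 : 0 ≤ 2 * ε ^ β := by positivity
  have c1 := hXs hε0 (s := s) (v := fun l => (character (-l) (ε • w) - 1) * u l) (r := s + β)
    (u := u) fun l => hgen s l (-l) (u l) (wt_neg l)
  have c2 := hXs zero_le_one (s := t) (v := fun k => character k (ε • w) * g k) (r := t + β)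
    (u := g) fun k => hmono t k (g k) _ (by rw [norm_mul, norm_character, one_mul])
  have c3 := hXs zero_le_one (s := s) (v := u) (r := s + β) (u := u) fun k => hmono s k (u k) _ rfl
  have c4 := hXs hε0 (s := t) (v := fun k => (character k (ε • w) - 1) * g k) (r := t + β)
    (u := g) fun k => hgen t k k (g k) rfl
  refine (norm_add_le _ _).trans ?_
  calc _ ≤ K * (2 * ε ^ β * X) * (1 * Y) + K * (1 * X) * (2 * ε ^ β * Y) := by
        refine add_le_add (b1.trans ?_) (b2.trans ?_)
        · gcongr
        · gcongr
    _ = _ := by ring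

theorem opBound_mollSeq_sub (h : IsKernel f) {z : (Fin 2 → ℤ) → ℂ} {s t K β : ℝ} (hK : 0 ≤ K)
    (hβ : 0 ≤ β) (hβ1 : β ≤ 1) (hz : OpBound z s t K) {ε ε' : ℝ} (hε' : 0 ≤ ε') (hle : ε' ≤ ε) :
    OpBound (fun k => mollSeq f ε z k - mollSeq f ε' z k) (s + β) (t + β) (8 * ε ^ β * K) := by
  have h1 := h.opBound_mollSeq_sub_self hK hβ hβ1 hz (hε'.trans hle)
  have h2 := h.opBound_mollSeq_sub_self hK hβ hβ1 hz hε'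
  have h3 := (h1.sub h2).mono (K' := 8 * ε ^ β * K) (by
    have : ε' ^ β ≤ ε ^ β := Real.rpow_le_rpow hε' hle hβ
    nlinarith [mul_le_mul_of_nonneg_right this hK])
  simpa using h3

end IsKernel

/-! ## Solution of the fixed point equation -/

/-- The values at 1/(n+1) form a Cauchy sequence; letting ε' tend to 0 along it in the hypothesis
gives the rate for the limit. -/
theorem exists_limit_of_rate {E : Type*} [NormedAddCommGroup E] [CompleteSpace E] {u : ℝ → E}
    {C β : ℝ} (hβ : 0 < β) (h : ∀ ε ε', 0 < ε' → ε' ≤ ε → ‖u ε - u ε'‖ ≤ C * ε ^ β) :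
    ∃ v, ∀ ε, 0 < ε → ‖u ε - v‖ ≤ C * ε ^ β := by
  have hpos : ∀ n : ℕ, (0 : ℝ) < 1 / ((n : ℝ) + 1) := fun n => by positivity
  have hlim : Tendsto (fun n : ℕ => C * (1 / ((n : ℝ) + 1)) ^ β) atTop (𝓝 0) := by
    have h1 := (tendsto_one_div_add_atTop_nhds_zero_nat (𝕜 := ℝ)).rpow_const (p := β)
      (Or.inr hβ.le)
    rw [Real.zero_rpow hβ.ne'] at h1
    simpa using h1.const_mul C
  have hc : CauchySeq fun n : ℕ => u (1 / ((n : ℝ) + 1)) := by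
    refine cauchySeq_of_le_tendsto_0' _ (fun n m hnm => ?_) hlim
    rw [dist_eq_norm]
    exact h _ _ (hpos m) (by gcongr)
  obtain ⟨v, hv⟩ := cauchySeq_tendsto_of_complete hc
  refine ⟨v, fun ε hε => ?_⟩
  refine le_of_tendsto (tendsto_const_nhds.sub hv).norm ?_
  filter_upwards [(tendsto_one_div_add_atTop_nhds_zero_nat (𝕜 := ℝ)).eventually
    (eventually_le_nhds hε)] with n hn
  exact h _ _ (hpos n) hn

theorem OpBound.mono_exponents {z : (Fin 2 → ℤ) → ℂ} {s t s' t' K : ℝ} (hK : 0 ≤ K)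
    (h : OpBound z s t K) (hs : s ≤ s') (ht : t ≤ t') : OpBound z s' t' K := by
  intro S f g
  refine (h S f g).trans ?_
  have hm : ∀ {a b : ℝ} (_ : a ≤ b) (f : (Fin 2 → ℤ) → ℂ),
      √(∑ l ∈ S, (wt l ^ a * ‖f l‖) ^ 2) ≤ √(∑ l ∈ S, (wt l ^ b * ‖f l‖) ^ 2) := by
    intro a b hab f
    refine Real.sqrt_le_sqrt (Finset.sum_le_sum fun k _ => ?_)
    have := wt_pos k
    have h1 : wt k ^ a ≤ wt k ^ b := Real.rpow_le_rpow_of_exponent_le (one_le_wt k) hab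
    gcongr
  have := hm hs f
  have := hm ht g
  gcongr

theorem HsBound.mono_exponent {s s' M : ℝ} {f : (Fin 2 → ℤ) → ℂ} (h : HsBound s f M)
    (hs : s' ≤ s) : HsBound s' f M := by
  have := h.of_le (s' := s') (g := f) zero_le_one fun k => by
    rw [one_mul]
    gcongr
    exact one_le_wt k
  simpa using this

theorem hsBound_of_norm_le {s a D : ℝ} (hD : 0 ≤ D) (hs : 1 < a - s) {f : (Fin 2 → ℤ) → ℂ}
    (h : ∀ k, ‖f k‖ ≤ D * wt k ^ (-a)) : HsBound s f (D * (1 + wtSum (2 * (a - s)))) := by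
  have hw0 := wtSum_nonneg (2 * (a - s))
  refine ⟨by positivity, fun S => ?_⟩
  calc _ ≤ ∑ k ∈ S, D ^ 2 * wt k ^ (-(2 * (a - s))) := by
        refine Finset.sum_le_sum fun k _ => ?_
        have hw := wt_pos k
        have e : wt k ^ (-(2 * (a - s))) = (wt k ^ s * wt k ^ (-a)) ^ 2 := by
          rw [← Real.rpow_add hw, ← Real.rpow_natCast, ← Real.rpow_mul hw.le]
          congr 1; push_cast; ring
        rw [e, ← mul_pow]
        refine pow_le_pow_left₀ (by positivity) ?_ 2
        calc _ ≤ wt k ^ s * (D * wt k ^ (-a)) := by gcongr; exact h k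
          _ = _ := by ring
    _ ≤ D ^ 2 * wtSum (2 * (a - s)) := by
        rw [← Finset.mul_sum]
        gcongr
        exact (summable_wt_rpow (by linarith)).sum_le_tsum S fun k _ =>
          Real.rpow_nonneg (wt_pos k).le _
    _ ≤ _ := by
        rw [mul_pow]
        gcongr
        nlinarith

theorem norm_conv_le_of_norm_le {f g : (Fin 2 → ℤ) → ℂ} {D a : ℝ} (hD : 0 ≤ D) (ha : 2 < a)
    (hf : ∀ k, ‖f k‖ ≤ D * wt k ^ (-a)) (hg : ∀ k, ‖g k‖ ≤ D * wt k ^ (-a)) (k : Fin 2 → ℤ) :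
    ‖conv f g k‖ ≤ D ^ 2 * (2 ^ a * 2 * wtSum a) * wt k ^ (-a) := by
  have h1 := summable_wt_conv (a := a) (b := a) (c := a) le_rfl le_rfl (by linarith)
    (by linarith) k
  have h2 := tsum_wt_conv_le (a := a) (b := a) (c := a) le_rfl le_rfl (by linarith)
    (by linarith) k
  have hle : ∀ l, ‖f (k - l) * g l‖ ≤ D ^ 2 * (wt l ^ (-a) * wt (k - l) ^ (-a)) := fun l => by
    rw [norm_mul]
    have := wt_pos l
    have := wt_pos (k - l)
    calc _ ≤ (D * wt (k - l) ^ (-a)) * (D * wt l ^ (-a)) := by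
          gcongr
          · exact hf _
          · exact hg _
      _ = _ := by ring
  have h3 := tsum_of_norm_bounded (h1.mul_left (D ^ 2)).hasSum hle
  rw [tsum_mul_left] at h3
  refine h3.trans ?_
  rw [mul_assoc]
  refine mul_le_mul_of_nonneg_left (h2.trans (le_of_eq ?_)) (sq_nonneg D)
  rw [add_sub_cancel_right]

/-- The bounds on the (transformed) noise on which the construction of the solution relies. -/
structure NoiseBound (f : Plane → ℝ) (κ K : ℝ) (z : Fin 3 → (Fin 2 → ℤ) → ℂ) : Prop where
  hsBound : ∀ j, HsBound (-(3 * κ / 8)) (z j) K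
  opBound : ∀ j, OpBound (z j) (1 - 5 * κ / 8) (3 * κ / 8) K
  conv_sub : ∀ j ε ε', 0 < ε' → ε' ≤ ε → ε ≤ 1 → HsBound (-(κ / 2))
    (fun k => conv (mollSeq f ε (z (j + 1))) (starSeq (mollSeq f ε (z (j + 2)))) k -
      conv (mollSeq f ε' (z (j + 1))) (starSeq (mollSeq f ε' (z (j + 2)))) k) (K * ε ^ (κ / 8))

/-- The coefficients of `∂_{z̄}⁻¹ (y ȳ' - ȳ y')`, for `y = c + g z` and `y' = c' + g' z'`, in terms of
`z`, `z'` and the coefficients `X` of `z z̄'`. -/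
noncomputable def forcing (c c' : ℂ) (g g' : ℝ) (z z' X : (Fin 2 → ℤ) → ℂ) (k : Fin 2 → ℤ) : ℂ :=
  (dbarSymbol k)⁻¹ * ((g' * c : ℂ) * starSeq z' k + (-(g' * star c) : ℂ) * z' k +
    ((g * star c' : ℂ) * z k + (-(g * c') : ℂ) * starSeq z k) +
    ((g * g' : ℂ) * X k + (-(g * g') : ℂ) * starSeq X k))

/-- Every term of `forcing` has a factor g or g', hence the factor σ: the product of the two
constants only enters the zero mode, which is discarded. The constants are 4, from the inverse,
times four terms with z or z' and two with X. -/
theorem hsBound_forcing {p σ M N : ℝ} {c c' : ℂ} {g g' : ℝ} {z z' X : (Fin 2 → ℤ) → ℂ}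
    (hσ1 : σ ≤ 1) (hc : ‖c‖ ≤ 1) (hc' : ‖c'‖ ≤ 1) (hg : |g| ≤ σ)
    (hg' : |g'| ≤ σ) (hz : HsBound (p - 1) z M) (hz' : HsBound (p - 1) z' M)
    (hX : HsBound (p - 1) X N) : HsBound p (forcing c c' g g' z z' X) (σ * (16 * M + 8 * N)) := by
  have hM := hz.1
  have hN := hX.1
  have hg0 := abs_nonneg g
  have hg0' := abs_nonneg g'
  have hσ : 0 ≤ σ := hg0.trans hg
  have e1 : ‖(g' * c : ℂ)‖ ≤ σ := by
    rw [norm_mul, Complex.norm_real, Real.norm_eq_abs]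
    nlinarith [norm_nonneg c]
  have e2 : ‖(-(g' * star c) : ℂ)‖ ≤ σ := by
    rw [norm_neg, norm_mul, Complex.norm_real, Real.norm_eq_abs, norm_star]
    nlinarith [norm_nonneg c]
  have e3 : ‖(g * star c' : ℂ)‖ ≤ σ := by
    rw [norm_mul, Complex.norm_real, Real.norm_eq_abs, norm_star]
    nlinarith [norm_nonneg c']
  have e4 : ‖(-(g * c') : ℂ)‖ ≤ σ := by
    rw [norm_neg, norm_mul, Complex.norm_real, Real.norm_eq_abs]
    nlinarith [norm_nonneg c']
  have e5 : ‖(g * g' : ℂ)‖ ≤ σ := by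
    rw [norm_mul, Complex.norm_real, Real.norm_eq_abs, Complex.norm_real, Real.norm_eq_abs]
    nlinarith
  have h1 := (((hz'.starSeq.const_mul (g' * c)).mono (mul_le_mul_of_nonneg_right e1 hM)).add
    ((hz'.const_mul (-(g' * star c))).mono (mul_le_mul_of_nonneg_right e2 hM))).add
    (((hz.const_mul (g * star c')).mono (mul_le_mul_of_nonneg_right e3 hM)).add
    ((hz.starSeq.const_mul (-(g * c'))).mono (mul_le_mul_of_nonneg_right e4 hM)))
  have h2 := ((hX.const_mul (g * g')).mono (mul_le_mul_of_nonneg_right e5 hN)).add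
    ((hX.starSeq.const_mul (-(g * g'))).mono
      (mul_le_mul_of_nonneg_right ((norm_neg _).trans_le e5) hN))
  refine ((h1.add h2).inv_dbarSymbol_mul).mono (le_of_eq ?_)
  ring

theorem forcing_sub (c c' : ℂ) (g g' : ℝ) (z z' X v v' Y : (Fin 2 → ℤ) → ℂ) (k : Fin 2 → ℤ) :
    forcing c c' g g' z z' X k - forcing c c' g g' v v' Y k =
      forcing c c' g g' (fun l => z l - v l) (fun l => z' l - v' l) (fun l => X l - Y l) k := by
  simp only [forcing, starSeq_sub]
  ring

theorem conv_single_left (c : ℂ) (g : (Fin 2 → ℤ) → ℂ) (k : Fin 2 → ℤ) :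
    conv (Pi.single 0 c) g k = c * g k := by
  rw [conv, tsum_eq_single k]
  · simp
  · intro l hl
    rw [Pi.single_eq_of_ne (sub_ne_zero.mpr hl.symm), zero_mul]

theorem starSeq_single (c : ℂ) : starSeq (Pi.single 0 c) = Pi.single 0 (star c) := by
  funext k
  by_cases hk : k = 0
  · simp [starSeq, hk]
  · rw [starSeq, Pi.single_eq_of_ne (neg_ne_zero.mpr hk), Pi.single_eq_of_ne hk, star_zero]

theorem wedge_single_left (c : ℂ) (g : (Fin 2 → ℤ) → ℂ) (k : Fin 2 → ℤ) :
    wedge (Pi.single 0 c) g k = c * starSeq g k - star c * g k := by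
  rw [wedge, starSeq_single, conv_single_left, conv_single_left]

/-- Expansion of the wedge product by bilinearity, which is legitimate because z and z' are
absolutely summable. The part with both constants is supported at frequency 0. -/
theorem forcing_eq {c c' : ℂ} {g g' : ℝ} {z z' : (Fin 2 → ℤ) → ℂ} (hz : WtSummable 0 z)
    (hz' : WtSummable 0 z') (k : Fin 2 → ℤ) :
    (dbarSymbol k)⁻¹ * wedge (fun l => (Pi.single 0 c : (Fin 2 → ℤ) → ℂ) l + (g : ℂ) * z l)
      (fun l => (Pi.single 0 c' : (Fin 2 → ℤ) → ℂ) l + (g' : ℂ) * z' l) k =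
      forcing c c' g g' z z' (conv z (starSeq z')) k := by
  by_cases hk : k = 0
  · simp [hk, forcing, dbarSymbol_zero]
  have s1 := wtSummable_single 0 c
  have s2 := wtSummable_single 0 c'
  have hgz := hz.const_mul (g : ℂ)
  have hgz' := hz'.const_mul (g' : ℂ)
  rw [wedge_add_left (s1.wedgeSummable (s2.add hgz') k) (hgz.wedgeSummable (s2.add hgz') k),
    wedge_add_right (s1.wedgeSummable s2 k) (s1.wedgeSummable hgz' k),
    wedge_add_right (hgz.wedgeSummable s2 k) (hgz.wedgeSummable hgz' k),
    wedge_swap (Pi.single 0 c) (Pi.single 0 c'), wedge_single_left, wedge_single_left,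
    wedge_swap (fun l => (g : ℂ) * z l) (Pi.single 0 c'), wedge_single_left,
    wedge_real_mul_left, wedge_swap z, wedge_real_mul_left, wedge_swap z', starSeq_real_mul,
    starSeq_real_mul, starSeq_single, Pi.single_eq_of_ne hk, Pi.single_eq_of_ne hk, forcing,
    starSeq_conv, starSeq_starSeq, wedge]
  ring

/-- At scales ε ≥ 1 high frequencies are damped uniformly in ε. Four powers of decay against a
growth of order at most one leave the exponent -3. This is needed because the rate is claimed for
large ε too. -/
theorem IsKernel.exists_norm_mollSeq_le {f : Plane → ℝ} (h : IsKernel f) {s M : ℝ}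
    (hs : -1 ≤ s) (hM : 0 ≤ M) :
    ∃ D, 0 ≤ D ∧ ∀ z : (Fin 2 → ℤ) → ℂ, HsBound s z M → ∀ ε, 1 ≤ ε → ∀ k,
      ‖mollSeq f ε z k‖ ≤ D * wt k ^ (-3 : ℝ) := by
  obtain ⟨C, hC, hk⟩ := h.exists_norm_waveFT_le 4
  refine ⟨C * 2 * M, by positivity, fun z hz ε hε k => ?_⟩
  have h1 := hk k ε (by linarith)
  have h2 := hz.norm_le k
  have hw := wt_pos k
  have h3 : (ε ^ 4)⁻¹ ≤ 1 := inv_le_one_of_one_le₀ (one_le_pow₀ hε)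
  rw [mollSeq, norm_mul]
  calc _ ≤ (C * (1 + 1) * (wt k ^ 4)⁻¹) * (M * wt k ^ (-s)) := by
        gcongr
        exact h1.trans (by gcongr)
    _ = C * 2 * M * ((wt k ^ 4)⁻¹ * wt k ^ (-s)) := by ring
    _ ≤ _ := by
        gcongr
        rw [← Real.rpow_natCast, ← Real.rpow_neg hw.le, ← Real.rpow_add hw]
        exact Real.rpow_le_rpow_of_exponent_le (one_le_wt k) (by push_cast; linarith)

theorem IsKernel.exists_hsBound_conv_mollSeq {f : Plane → ℝ} (h : IsKernel f) {s M : ℝ}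
    (hs : -1 ≤ s) (hM : 0 ≤ M) :
    ∃ N, 0 ≤ N ∧ ∀ z z' : (Fin 2 → ℤ) → ℂ, HsBound s z M → HsBound s z' M → ∀ ε, 1 ≤ ε →
      HsBound 0 (conv (mollSeq f ε z) (starSeq (mollSeq f ε z'))) N := by
  obtain ⟨D, hD, key⟩ := h.exists_norm_mollSeq_le hs hM
  have hw0 := wtSum_nonneg 3
  have hD2 : 0 ≤ D ^ 2 * (2 ^ (3 : ℝ) * 2 * wtSum 3) := by positivity
  -- An `HsBound` includes that its constant is nonnegative; this is read off from the zero
  -- sequence.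
  refine ⟨_, (hsBound_of_norm_le (s := 0) (a := 3) (f := 0) hD2 (by norm_num) fun k => ?_).1,
    fun z z' hz hz' ε hε => hsBound_of_norm_le (s := 0) (a := 3) hD2 (by norm_num) fun k =>
      norm_conv_le_of_norm_le hD (by norm_num) (key z hz ε hε) (fun l => ?_) k⟩
  · have := wt_pos k
    simp only [Pi.zero_apply, norm_zero]
    positivity
  · have := key z' hz' ε hε (-l)
    rwa [wt_neg, ← norm_star] at this

/-- The coefficients of `c + γ z`. -/
noncomputable def affineSeq (c : Fin 3 → ℂ) (γ : Fin 3 → ℝ) (z : Fin 3 → (Fin 2 → ℤ) → ℂ)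
    (j : Fin 3) (k : Fin 2 → ℤ) : ℂ :=
  (Pi.single 0 (c j) : (Fin 2 → ℤ) → ℂ) k + (γ j : ℂ) * z j k

/-- In the expansion of (y + u) ∧ (y + u), the term y ∧ y is A, the mixed terms form `linOp` by
antisymmetry, and u ∧ u is `quadOp`. For k ≠ 0 the multiplier property makes all these convolutions
converge. -/
theorem unweight_fixedPoint {p : ℝ} (hp : 1 / 2 < p) (hp1 : p ≤ 1)
    {y : Fin 3 → (Fin 2 → ℤ) → ℂ} (hy : ∀ j, IsMultiplier p (y j)) (hys : ∀ j, WtSummable 0 (y j))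
    {A u : SeqL2Triple}
    (hA : ∀ j k, unweight p (A j) k = (dbarSymbol k)⁻¹ * wedge (y (j + 1)) (y (j + 2)) k)
    (hu : u = A + linOp p y u + quadOp p hp hp1 u u) (j : Fin 3) (k : Fin 2 → ℤ) :
    unweight p (u j) k = (dbarSymbol k)⁻¹ *
      wedge (fun l => y (j + 1) l + unweight p (u (j + 1)) l)
        (fun l => y (j + 2) l + unweight p (u (j + 2)) l) k := by
  have hm := fun j => isMultiplier_unweight hp hp1 (u j)
  have e : unweight p (u j) k = unweight p (A j) k + unweight p (linOp p y u j) k +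
      unweight p (quadOp p hp hp1 u u j) k := by
    conv_lhs => rw [hu]
    rw [Pi.add_apply, Pi.add_apply, unweight_add, unweight_add]
  rw [e, hA, linOp_apply, unweight_sub, quadOp_apply, unweight_wedgeOp (hy _),
    unweight_wedgeOp (hy _), unweight_wedgeOp (hm _)]
  by_cases hk : k = 0
  · simp [hk, dbarSymbol_zero]
  have w11 := (hys (j + 1)).wedgeSummable (hys (j + 2)) k
  have w12 := (hy (j + 1)).wedgeSummable (u (j + 2)) hk
  have w21 := ((hy (j + 2)).wedgeSummable (u (j + 1)) hk).symm
  have w22 := (hm (j + 1)).wedgeSummable (u (j + 2)) hk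
  rw [wedge_add_left (w11.symm.add_left w12.symm).symm (w21.symm.add_left w22.symm).symm,
    wedge_add_right w11 w12, wedge_add_right w21 w22, wedge_swap (y (j + 2))]
  ring

/-- A contraction at every scale with bounds uniform in ε, followed by the comparison of two scales.
The noise is bounded with exponents -3κ/8 and 1 - 5κ/8, while the equation is solved with -κ/2 and 1
- κ/2; the margin κ/8 buys the rate ε^{κ/8}. -/
theorem IsKernel.exists_solution {f : Plane → ℝ} (h : IsKernel f) {κ : ℝ} (hκ : 0 < κ)
    (hκ1 : κ < 1 / 2) {K : ℝ} (hK : 0 ≤ K) : ∃ C σ : ℝ, 0 ≤ C ∧ 0 < σ ∧ σ ≤ 1 ∧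
      ∀ z, NoiseBound f κ K z → ∀ (γ : Fin 3 → ℝ) (c : Fin 3 → ℂ), (∀ j, |γ j| ≤ σ) →
        (∀ j, ‖c j‖ ≤ 1 / 128) → ∃ (u : ℝ → SeqL2Triple) (v : SeqL2Triple),
          (∀ ε, 0 < ε → ∀ j k, unweight (1 - κ / 2) (u ε j) k = (dbarSymbol k)⁻¹ * wedge
            (fun l => affineSeq c γ (fun j => mollSeq f ε (z j)) (j + 1) l +
              unweight (1 - κ / 2) (u ε (j + 1)) l)
            (fun l => affineSeq c γ (fun j => mollSeq f ε (z j)) (j + 2) l +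
              unweight (1 - κ / 2) (u ε (j + 2)) l) k) ∧
          ∀ ε, 0 < ε → ‖u ε - v‖ ≤ C * ε ^ (κ / 8) := by
  set p := 1 - κ / 2 with hpdef
  have hp : 1 / 2 < p := by linarith
  have hp1 : p ≤ 1 := by linarith
  have hβ : 0 < κ / 8 := by linarith
  have hβ1 : κ / 8 ≤ 1 := by linarith
  obtain ⟨N₁, hN₁, hconv⟩ := h.exists_hsBound_conv_mollSeq (s := -(3 * κ / 8)) (by linarith) hK
  set Q := quadOp p hp hp1
  -- The admissible size of the forcing, chosen so that `‖Q‖ * α ≤ 1 / 16`.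
  set α := 1 / (16 * (‖Q‖ + 1)) with hα
  have hQ0 := norm_nonneg Q
  have hα0 : 0 < α := by positivity
  have hQα : ‖Q‖ * α ≤ 1 / 16 := by
    rw [hα, mul_one_div, div_le_div_iff₀ (by positivity) (by norm_num)]
    linarith
  set N := N₁ + K
  set B := 16 * K + 8 * N
  have hB : 0 ≤ B := by positivity
  -- The three entries give γ at most 1, multiplier norm at most 1/128 for the noise part of y, and
  -- forcing at most α.
  set σ := min 1 (min (1 / (128 * (K + 1))) (α / (B + 1))) with hσdef
  have hσ0 : 0 < σ := by positivity
  have hσ1 : σ ≤ 1 := min_le_left _ _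
  have hσK : σ * K ≤ 1 / 128 := by
    have : σ ≤ 1 / (128 * (K + 1)) := (min_le_right _ _).trans (min_le_left _ _)
    calc σ * K ≤ 1 / (128 * (K + 1)) * (K + 1) := by gcongr; linarith
      _ = _ := by field_simp
  have hσB : σ * B ≤ α := by
    have : σ ≤ α / (B + 1) := (min_le_right _ _).trans (min_le_right _ _)
    calc σ * B ≤ α / (B + 1) * (B + 1) := by gcongr; linarith
      _ = _ := by field_simp
  -- The first summand comes from the difference of the forcings, the second from that of the linear
  -- operators. The last covers ε ≥ 1, where two solutions in the ball of radius 2α differ by at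
  -- most 4α.
  set C := 2 * (16 * (4 * K) + 8 * K) + 4 * α * (16 * (8 * K)) + 4 * α
  refine ⟨C, σ, by positivity, hσ0, hσ1, fun z hz γ c hγ hc => ?_⟩
  have hc1 : ∀ j, ‖c j‖ ≤ 1 := fun j => (hc j).trans (by norm_num)
  set zε : ℝ → Fin 3 → (Fin 2 → ℤ) → ℂ := fun ε j => mollSeq f ε (z j)
  set X : ℝ → Fin 3 → (Fin 2 → ℤ) → ℂ := fun ε j =>
    conv (zε ε (j + 1)) (starSeq (zε ε (j + 2)))
  set y : ℝ → Fin 3 → (Fin 2 → ℤ) → ℂ := fun ε => affineSeq c γ (zε ε)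
  have hpm : p - 1 = -(κ / 2) := by rw [hpdef]; ring
  have hzs : ∀ ε, 0 < ε → ∀ j N, WtSummable N (zε ε j) := fun ε hε j N =>
    h.wtSummable_mollSeq (hz.hsBound j) hε N
  have hys : ∀ ε, 0 < ε → ∀ j, WtSummable 0 (y ε j) := fun ε hε j =>
    (wtSummable_single 0 (c j)).add ((hzs ε hε j 0).const_mul _)
  have hzH : ∀ ε j, HsBound (p - 1) (zε ε j) K := fun ε j =>
    h.hsBound_mollSeq ((hz.hsBound j).mono_exponent (by linarith)) ε
  have hzO : ∀ ε j, OpBound (zε ε j) p (1 - p) K := fun ε j =>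
    h.opBound_mollSeq ((hz.opBound j).mono_exponents hK (by linarith) (by linarith)) ε
  have hX1 : ∀ ε, 1 ≤ ε → ∀ j, HsBound (p - 1) (X ε j) N₁ := fun ε hε j =>
    (hconv _ _ (hz.hsBound _) (hz.hsBound _) ε hε).mono_exponent (by linarith)
  have hXsub : ∀ ε ε', 0 < ε' → ε' ≤ ε → ε ≤ 1 → ∀ j,
      HsBound (p - 1) (fun k => X ε j k - X ε' j k) (K * ε ^ (κ / 8)) := by
    intro ε ε' hε' hle hε j
    rw [hpm]
    exact hz.conv_sub j ε ε' hε' hle hε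
  -- The noise hypothesis only controls differences of products at scales up to 1; the product at
  -- scale 1, bounded by smoothing, anchors them.
  have hX : ∀ ε, 0 < ε → ∀ j, HsBound (p - 1) (X ε j) N := by
    intro ε hε j
    rcases le_total 1 ε with h1 | h1
    · exact (hX1 ε h1 j).mono (by simp only [N]; linarith)
    · have := (hX1 1 le_rfl j).sub (hXsub 1 ε hε h1 le_rfl j)
      simpa [N] using this
  -- 1/128 from the constants and 1/128 from the noise. The factor 16 in `norm_linOp_le` then gives
  -- the required 1/4.
  have hyO : ∀ ε j, OpBound (y ε j) p (1 - p) (1 / 64) := fun ε j => by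
    refine ((opBound_single (by linarith) (by linarith) (c j)).add
      ((hzO ε j).const_mul (γ j : ℂ))).mono ?_
    rw [Complex.norm_real, Real.norm_eq_abs]
    nlinarith [hc j, mul_le_mul_of_nonneg_right (hγ j) hK]
  have hym : ∀ ε j, IsMultiplier p (y ε j) := fun ε j => ⟨_, by norm_num, hyO ε j⟩
  have hL : ∀ ε, ‖linOp p (y ε)‖ ≤ 1 / 4 := fun ε =>
    (norm_linOp_le (by norm_num) (hyO ε)).trans (by norm_num)
  have hLsub : ∀ ε ε', 0 < ε' → ε' ≤ ε →
      ‖linOp p (y ε) - linOp p (y ε')‖ ≤ 16 * (8 * ε ^ (κ / 8) * K) := by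
    intro ε ε' hε' hle
    have hε0 : 0 ≤ ε := hε'.le.trans hle
    refine norm_linOp_sub_le (by positivity) (hym ε) (hym ε') fun j => ?_
    have h1 := (h.opBound_mollSeq_sub hK hβ.le hβ1 (hz.opBound j) hε'.le hle).const_mul (γ j : ℂ)
    have e1 : 1 - 5 * κ / 8 + κ / 8 = p := by rw [hpdef]; ring
    have e2 : 3 * κ / 8 + κ / 8 = 1 - p := by rw [hpdef]; ring
    rw [e1, e2] at h1
    have e3 : (fun k => y ε j k - y ε' j k) =
        fun k => (γ j : ℂ) * (mollSeq f ε (z j) k - mollSeq f ε' (z j) k) := by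
      funext k
      simp only [y, affineSeq, zε]
      ring
    rw [e3]
    refine h1.mono ?_
    rw [Complex.norm_real, Real.norm_eq_abs]
    exact mul_le_of_le_one_left (by positivity) ((hγ j).trans hσ1)
  set F : ℝ → Fin 3 → (Fin 2 → ℤ) → ℂ := fun ε j =>
    forcing (c (j + 1)) (c (j + 2)) (γ (j + 1)) (γ (j + 2)) (zε ε (j + 1)) (zε ε (j + 2)) (X ε j)
  have hF : ∀ ε, 0 < ε → ∀ j, HsBound p (F ε j) (σ * B) := fun ε hε j =>
    hsBound_forcing hσ1 (hc1 _) (hc1 _) (hγ _) (hγ _) (hzH ε _) (hzH ε _) (hX ε hε j)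
  have hex : ∀ ε, 0 < ε → ∃ A u : SeqL2Triple, (∀ j, unweight p (A j) = F ε j) ∧ ‖u‖ ≤ 2 * α ∧
      u = A + linOp p (y ε) u + Q u u := by
    intro ε hε
    have hA : ∀ j, unweight p ((hF ε hε j).weight) = F ε j := fun j => HsBound.unweight_weight _
    have hAn : ‖(fun j => (hF ε hε j).weight : SeqL2Triple)‖ ≤ α := by
      refine (pi_norm_le_iff_of_nonneg hα0.le).mpr fun j => ?_
      refine (norm_le_of_hsBound_unweight (p := p) ?_).trans hσB
      rw [hA]
      exact hF ε hε j
    obtain ⟨u, hu, hfix⟩ := exists_quadratic_fixedPoint Q (linOp p (y ε))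
      (fun j => (hF ε hε j).weight : SeqL2Triple) hAn (hL ε) hQα
    exact ⟨_, u, hA, hu, hfix⟩
  choose! A u hA hu hfix using hex
  have hrate : ∀ ε ε', 0 < ε' → ε' ≤ ε → ‖u ε - u ε'‖ ≤ C * ε ^ (κ / 8) := by
    intro ε ε' hε' hle
    have hε : 0 < ε := hε'.trans_le hle
    have hpow : 0 ≤ ε ^ (κ / 8) := by positivity
    rcases le_total ε 1 with h1 | h1
    · have hAd : ‖A ε - A ε'‖ ≤ 16 * (4 * ε ^ (κ / 8) * K) + 8 * (K * ε ^ (κ / 8)) := by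
        refine (pi_norm_le_iff_of_nonneg (by positivity)).mpr fun j => ?_
        refine norm_le_of_hsBound_unweight (p := p) ?_
        have e : unweight p ((A ε - A ε') j) = fun k => F ε j k - F ε' j k := by
          funext k
          rw [Pi.sub_apply, unweight_sub, hA ε hε, hA ε' hε']
        rw [e]
        simp only [F, forcing_sub]
        have hd : ∀ j, HsBound (p - 1) (fun l => zε ε j l - zε ε' j l) (4 * ε ^ (κ / 8) * K) := by
          intro j
          refine h.hsBound_mollSeq_sub hβ.le hβ1 ?_ hε'.le hle
          have : p - 1 + κ / 8 = -(3 * κ / 8) := by rw [hpdef]; ring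
          rw [this]
          exact hz.hsBound j
        refine (hsBound_forcing hσ1 (hc1 _) (hc1 _) (hγ _) (hγ _) (hd _) (hd _)
          (hXsub ε ε' hε' hle h1 j)).mono ?_
        exact mul_le_of_le_one_left (by positivity) hσ1
      have h2 := norm_sub_le_of_quadratic_fixedPoint Q _ _ _ _ (hL ε) hQα (hu ε hε) (hu ε' hε')
        (hfix ε hε) (hfix ε' hε')
      have h3 := hLsub ε ε' hε' hle
      refine h2.trans ?_
      calc _ ≤ 2 * (16 * (4 * ε ^ (κ / 8) * K) + 8 * (K * ε ^ (κ / 8))) +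
            4 * α * (16 * (8 * ε ^ (κ / 8) * K)) := by gcongr
        _ ≤ _ := by
          simp only [C]
          nlinarith [mul_nonneg hα0.le hpow]
    · have h2 : ‖u ε - u ε'‖ ≤ 4 * α :=
        (norm_sub_le _ _).trans (by linarith [hu ε hε, hu ε' hε'])
      have h3 : 1 ≤ ε ^ (κ / 8) := Real.one_le_rpow h1 hβ.le
      have h4 : 4 * α ≤ C := by
        simp only [C]
        have : 0 ≤ 2 * (16 * (4 * K) + 8 * K) + 4 * α * (16 * (8 * K)) := by positivity
        linarith
      calc _ ≤ 4 * α * 1 := by linarith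
        _ ≤ C * ε ^ (κ / 8) := by gcongr
  obtain ⟨v, hv⟩ := exists_limit_of_rate hβ hrate
  refine ⟨u, v, fun ε hε j k => ?_, hv⟩
  refine unweight_fixedPoint hp hp1 (hym ε) (hys ε hε) (fun j k => ?_) (hfix ε hε) j k
  rw [hA ε hε]
  exact (forcing_eq (hzs ε hε _ 0) (hzs ε hε _ 0) k).symm

/-! ## Distributions given by Fourier coefficients -/

theorem exists_add_latticePt_mem_cell (x : Plane) : ∃ n, x + latticePt n ∈ cell := by
  have hp : 0 < 2 * Real.pi := by positivity
  refine ⟨fun i => -toIocDiv hp (-Real.pi) (x i), fun i => ?_⟩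
  have h := toIocMod_mem_Ioc hp (-Real.pi) (x i)
  have e : toIocMod hp (-Real.pi) (x i) =
      (x + latticePt fun i => -toIocDiv hp (-Real.pi) (x i)) i := by
    simp only [toIocMod, latticePt, PiLp.add_apply, zsmul_eq_mul, Int.cast_neg]
    ring
  rw [e] at h
  refine ⟨h.1, h.2.trans (by linarith)⟩

theorem exists_norm_le_of_periodic {E : Type*} [NormedAddCommGroup E] {F : Plane → E}
    (hF : Continuous F) (hper : ∀ x n, F (x + latticePt n) = F x) : ∃ B, ∀ x, ‖F x‖ ≤ B := by
  obtain ⟨B, hB⟩ := isBounded_cell.isCompact_closure.exists_bound_of_continuousOn hF.continuousOn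
  refine ⟨B, fun x => ?_⟩
  obtain ⟨n, hn⟩ := exists_add_latticePt_mem_cell x
  rw [← hper x n]
  exact hB _ (subset_closure hn)

theorem exists_norm_iteratedFDeriv_le (φ : TorusTest) (N : ℕ) :
    ∃ B, ∀ m ≤ N, ∀ x, ‖iteratedFDeriv ℝ m (φ : Plane → ℂ) x‖ ≤ B := by
  have h : ∀ m : ℕ, ∃ B, ∀ x, ‖iteratedFDeriv ℝ m (φ : Plane → ℂ) x‖ ≤ B := fun m => by
    refine exists_norm_le_of_periodic (φ.2.1.continuous_iteratedFDeriv (m := m) ?_) fun x n => ?_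
    · exact_mod_cast le_top
    · rw [← iteratedFDeriv_comp_add_right]
      congr 1
      exact funext fun y => φ.2.2 y n
  choose B hB using h
  refine ⟨∑ m ∈ Finset.range (N + 1), |B m|, fun m hm x => ?_⟩
  refine ((hB m x).trans (le_abs_self _)).trans ?_
  exact Finset.single_le_sum (f := fun m => |B m|) (fun _ _ => abs_nonneg _)
    (Finset.mem_range.mpr (by omega))

/-- The coefficients `a` define a distribution of order at most two. -/
def DistSummable (a : (Fin 2 → ℤ) → ℂ) : Prop := Summable fun k => wt k ^ (-2 : ℝ) * ‖a k‖

theorem DistSummable.add {a b : (Fin 2 → ℤ) → ℂ} (ha : DistSummable a) (hb : DistSummable b) :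
    DistSummable fun k => a k + b k := by
  refine Summable.of_nonneg_of_le (fun k => ?_) (fun k => ?_) (Summable.add ha hb)
  · exact mul_nonneg (Real.rpow_nonneg (wt_pos k).le _) (norm_nonneg _)
  · rw [← mul_add]
    exact mul_le_mul_of_nonneg_left (norm_add_le _ _) (Real.rpow_nonneg (wt_pos k).le _)

theorem DistSummable.const_mul {a : (Fin 2 → ℤ) → ℂ} (ha : DistSummable a) (c : ℂ) :
    DistSummable fun k => c * a k := by
  refine (Summable.mul_left ‖c‖ ha).congr fun k => ?_
  rw [norm_mul]; ring

theorem DistSummable.sub {a b : (Fin 2 → ℤ) → ℂ} (ha : DistSummable a) (hb : DistSummable b) :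
    DistSummable fun k => a k - b k := by
  refine (ha.add (hb.const_mul (-1))).congr fun k => ?_
  congr 2; ring

theorem HsBound.summable_wt_mul {s q M : ℝ} {a : (Fin 2 → ℤ) → ℂ} (h : HsBound s a M)
    (hq : 2 < 2 * (s + q)) : Summable fun k => wt k ^ (-q) * ‖a k‖ := by
  refine Summable.of_nonneg_of_le (fun k => ?_) (fun k => ?_)
    (h.summable.add (summable_wt_rpow hq))
  · exact mul_nonneg (Real.rpow_nonneg (wt_pos k).le _) (norm_nonneg _)
  · have hw := wt_pos k
    have e1 : wt k ^ (-(2 * (s + q))) = (wt k ^ (-(s + q))) ^ 2 := by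
      rw [← Real.rpow_natCast, ← Real.rpow_mul hw.le]; congr 1; push_cast; ring
    have e2 : wt k ^ (-q) = wt k ^ s * wt k ^ (-(s + q)) := by
      rw [← Real.rpow_add hw]; congr 1; ring
    rw [e1, e2]
    have h1 : 0 ≤ wt k ^ s * ‖a k‖ := by positivity
    have h2 : 0 ≤ wt k ^ (-(s + q)) := by positivity
    nlinarith [sq_nonneg (wt k ^ s * ‖a k‖ - wt k ^ (-(s + q)))]

theorem HsBound.tsum_wt_mul_le {s q M : ℝ} {a : (Fin 2 → ℤ) → ℂ} (h : HsBound s a M)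
    (hq : 2 < 2 * (s + q)) :
    ∑' k, wt k ^ (-q) * ‖a k‖ ≤ √(wtSum (2 * (s + q))) * M := by
  refine (h.summable_wt_mul hq).tsum_le_of_sum_le fun S => ?_
  have e : ∀ k, wt k ^ (-q) * ‖a k‖ = wt k ^ (-(s + q)) * (wt k ^ s * ‖a k‖) := fun k => by
    rw [← mul_assoc, ← Real.rpow_add (wt_pos k)]; congr 2; ring
  simp only [e]
  refine (Real.sum_mul_le_sqrt_mul_sqrt _ _ _).trans ?_
  gcongr
  · have e2 : ∀ k : Fin 2 → ℤ, (wt k ^ (-(s + q))) ^ 2 = wt k ^ (-(2 * (s + q))) := fun k => by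
      rw [← Real.rpow_natCast, ← Real.rpow_mul (wt_pos k).le]; congr 1; push_cast; ring
    simp only [e2]
    exact (summable_wt_rpow hq).sum_le_tsum S fun k _ => Real.rpow_nonneg (wt_pos k).le _
  · exact (Real.sqrt_le_sqrt (h.2 S)).trans_eq (Real.sqrt_sq h.1)

theorem HsBound.distSummable {s M : ℝ} {a : (Fin 2 → ℤ) → ℂ} (h : HsBound s a M) (hs : -1 < s) :
    DistSummable a := h.summable_wt_mul (by linarith)

theorem WtSummable.distSummable {a : (Fin 2 → ℤ) → ℂ} (h : WtSummable 0 a) : DistSummable a := by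
  obtain ⟨M, hM⟩ := h.exists_hsBound (s := 0) (by simp)
  exact hM.distSummable (by norm_num)

theorem exists_norm_torusFT_le (φ : TorusTest) :
    ∃ B, ∀ k, ‖torusFT φ k‖ ≤ B * wt k ^ (-2 : ℝ) := by
  obtain ⟨B, hB⟩ := exists_norm_iteratedFDeriv_le φ 2
  exact ⟨_, norm_torusFT_mul_wt_sq_le φ hB⟩

theorem DistSummable.summable {a : (Fin 2 → ℤ) → ℂ} (h : DistSummable a) (φ : TorusTest) :
    Summable fun k => a k * torusFT φ k := by
  obtain ⟨B, hB⟩ := exists_norm_torusFT_le φ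
  refine Summable.of_norm_bounded (Summable.mul_left B h) fun k => ?_
  rw [norm_mul]
  calc _ ≤ ‖a k‖ * (B * wt k ^ (-2 : ℝ)) := by gcongr; exact hB k
    _ = _ := by ring

theorem torusFT_add (φ ψ : TorusTest) (k : Fin 2 → ℤ) :
    torusFT (φ + ψ) k = torusFT φ k + torusFT ψ k := by
  rw [torusFT, torusFT, torusFT, ← integral_add]
  · simp [mul_add]
  · exact ((continuous_character k).mul φ.2.1.continuous).integrableOn_cell
  · exact ((continuous_character k).mul ψ.2.1.continuous).integrableOn_cell

theorem torusFT_smul (c : ℂ) (φ : TorusTest) (k : Fin 2 → ℤ) :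
    torusFT (c • φ) k = c * torusFT φ k := by
  rw [torusFT, torusFT, ← integral_const_mul]
  simp [mul_left_comm]

/-- The distribution with Fourier coefficients `a`. -/
noncomputable def seqDistribution (a : (Fin 2 → ℤ) → ℂ) (h : DistSummable a) : TorusDistribution :=
  ⟨{ toFun := fun φ => ∑' k, a k * torusFT φ k
     map_add' := by
      intro φ ψ
      simp only [torusFT_add, mul_add]
      exact (h.summable φ).tsum_add (h.summable ψ)
     map_smul' := by
      intro c φ
      simp only [torusFT_smul, RingHom.id_apply, smul_eq_mul, ← tsum_mul_left]
      exact tsum_congr fun k => by ring },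
   by
    refine ⟨2, 16 * volume.real cell * ∑' k, wt k ^ (-2 : ℝ) * ‖a k‖, fun φ B hB => ?_⟩
    have h1 : ∀ k, ‖a k * torusFT φ k‖ ≤
        16 * volume.real cell * B * (wt k ^ (-2 : ℝ) * ‖a k‖) := fun k => by
      rw [norm_mul]
      calc _ ≤ ‖a k‖ * (16 * volume.real cell * B * wt k ^ (-2 : ℝ)) := by
            gcongr; exact norm_torusFT_mul_wt_sq_le φ hB k
        _ = _ := by ring
    have h2 := tsum_of_norm_bounded (Summable.hasSum (Summable.mul_left
      (16 * volume.real cell * B) h)) h1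
    rw [tsum_mul_left] at h2
    refine h2.trans (le_of_eq ?_)
    ring⟩

theorem pairing_sub (S T : TorusDistribution) (φ : TorusTest) :
    pairing (S - T) φ = pairing S φ - pairing T φ := rfl

theorem pairing_trigTest_sub {a b : (Fin 2 → ℤ) → ℂ} (ha : ∀ N, WtSummable N a)
    (hb : DistSummable b) (φ : TorusTest) :
    pairing (toDistribution (trigTest a ha) - seqDistribution b hb) φ =
      ∑' k, (a k - b k) * torusFT φ k := by
  rw [pairing_sub, pairing_toDistribution_trigTest]
  change _ - ∑' k, b k * torusFT φ k = _
  rw [← ((ha 0).distSummable.summable φ).tsum_sub (hb.summable φ)]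
  exact tsum_congr fun k => by ring

theorem torusFT_rescaled (φ : 𝓓(unitBall, ℝ)) {l : ℝ} (hl : 0 < l) (y : Plane) (k : Fin 2 → ℤ) :
    torusFT (rescaled φ l hl y) k = character k y * waveFT φ k l :=
  torusFT_periodize_dilate k φ φ.contDiff φ.hasCompactSupport l hl y

/-! ## Negative Hölder norms -/

theorem holderNormReal_le {α D : ℝ} {g : TorusTest → ℝ}
    (h : ∀ φ ∈ unitTests ⌊-α + 1⌋₊, ∀ y l (hl : 0 < l), l ≤ 1 →
      |g (rescaled φ l hl y)| ≤ D * l ^ α) : holderNormReal α g ≤ ENNReal.ofReal D := by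
  refine iSup₂_le fun φ hφ => iSup₂_le fun y l => iSup₂_le fun hl hl1 => ?_
  refine ENNReal.ofReal_le_ofReal ?_
  rw [div_le_iff₀ (by positivity)]
  exact h φ hφ y l hl hl1

/-- Six real norms, each at most D, give √6 D ≤ 3 D. -/
theorem holderNorm_le {α D : ℝ} (hD : 0 ≤ D) {T : Fin 3 → TorusDistribution}
    (h : ∀ k, ∀ φ ∈ unitTests ⌊-α + 1⌋₊, ∀ y l (hl : 0 < l), l ≤ 1 →
      ‖pairing (T k) (rescaled φ l hl y)‖ ≤ D * l ^ α) :
    holderNorm α T ≤ ENNReal.ofReal (3 * D) := by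
  have h1 : ∀ k, holderNormReal α (fun φ => (pairing (T k) φ).re) ≤ ENNReal.ofReal D := fun k =>
    holderNormReal_le fun φ hφ y l hl hl1 =>
      (Complex.abs_re_le_norm _).trans (h k φ hφ y l hl hl1)
  have h2 : ∀ k, holderNormReal α (fun φ => (pairing (T k) φ).im) ≤ ENNReal.ofReal D := fun k =>
    holderNormReal_le fun φ hφ y l hl hl1 =>
      (Complex.abs_im_le_norm _).trans (h k φ hφ y l hl hl1)
  have e : ENNReal.ofReal (3 * D) = (ENNReal.ofReal (3 * D) ^ 2) ^ (1 / 2 : ℝ) := by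
    rw [← ENNReal.rpow_natCast, ← ENNReal.rpow_mul]
    norm_num
  rw [e, holderNorm]
  refine ENNReal.rpow_le_rpow ?_ (by norm_num)
  calc _ ≤ ∑ _k : Fin 3, (ENNReal.ofReal D ^ 2 + ENNReal.ofReal D ^ 2) := by
        gcongr with k
        · exact h1 k
        · exact h2 k
    _ = ENNReal.ofReal (6 * D ^ 2) := by
        rw [← ENNReal.ofReal_pow hD, ← ENNReal.ofReal_add (by positivity) (by positivity),
          Finset.sum_const, Finset.card_univ, Fintype.card_fin, ← ENNReal.ofReal_nsmul]
        congr 1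
        simp
        ring
    _ ≤ _ := by
        rw [← ENNReal.ofReal_pow (by positivity)]
        refine ENNReal.ofReal_le_ofReal ?_
        nlinarith [sq_nonneg D]

/-- The area of the unit disc. -/
noncomputable def discArea : ℝ := volume.real (Metric.ball (0 : Plane) 1)

theorem discArea_nonneg : 0 ≤ discArea := measureReal_nonneg

theorem norm_waveFT_le_discArea {g : Plane → ℝ} (hg : ∀ x, |g x| ≤ 1)
    (hs : ∀ x, x ∉ Metric.ball (0 : Plane) 1 → g x = 0) (k : Fin 2 → ℤ) (t : ℝ) :
    ‖waveFT g k t‖ ≤ discArea := by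
  have e : waveFT g k t = ∫ w in Metric.ball (0 : Plane) 1, (g w : ℂ) * character k (t • w) := by
    rw [waveFT, setIntegral_eq_integral_of_forall_compl_eq_zero]
    intro x hx
    rw [hs x hx]; simp
  rw [e, discArea, ← one_mul (volume.real _)]
  refine norm_setIntegral_le_of_norm_le_const measure_ball_lt_top fun x _ => ?_
  rw [norm_mul, norm_character, mul_one, Complex.norm_real]
  exact hg x

theorem eq_zero_of_notMem_unitBall (φ : 𝓓(unitBall, ℝ)) {x : Plane}
    (hx : x ∉ Metric.ball (0 : Plane) 1) : φ x = 0 :=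
  image_eq_zero_of_notMem_tsupport fun h => hx (φ.tsupport_subset h)

theorem abs_le_one_of_mem_unitTests {φ : 𝓓(unitBall, ℝ)} (hφ : φ ∈ unitTests 1) (x : Plane) :
    |φ x| ≤ 1 := by
  simpa using hφ 0 (by norm_num) 0 x

theorem abs_partialDeriv_le_one_of_mem_unitTests {φ : 𝓓(unitBall, ℝ)} (hφ : φ ∈ unitTests 1)
    (i : Fin 2) (x : Plane) : |partialDeriv i φ x| ≤ 1 := by
  have := hφ 1 le_rfl (fun _ => i) x
  simpa [iteratedFDeriv_one_apply, partialDeriv] using this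

theorem partialDeriv_eq_zero_of_notMem_unitBall (φ : 𝓓(unitBall, ℝ)) (i : Fin 2) {x : Plane}
    (hx : x ∉ Metric.ball (0 : Plane) 1) : partialDeriv i φ x = 0 := by
  have h1 : fderiv ℝ φ x = 0 := by
    refine image_eq_zero_of_notMem_tsupport (f := fderiv ℝ φ) fun h => hx ?_
    exact φ.tsupport_subset (tsupport_fderiv_subset ℝ h)
  rw [partialDeriv, h1]
  simp

theorem norm_waveFT_le_of_mem_unitTests {φ : 𝓓(unitBall, ℝ)} (hφ : φ ∈ unitTests 1)
    (k : Fin 2 → ℤ) (t : ℝ) : ‖waveFT φ k t‖ ≤ discArea := by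
  exact norm_waveFT_le_discArea (abs_le_one_of_mem_unitTests hφ)
    (fun x hx => eq_zero_of_notMem_unitBall φ hx) k t

theorem mul_norm_waveFT_le_of_mem_unitTests {φ : 𝓓(unitBall, ℝ)} (hφ : φ ∈ unitTests 1)
    (k : Fin 2 → ℤ) {t : ℝ} (ht : 0 ≤ t) : t * ‖k‖ * ‖waveFT φ k t‖ ≤ discArea := by
  refine norm_mul_waveFT_le φ.contDiff φ.hasCompactSupport k ht fun i => ?_
  exact norm_waveFT_le_discArea (abs_partialDeriv_le_one_of_mem_unitTests hφ i)
    (fun x hx => partialDeriv_eq_zero_of_notMem_unitBall φ i hx) k t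

/-- Interpolation between the sup bound on φ and one integration by parts; `unitTests 1` controls no
further derivatives. The factor 2 comes from `wt k = 1 + ‖k‖` together with l ≤ 1. -/
theorem norm_waveFT_le_rpow {φ : 𝓓(unitBall, ℝ)} (hφ : φ ∈ unitTests 1) {κ : ℝ} (hκ : 0 ≤ κ)
    (hκ1 : κ ≤ 1) (k : Fin 2 → ℤ) {l : ℝ} (hl : 0 < l) (hl1 : l ≤ 1) :
    ‖waveFT φ k l‖ ≤ 2 * discArea * l ^ (-κ) * wt k ^ (-κ) := by
  have hV := discArea_nonneg
  have hw := wt_pos k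
  have h1 := norm_waveFT_le_of_mem_unitTests hφ k l
  have h2 := mul_norm_waveFT_le_of_mem_unitTests hφ k hl.le
  have h3 : ‖waveFT φ k l‖ * (l * wt k) ≤ 2 * discArea := by
    have : wt k = 1 + ‖k‖ := rfl
    rw [this]
    nlinarith [norm_nonneg (waveFT φ k l)]
  rw [mul_assoc, ← Real.mul_rpow hl.le hw.le, Real.rpow_neg (by positivity), ← div_eq_mul_inv,
    le_div_iff₀ (by positivity)]
  rcases le_total (l * wt k) 1 with h | h
  · have : (l * wt k) ^ κ ≤ 1 := Real.rpow_le_one (by positivity) h hκ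
    nlinarith [norm_nonneg (waveFT φ k l)]
  · have : (l * wt k) ^ κ ≤ l * wt k := by
      calc _ ≤ (l * wt k) ^ (1 : ℝ) := Real.rpow_le_rpow_of_exponent_le h hκ1
        _ = _ := Real.rpow_one _
    exact (mul_le_mul_of_nonneg_left this (norm_nonneg _)).trans h3

/-- The distribution with coefficients `a`, tested with rescaled unit test functions, is bounded by
`D l^(-κ)`. -/
def PairBound (κ : ℝ) (a : (Fin 2 → ℤ) → ℂ) (D : ℝ) : Prop :=
  ∀ φ ∈ unitTests 1, ∀ (y : Plane) (l : ℝ), 0 < l → l ≤ 1 →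
    ‖∑' k, a k * (character k y * waveFT φ k l)‖ ≤ D * l ^ (-κ)

theorem PairBound.mono {κ D D' : ℝ} {a : (Fin 2 → ℤ) → ℂ} (h : PairBound κ a D) (hD : D ≤ D') :
    PairBound κ a D' := fun φ hφ y l hl hl1 =>
  (h φ hφ y l hl hl1).trans (mul_le_mul_of_nonneg_right hD (Real.rpow_nonneg hl.le _))

theorem PairBound.const_mul {κ D : ℝ} {a : (Fin 2 → ℤ) → ℂ} (h : PairBound κ a D) (c : ℂ) :
    PairBound κ (fun k => c * a k) (‖c‖ * D) := by
  intro φ hφ y l hl hl1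
  simp only [mul_assoc c, tsum_mul_left]
  rw [norm_mul, mul_assoc]
  exact mul_le_mul_of_nonneg_left (h φ hφ y l hl hl1) (norm_nonneg _)

theorem PairBound.add {κ D D' : ℝ} {a b : (Fin 2 → ℤ) → ℂ} (h : PairBound κ a D)
    (h' : PairBound κ b D') (ha : DistSummable a) (hb : DistSummable b) :
    PairBound κ (fun k => a k + b k) (D + D') := by
  intro φ hφ y l hl hl1
  have s1 := ha.summable (rescaled φ l hl y)
  have s2 := hb.summable (rescaled φ l hl y)
  simp only [torusFT_rescaled] at s1 s2
  simp only [add_mul]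
  rw [s1.tsum_add s2]
  exact (norm_add_le _ _).trans (add_le_add (h φ hφ y l hl hl1) (h' φ hφ y l hl hl1))

/-- The embedding of H^s in C^{-κ}: by Cauchy–Schwarz the coefficients are summable against `wt k ^
(-κ)`. With s = 1 - κ/2 it applies to the remainder u, but the exponent -3κ/8 of z is too low, so
`RoughNoise` has a separate field for the noise. -/
theorem HsBound.pairBound {κ s M : ℝ} (hκ : 0 ≤ κ) (hκ1 : κ ≤ 1) (hs : 1 < s + κ)
    {a : (Fin 2 → ℤ) → ℂ} (h : HsBound s a M) :
    PairBound κ a (2 * discArea * √(wtSum (2 * (s + κ))) * M) := by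
  intro φ hφ y l hl hl1
  have h1 := h.summable_wt_mul (q := κ) (by linarith)
  have h2 := h.tsum_wt_mul_le (q := κ) (by linarith)
  have hV := discArea_nonneg
  have hle : ∀ k, ‖a k * (character k y * waveFT φ k l)‖ ≤
      2 * discArea * l ^ (-κ) * (wt k ^ (-κ) * ‖a k‖) := fun k => by
    rw [norm_mul, norm_mul, norm_character, one_mul]
    calc _ ≤ ‖a k‖ * (2 * discArea * l ^ (-κ) * wt k ^ (-κ)) := by
          gcongr; exact norm_waveFT_le_rpow hφ hκ hκ1 k hl hl1
      _ = _ := by ring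
  refine (tsum_of_norm_bounded (h1.mul_left _).hasSum hle).trans ?_
  rw [tsum_mul_left]
  calc _ ≤ 2 * discArea * l ^ (-κ) * (√(wtSum (2 * (s + κ))) * M) := by gcongr
    _ = _ := by ring

/-! ## Solutions driven by rough noise -/

/-- The coefficients of `∂_{z̄}⁻¹ (i ξ)`. -/
noncomputable def dbarInv (ξ : (Fin 2 → ℤ) → ℂ) (k : Fin 2 → ℤ) : ℂ :=
  (dbarSymbol k)⁻¹ * (Complex.I * ξ k)

theorem mollSeq_dbarInv (f : Plane → ℝ) (ε : ℝ) (ξ : (Fin 2 → ℤ) → ℂ) :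
    mollSeq f ε (dbarInv ξ) = dbarInv (mollSeq f ε ξ) := by
  funext k
  simp only [mollSeq, dbarInv]
  ring

/-- The bounds on the Fourier coefficients of the noise on which the construction relies. -/
structure RoughNoise (f : Plane → ℝ) (κ K : ℝ) (ξ : Fin 3 → (Fin 2 → ℤ) → ℂ) : Prop where
  hermitian : ∀ j k, ξ j (-k) = star (ξ j k)
  zero_le : ∀ j, ‖ξ j 0‖ ≤ K
  zero_two : ξ 2 0 = 0
  exists_hsBound : ∀ j, ∃ s M, HsBound s (ξ j) M
  noiseBound : NoiseBound f κ K fun j => dbarInv (ξ j)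
  pairBound : ∀ j ε, 0 < ε → ε ≤ 1 →
    PairBound κ (fun k => mollSeq f ε (dbarInv (ξ j)) k - dbarInv (ξ j) k) (K * ε ^ (κ / 8))

/-- The means of the solution. -/
noncomputable def meanVec (γ : Fin 3 → ℝ) (a : Fin 3 → ℝ) : Fin 3 → ℂ :=
  ![Complex.I * (64 * γ 1 * a 1 : ℝ), Complex.I * (-(64 * γ 0 * a 0) : ℝ), (1 / 128 : ℝ)]

/-- With the real third mean 1/128 the first two equations are linear in the imaginary parts of the
other two means, whence the factor 64 = 128 / 2. In the third equation both products of imaginary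
numbers are real and cancel, and a 2 = 0. -/
theorem meanVec_eq (γ a : Fin 3 → ℝ) (ha : a 2 = 0) (j : Fin 3) :
    meanVec γ a (j + 1) * star (meanVec γ a (j + 2)) -
      star (meanVec γ a (j + 1)) * meanVec γ a (j + 2) + Complex.I * γ j * a j = 0 := by
  have e1 : (0 : Fin 3) + 1 = 1 := rfl
  have e2 : (0 : Fin 3) + 2 = 2 := rfl
  have e3 : (1 : Fin 3) + 1 = 2 := rfl
  have e4 : (1 : Fin 3) + 2 = 0 := rfl
  have e5 : (2 : Fin 3) + 1 = 0 := rfl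
  have e6 : (2 : Fin 3) + 2 = 1 := rfl
  fin_cases j <;> simp only [Fin.zero_eta, Fin.mk_one, Fin.reduceFinMk, e1, e2, e3, e4, e5, e6] <;>
    simp [meanVec, ha] <;> ring

theorem norm_meanVec_le {γ a : Fin 3 → ℝ} {σ K : ℝ} (hγ : ∀ j, |γ j| ≤ σ) (ha : ∀ j, |a j| ≤ K)
    (h : σ * K ≤ 1 / 8192) (j : Fin 3) : ‖meanVec γ a j‖ ≤ 1 / 128 := by
  have h1 : ∀ j, |64 * γ j * a j| ≤ 1 / 128 := fun j => by
    rw [abs_mul, abs_mul]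
    have := mul_le_mul (hγ j) (ha j) (abs_nonneg _) ((abs_nonneg _).trans (hγ j))
    rw [abs_of_pos (by norm_num : (0 : ℝ) < 64)]
    linarith
  fin_cases j
  · have := h1 1
    simpa [meanVec, abs_mul] using this
  · have := h1 0
    simpa [meanVec, abs_mul] using this
  · simp [meanVec]

/-- The limit is c + γ z + v. The term γ z is reached at the rate assumed for the noise, and the
remainder converges in H^p and therefore in C^{-κ}. -/
theorem IsKernel.exists_pairBound_solution {f : Plane → ℝ} (h : IsKernel f) {κ : ℝ} (hκ : 0 < κ)
    (hκ1 : κ < 1 / 2) {K : ℝ} (hK : 0 ≤ K) : ∃ C σ : ℝ, 0 ≤ C ∧ 0 < σ ∧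
      ∀ ξ, RoughNoise f κ K ξ → ∀ γ : Fin 3 → ℝ, (∀ j, |γ j| ≤ σ) →
        ∃ (r : ℝ → Fin 3 → (Fin 2 → ℤ) → ℂ) (R : Fin 3 → (Fin 2 → ℤ) → ℂ),
          (∀ j, DistSummable (R j)) ∧ (∀ ε, 0 < ε → ∀ j N, WtSummable N (r ε j)) ∧
          (∀ ε, 0 < ε → ∀ j x, dbar (trigSeries (r ε j)) x =
            trigSeries (r ε (j + 1)) x * star (trigSeries (r ε (j + 2)) x) -
              star (trigSeries (r ε (j + 1)) x) * trigSeries (r ε (j + 2)) x +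
              (γ j : ℂ) * Complex.I * trigSeries (mollSeq f ε (ξ j)) x) ∧
          ∀ ε, 0 < ε → ∀ j, PairBound κ (fun k => r ε j k - R j k) (C * ε ^ (κ / 8)) := by
  obtain ⟨C₁, σ₁, hC₁, hσ₁, hσ₁1, hsol⟩ := h.exists_solution hκ hκ1 hK
  obtain ⟨D, hD, hmoll⟩ := h.exists_norm_mollSeq_le (s := -(3 * κ / 8)) (by linarith) hK
  have hβ : 0 < κ / 8 := by linarith
  have hV := discArea_nonneg
  set p := 1 - κ / 2 with hpdef
  have hp : 1 / 2 < p := by linarith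
  have hp1 : p ≤ 1 := by linarith
  set B₁ := 2 * discArea * √(wtSum (2 * (p + κ)))
  have hB₁ : 0 ≤ B₁ := by positivity
  have hw0 := wtSum_nonneg (2 * (3 - p))
  set E := D * (1 + wtSum (2 * (3 - p)))
  have hE : 0 ≤ E := by positivity
  -- 8192 = 64 * 128 keeps the means of `meanVec` below 1/128.
  set σ := min σ₁ (1 / (8192 * (K + 1)))
  have hσK : σ * K ≤ 1 / 8192 := by
    calc σ * K ≤ 1 / (8192 * (K + 1)) * (K + 1) := by
          gcongr
          · exact min_le_right _ _
          · linarith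
      _ = _ := by field_simp
  refine ⟨K + B₁ * (E + E) + B₁ * C₁, σ, by positivity, by positivity, fun ξ hξ γ hγ => ?_⟩
  have hγ1 : ∀ j, |γ j| ≤ 1 := fun j => (hγ j).trans ((min_le_left _ _).trans hσ₁1)
  set a : Fin 3 → ℝ := fun j => (ξ j 0).re
  have ha : ∀ j, ξ j 0 = a j := fun j => by
    have h1 := hξ.hermitian j 0
    rw [neg_zero] at h1
    exact (Complex.conj_eq_iff_re.mp h1.symm).symm
  have haK : ∀ j, |a j| ≤ K := fun j => (Complex.abs_re_le_norm _).trans (hξ.zero_le j)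
  have ha2 : a 2 = 0 := by simp only [a, hξ.zero_two, Complex.zero_re]
  set c := meanVec γ a
  obtain ⟨u, v, hfix, hrate⟩ := hsol _ hξ.noiseBound γ c
    (fun j => (hγ j).trans (min_le_left _ _)) (norm_meanVec_le hγ haK hσK)
  set z : Fin 3 → (Fin 2 → ℤ) → ℂ := fun j => dbarInv (ξ j)
  set y : ℝ → Fin 3 → (Fin 2 → ℤ) → ℂ := fun ε => affineSeq c γ fun j => mollSeq f ε (z j)
  have hzD : ∀ j, DistSummable (z j) := fun j =>
    (hξ.noiseBound.hsBound j).distSummable (by linarith)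
  have hzεD : ∀ ε j, DistSummable (mollSeq f ε (z j)) := fun ε j =>
    (h.hsBound_mollSeq (hξ.noiseBound.hsBound j) ε).distSummable (by linarith)
  have hclass := fun ε hε => dbar_trigSeries_of_fixedPoint hp hp1 (c := c) (γ := γ)
    (w := fun j => mollSeq f ε (ξ j)) (y := y ε) (u := fun j => unweight p (u ε j))
    (fun j N => by
      obtain ⟨s, M, hM⟩ := hξ.exists_hsBound j
      exact h.wtSummable_mollSeq hM hε N)
    (fun j k => by
      simp only [mollSeq, hξ.hermitian, waveFT_neg_left, star_mul'])
    (fun j => by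
      simp only [mollSeq, h.waveFT_zero, one_mul, ha]
      exact meanVec_eq γ a ha2 j)
    (fun j k => by
      simp only [y, z, affineSeq, mollSeq_dbarInv]
      rfl)
    (fun j => ⟨_, hsBound_unweight p _⟩) (hfix ε hε)
  refine ⟨fun ε j k => y ε j k + unweight p (u ε j) k,
    fun j k => affineSeq c γ z j k + unweight p (v j) k, fun j => ?_,
    fun ε hε => (hclass ε hε).1, fun ε hε => (hclass ε hε).2, fun ε hε j => ?_⟩
  · exact ((wtSummable_single 0 (c j)).distSummable.add ((hzD j).const_mul _)).add
      ((hsBound_unweight p (v j)).distSummable (by linarith))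
  have hε0 : 0 ≤ ε ^ (κ / 8) := by positivity
  have hz : PairBound κ (fun k => mollSeq f ε (z j) k - z j k)
      ((K + B₁ * (E + E)) * ε ^ (κ / 8)) := by
    -- For ε ≥ 1 the comparison passes through scale 1, since the mollifications at scales at least
    -- 1 are bounded in H^p uniformly.
    rcases le_total ε 1 with h1 | h1
    · refine (hξ.pairBound j ε hε h1).mono ?_
      gcongr
      exact le_add_of_nonneg_right (by positivity)
    · have hEb : ∀ ε, 1 ≤ ε → HsBound p (mollSeq f ε (z j)) E := fun ε h1 =>
        hsBound_of_norm_le hD (by linarith) (hmoll _ (hξ.noiseBound.hsBound j) ε h1)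
      have h2 := ((hEb ε h1).sub (hEb 1 le_rfl)).pairBound hκ.le (by linarith) (by linarith)
      have h3 := h2.add (hξ.pairBound j 1 one_pos le_rfl) ((hzεD ε j).sub (hzεD 1 j))
        ((hzεD 1 j).sub (hzD j))
      have e : (fun k => mollSeq f ε (z j) k - z j k) = fun k =>
          (mollSeq f ε (z j) k - mollSeq f 1 (z j) k) + (mollSeq f 1 (z j) k - z j k) := by
        funext k; ring
      rw [e]
      refine h3.mono ?_
      have h4 : 1 ≤ ε ^ (κ / 8) := Real.one_le_rpow h1 hβ.le
      rw [Real.one_rpow, mul_one, add_comm]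
      exact le_mul_of_one_le_right (by positivity) h4
  have hu : PairBound κ (fun k => unweight p (u ε j) k - unweight p (v j) k)
      (B₁ * C₁ * ε ^ (κ / 8)) := by
    have h1 : HsBound p (fun k => unweight p (u ε j) k - unweight p (v j) k)
        (C₁ * ε ^ (κ / 8)) := by
      have h2 := hsBound_unweight p ((u ε - v) j)
      have e : unweight p ((u ε - v) j) = fun k => unweight p (u ε j) k - unweight p (v j) k := by
        funext k
        rw [Pi.sub_apply, unweight_sub]
      rw [e] at h2
      exact h2.mono ((norm_le_pi_norm _ j).trans (hrate ε hε))
    exact (h1.pairBound hκ.le (by linarith) (by linarith)).mono (le_of_eq (by ring))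
  have hsum := (hz.const_mul (γ j : ℂ)).add hu (((hzεD ε j).sub (hzD j)).const_mul _)
    (((hsBound_unweight p (u ε j)).distSummable (by linarith)).sub
      ((hsBound_unweight p (v j)).distSummable (by linarith)))
  have e : (fun k => y ε j k + unweight p (u ε j) k - (affineSeq c γ z j k + unweight p (v j) k)) =
      fun k => (γ j : ℂ) * (mollSeq f ε (z j) k - z j k) +
        (unweight p (u ε j) k - unweight p (v j) k) := by
    funext k
    simp only [y, affineSeq]
    ring
  rw [e]
  refine hsum.mono ?_
  rw [Complex.norm_real, Real.norm_eq_abs, add_mul _ (B₁ * C₁)]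
  exact add_le_add_left (mul_le_of_le_one_left (by positivity) (hγ1 j)) _

theorem IsKernel.exists_rough_solution {f : Plane → ℝ} (h : IsKernel f) {κ : ℝ} (hκ : 0 < κ)
    (hκ1 : κ < 1 / 2) {K : ℝ} (hK : 0 ≤ K) : ∃ C σ : ℝ, 0 < σ ∧
      ∀ ξ, RoughNoise f κ K ξ → ∀ γ : EuclideanSpace ℝ (Fin 3), ‖γ‖ < σ →
        ∃ (r : ℝ → Fin 3 → TorusTest) (R : Fin 3 → TorusDistribution),
          (∀ ε, 0 < ε → SolvesMollifiedCR γ (fun j => trigSeries (mollSeq f ε (ξ j))) (r ε)) ∧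
          holderNorm (-κ) R < ∞ ∧
          Tendsto (fun ε => holderNorm (-κ) (fun k => toDistribution (r ε k) - R k))
            (𝓝[>] 0) (𝓝 0) ∧
          ∀ ε : ℝ, 0 < ε → holderNorm (-κ) (fun k => toDistribution (r ε k) - R k) ≤
            ENNReal.ofReal (C * ε ^ (κ / 8)) := by
  obtain ⟨C, σ, hC, hσ, hsol⟩ := h.exists_pairBound_solution hκ hκ1 hK
  refine ⟨3 * C, σ, hσ, fun ξ hξ γ hγ => ?_⟩
  obtain ⟨r, R, hR, hr, heq, hrate⟩ := hsol ξ hξ γ fun j =>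
    (PiLp.norm_apply_le γ j).trans hγ.le
  -- For 0 < κ < 1 only one derivative of the test functions is controlled.
  have hfloor : ⌊-(-κ) + 1⌋₊ = 1 := by
    rw [neg_neg, Nat.floor_eq_iff (by linarith)]
    constructor
    · push_cast; linarith
    · push_cast; linarith
  set T : ℝ → Fin 3 → TorusTest := fun ε j =>
    if hε : 0 < ε then trigTest (r ε j) (hr ε hε j) else 0
  have hT : ∀ ε (hε : 0 < ε) j, T ε j = trigTest (r ε j) (hr ε hε j) := fun ε hε j => dif_pos hε
  have hTx : ∀ ε, 0 < ε → ∀ j, (T ε j : Plane → ℂ) = trigSeries (r ε j) := fun ε hε j => by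
    rw [hT ε hε]; rfl
  have hbound : ∀ ε, 0 < ε →
      holderNorm (-κ) (fun k => toDistribution (T ε k) - seqDistribution (R k) (hR k)) ≤
        ENNReal.ofReal (3 * C * ε ^ (κ / 8)) := by
    intro ε hε
    rw [mul_assoc]
    refine holderNorm_le (by positivity) fun j φ hφ y l hl hl1 => ?_
    rw [hfloor] at hφ
    rw [hT ε hε, pairing_trigTest_sub (hr ε hε j) (hR j)]
    simp only [torusFT_rescaled]
    exact hrate ε hε j φ hφ y l hl hl1
  refine ⟨T, fun j => seqDistribution (R j) (hR j), fun ε hε x => ?_, ?_, ?_, hbound⟩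
  · simp only [hTx ε hε]
    have e1 : (0 : Fin 3) + 1 = 1 := rfl
    have e2 : (0 : Fin 3) + 2 = 2 := rfl
    have e3 : (1 : Fin 3) + 1 = 2 := rfl
    have e4 : (1 : Fin 3) + 2 = 0 := rfl
    have e5 : (2 : Fin 3) + 1 = 0 := rfl
    have e6 : (2 : Fin 3) + 2 = 1 := rfl
    have h0 := heq ε hε 0 x
    have h1 := heq ε hε 1 x
    have h2 := heq ε hε 2 x
    rw [e1, e2] at h0
    rw [e3, e4] at h1
    rw [e5, e6] at h2
    -- The second equation of the system lists the factors of its products in the other order than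
    -- the cyclic form.
    refine ⟨h0, h1.trans ?_, h2⟩
    ring
  -- The limit has finite norm because it differs from the smooth solution at scale 1 by the rate at
  -- ε = 1.
  · have h1 : ∀ j, ∃ M, HsBound 1 (r 1 j) M := fun j =>
      (hr 1 one_pos j 1).exists_hsBound (by simp)
    choose M hM using h1
    have h2 : ∀ j, PairBound κ (R j) (2 * discArea * √(wtSum (2 * (1 + κ))) * M j + C) := by
      intro j
      have h3 := ((hM j).pairBound hκ.le (by linarith) (by linarith)).add
        ((hrate 1 one_pos j).const_mul (-1)) (hr 1 one_pos j 0).distSummable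
        (((hr 1 one_pos j 0).distSummable.sub (hR j)).const_mul (-1))
      rw [Real.one_rpow, norm_neg, norm_one, one_mul, mul_one] at h3
      have e : (R j) = fun k => r 1 j k + -1 * (r 1 j k - R j k) := by
        funext k; ring
      rw [e]
      exact h3
    set B := ∑ j, (2 * discArea * √(wtSum (2 * (1 + κ))) * M j + C)
    have hV := discArea_nonneg
    have hj : ∀ j, 0 ≤ 2 * discArea * √(wtSum (2 * (1 + κ))) * M j + C := fun j => by
      have := (hM j).1
      positivity
    refine (holderNorm_le (D := B) (Finset.sum_nonneg fun j _ => hj j)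
      fun j φ hφ y l hl hl1 => ?_).trans_lt ENNReal.ofReal_lt_top
    rw [hfloor] at hφ
    have h4 := h2 j φ hφ y l hl hl1
    have e : pairing (seqDistribution (R j) (hR j)) (rescaled φ l hl y) =
        ∑' k, R j k * (character k y * waveFT φ k l) := by
      simp only [← torusFT_rescaled φ hl y]
      rfl
    rw [e]
    refine h4.trans ?_
    gcongr
    exact Finset.single_le_sum (f := fun j => 2 * discArea * √(wtSum (2 * (1 + κ))) * M j + C)
      (fun j _ => hj j) (Finset.mem_univ j)
  · have hlim : Tendsto (fun ε : ℝ => ENNReal.ofReal (3 * C * ε ^ (κ / 8))) (𝓝[>] 0) (𝓝 0) := by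
      rw [← ENNReal.ofReal_zero]
      refine (ENNReal.continuous_ofReal.tendsto 0).comp ?_
      have h1 : Tendsto (fun ε : ℝ => ε ^ (κ / 8)) (𝓝 0) (𝓝 0) := by
        have := (Real.continuous_rpow_const (q := κ / 8) (by linarith)).tendsto 0
        rwa [Real.zero_rpow (by linarith)] at this
      have h2 := (h1.mono_left (nhdsWithin_le_nhds (s := Set.Ioi 0))).const_mul (3 * C)
      rwa [mul_zero] at h2
    refine tendsto_of_tendsto_of_tendsto_of_le_of_le' tendsto_const_nhds hlim
      (Eventually.of_forall fun _ => zero_le) ?_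
    filter_upwards [self_mem_nhdsWithin] with ε hε
    exact hbound ε hε

/-! ## Boundedness in probability -/

/-- With probability close to one, `H ω K` holds for a (large) deterministic constant `K`. -/
def BoundedInProb {Ω : Type*} [MeasurableSpace Ω] (P : Measure Ω) (H : Ω → ℝ → Prop) : Prop :=
  ∀ δ : ℝ, 0 < δ → ∃ K : ℝ, 0 ≤ K ∧ ∃ A : Set Ω, MeasurableSet A ∧ P Aᶜ ≤ ENNReal.ofReal δ ∧
    ∀ ω ∈ A, H ω K

namespace BoundedInProb

variable {Ω : Type*} [MeasurableSpace Ω] {P : Measure Ω} {H H' : Ω → ℝ → Prop}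

theorem imp {g : ℝ → ℝ} (h : BoundedInProb P H) (hg : ∀ K, 0 ≤ K → 0 ≤ g K)
    (himp : ∀ ω K, 0 ≤ K → H ω K → H' ω (g K)) : BoundedInProb P H' := by
  intro δ hδ
  obtain ⟨K, hK, A, hA, hPA, hH⟩ := h δ hδ
  exact ⟨g K, hg K hK, A, hA, hPA, fun ω hω => himp ω K hK (hH ω hω)⟩

theorem and (h : BoundedInProb P H) (h' : BoundedInProb P H')
    (hm : ∀ ω K K', K ≤ K' → H ω K → H ω K') (hm' : ∀ ω K K', K ≤ K' → H' ω K → H' ω K') :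
    BoundedInProb P fun ω K => H ω K ∧ H' ω K := by
  intro δ hδ
  obtain ⟨K, hK, A, hA, hPA, hH⟩ := h (δ / 2) (by positivity)
  obtain ⟨K', hK', A', hA', hPA', hH'⟩ := h' (δ / 2) (by positivity)
  refine ⟨K + K', by positivity, A ∩ A', hA.inter hA', ?_, fun ω hω =>
    ⟨hm ω K _ (by linarith) (hH ω hω.1), hm' ω K' _ (by linarith) (hH' ω hω.2)⟩⟩
  rw [Set.compl_inter]
  refine (measure_union_le _ _).trans ((add_le_add hPA hPA').trans ?_)
  rw [← ENNReal.ofReal_add (by positivity) (by positivity), add_halves]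

/-- The exceptional null set need not be measurable, so a measurable hull of it is removed. -/
theorem and_ae (h : BoundedInProb P H) {p : Ω → Prop} (hp : ∀ᵐ ω ∂P, p ω) :
    BoundedInProb P fun ω K => H ω K ∧ p ω := by
  intro δ hδ
  obtain ⟨K, hK, A, hA, hPA, hH⟩ := h δ hδ
  set N := toMeasurable P {ω | ¬p ω}
  have hN : P N = 0 := (measure_toMeasurable _).trans (ae_iff.mp hp)
  refine ⟨K, hK, A \ N, hA.diff (measurableSet_toMeasurable _ _), ?_, fun ω hω =>
    ⟨hH ω hω.1, by_contra fun h => hω.2 (subset_toMeasurable P {ω | ¬p ω} h)⟩⟩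
  rw [Set.sdiff_eq, Set.compl_inter, compl_compl]
  exact (measure_union_le _ _).trans (by rw [hN, add_zero]; exact hPA)

theorem forall_finite {ι : Type*} [Finite ι] {H : ι → Ω → ℝ → Prop}
    (h : ∀ i, BoundedInProb P (H i)) (hm : ∀ i ω K K', K ≤ K' → H i ω K → H i ω K') :
    BoundedInProb P fun ω K => ∀ i, H i ω K := by
  classical
  cases nonempty_fintype ι
  have key : ∀ S : Finset ι, BoundedInProb P fun ω K => ∀ i ∈ S, H i ω K := by
    intro S
    induction S using Finset.induction_on with
    | empty =>
      refine fun δ hδ => ⟨0, le_rfl, Set.univ, MeasurableSet.univ, by simp, fun ω _ i hi => ?_⟩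
      simp at hi
    | insert i S hi ih =>
      refine ((h i).and ih (hm i) fun ω K K' hK hH j hj => hm j ω K K' hK (hH j hj)).imp
        (g := id) (fun K hK => hK) fun ω K _ hH j hj => ?_
      rcases Finset.mem_insert.mp hj with rfl | hj
      · exact hH.1
      · exact hH.2 j hj
  exact (key Finset.univ).imp (g := id) (fun K hK => hK) fun ω K _ hH i =>
    hH i (Finset.mem_univ i)

/-- Fatou bounds the mean of the lower limit of Y by C. By Markov the lower limit is below K = (C +
1) / δ outside a set of measure at most δ, and there Y n ω ≤ K for infinitely many n. Infinitely
many truncations suffice: the uses below enlarge a finite set to such a truncation or pass to a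
limit. -/
theorem of_frequently {Y : ℕ → Ω → ℝ≥0∞} (hY : ∀ n, AEMeasurable (Y n) P) {C : ℝ≥0∞}
    (hC : C ≠ ∞) (hint : ∀ n, ∫⁻ ω, Y n ω ∂P ≤ C)
    (hH : ∀ ω K, 0 ≤ K → (∃ᶠ n in atTop, Y n ω ≤ ENNReal.ofReal K) → H ω K) :
    BoundedInProb P H := by
  intro δ hδ
  set Z : Ω → ℝ≥0∞ := fun ω => liminf (fun n => Y n ω) atTop
  have hZ : AEMeasurable Z P := by
    refine ⟨fun ω => liminf (fun n => (hY n).mk _ ω) atTop,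
      Measurable.liminf fun n => (hY n).measurable_mk, ?_⟩
    filter_upwards [ae_all_iff.mpr fun n => (hY n).ae_eq_mk] with ω hω
    simp only [Z, hω]
  have hZint : ∫⁻ ω, Z ω ∂P ≤ C := (lintegral_liminf_le' hY).trans
    (liminf_le_of_le ⟨0, Eventually.of_forall fun _ => zero_le⟩ fun b hb => by
      obtain ⟨n, hn⟩ := hb.exists
      exact hn.trans (hint n))
  set K : ℝ := (C.toReal + 1) / δ
  have hK : 0 < K := by positivity
  refine ⟨K, hK.le, (toMeasurable P {ω | ENNReal.ofReal K ≤ Z ω})ᶜ,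
    (measurableSet_toMeasurable _ _).compl, ?_, fun ω hω => hH ω K hK.le ?_⟩
  · rw [compl_compl, measure_toMeasurable]
    have h1 := mul_meas_ge_le_lintegral₀ hZ (ENNReal.ofReal K)
    have h2 : ENNReal.ofReal K ≠ 0 := by simpa using hK
    refine (ENNReal.le_div_iff_mul_le (Or.inl h2) (Or.inl ENNReal.ofReal_ne_top)).mpr
      ((mul_comm _ _).trans_le (h1.trans hZint)) |>.trans ?_
    rw [ENNReal.div_le_iff_le_mul (Or.inl h2) (Or.inl ENNReal.ofReal_ne_top),
      ← ENNReal.ofReal_mul hδ.le, ← ENNReal.ofReal_toReal hC]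
    refine ENNReal.ofReal_le_ofReal ?_
    simp only [K]
    rw [mul_div_cancel₀ _ hδ.ne']
    linarith
  · have h1 : Z ω < ENNReal.ofReal K := by
      by_contra hlt
      exact hω (subset_toMeasurable P {ω | ENNReal.ofReal K ≤ Z ω} (not_lt.mp hlt))
    exact (frequently_lt_of_liminf_lt (by isBoundedDefault) h1).mono fun n hn => hn.le

theorem of_frequently_real {Y : ℕ → Ω → ℝ} (h0 : ∀ n ω, 0 ≤ Y n ω)
    (hY : ∀ n, Integrable (Y n) P) {C : ℝ} (hint : ∀ n, ∫ ω, Y n ω ∂P ≤ C)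
    (hH : ∀ ω K, 0 ≤ K → (∃ᶠ n in atTop, Y n ω ≤ K) → H ω K) : BoundedInProb P H := by
  refine of_frequently (Y := fun n ω => ENNReal.ofReal (Y n ω))
    (fun n => (hY n).aestronglyMeasurable.aemeasurable.ennreal_ofReal)
    (C := ENNReal.ofReal C) ENNReal.ofReal_ne_top (fun n => ?_) fun ω K hK hfr => ?_
  · rw [← ofReal_integral_eq_lintegral_ofReal (hY n) (Eventually.of_forall (h0 n))]
    exact ENNReal.ofReal_le_ofReal (hint n)
  · exact hH ω K hK (hfr.mono fun n hn => (ENNReal.ofReal_le_ofReal_iff hK).mp hn)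

end BoundedInProb

/-- The box of frequencies of size `n`. -/
noncomputable def freqBox (n : ℕ) : Finset (Fin 2 → ℤ) := Finset.Icc (fun _ => -(n : ℤ)) fun _ => (n : ℤ)

theorem tendsto_freqBox : Tendsto freqBox atTop atTop := by
  refine tendsto_atTop_finset_of_monotone (fun m n hmn => ?_) fun k => ?_
  · refine Finset.Icc_subset_Icc (fun _ => ?_) fun _ => ?_ <;> simp <;> omega
  · refine ⟨(k 0).natAbs + (k 1).natAbs, ?_⟩
    rw [freqBox, Finset.mem_Icc]
    have h0 := Int.natCast_natAbs (k 0)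
    have h1 := Int.natCast_natAbs (k 1)
    constructor <;> intro i <;> fin_cases i <;> push_cast <;>
      simp only [← h0, ← h1] <;> omega

theorem eventually_subset_freqBox (S : Finset (Fin 2 → ℤ)) : ∀ᶠ n in atTop, S ⊆ freqBox n :=
  tendsto_freqBox.eventually (eventually_ge_atTop S)

/-! ## Uncorrelated families and the first random bounds -/

instance : ENNReal.HolderTriple 4 4 2 where
  inv_add_inv_eq_inv := by
    rw [← two_mul, ← ENNReal.toReal_eq_toReal_iff' (by finiteness) (by finiteness)]
    rw [ENNReal.toReal_mul, ENNReal.toReal_inv, ENNReal.toReal_inv]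
    norm_num

/-- Pythagoras in L²(P). -/
theorem integral_norm_sq_sum {Ω τ : Type*} [MeasurableSpace Ω] {P : Measure Ω} {y : τ → Ω → ℂ}
    (hy : ∀ i, MemLp (y i) 2 P) (T : Finset τ) (c : τ → ℂ)
    (h : ∀ i ∈ T, ∀ j ∈ T, i ≠ j → ∫ ω, y i ω * star (y j ω) ∂P = 0) :
    ∫ ω, ‖∑ i ∈ T, c i * y i ω‖ ^ 2 ∂P = ∑ i ∈ T, ‖c i‖ ^ 2 * ∫ ω, ‖y i ω‖ ^ 2 ∂P := by
  have hint : ∀ i j, Integrable (fun ω => y i ω * star (y j ω)) P := fun i j =>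
    (hy i).integrable_mul (hy j).star
  have e : ∀ ω, ((‖∑ i ∈ T, c i * y i ω‖ ^ 2 : ℝ) : ℂ) =
      ∑ i ∈ T, ∑ j ∈ T, (c i * star (c j)) * (y i ω * star (y j ω)) := fun ω => by
    rw [Complex.ofReal_pow, ← Complex.mul_conj', ← Complex.star_def, star_sum, Finset.sum_mul_sum]
    refine Finset.sum_congr rfl fun i _ => Finset.sum_congr rfl fun j _ => ?_
    rw [star_mul']
    ring
  have key : ((∫ ω, ‖∑ i ∈ T, c i * y i ω‖ ^ 2 ∂P : ℝ) : ℂ) =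
      ((∑ i ∈ T, ‖c i‖ ^ 2 * ∫ ω, ‖y i ω‖ ^ 2 ∂P : ℝ) : ℂ) := by
    rw [← integral_complex_ofReal]
    simp only [e]
    rw [integral_finsetSum _ fun i _ => integrable_finsetSum _ fun j _ => (hint i j).const_mul _]
    push_cast
    refine Finset.sum_congr rfl fun i hi => ?_
    rw [integral_finsetSum _ fun j _ => (hint i j).const_mul _,
      Finset.sum_eq_single_of_mem i hi fun j hj hji => by
        rw [integral_const_mul, h i hi j hj hji.symm, mul_zero], integral_const_mul,
      ← Complex.mul_conj', Complex.star_def, ← integral_complex_ofReal]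
    congr 1
    refine integral_congr_ae (Eventually.of_forall fun ω => ?_)
    simp only
    rw [Complex.mul_conj', Complex.ofReal_pow]
  exact_mod_cast key

/-- Random variables `x_{(k, j)}` of size `|k|⁻¹`, such that an index which occurs only once makes
a fourth moment vanish. -/
structure NoiseFamily {Ω : Type*} [MeasurableSpace Ω] (P : Measure Ω)
    (x : (Fin 2 → ℤ) × Fin 3 → Ω → ℂ) (C : ℝ) : Prop where
  memLp : ∀ i, MemLp (x i) 4 P
  moment : ∀ i, ∫ ω, ‖x i ω‖ ^ 4 ∂P ≤ C * wt i.1 ^ (-4 : ℝ)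
  vanish : ∀ a b c d, a ≠ b → a ≠ c → a ≠ d →
    ∫ ω, x a ω * star (x b ω) * star (x c ω) * x d ω ∂P = 0

namespace NoiseFamily

variable {Ω : Type*} [MeasurableSpace Ω] {P : Measure Ω}
  {x : (Fin 2 → ℤ) × Fin 3 → Ω → ℂ} {C : ℝ}

theorem nonneg (h : NoiseFamily P x C) : 0 ≤ C := by
  have h1 := h.moment (0, 0)
  have h2 : 0 ≤ ∫ ω, ‖x (0, 0) ω‖ ^ 4 ∂P := integral_nonneg fun _ => by positivity
  simp only [wt, norm_zero, add_zero, Real.one_rpow, mul_one] at h1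
  exact h2.trans h1

theorem integrable_pow_four (h : NoiseFamily P x C) (i : (Fin 2 → ℤ) × Fin 3) :
    Integrable (fun ω => ‖x i ω‖ ^ 4) P := (h.memLp i).integrable_norm_pow (by norm_num)

theorem memLp_mul_star (h : NoiseFamily P x C) (a b : (Fin 2 → ℤ) × Fin 3) :
    MemLp (fun ω => x a ω * star (x b ω)) 2 P := (h.memLp b).star.mul' (h.memLp a)

/-- Integration of t ≤ v + v⁻¹ t² with t = |x|² and v = `wt ^ (-2)`, the expected size of t. -/
theorem integral_sq_le [IsProbabilityMeasure P] (h : NoiseFamily P x C) (i : (Fin 2 → ℤ) × Fin 3) :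
    ∫ ω, ‖x i ω‖ ^ 2 ∂P ≤ (C + 1) * wt i.1 ^ (-2 : ℝ) := by
  have hw := wt_pos i.1
  have e4 : wt i.1 ^ (-4 : ℝ) = (wt i.1 ^ (-2 : ℝ)) ^ 2 := by
    rw [← Real.rpow_natCast, ← Real.rpow_mul hw.le]; norm_num
  set v := wt i.1 ^ (-2 : ℝ)
  have hv : 0 < v := Real.rpow_pos_of_pos hw _
  have h1 := h.moment i
  rw [e4] at h1
  have hle : ∀ ω, ‖x i ω‖ ^ 2 ≤ v + v⁻¹ * ‖x i ω‖ ^ 4 := fun ω => by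
    have e : ‖x i ω‖ ^ 4 = (‖x i ω‖ ^ 2) ^ 2 := by ring
    rw [e]
    set t := ‖x i ω‖ ^ 2
    have : 0 ≤ t := by positivity
    have h2 : t ≤ (v ^ 2 + t ^ 2) / v := by
      rw [le_div_iff₀ hv]; nlinarith [sq_nonneg (t - v)]
    refine h2.trans (le_of_eq ?_)
    field_simp
  calc ∫ ω, ‖x i ω‖ ^ 2 ∂P ≤ ∫ ω, (v + v⁻¹ * ‖x i ω‖ ^ 4) ∂P := by
        refine integral_mono_of_nonneg (Eventually.of_forall fun ω => sq_nonneg _)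
          ((integrable_const _).add ((h.integrable_pow_four i).const_mul _))
          (Eventually.of_forall hle)
    _ = v + v⁻¹ * ∫ ω, ‖x i ω‖ ^ 4 ∂P := by
        rw [integral_add (integrable_const _) ((h.integrable_pow_four i).const_mul _),
          integral_const_mul]
        simp
    _ ≤ v + v⁻¹ * (C * v ^ 2) := by gcongr
    _ = _ := by field_simp; ring

theorem integrable_sq_mul_sq (h : NoiseFamily P x C) (a b : (Fin 2 → ℤ) × Fin 3) :
    Integrable (fun ω => ‖x a ω‖ ^ 2 * ‖x b ω‖ ^ 2) P := by
  refine ((h.memLp_mul_star a b).integrable_norm_pow (by norm_num)).congr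
    (Eventually.of_forall fun ω => ?_)
  simp only [norm_mul, norm_star, mul_pow]

/-- A weighted arithmetic–geometric mean inequality; the weights make both fourth moments contribute
the product uv of the expected sizes. -/
theorem integral_sq_mul_sq_le (h : NoiseFamily P x C) (a b : (Fin 2 → ℤ) × Fin 3) :
    ∫ ω, ‖x a ω‖ ^ 2 * ‖x b ω‖ ^ 2 ∂P ≤ C * (wt a.1 ^ (-2 : ℝ) * wt b.1 ^ (-2 : ℝ)) := by
  have e4 : ∀ i : (Fin 2 → ℤ) × Fin 3, wt i.1 ^ (-4 : ℝ) = (wt i.1 ^ (-2 : ℝ)) ^ 2 := fun i => by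
    rw [← Real.rpow_natCast, ← Real.rpow_mul (wt_pos _).le]; norm_num
  have ha := h.moment a
  have hb := h.moment b
  rw [e4] at ha hb
  have hu : 0 < wt a.1 ^ (-2 : ℝ) := Real.rpow_pos_of_pos (wt_pos _) _
  have hv : 0 < wt b.1 ^ (-2 : ℝ) := Real.rpow_pos_of_pos (wt_pos _) _
  set u := wt a.1 ^ (-2 : ℝ)
  set v := wt b.1 ^ (-2 : ℝ)
  have hle : ∀ ω, ‖x a ω‖ ^ 2 * ‖x b ω‖ ^ 2 ≤
      v / (2 * u) * ‖x a ω‖ ^ 4 + u / (2 * v) * ‖x b ω‖ ^ 4 := fun ω => by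
    have e : v / (2 * u) * ‖x a ω‖ ^ 4 + u / (2 * v) * ‖x b ω‖ ^ 4 =
        ((v * ‖x a ω‖ ^ 2) ^ 2 + (u * ‖x b ω‖ ^ 2) ^ 2) / (2 * u * v) := by
      field_simp
    rw [e, le_div_iff₀ (by positivity)]
    nlinarith [sq_nonneg (v * ‖x a ω‖ ^ 2 - u * ‖x b ω‖ ^ 2)]
  calc _ ≤ ∫ ω, (v / (2 * u) * ‖x a ω‖ ^ 4 + u / (2 * v) * ‖x b ω‖ ^ 4) ∂P := by
        refine integral_mono_of_nonneg (Eventually.of_forall fun ω => by positivity)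
          (((h.integrable_pow_four a).const_mul _).add ((h.integrable_pow_four b).const_mul _))
          (Eventually.of_forall hle)
    _ = v / (2 * u) * ∫ ω, ‖x a ω‖ ^ 4 ∂P + u / (2 * v) * ∫ ω, ‖x b ω‖ ^ 4 ∂P := by
        rw [integral_add ((h.integrable_pow_four a).const_mul _)
          ((h.integrable_pow_four b).const_mul _), integral_const_mul, integral_const_mul]
    _ ≤ v / (2 * u) * (C * u ^ 2) + u / (2 * v) * (C * v ^ 2) := by gcongr
    _ = _ := by field_simp; ring

/-- The mean of the squared H^s norm is at most a multiple of the sum of `wt k ^ (-2 + 2s)`, which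
is finite for s < 0. -/
theorem boundedInProb_hsBound [IsProbabilityMeasure P] (h : NoiseFamily P x C) {s : ℝ} (hs : s < 0) (j : Fin 3) :
    BoundedInProb P fun ω K => HsBound s (fun k => x (k, j) ω) (√K) := by
  refine BoundedInProb.of_frequently_real
    (Y := fun n ω => ∑ k ∈ freqBox n, (wt k ^ s * ‖x (k, j) ω‖) ^ 2)
    (C := (C + 1) * wtSum (2 - 2 * s)) (fun n ω => Finset.sum_nonneg fun _ _ => sq_nonneg _)
    (fun n => integrable_finsetSum _ fun k _ => ?_) (fun n => ?_) fun ω K hK hfr => ?_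
  · simp only [mul_pow]
    exact ((h.memLp (k, j)).mono_exponent (by norm_num) |>.integrable_norm_pow
      (p := 2) (by norm_num)).const_mul _
  · simp only [mul_pow]
    rw [integral_finsetSum _ fun k _ => ((h.memLp (k, j)).mono_exponent (by norm_num)
      |>.integrable_norm_pow (p := 2) (by norm_num)).const_mul _]
    have hC := h.nonneg
    calc _ ≤ ∑ k ∈ freqBox n, (C + 1) * wt k ^ (-(2 - 2 * s)) := by
          refine Finset.sum_le_sum fun k _ => ?_
          have hw := wt_pos k
          rw [integral_const_mul]
          refine (mul_le_mul_of_nonneg_left (h.integral_sq_le (k, j)) (sq_nonneg _)).trans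
            (le_of_eq ?_)
          have e : wt k ^ (-(2 - 2 * s)) = (wt k ^ s) ^ 2 * wt k ^ (-2 : ℝ) := by
            rw [← Real.rpow_natCast, ← Real.rpow_mul hw.le, ← Real.rpow_add hw]
            congr 1; push_cast; ring
          rw [e]
          ring
      _ ≤ _ := by
          rw [← Finset.mul_sum]
          gcongr
          exact (summable_wt_rpow (by linarith)).sum_le_tsum _ fun k _ =>
            Real.rpow_nonneg (wt_pos k).le _
  · refine ⟨Real.sqrt_nonneg K, fun S => ?_⟩
    obtain ⟨n, hn, hS⟩ := (hfr.and_eventually (eventually_subset_freqBox S)).exists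
    rw [Real.sq_sqrt hK]
    exact (Finset.sum_le_sum_of_subset_of_nonneg hS fun _ _ _ => sq_nonneg _).trans hn

end NoiseFamily

/-! ### Multiplication by the noise -/

/-- The fourth power of a Schatten norm of the operator of multiplication by `z`, truncated to the
frequencies in `S`. -/
noncomputable def schattenSum (s t : ℝ) (z : (Fin 2 → ℤ) → ℂ) (S : Finset (Fin 2 → ℤ)) : ℝ :=
  ∑ l ∈ S, ∑ l' ∈ S, (wt l ^ (-s) * wt l' ^ (-s) *
    ‖∑ k ∈ S, ((wt k ^ (-(2 * t)) : ℝ) : ℂ) * (z (k - l) * star (z (k - l')))‖) ^ 2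

theorem schattenSum_nonneg (s t : ℝ) (z : (Fin 2 → ℤ) → ℂ) (S : Finset (Fin 2 → ℤ)) :
    0 ≤ schattenSum s t z S :=
  Finset.sum_nonneg fun _ _ => Finset.sum_nonneg fun _ _ => sq_nonneg _

/-- Let T be the truncated multiplication operator between the weighted spaces. Then ‖T f‖² is a
quadratic form in f with matrix T*T, and Cauchy–Schwarz bounds it by the Hilbert–Schmidt norm of
T*T, whose square is `schattenSum`. Two square roots give the bound for T. -/
theorem norm_sum_mul_le_of_schattenSum {s t : ℝ} {z : (Fin 2 → ℤ) → ℂ} {S : Finset (Fin 2 → ℤ)}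
    {M : ℝ} (hM : schattenSum s t z S ≤ M) (f g : (Fin 2 → ℤ) → ℂ) :
    ‖∑ k ∈ S, ∑ l ∈ S, z (k - l) * f l * g k‖ ≤
      √(√M) * √(∑ l ∈ S, (wt l ^ s * ‖f l‖) ^ 2) * √(∑ k ∈ S, (wt k ^ t * ‖g k‖) ^ 2) := by
  set X := ∑ l ∈ S, (wt l ^ s * ‖f l‖) ^ 2
  have hX : 0 ≤ X := Finset.sum_nonneg fun _ _ => sq_nonneg _
  set H : (Fin 2 → ℤ) → ℂ := fun k => ∑ l ∈ S, z (k - l) * f l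
  have h1 : ∑ k ∈ S, (wt k ^ (-t) * ‖H k‖) ^ 2 ≤ √M * X := by
    have e0 : ∀ k : Fin 2 → ℤ, (wt k ^ (-t)) ^ 2 = wt k ^ (-(2 * t)) := fun k => by
      rw [← Real.rpow_natCast, ← Real.rpow_mul (wt_pos k).le]; congr 1; push_cast; ring
    have e : ((∑ k ∈ S, (wt k ^ (-t) * ‖H k‖) ^ 2 : ℝ) : ℂ) =
        ∑ l ∈ S, ∑ l' ∈ S, (f l * star (f l')) *
          ∑ k ∈ S, ((wt k ^ (-(2 * t)) : ℝ) : ℂ) * (z (k - l) * star (z (k - l'))) := by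
      have e1 : ∀ k, (((wt k ^ (-t) * ‖H k‖) ^ 2 : ℝ) : ℂ) = ∑ l ∈ S, ∑ l' ∈ S,
          (f l * star (f l')) *
            (((wt k ^ (-(2 * t)) : ℝ) : ℂ) * (z (k - l) * star (z (k - l')))) := fun k => by
        rw [mul_pow, e0, Complex.ofReal_mul, Complex.ofReal_pow, ← Complex.mul_conj',
          ← Complex.star_def, star_sum, Finset.sum_mul_sum, Finset.mul_sum]
        refine Finset.sum_congr rfl fun l _ => ?_
        rw [Finset.mul_sum]
        refine Finset.sum_congr rfl fun l' _ => ?_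
        rw [star_mul']
        ring
      rw [Complex.ofReal_sum]
      simp only [e1]
      rw [Finset.sum_comm]
      refine Finset.sum_congr rfl fun l _ => ?_
      rw [Finset.sum_comm]
      exact Finset.sum_congr rfl fun l' _ => (Finset.mul_sum _ _ _).symm
    have h2 : ∑ k ∈ S, (wt k ^ (-t) * ‖H k‖) ^ 2 ≤ ∑ q ∈ S ×ˢ S,
        ((wt q.1 ^ s * ‖f q.1‖) * (wt q.2 ^ s * ‖f q.2‖)) *
          (wt q.1 ^ (-s) * wt q.2 ^ (-s) * ‖∑ k ∈ S, ((wt k ^ (-(2 * t)) : ℝ) : ℂ) *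
            (z (k - q.1) * star (z (k - q.2)))‖) := by
      have h3 : ∑ k ∈ S, (wt k ^ (-t) * ‖H k‖) ^ 2 =
          ‖((∑ k ∈ S, (wt k ^ (-t) * ‖H k‖) ^ 2 : ℝ) : ℂ)‖ := by
        rw [Complex.norm_real, Real.norm_of_nonneg (Finset.sum_nonneg fun _ _ => sq_nonneg _)]
      rw [h3, e, Finset.sum_product]
      refine (norm_sum_le _ _).trans (Finset.sum_le_sum fun l _ => (norm_sum_le _ _).trans
        (Finset.sum_le_sum fun l' _ => ?_))
      rw [norm_mul, norm_mul, norm_star]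
      have hw : ∀ k : Fin 2 → ℤ, wt k ^ s * wt k ^ (-s) = 1 := fun k => by
        rw [← Real.rpow_add (wt_pos k)]; simp
      have key : ∀ N : ℝ, ‖f l‖ * ‖f l'‖ * N = ((wt l ^ s * ‖f l‖) * (wt l' ^ s * ‖f l'‖)) *
          (wt l ^ (-s) * wt l' ^ (-s) * N) := fun N => by
        calc ‖f l‖ * ‖f l'‖ * N = (wt l ^ s * wt l ^ (-s)) * (wt l' ^ s * wt l' ^ (-s)) *
              (‖f l‖ * ‖f l'‖ * N) := by rw [hw, hw]; ring
          _ = _ := by ring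
      exact (key _).le
    refine h2.trans ((Real.sum_mul_le_sqrt_mul_sqrt _ _ _).trans ?_)
    rw [mul_comm]
    gcongr
    · refine le_trans (le_of_eq ?_) hM
      rw [Finset.sum_product]
      rfl
    · refine (Real.sqrt_le_left hX).mpr (le_of_eq ?_)
      rw [Finset.sum_product, sq, Finset.sum_mul_sum]
      exact Finset.sum_congr rfl fun _ _ => Finset.sum_congr rfl fun _ _ => by ring
  have h4 : ‖∑ k ∈ S, ∑ l ∈ S, z (k - l) * f l * g k‖ ≤
      ∑ k ∈ S, (wt k ^ (-t) * ‖H k‖) * (wt k ^ t * ‖g k‖) := by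
    refine (norm_sum_le _ _).trans (Finset.sum_le_sum fun k _ => ?_)
    rw [← Finset.sum_mul, norm_mul]
    have hw : wt k ^ (-t) * wt k ^ t = 1 := by rw [← Real.rpow_add (wt_pos k)]; simp
    refine le_of_eq ?_
    calc _ = (wt k ^ (-t) * wt k ^ t) * (‖H k‖ * ‖g k‖) := by rw [hw, one_mul]
      _ = _ := by ring
  refine h4.trans ((Real.sum_mul_le_sqrt_mul_sqrt _ _ _).trans ?_)
  gcongr
  rw [← Real.sqrt_mul (Real.sqrt_nonneg M)]
  exact Real.sqrt_le_sqrt h1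

/-- Sequences supported in S are extended by zero to a truncation that contains S. -/
theorem opBound_of_frequently_schattenSum {s t M : ℝ} {z : (Fin 2 → ℤ) → ℂ}
    (h : ∃ᶠ n in atTop, schattenSum s t z (freqBox n) ≤ M) : OpBound z s t (√(√M)) := by
  classical
  intro S f g
  obtain ⟨n, hn, hS⟩ := (h.and_eventually (eventually_subset_freqBox S)).exists
  have h1 := norm_sum_mul_le_of_schattenSum hn (fun l => if l ∈ S then f l else 0)
    fun k => if k ∈ S then g k else 0
  have e : ∀ F : (Fin 2 → ℤ) → ℂ, ∀ r : ℝ,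
      ∑ l ∈ freqBox n, (wt l ^ r * ‖if l ∈ S then F l else 0‖) ^ 2 =
        ∑ l ∈ S, (wt l ^ r * ‖F l‖) ^ 2 := fun F r => by
    rw [← Finset.sum_subset hS (fun l _ hl => by simp [hl])]
    exact Finset.sum_congr rfl fun l hl => by simp [hl]
  rw [e, e] at h1
  refine le_trans (le_of_eq ?_) h1
  congr 1
  rw [← Finset.sum_subset hS (fun k _ hk => by simp [hk])]
  refine Finset.sum_congr rfl fun k hk => ?_
  rw [← Finset.sum_subset hS (fun l _ hl => by simp [hl])]
  exact Finset.sum_congr rfl fun l hl => by simp [hk, hl]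

namespace NoiseFamily

variable {Ω : Type*} [MeasurableSpace Ω] {P : Measure Ω}
  {x : (Fin 2 → ℤ) × Fin 3 → Ω → ℂ} {C : ℝ}

/-- The complex conjugate of `vanish` with a, b exchanged and c, d exchanged. -/
theorem vanish' (h : NoiseFamily P x C) (a b c d : (Fin 2 → ℤ) × Fin 3) (hba : b ≠ a)
    (hbc : b ≠ c) (hbd : b ≠ d) :
    ∫ ω, x a ω * star (x b ω) * star (x c ω) * x d ω ∂P = 0 := by
  have h1 := congrArg star (h.vanish b a d c hba hbd hbc)
  rw [star_zero, Complex.star_def, ← integral_conj] at h1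
  rw [← h1]
  refine integral_congr_ae (Eventually.of_forall fun ω => ?_)
  simp only [Complex.star_def, map_mul, Complex.conj_conj]
  ring

/-- For l ≠ l' the products at different k are uncorrelated, because some index of the fourth moment
occurs only once. Only the diagonal of the square survives. -/
theorem integral_norm_sq_offDiag_le (h : NoiseFamily P x C) (j : Fin 3) {l l' : Fin 2 → ℤ}
    (hl : l ≠ l') (c : (Fin 2 → ℤ) → ℝ) (S : Finset (Fin 2 → ℤ)) :
    ∫ ω, ‖∑ k ∈ S, (c k : ℂ) * (x (k - l, j) ω * star (x (k - l', j) ω))‖ ^ 2 ∂P ≤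
      C * ∑ k ∈ S, c k ^ 2 * (wt (k - l) ^ (-2 : ℝ) * wt (k - l') ^ (-2 : ℝ)) := by
  rw [integral_norm_sq_sum (y := fun k ω => x (k - l, j) ω * star (x (k - l', j) ω))
    (fun k => h.memLp_mul_star _ _) S (fun k => (c k : ℂ)), Finset.mul_sum]
  · refine Finset.sum_le_sum fun k _ => ?_
    rw [Complex.norm_real, Real.norm_eq_abs, sq_abs]
    simp only [norm_mul, norm_star, mul_pow]
    exact (mul_le_mul_of_nonneg_left (h.integral_sq_mul_sq_le _ _) (sq_nonneg _)).trans
      (le_of_eq (by ring))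
  · intro k _ k' _ hk
    have e : ∀ ω, x (k - l, j) ω * star (x (k - l', j) ω) *
        star (x (k' - l, j) ω * star (x (k' - l', j) ω)) =
        x (k - l, j) ω * star (x (k - l', j) ω) * star (x (k' - l, j) ω) * x (k' - l', j) ω := by
      intro ω
      rw [star_mul', star_star]
      ring
    simp only [e]
    have h1 : ((k - l, j) : (Fin 2 → ℤ) × Fin 3) ≠ (k - l', j) := fun h => hl (by simpa using h)
    have h2 : ∀ l : Fin 2 → ℤ, ((k - l, j) : (Fin 2 → ℤ) × Fin 3) ≠ (k' - l, j) :=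
      fun l h => hk (by simpa using h)
    -- The first index can only coincide with the last. In that case the second index takes its
    -- place: it differs from the first and the last, and coincidence with the third would give 2 (k
    -- - k') = 0.
    by_cases h3 : k - l = k' - l'
    · refine h.vanish' _ _ _ _ h1.symm (fun h4 => ?_) (h2 l')
      have h5 : k - l' = k' - l := (Prod.ext_iff.mp h4).1
      have h6 : (2 : ℤ) • (k - k') = 0 := by
        have : (2 : ℤ) • (k - k') = (k - l - (k' - l')) + (k - l' - (k' - l)) := by
          rw [two_smul]; abel
        rw [this, h3, h5]; simp
      exact hk (sub_eq_zero.mp ((smul_eq_zero.mp h6).resolve_left (by norm_num)))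
    · exact h.vanish _ _ _ _ h1 (h2 l) fun h4 => h3 (Prod.ext_iff.mp h4).1

/-- For l = l' the summands are nonnegative and nothing cancels; the square is expanded and
estimated termwise. -/
theorem integral_norm_sq_diag_le (h : NoiseFamily P x C) (j : Fin 3) (l : Fin 2 → ℤ)
    {c : (Fin 2 → ℤ) → ℝ} (hc : ∀ k, 0 ≤ c k) (S : Finset (Fin 2 → ℤ)) :
    ∫ ω, ‖∑ k ∈ S, (c k : ℂ) * (x (k - l, j) ω * star (x (k - l, j) ω))‖ ^ 2 ∂P ≤
      C * (∑ k ∈ S, c k * wt (k - l) ^ (-2 : ℝ)) ^ 2 := by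
  have hint := fun k k' => (h.integrable_sq_mul_sq (k - l, j) (k' - l, j)).const_mul (c k * c k')
  calc _ ≤ ∫ ω, ∑ k ∈ S, ∑ k' ∈ S,
        (c k * c k') * (‖x (k - l, j) ω‖ ^ 2 * ‖x (k' - l, j) ω‖ ^ 2) ∂P := by
        refine integral_mono_of_nonneg (Eventually.of_forall fun _ => sq_nonneg _)
          (integrable_finsetSum _ fun k _ => integrable_finsetSum _ fun k' _ => hint k k')
          (Eventually.of_forall fun ω => ?_)
        have h1 : ‖∑ k ∈ S, (c k : ℂ) * (x (k - l, j) ω * star (x (k - l, j) ω))‖ ≤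
            ∑ k ∈ S, c k * ‖x (k - l, j) ω‖ ^ 2 := by
          refine (norm_sum_le _ _).trans (Finset.sum_le_sum fun k _ => ?_)
          rw [norm_mul, norm_mul, norm_star, Complex.norm_real, Real.norm_of_nonneg (hc k), sq]
        refine (pow_le_pow_left₀ (norm_nonneg _) h1 2).trans (le_of_eq ?_)
        rw [sq, Finset.sum_mul_sum]
        exact Finset.sum_congr rfl fun _ _ => Finset.sum_congr rfl fun _ _ => by ring
    _ = ∑ k ∈ S, ∑ k' ∈ S,
        (c k * c k') * ∫ ω, ‖x (k - l, j) ω‖ ^ 2 * ‖x (k' - l, j) ω‖ ^ 2 ∂P := by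
        rw [integral_finsetSum _ fun k _ => integrable_finsetSum _ fun k' _ => hint k k']
        refine Finset.sum_congr rfl fun k _ => ?_
        rw [integral_finsetSum _ fun k' _ => hint k k']
        exact Finset.sum_congr rfl fun k' _ => integral_const_mul _ _
    _ ≤ ∑ k ∈ S, ∑ k' ∈ S,
        (c k * c k') * (C * (wt (k - l) ^ (-2 : ℝ) * wt (k' - l) ^ (-2 : ℝ))) := by
        refine Finset.sum_le_sum fun k _ => Finset.sum_le_sum fun k' _ => ?_
        exact mul_le_mul_of_nonneg_left (h.integral_sq_mul_sq_le _ _)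
          (mul_nonneg (hc k) (hc k'))
    _ = _ := by
        rw [sq, Finset.sum_mul_sum, Finset.mul_sum]
        refine Finset.sum_congr rfl fun _ _ => ?_
        rw [Finset.mul_sum]
        exact Finset.sum_congr rfl fun _ _ => by ring

theorem integrable_schatten_entry (h : NoiseFamily P x C) (j : Fin 3) (l l' : Fin 2 → ℤ)
    (c : (Fin 2 → ℤ) → ℝ) (S : Finset (Fin 2 → ℤ)) :
    Integrable (fun ω =>
      ‖∑ k ∈ S, (c k : ℂ) * (x (k - l, j) ω * star (x (k - l', j) ω))‖ ^ 2) P := by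
  have h1 : MemLp (fun ω => ∑ k ∈ S, (c k : ℂ) * (x (k - l, j) ω * star (x (k - l', j) ω))) 2 P :=
    memLp_finsetSum _ fun k _ => (h.memLp_mul_star _ _).const_mul _
  exact h1.integrable_norm_pow (by norm_num)

theorem integrable_schattenSum (h : NoiseFamily P x C) (s t : ℝ) (j : Fin 3)
    (S : Finset (Fin 2 → ℤ)) :
    Integrable (fun ω => schattenSum s t (fun k => x (k, j) ω) S) P := by
  refine integrable_finsetSum _ fun l _ => integrable_finsetSum _ fun l' _ => ?_
  simp only [mul_pow _ (‖_‖)]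
  exact (h.integrable_schatten_entry j l l' _ S).const_mul _

/-- The cancellation off the diagonal gives the sums D, where the convolutions over l and l' are
carried out first and leave `wt k ^ (-2c)`. The diagonal gives E, where the convolution over k comes
first and leaves `wt l ^ (-2c')`. The hypotheses are the conditions for these convolutions and for
the remaining lattice sums to converge. -/
theorem integral_schattenSum_le (h : NoiseFamily P x C) {s t c c' : ℝ} (hc0 : 0 ≤ c)
    (hcs : c ≤ 2 * s) (hc2 : c ≤ 2) (hc3 : 2 < 2 * s + 2 - c) (hc4 : 2 < 4 * t + 2 * c)
    (hc0' : 0 ≤ c') (hct : c' ≤ 2 * t) (hc2' : c' ≤ 2) (hc3' : 2 < 2 * t + 2 - c')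
    (hc4' : 2 < 4 * s + 2 * c') (j : Fin 3) (S : Finset (Fin 2 → ℤ)) :
    ∫ ω, schattenSum s t (fun k => x (k, j) ω) S ∂P ≤
      C * ((2 ^ c * 2 * wtSum (2 * s + 2 - c)) ^ 2 * wtSum (4 * t + 2 * c) +
        (2 ^ c' * 2 * wtSum (2 * t + 2 - c')) ^ 2 * wtSum (4 * s + 2 * c')) := by
  have hC := h.nonneg
  have hpos : ∀ (k : Fin 2 → ℤ) (r : ℝ), 0 ≤ wt k ^ r := fun k r =>
    Real.rpow_nonneg (wt_pos k).le r
  have hpow : ∀ (k : Fin 2 → ℤ) (r : ℝ), (wt k ^ r) ^ 2 = wt k ^ (2 * r) := fun k r => by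
    rw [← Real.rpow_natCast, ← Real.rpow_mul (wt_pos k).le]; congr 1; push_cast; ring
  set A := 2 ^ c * 2 * wtSum (2 * s + 2 - c)
  set A' := 2 ^ c' * 2 * wtSum (2 * t + 2 - c')
  set w : (Fin 2 → ℤ) → ℝ := fun k => wt k ^ (-(2 * t))
  set v : (Fin 2 → ℤ) → ℝ := fun l => wt l ^ (-(2 * s))
  have hv : ∀ l, 0 ≤ v l := fun l => hpos _ _
  have hsum1 : ∀ k, ∑ l ∈ S, v l * wt (k - l) ^ (-2 : ℝ) ≤ A * wt k ^ (-c) := fun k =>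
    sum_wt_conv_le hcs hc2 hc0 hc3 k S
  have hsum2 : ∀ l, ∑ k ∈ S, w k * wt (k - l) ^ (-2 : ℝ) ≤ A' * wt l ^ (-c') := fun l => by
    simp only [wt_sub_comm _ l]
    exact sum_wt_conv_le hct hc2' hc0' hc3' l S
  set D : (Fin 2 → ℤ) → (Fin 2 → ℤ) → ℝ := fun l l' =>
    ∑ k ∈ S, w k ^ 2 * (wt (k - l) ^ (-2 : ℝ) * wt (k - l') ^ (-2 : ℝ))
  set E : (Fin 2 → ℤ) → ℝ := fun l => (∑ k ∈ S, w k * wt (k - l) ^ (-2 : ℝ)) ^ 2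
  have hD0 : ∀ l l', 0 ≤ D l l' := fun l l' => Finset.sum_nonneg fun k _ =>
    mul_nonneg (sq_nonneg _) (mul_nonneg (hpos _ _) (hpos _ _))
  have hentry : ∀ l l',
      ∫ ω, ‖∑ k ∈ S, (w k : ℂ) * (x (k - l, j) ω * star (x (k - l', j) ω))‖ ^ 2 ∂P ≤
        C * (D l l' + if l = l' then E l else 0) := by
    intro l l'
    by_cases hl : l = l'
    · subst hl
      rw [if_pos rfl]
      refine (h.integral_norm_sq_diag_le j l (fun k => hpos k _) S).trans ?_
      exact mul_le_mul_of_nonneg_left (le_add_of_nonneg_left (hD0 l l)) hC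
    · rw [if_neg hl, add_zero]
      exact h.integral_norm_sq_offDiag_le j hl w S
  have hsumD : ∑ l ∈ S, ∑ l' ∈ S, (v l * v l') * D l l' ≤ A ^ 2 * wtSum (4 * t + 2 * c) := by
    calc _ = ∑ k ∈ S, w k ^ 2 * (∑ l ∈ S, v l * wt (k - l) ^ (-2 : ℝ)) ^ 2 := by
          simp only [D, Finset.mul_sum]
          have : ∀ l ∈ S, ∑ l' ∈ S, ∑ k ∈ S, v l * v l' *
              (w k ^ 2 * (wt (k - l) ^ (-2 : ℝ) * wt (k - l') ^ (-2 : ℝ))) =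
              ∑ k ∈ S, ∑ l' ∈ S, v l * v l' *
              (w k ^ 2 * (wt (k - l) ^ (-2 : ℝ) * wt (k - l') ^ (-2 : ℝ))) := fun l _ =>
            Finset.sum_comm
          rw [Finset.sum_congr rfl this, Finset.sum_comm]
          refine Finset.sum_congr rfl fun k _ => ?_
          rw [sq (∑ l ∈ S, _), Finset.sum_mul_sum, Finset.mul_sum]
          refine Finset.sum_congr rfl fun l _ => ?_
          rw [Finset.mul_sum]
          exact Finset.sum_congr rfl fun l' _ => by ring
      _ ≤ ∑ k ∈ S, w k ^ 2 * (A * wt k ^ (-c)) ^ 2 := by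
          refine Finset.sum_le_sum fun k _ => mul_le_mul_of_nonneg_left ?_ (sq_nonneg _)
          exact pow_le_pow_left₀ (Finset.sum_nonneg fun l _ => mul_nonneg (hv l) (hpos _ _))
            (hsum1 k) 2
      _ = A ^ 2 * ∑ k ∈ S, wt k ^ (-(4 * t + 2 * c)) := by
          rw [Finset.mul_sum]
          refine Finset.sum_congr rfl fun k _ => ?_
          rw [mul_pow, hpow, hpow, mul_left_comm, ← Real.rpow_add (wt_pos k)]
          congr 2
          ring
      _ ≤ _ := by
          refine mul_le_mul_of_nonneg_left ?_ (sq_nonneg A)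
          exact (summable_wt_rpow hc4).sum_le_tsum S fun k _ => hpos _ _
  have hsumE : ∑ l ∈ S, v l ^ 2 * E l ≤ A' ^ 2 * wtSum (4 * s + 2 * c') := by
    calc _ ≤ ∑ l ∈ S, v l ^ 2 * (A' * wt l ^ (-c')) ^ 2 := by
          refine Finset.sum_le_sum fun l _ => mul_le_mul_of_nonneg_left ?_ (sq_nonneg _)
          exact pow_le_pow_left₀ (Finset.sum_nonneg fun k _ => mul_nonneg (hpos _ _) (hpos _ _))
            (hsum2 l) 2
      _ = A' ^ 2 * ∑ l ∈ S, wt l ^ (-(4 * s + 2 * c')) := by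
          rw [Finset.mul_sum]
          refine Finset.sum_congr rfl fun k _ => ?_
          rw [mul_pow, hpow, hpow, mul_left_comm, ← Real.rpow_add (wt_pos k)]
          congr 2
          ring
      _ ≤ _ := by
          refine mul_le_mul_of_nonneg_left ?_ (sq_nonneg A')
          exact (summable_wt_rpow hc4').sum_le_tsum S fun k _ => hpos _ _
  have hvv : ∀ l l' : Fin 2 → ℤ, (wt l ^ (-s) * wt l' ^ (-s)) ^ 2 = v l * v l' := fun l l' => by
    rw [mul_pow, hpow, hpow, mul_neg]
  have hint := fun l l' =>
    (h.integrable_schatten_entry j l l' w S).const_mul (v l * v l')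
  calc _ = ∑ l ∈ S, ∑ l' ∈ S, (v l * v l') *
        ∫ ω, ‖∑ k ∈ S, (w k : ℂ) * (x (k - l, j) ω * star (x (k - l', j) ω))‖ ^ 2 ∂P := by
        simp only [schattenSum, mul_pow _ (‖_‖), hvv]
        rw [integral_finsetSum _ fun l _ => integrable_finsetSum _ fun l' _ => hint l l']
        refine Finset.sum_congr rfl fun l _ => ?_
        rw [integral_finsetSum _ fun l' _ => hint l l']
        exact Finset.sum_congr rfl fun l' _ => integral_const_mul _ _
    _ ≤ ∑ l ∈ S, ∑ l' ∈ S, (v l * v l') * (C * (D l l' + if l = l' then E l else 0)) := by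
        refine Finset.sum_le_sum fun l _ => Finset.sum_le_sum fun l' _ => ?_
        exact mul_le_mul_of_nonneg_left (hentry l l') (mul_nonneg (hv l) (hv l'))
    _ = C * (∑ l ∈ S, ∑ l' ∈ S, (v l * v l') * D l l' + ∑ l ∈ S, v l ^ 2 * E l) := by
        rw [mul_add, Finset.mul_sum, Finset.mul_sum, ← Finset.sum_add_distrib]
        refine Finset.sum_congr rfl fun l hl => ?_
        have e : ∑ l' ∈ S, (v l * v l') * (if l = l' then E l else 0) = v l ^ 2 * E l := by
          rw [Finset.sum_eq_single_of_mem l hl fun l' _ hne => by rw [if_neg hne.symm, mul_zero],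
            if_pos rfl, sq]
        rw [← e, Finset.mul_sum, Finset.mul_sum, ← Finset.sum_add_distrib]
        exact Finset.sum_congr rfl fun l' _ => by ring
    _ ≤ _ := mul_le_mul_of_nonneg_left (add_le_add hsumD hsumE) hC

/-- The value c = 2 - 11κ/8 lies κ/8 below twice the exponent 1 - 5κ/8, and this slack makes the
first convolution converge. The choice c' = 3κ/8 leaves a slack of 3κ/8 in the second. -/
theorem boundedInProb_opBound (h : NoiseFamily P x C) {κ : ℝ} (hκ : 0 < κ) (hκ1 : κ < 1 / 2)
    (j : Fin 3) : BoundedInProb P fun ω K =>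
      OpBound (fun k => x (k, j) ω) (1 - 5 * κ / 8) (3 * κ / 8) (√(√K)) :=
  BoundedInProb.of_frequently_real
    (Y := fun n ω => schattenSum (1 - 5 * κ / 8) (3 * κ / 8) (fun k => x (k, j) ω) (freqBox n))
    (fun n ω => schattenSum_nonneg _ _ _ _) (fun n => h.integrable_schattenSum _ _ j _)
    (fun n => h.integral_schattenSum_le (c := 2 - 11 * κ / 8) (c' := 3 * κ / 8)
      (by linarith) (by linarith) (by linarith) (by linarith) (by linarith) (by linarith)
      (by linarith) (by linarith) (by linarith) (by linarith) j (freqBox n))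
    fun _ _ _ hfr => opBound_of_frequently_schattenSum hfr

end NoiseFamily

/-! ## Products of mollified noises -/

/-- The derivative has size ‖k‖ and decays in s‖k‖ to every order; order `⌈q⌉₊` covers the real
exponent q. At k = 0 the transform is constant and the derivative vanishes. -/
theorem IsKernel.exists_norm_deriv_waveFT_le {f : Plane → ℝ} (h : IsKernel f) {q : ℝ}
    (hq : 0 ≤ q) : ∃ C, 0 ≤ C ∧ ∀ (k : Fin 2 → ℤ) (s : ℝ), 0 < s →
      ‖deriv (waveFT f k) s‖ ≤ C * wt k * (s * wt k) ^ (-q) := by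
  obtain ⟨C₀, hC₀, h₀⟩ := exists_pow_mul_norm_deriv_waveFT_le 0 h.contDiff h.hasCompactSupport
  obtain ⟨C₁, hC₁, h₁⟩ :=
    exists_pow_mul_norm_deriv_waveFT_le ⌈q⌉₊ h.contDiff h.hasCompactSupport
  refine ⟨C₀ + 2 ^ ⌈q⌉₊ * C₁, by positivity, fun k s hs => ?_⟩
  have hw := wt_pos k
  have hx : 0 < s * wt k := by positivity
  by_cases hk : k = 0
  · have e : waveFT f k = fun _ => 1 := funext fun t => by rw [hk, h.waveFT_zero]
    rw [e, deriv_const, norm_zero]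
    positivity
  have a0 := h₀ k s hs.le
  have a1 := h₁ k s hs.le
  rw [pow_zero, one_mul] at a0
  rw [Real.rpow_neg hx.le, ← div_eq_mul_inv, le_div_iff₀ (by positivity)]
  have h2 : (s * wt k) ^ q ≤ 1 + 2 ^ ⌈q⌉₊ * (s * ‖k‖) ^ ⌈q⌉₊ := by
    rcases le_total (s * wt k) 1 with h3 | h3
    · exact (Real.rpow_le_one hx.le h3 hq).trans (le_add_of_nonneg_right (by positivity))
    · calc (s * wt k) ^ q ≤ (s * wt k) ^ (⌈q⌉₊ : ℝ) :=
            Real.rpow_le_rpow_of_exponent_le h3 (Nat.le_ceil q)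
        _ = (s * wt k) ^ ⌈q⌉₊ := Real.rpow_natCast _ _
        _ ≤ (s * (2 * ‖k‖)) ^ ⌈q⌉₊ := by gcongr; exact wt_le_two_mul_norm hk
        _ = 2 ^ ⌈q⌉₊ * (s * ‖k‖) ^ ⌈q⌉₊ := by rw [← mul_pow]; congr 1; ring
        _ ≤ _ := by linarith
  have hk1 : ‖k‖ ≤ wt k := by unfold wt; linarith
  calc _ ≤ ‖deriv (waveFT f k) s‖ * (1 + 2 ^ ⌈q⌉₊ * (s * ‖k‖) ^ ⌈q⌉₊) := by gcongr
    _ = ‖deriv (waveFT f k) s‖ +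
        2 ^ ⌈q⌉₊ * ((s * ‖k‖) ^ ⌈q⌉₊ * ‖deriv (waveFT f k) s‖) := by ring
    _ ≤ C₀ * ‖k‖ + 2 ^ ⌈q⌉₊ * (C₁ * ‖k‖) := by gcongr
    _ = (C₀ + 2 ^ ⌈q⌉₊ * C₁) * ‖k‖ := by ring
    _ ≤ _ := by gcongr

theorem IsKernel.differentiable_waveFT {f : Plane → ℝ} (h : IsKernel f) (k : Fin 2 → ℤ) :
    Differentiable ℝ (waveFT f k) := fun t =>
  (hasDerivAt_waveFT h.contDiff.continuous h.hasCompactSupport k t).differentiableAt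

theorem IsKernel.continuous_deriv_waveFT {f : Plane → ℝ} (h : IsKernel f) (k : Fin 2 → ℤ) :
    Continuous (deriv (waveFT f k)) :=
  _root_.continuous_deriv_waveFT h.contDiff.continuous h.hasCompactSupport k

/-- Cauchy–Schwarz with the weight s^{-1+2β}, whose integral over (0, b] is b^{2β} / (2β). It is
obtained by integrating 2t‖g‖ ≤ t² s^{-1+2β} + s^{1-2β} ‖g‖² with the optimal t = X / A. -/
theorem norm_sq_intervalIntegral_le {g : ℝ → ℂ} (hg : Continuous g) {a b β : ℝ} (ha : 0 < a)
    (hab : a ≤ b) (hβ : 0 < β) :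
    ‖∫ s in a..b, g s‖ ^ 2 ≤ b ^ (2 * β) / (2 * β) * ∫ s in a..b, s ^ (1 - 2 * β) * ‖g s‖ ^ 2 := by
  have hb : 0 < b := ha.trans_le hab
  have hcont : ∀ r : ℝ, ContinuousOn (fun s : ℝ => s ^ r) (Set.uIcc a b) := fun r s hs => by
    rw [Set.uIcc_of_le hab] at hs
    exact (Real.continuousAt_rpow_const s r (Or.inl (ha.trans_le hs.1).ne')).continuousWithinAt
  set X := ∫ s in a..b, ‖g s‖
  set B := ∫ s in a..b, s ^ (1 - 2 * β) * ‖g s‖ ^ 2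
  set A := b ^ (2 * β) / (2 * β)
  have hA : 0 < A := by positivity
  have hA' : ∫ s in a..b, s ^ (-1 + 2 * β) ≤ A := by
    rw [integral_rpow (Or.inl (by linarith)), show -1 + 2 * β + 1 = 2 * β by ring]
    have : 0 ≤ a ^ (2 * β) := by positivity
    simp only [A]
    gcongr
    linarith
  have hX : ‖∫ s in a..b, g s‖ ≤ X := intervalIntegral.norm_integral_le_integral_norm hab
  have hX0 : 0 ≤ X := (norm_nonneg _).trans hX
  have i1 : IntervalIntegrable (fun s => s ^ (1 - 2 * β) * ‖g s‖ ^ 2) volume a b :=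
    ((hcont _).mul (hg.norm.pow 2).continuousOn).intervalIntegrable
  have i2 : IntervalIntegrable (fun s : ℝ => s ^ (-1 + 2 * β)) volume a b :=
    (hcont _).intervalIntegrable
  set t := X / A
  have key : 2 * t * X ≤ t ^ 2 * A + B := by
    calc 2 * t * X = ∫ s in a..b, 2 * t * ‖g s‖ := by rw [intervalIntegral.integral_const_mul]
      _ ≤ ∫ s in a..b, (t ^ 2 * s ^ (-1 + 2 * β) + s ^ (1 - 2 * β) * ‖g s‖ ^ 2) := by
          refine intervalIntegral.integral_mono_on hab
            ((hg.norm.const_mul (2 * t)).intervalIntegrable a b) ((i2.const_mul _).add i1)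
            fun s hs => ?_
          have hs0 : 0 < s := ha.trans_le hs.1
          have e : s ^ (-1 + 2 * β) * s ^ (1 - 2 * β) = 1 := by
            rw [← Real.rpow_add hs0]; simp
          have hv : 0 < s ^ (1 - 2 * β) := by positivity
          have e2 : s ^ (-1 + 2 * β) = (s ^ (1 - 2 * β))⁻¹ := eq_inv_of_mul_eq_one_left e
          rw [e2]
          set v := s ^ (1 - 2 * β)
          have : t ^ 2 * v⁻¹ + v * ‖g s‖ ^ 2 - 2 * t * ‖g s‖ = (t - v * ‖g s‖) ^ 2 * v⁻¹ := by
            field_simp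
            ring
          have h2 : 0 ≤ (t - v * ‖g s‖) ^ 2 * v⁻¹ := by positivity
          linarith
      _ = t ^ 2 * (∫ s in a..b, s ^ (-1 + 2 * β)) + B := by
          rw [intervalIntegral.integral_add (i2.const_mul _) i1,
            intervalIntegral.integral_const_mul]
      _ ≤ _ := by gcongr
  have e1 : t * A = X := by simp only [t]; field_simp
  calc _ ≤ X ^ 2 := pow_le_pow_left₀ (norm_nonneg _) hX 2
    _ ≤ A * B := by
        have h3 : t ^ 2 * A = t * X := by rw [sq, mul_assoc, e1]
        have h4 : t * X ≤ B := by linarith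
        calc X ^ 2 = A * (t * X) := by rw [← mul_assoc, mul_comm A t, e1, sq]
          _ ≤ _ := by gcongr

/-- The multiplier of the product of two mollified functions. -/
noncomputable def pairMult (f : Plane → ℝ) (k l : Fin 2 → ℤ) (s : ℝ) : ℂ :=
  waveFT f (k - l) s * waveFT f l s

namespace IsKernel

variable {f : Plane → ℝ}

theorem deriv_pairMult (h : IsKernel f) (k l : Fin 2 → ℤ) (s : ℝ) :
    deriv (pairMult f k l) s =
      deriv (waveFT f (k - l)) s * waveFT f l s + waveFT f (k - l) s * deriv (waveFT f l) s :=
  ((h.differentiable_waveFT (k - l) s).hasDerivAt.mul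
    (h.differentiable_waveFT l s).hasDerivAt).deriv

theorem differentiable_pairMult (h : IsKernel f) (k l : Fin 2 → ℤ) :
    Differentiable ℝ (pairMult f k l) :=
  (h.differentiable_waveFT (k - l)).mul (h.differentiable_waveFT l)

theorem continuous_deriv_pairMult (h : IsKernel f) (k l : Fin 2 → ℤ) :
    Continuous (deriv (pairMult f k l)) := by
  rw [funext (h.deriv_pairMult k l)]
  exact ((h.continuous_deriv_waveFT _).mul (h.differentiable_waveFT _).continuous).add
    ((h.differentiable_waveFT _).continuous.mul (h.continuous_deriv_waveFT _))

/-- The product rule: one factor is at most 1, and the derivative of the other is at most a multiple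
of s^{-1+b} times the power b of its weight. -/
theorem exists_norm_sq_deriv_pairMult_le (h : IsKernel f) {b : ℝ} (hb1 : b ≤ 1) :
    ∃ C, 0 ≤ C ∧ ∀ (k l : Fin 2 → ℤ) (s : ℝ), 0 < s → ‖deriv (pairMult f k l) s‖ ^ 2 ≤
      C * s ^ (-2 + 2 * b) * (wt (k - l) ^ (2 * b) + wt l ^ (2 * b)) := by
  obtain ⟨C, hC, hd⟩ := h.exists_norm_deriv_waveFT_le (q := 1 - b) (by linarith)
  refine ⟨2 * C ^ 2, by positivity, fun k l s hs => ?_⟩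
  have hd' : ∀ k, ‖deriv (waveFT f k) s‖ ≤ C * (s ^ (-1 + b) * wt k ^ b) := fun k => by
    have hw := wt_pos k
    refine (hd k s hs).trans (le_of_eq ?_)
    rw [Real.mul_rpow hs.le hw.le]
    have e : wt k ^ b = wt k * wt k ^ (-(1 - b)) := by
      nth_rewrite 2 [← Real.rpow_one (wt k)]
      rw [← Real.rpow_add hw]; congr 1; ring
    have e2 : s ^ (-1 + b) = s ^ (-(1 - b)) := by congr 1; ring
    rw [e, e2]; ring
  have h1 : ‖deriv (pairMult f k l) s‖ ≤
      C * (s ^ (-1 + b) * wt (k - l) ^ b) + C * (s ^ (-1 + b) * wt l ^ b) := by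
    rw [h.deriv_pairMult]
    refine (norm_add_le _ _).trans ?_
    rw [norm_mul, norm_mul]
    refine add_le_add ?_ ?_
    · exact (mul_le_of_le_one_right (norm_nonneg _) (h.norm_waveFT_le_one _ _)).trans (hd' _)
    · exact (mul_le_of_le_one_left (norm_nonneg _) (h.norm_waveFT_le_one _ _)).trans (hd' _)
  have e : ∀ {y : ℝ}, 0 < y → ∀ r : ℝ, y ^ (2 * r) = (y ^ r) ^ 2 := fun hy r => by
    rw [← Real.rpow_natCast, ← Real.rpow_mul hy.le]; congr 1; push_cast; ring
  rw [show -2 + 2 * b = 2 * (-1 + b) by ring, e hs, e (wt_pos _), e (wt_pos _)]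
  refine (pow_le_pow_left₀ (norm_nonneg _) h1 2).trans ?_
  set u := wt (k - l) ^ b
  set v := wt l ^ b
  set r := s ^ (-1 + b)
  nlinarith [sq_nonneg (C * r * (u - v))]

end IsKernel

/-- The derivative in `s` of the truncated coefficients of the product of two noises mollified at
scale `s`. -/
noncomputable def prodDeriv (f : Plane → ℝ) (z w : (Fin 2 → ℤ) → ℂ) (S : Finset (Fin 2 → ℤ))
    (k : Fin 2 → ℤ) (s : ℝ) : ℂ :=
  ∑ l ∈ S, deriv (pairMult f k l) s * (z (k - l) * w l)

/-- The density of the quantity which controls the products of two mollified noises. -/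
noncomputable def prodDensity (f : Plane → ℝ) (κ : ℝ) (z w : (Fin 2 → ℤ) → ℂ)
    (S : Finset (Fin 2 → ℤ)) (s : ℝ) : ℝ :=
  ∑ k ∈ S, wt k ^ (-κ) * (s ^ (1 - 2 * (κ / 8)) * ‖prodDeriv f z w S k s‖ ^ 2)

/-- The difference of the products at two scales is the integral of `prodDeriv` between them. By
`norm_sq_intervalIntegral_le` with β = κ/8, a bound on the integral of `prodDensity` over (0, 1]
gives the rate for all pairs of scales. The truncated sums converge because the mollified sequences
are summable. -/
theorem hsBound_conv_mollSeq_sub {f : Plane → ℝ} (h : IsKernel f) {κ K : ℝ} (hκ : 0 < κ)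
    (hK : 0 ≤ K) {z w : (Fin 2 → ℤ) → ℂ}
    (hz : ∀ ε, 0 < ε → WtSummable 0 (mollSeq f ε z))
    (hw : ∀ ε, 0 < ε → WtSummable 0 (mollSeq f ε w))
    (hfr : ∃ᶠ n in atTop, ∫⁻ s in Set.Ioc (0 : ℝ) 1,
      ENNReal.ofReal (prodDensity f κ z w (freqBox n) s) ≤ ENNReal.ofReal K)
    {ε ε' : ℝ} (hε' : 0 < ε') (hle : ε' ≤ ε) (hε1 : ε ≤ 1) :
    HsBound (-(κ / 2)) (fun k => conv (mollSeq f ε z) (mollSeq f ε w) k -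
      conv (mollSeq f ε' z) (mollSeq f ε' w) k) (√(4 / κ * K) * ε ^ (κ / 8)) := by
  have hε : 0 < ε := hε'.trans_le hle
  refine ⟨by positivity, fun S₀ => ?_⟩
  have hpos : ∀ (k : Fin 2 → ℤ) (r : ℝ), 0 ≤ wt k ^ r := fun k r =>
    Real.rpow_nonneg (wt_pos k).le r
  set Δ : Finset (Fin 2 → ℤ) → (Fin 2 → ℤ) → ℂ := fun S k =>
    ∑ l ∈ S, (pairMult f k l ε - pairMult f k l ε') * (z (k - l) * w l)
  have hlim : ∀ k, Tendsto (fun n => Δ (freqBox n) k) atTop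
      (𝓝 (conv (mollSeq f ε z) (mollSeq f ε w) k - conv (mollSeq f ε' z) (mollSeq f ε' w) k)) := by
    intro k
    have h1 : ∀ ε, 0 < ε → HasSum (fun l => pairMult f k l ε * (z (k - l) * w l))
        (conv (mollSeq f ε z) (mollSeq f ε w) k) := fun ε hε => by
      have := ((hz ε hε).convSummable (hw ε hε) k).of_norm.hasSum
      have e : (fun l => pairMult f k l ε * (z (k - l) * w l)) =
          fun l => mollSeq f ε z (k - l) * mollSeq f ε w l := funext fun l => by
        simp only [mollSeq, pairMult]
        ring
      rw [e]
      exact this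
    have h2 := (h1 ε hε).sub (h1 ε' hε')
    refine (Tendsto.comp h2 tendsto_freqBox).congr fun n => ?_
    simp only [Δ, Function.comp, sub_mul]
  have hT : Tendsto (fun n => ∑ k ∈ S₀, (wt k ^ (-(κ / 2)) * ‖Δ (freqBox n) k‖) ^ 2) atTop
      (𝓝 (∑ k ∈ S₀, (wt k ^ (-(κ / 2)) * ‖conv (mollSeq f ε z) (mollSeq f ε w) k -
        conv (mollSeq f ε' z) (mollSeq f ε' w) k‖) ^ 2)) :=
    tendsto_finsetSum _ fun k _ => ((hlim k).norm.const_mul _).pow 2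
  have hev := hfr.and_eventually (eventually_subset_freqBox S₀)
  refine le_of_tendsto_of_frequently hT (hev.mono fun n hn => ?_)
  obtain ⟨hn, hS⟩ := hn
  set S := freqBox n
  have hcont : ∀ k, Continuous (prodDeriv f z w S k) := fun k =>
    continuous_finsetSum _ fun l _ => (h.continuous_deriv_pairMult k l).mul continuous_const
  have hΔ : ∀ k, Δ S k = ∫ s in ε'..ε, prodDeriv f z w S k s := by
    intro k
    have hil : ∀ l, IntervalIntegrable (fun s => deriv (pairMult f k l) s * (z (k - l) * w l))
        volume ε' ε := fun l =>
      ((h.continuous_deriv_pairMult k l).mul continuous_const).intervalIntegrable _ _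
    simp only [prodDeriv]
    rw [intervalIntegral.integral_finsetSum fun l _ => hil l]
    refine Finset.sum_congr rfl fun l _ => ?_
    rw [intervalIntegral.integral_mul_const,
      intervalIntegral.integral_deriv_eq_sub (fun s _ => h.differentiable_pairMult k l s)
        ((h.continuous_deriv_pairMult k l).intervalIntegrable _ _)]
  have hrc : ContinuousOn (fun s : ℝ => s ^ (1 - 2 * (κ / 8))) (Set.uIcc ε' ε) := fun s hs => by
    rw [Set.uIcc_of_le hle] at hs
    exact (Real.continuousAt_rpow_const s _
      (Or.inl (hε'.trans_le hs.1).ne')).continuousWithinAt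
  have hii : ∀ k, IntervalIntegrable (fun s =>
      s ^ (1 - 2 * (κ / 8)) * ‖prodDeriv f z w S k s‖ ^ 2) volume ε' ε := fun k =>
    (hrc.mul ((hcont k).norm.pow 2).continuousOn).intervalIntegrable
  have hD0 : ∀ s, 0 < s → 0 ≤ prodDensity f κ z w S s := fun s hs =>
    Finset.sum_nonneg fun k _ => mul_nonneg (hpos _ _) (by positivity)
  have hDint : IntervalIntegrable (prodDensity f κ z w S) volume ε' ε := by
    refine ContinuousOn.intervalIntegrable (continuousOn_finsetSum _ fun k _ => ?_)
    exact continuousOn_const.mul (hrc.mul ((hcont k).norm.pow 2).continuousOn)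
  have hI : ∫ s in ε'..ε, prodDensity f κ z w S s ≤ K := by
    rw [intervalIntegral.integral_of_le hle]
    rw [← ENNReal.ofReal_le_ofReal_iff hK]
    rw [ofReal_integral_eq_lintegral_ofReal hDint.1]
    · refine le_trans ?_ hn
      exact lintegral_mono_set (Set.Ioc_subset_Ioc hε'.le hε1)
    · filter_upwards [ae_restrict_mem measurableSet_Ioc] with s hs
      exact hD0 s (hε'.trans hs.1)
  calc ∑ k ∈ S₀, (wt k ^ (-(κ / 2)) * ‖Δ S k‖) ^ 2
      ≤ ∑ k ∈ S, (wt k ^ (-(κ / 2)) * ‖Δ S k‖) ^ 2 :=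
        Finset.sum_le_sum_of_subset_of_nonneg hS fun _ _ _ => sq_nonneg _
    _ ≤ ∑ k ∈ S, ε ^ (2 * (κ / 8)) / (2 * (κ / 8)) * (wt k ^ (-κ) *
        ∫ s in ε'..ε, s ^ (1 - 2 * (κ / 8)) * ‖prodDeriv f z w S k s‖ ^ 2) := by
        refine Finset.sum_le_sum fun k _ => ?_
        have e : (wt k ^ (-(κ / 2))) ^ 2 = wt k ^ (-κ) := by
          rw [← Real.rpow_natCast, ← Real.rpow_mul (wt_pos k).le]; congr 1; push_cast; ring
        rw [mul_pow, e, hΔ, mul_left_comm]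
        exact mul_le_mul_of_nonneg_left
          (norm_sq_intervalIntegral_le (hcont k) hε' hle (by linarith)) (hpos _ _)
    _ = ε ^ (2 * (κ / 8)) / (2 * (κ / 8)) * ∫ s in ε'..ε, prodDensity f κ z w S s := by
        rw [← Finset.mul_sum]
        congr 1
        simp only [prodDensity]
        rw [intervalIntegral.integral_finsetSum fun k _ => (hii k).const_mul _]
        exact Finset.sum_congr rfl fun k _ => (intervalIntegral.integral_const_mul _ _).symm
    _ ≤ ε ^ (2 * (κ / 8)) / (2 * (κ / 8)) * K := by gcongr
    _ = _ := by
        rw [mul_pow, Real.sq_sqrt (by positivity), ← Real.rpow_natCast, ← Real.rpow_mul hε.le]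
        push_cast
        rw [mul_comm (κ / 8) 2]
        field_simp
        ring

theorem lintegral_ofReal_rpow_lt_top {r : ℝ} (hr : -1 < r) (B : ℝ) :
    ∫⁻ s in Set.Ioc (0 : ℝ) 1, ENNReal.ofReal (B * s ^ r) < ∞ := by
  have h1 : IntervalIntegrable (fun s : ℝ => s ^ r) volume 0 1 :=
    intervalIntegral.intervalIntegrable_rpow' hr
  have h2 : IntegrableOn (fun s : ℝ => B * s ^ r) (Set.Ioc 0 1) := (h1.const_mul B).1
  exact h2.lintegral_lt_top

/-- A bound in probability for quantities which are integrals over a scale parameter. -/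
theorem BoundedInProb.of_frequently_lintegral {Ω : Type*} [MeasurableSpace Ω] {P : Measure Ω}
    [SFinite P] {H : Ω → ℝ → Prop} {F : ℕ → Ω → ℝ → ℝ}
    (hF : ∀ n, AEMeasurable (fun q : Ω × ℝ => F n q.1 q.2)
      (P.prod (volume.restrict (Set.Ioc (0 : ℝ) 1))))
    (h0 : ∀ n ω s, 0 < s → 0 ≤ F n ω s) (hint : ∀ n s, 0 < s → Integrable (fun ω => F n ω s) P)
    {B r : ℝ} (hr : -1 < r)
    (hle : ∀ n s, 0 < s → s ≤ 1 → ∫ ω, F n ω s ∂P ≤ B * s ^ r)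
    (hH : ∀ ω K, 0 ≤ K → (∃ᶠ n in atTop,
      ∫⁻ s in Set.Ioc (0 : ℝ) 1, ENNReal.ofReal (F n ω s) ≤ ENNReal.ofReal K) → H ω K) :
    BoundedInProb P H := by
  refine BoundedInProb.of_frequently
    (Y := fun n ω => ∫⁻ s in Set.Ioc (0 : ℝ) 1, ENNReal.ofReal (F n ω s))
    (fun n => (hF n).ennreal_ofReal.lintegral_prod_right')
    (lintegral_ofReal_rpow_lt_top hr B).ne (fun n => ?_) hH
  rw [lintegral_lintegral_swap (hF n).ennreal_ofReal]
  refine setLIntegral_mono' measurableSet_Ioc fun s hs => ?_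
  rw [← ofReal_integral_eq_lintegral_ofReal (hint n s hs.1)
    (Eventually.of_forall fun ω => h0 n ω s hs.1)]
  exact ENNReal.ofReal_le_ofReal (hle n s hs.1 hs.2)

/-- The powers of s are (1 - κ/4) + (-2 + κ/2) = -1 + κ/4, integrable at 0. In frequency, the
derivative costs κ/2, the convolution over l leaves c = 2 - 3κ/4, and the final sum has exponent κ +
c = 2 + κ/4. -/
theorem IsKernel.exists_sum_deriv_pairMult_le {f : Plane → ℝ} (h : IsKernel f) {κ : ℝ}
    (hκ : 0 < κ) (hκ1 : κ < 1 / 2) : ∃ B, 0 ≤ B ∧ ∀ (S : Finset (Fin 2 → ℤ)) (s : ℝ), 0 < s →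
      ∑ k ∈ S, wt k ^ (-κ) * (s ^ (1 - 2 * (κ / 8)) *
        ∑ l ∈ S, ‖deriv (pairMult f k l) s‖ ^ 2 *
          (wt (k - l) ^ (-2 : ℝ) * wt l ^ (-2 : ℝ))) ≤ B * s ^ (-1 + κ / 4) := by
  have hpos : ∀ (k : Fin 2 → ℤ) (r : ℝ), 0 ≤ wt k ^ r := fun k r =>
    Real.rpow_nonneg (wt_pos k).le r
  obtain ⟨C, hC, hd⟩ := h.exists_norm_sq_deriv_pairMult_le (b := κ / 4) (by linarith)
  set c := 2 - 3 * κ / 4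
  set a := 2 - κ / 2
  set A := 2 ^ c * 2 * wtSum (2 + a - c)
  have hA : 0 ≤ A := by
    have := wtSum_nonneg (2 + a - c)
    positivity
  have hW := wtSum_nonneg (κ + c)
  have hca : c ≤ a := by simp only [c, a]; linarith
  have hc2 : c ≤ 2 := by simp only [c]; linarith
  have hc0 : 0 ≤ c := by simp only [c]; linarith
  have h2 : 2 < 2 + a - c := by simp only [c, a]; linarith
  refine ⟨C * (2 * A) * wtSum (κ + c), by positivity, fun S s hs => ?_⟩
  have e : ∀ k : Fin 2 → ℤ, wt k ^ (2 * (κ / 4)) * wt k ^ (-2 : ℝ) = wt k ^ (-a) := fun k => by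
    rw [← Real.rpow_add (wt_pos k)]; congr 1; simp only [a]; ring
  have hin : ∀ k, ∑ l ∈ S, ‖deriv (pairMult f k l) s‖ ^ 2 *
      (wt (k - l) ^ (-2 : ℝ) * wt l ^ (-2 : ℝ)) ≤
      C * s ^ (-2 + 2 * (κ / 4)) * (2 * A * wt k ^ (-c)) := by
    intro k
    have s1 : ∑ l ∈ S, wt l ^ (-2 : ℝ) * wt (k - l) ^ (-a) ≤ A * wt k ^ (-c) :=
      sum_wt_conv_le hc2 hca hc0 h2 k S
    have s2 : ∑ l ∈ S, wt l ^ (-a) * wt (k - l) ^ (-2 : ℝ) ≤ A * wt k ^ (-c) := by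
      have := sum_wt_conv_le hca hc2 hc0 (by linarith) k S
      rwa [add_comm a 2] at this
    calc _ ≤ ∑ l ∈ S, C * s ^ (-2 + 2 * (κ / 4)) *
          (wt l ^ (-2 : ℝ) * wt (k - l) ^ (-a) + wt l ^ (-a) * wt (k - l) ^ (-2 : ℝ)) := by
          refine Finset.sum_le_sum fun l _ => ?_
          refine (mul_le_mul_of_nonneg_right (hd k l s hs)
            (mul_nonneg (hpos _ _) (hpos _ _))).trans (le_of_eq ?_)
          rw [← e, ← e]
          ring
      _ ≤ _ := by
          rw [← Finset.mul_sum, Finset.sum_add_distrib]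
          gcongr
          linarith
  calc _ ≤ ∑ k ∈ S, wt k ^ (-κ) * (s ^ (1 - 2 * (κ / 8)) *
        (C * s ^ (-2 + 2 * (κ / 4)) * (2 * A * wt k ^ (-c)))) := by
        refine Finset.sum_le_sum fun k _ => mul_le_mul_of_nonneg_left ?_ (hpos _ _)
        exact mul_le_mul_of_nonneg_left (hin k) (by positivity)
    _ = C * (2 * A) * s ^ (-1 + κ / 4) * ∑ k ∈ S, wt k ^ (-(κ + c)) := by
        rw [Finset.mul_sum]
        refine Finset.sum_congr rfl fun k _ => ?_
        have e1 : s ^ (-1 + κ / 4) = s ^ (1 - 2 * (κ / 8)) * s ^ (-2 + 2 * (κ / 4)) := by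
          rw [← Real.rpow_add hs]; congr 1; ring
        have e2 : wt k ^ (-(κ + c)) = wt k ^ (-κ) * wt k ^ (-c) := by
          rw [← Real.rpow_add (wt_pos k)]; congr 1; ring
        rw [e1, e2]
        ring
    _ ≤ C * (2 * A) * s ^ (-1 + κ / 4) * wtSum (κ + c) := by
        gcongr
        exact (summable_wt_rpow (by simp only [c]; linarith)).sum_le_tsum S fun k _ => hpos _ _
    _ = _ := by ring

namespace NoiseFamily

variable {Ω : Type*} [MeasurableSpace Ω] {P : Measure Ω}
  {x : (Fin 2 → ℤ) × Fin 3 → Ω → ℂ} {C : ℝ}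

theorem aemeasurable (h : NoiseFamily P x C) (a : (Fin 2 → ℤ) × Fin 3) : AEMeasurable (x a) P :=
  (h.memLp a).aestronglyMeasurable.aemeasurable

/-- As the components i and i' differ, an index (k - l, i) never coincides with one of the second
component. The summands at different l are therefore orthogonal, and the second moment is a single
sum over l without any diagonal divergence. -/
theorem boundedInProb_conv [SFinite P] (h : NoiseFamily P x C) {f : Plane → ℝ} (hf : IsKernel f)
    {κ : ℝ} (hκ : 0 < κ) (hκ1 : κ < 1 / 2) {i i' : Fin 3} (hi : i ≠ i') :
    BoundedInProb P fun ω K =>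
      (∀ ε, 0 < ε → WtSummable 0 (mollSeq f ε fun k => x (k, i) ω)) →
      (∀ ε, 0 < ε → WtSummable 0 (mollSeq f ε (starSeq fun k => x (k, i') ω))) →
      ∀ ε ε', 0 < ε' → ε' ≤ ε → ε ≤ 1 → HsBound (-(κ / 2)) (fun k =>
        conv (mollSeq f ε fun k => x (k, i) ω) (mollSeq f ε (starSeq fun k => x (k, i') ω)) k -
        conv (mollSeq f ε' fun k => x (k, i) ω) (mollSeq f ε' (starSeq fun k => x (k, i') ω)) k)
        (√(4 / κ * K) * ε ^ (κ / 8)) := by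
  obtain ⟨B, hB, hsum⟩ := hf.exists_sum_deriv_pairMult_le hκ hκ1
  have hC := h.nonneg
  have hpos : ∀ (k : Fin 2 → ℤ) (r : ℝ), 0 ≤ wt k ^ r := fun k r =>
    Real.rpow_nonneg (wt_pos k).le r
  have hmem : ∀ k l, MemLp (fun ω => x (k - l, i) ω * star (x (-l, i') ω)) 2 P := fun k l =>
    h.memLp_mul_star _ _
  have hI : ∀ (S : Finset (Fin 2 → ℤ)) (k : Fin 2 → ℤ) (s : ℝ), Integrable (fun ω =>
      ‖prodDeriv f (fun k => x (k, i) ω) (starSeq fun k => x (k, i') ω) S k s‖ ^ 2) P := by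
    intro S k s
    have h1 : MemLp (fun ω => ∑ l ∈ S, deriv (pairMult f k l) s *
        (x (k - l, i) ω * star (x (-l, i') ω))) 2 P :=
      memLp_finsetSum _ fun l _ => (hmem k l).const_mul _
    exact h1.integrable_norm_pow (by norm_num)
  have hE : ∀ (S : Finset (Fin 2 → ℤ)) (k : Fin 2 → ℤ) (s : ℝ), ∫ ω,
      ‖prodDeriv f (fun k => x (k, i) ω) (starSeq fun k => x (k, i') ω) S k s‖ ^ 2 ∂P ≤
      C * ∑ l ∈ S, ‖deriv (pairMult f k l) s‖ ^ 2 *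
        (wt (k - l) ^ (-2 : ℝ) * wt l ^ (-2 : ℝ)) := by
    intro S k s
    have h1 := integral_norm_sq_sum (hmem k) S (fun l => deriv (pairMult f k l) s) ?_
    · refine (le_of_eq h1).trans ?_
      rw [Finset.mul_sum]
      refine Finset.sum_le_sum fun l _ => ?_
      simp only [norm_mul, norm_star, mul_pow]
      have := h.integral_sq_mul_sq_le (k - l, i) (-l, i')
      simp only [wt_neg] at this
      exact (mul_le_mul_of_nonneg_left this (sq_nonneg _)).trans (le_of_eq (by ring))
    · intro l _ l' _ hl
      have e : ∀ ω, x (k - l, i) ω * star (x (-l, i') ω) *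
          star (x (k - l', i) ω * star (x (-l', i') ω)) =
          x (k - l, i) ω * star (x (-l, i') ω) * star (x (k - l', i) ω) * x (-l', i') ω := by
        intro ω
        rw [star_mul', star_star]
        ring
      simp only [e]
      exact h.vanish _ _ _ _ (fun h => hi (Prod.ext_iff.mp h).2)
        (fun h => hl (by simpa using h)) fun h => hi (Prod.ext_iff.mp h).2
  refine BoundedInProb.of_frequently_lintegral (B := C * B) (r := -1 + κ / 4)
    (F := fun n ω => prodDensity f κ (fun k => x (k, i) ω) (starSeq fun k => x (k, i') ω)
      (freqBox n)) (fun n => ?_) (fun n ω s hs => ?_) (fun n s hs => ?_) (by linarith)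
    (fun n s hs hs1 => ?_) fun ω K hK hfr hz hw ε ε' hε' hle hε1 =>
      hsBound_conv_mollSeq_sub hf hκ hK hz hw hfr hε' hle hε1
  · have hx : ∀ a, AEMeasurable (fun q : Ω × ℝ => x a q.1)
        (P.prod (volume.restrict (Set.Ioc (0 : ℝ) 1))) := fun a =>
      (h.aemeasurable a).comp_quasiMeasurePreserving Measure.quasiMeasurePreserving_fst
    have hs : ∀ r : ℝ, Measurable fun q : Ω × ℝ => q.2 ^ r := fun r =>
      measurable_snd.pow_const r
    have hd : ∀ k l, Measurable fun q : Ω × ℝ => deriv (pairMult f k l) q.2 := fun k l =>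
      (hf.continuous_deriv_pairMult k l).measurable.comp measurable_snd
    simp only [prodDensity, prodDeriv, starSeq]
    refine Finset.aemeasurable_fun_sum _ fun k _ => AEMeasurable.const_mul ?_ _
    refine (hs _).aemeasurable.mul (AEMeasurable.pow_const (AEMeasurable.norm ?_) 2)
    refine Finset.aemeasurable_fun_sum _ fun l _ => (hd k l).aemeasurable.mul ((hx _).mul ?_)
    exact continuous_star.measurable.comp_aemeasurable (hx _)
  · exact Finset.sum_nonneg fun k _ => mul_nonneg (hpos _ _) (by positivity)
  · exact integrable_finsetSum _ fun k _ => ((hI _ k s).const_mul _).const_mul _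
  · simp only [prodDensity]
    rw [integral_finsetSum _ fun k _ => ((hI _ k s).const_mul _).const_mul _]
    calc _ ≤ ∑ k ∈ freqBox n, C * (wt k ^ (-κ) * (s ^ (1 - 2 * (κ / 8)) *
          ∑ l ∈ freqBox n, ‖deriv (pairMult f k l) s‖ ^ 2 *
            (wt (k - l) ^ (-2 : ℝ) * wt l ^ (-2 : ℝ)))) := by
          refine Finset.sum_le_sum fun k _ => ?_
          rw [integral_const_mul, integral_const_mul]
          have h1 := mul_le_mul_of_nonneg_left (hE (freqBox n) k s)
            (mul_nonneg (hpos k (-κ)) (Real.rpow_nonneg hs.le (1 - 2 * (κ / 8))))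
          rw [← mul_assoc]
          exact h1.trans (le_of_eq (by ring))
      _ ≤ _ := by
          rw [← Finset.mul_sum, mul_assoc]
          exact mul_le_mul_of_nonneg_left (hsum _ s hs) hC

end NoiseFamily

/-! ## Testing the derivative of the mollified noise -/

/-- The trigonometric polynomial with coefficients `c` and frequencies in `S`. -/
noncomputable def trigPoly (c : (Fin 2 → ℤ) → ℂ) (S : Finset (Fin 2 → ℤ)) (x : Plane) : ℂ :=
  ∑ k ∈ S, c k * character k x

theorem continuous_trigPoly (c : (Fin 2 → ℤ) → ℂ) (S : Finset (Fin 2 → ℤ)) :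
    Continuous (trigPoly c S) :=
  continuous_finsetSum _ fun k _ => continuous_const.mul (continuous_character k)

theorem trigPoly_add_latticePt (c : (Fin 2 → ℤ) → ℂ) (S : Finset (Fin 2 → ℤ)) (x : Plane)
    (n : Fin 2 → ℤ) : trigPoly c S (x + latticePt n) = trigPoly c S x := by
  simp only [trigPoly, character_add, character_latticePt, mul_one]

/-- The integral of `|F|^p` over the torus, for the trigonometric polynomial `F`. -/
noncomputable def cellMoment (p : ℕ) (c : (Fin 2 → ℤ) → ℂ) (S : Finset (Fin 2 → ℤ)) : ℝ :=
  ∫ x in cell, ‖trigPoly c S x‖ ^ p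

theorem cellMoment_nonneg (p : ℕ) (c : (Fin 2 → ℤ) → ℂ) (S : Finset (Fin 2 → ℤ)) :
    0 ≤ cellMoment p c S := integral_nonneg fun _ => by positivity

theorem sum_mul_waveFT_eq_integral {g : Plane → ℝ} (hg : Continuous g) (hc : HasCompactSupport g)
    (c : (Fin 2 → ℤ) → ℂ) (S : Finset (Fin 2 → ℤ)) (y : Plane) (l : ℝ) :
    ∑ k ∈ S, c k * (character k y * waveFT g k l) = ∫ w, (g w : ℂ) * trigPoly c S (y + l • w) := by
  simp only [trigPoly, Finset.mul_sum]
  have hi : ∀ k, Integrable fun w => (g w : ℂ) * (c k * character k (y + l • w)) := fun k => by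
    refine ((integrable_mul_character hg hc k l).const_mul (c k * character k y)).congr
      (Eventually.of_forall fun w => ?_)
    simp only [character_add]
    ring
  rw [integral_finsetSum _ fun k _ => hi k]
  refine Finset.sum_congr rfl fun k _ => ?_
  rw [waveFT, ← integral_const_mul, ← integral_const_mul]
  refine integral_congr_ae (Eventually.of_forall fun w => ?_)
  simp only [character_add]
  ring

/-- The change of variables gives l⁻², and the ball of radius l ≤ 1 fits into one cell because 1 <
π. -/
theorem setIntegral_ball_comp_smul_le {h : Plane → ℝ} (hc : Continuous h) (h0 : ∀ x, 0 ≤ h x)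
    (hper : ∀ x n, h (x + latticePt n) = h x) (y : Plane) {l : ℝ} (hl : 0 < l) (hl1 : l ≤ 1) :
    ∫ w in Metric.ball (0 : Plane) 1, h (y + l • w) ≤ (l ^ 2)⁻¹ * ∫ x in cell, h x := by
  set G : Plane → ℝ := (Metric.ball (0 : Plane) l).indicator fun v => h (y + v)
  have e1 : ∫ w in Metric.ball (0 : Plane) 1, h (y + l • w) = ∫ w, G (l • w) := by
    rw [← integral_indicator Metric.isOpen_ball.measurableSet]
    congr 1
    funext w
    have : w ∈ Metric.ball (0 : Plane) 1 ↔ l • w ∈ Metric.ball (0 : Plane) l := by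
      rw [mem_ball_zero_iff, mem_ball_zero_iff, norm_smul, Real.norm_of_nonneg hl.le]
      constructor
      · intro hw; nlinarith
      · intro hw; nlinarith
    by_cases hw : w ∈ Metric.ball (0 : Plane) 1
    · simp only [G]
      rw [Set.indicator_of_mem hw, Set.indicator_of_mem (this.mp hw)]
    · simp only [G]
      rw [Set.indicator_of_notMem hw, Set.indicator_of_notMem fun h => hw (this.mpr h)]
  have hper' : ∀ x n, h (y + (x + latticePt n)) = h (y + x) := fun x n => by
    rw [← add_assoc, hper]
  have hci : IntegrableOn (fun v => h (y + v)) cell :=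
    ((hc.comp (continuous_const.add continuous_id)).continuousOn.integrableOn_compact
      isBounded_cell.isCompact_closure).mono_set subset_closure
  have hsub : Metric.ball (0 : Plane) l ⊆ cell := by
    intro v hv i
    rw [mem_ball_zero_iff] at hv
    have h1 : ‖v i‖ ≤ ‖v‖ := PiLp.norm_apply_le v i
    have h2 := abs_le.mp (h1.trans (hv.le.trans hl1))
    have := Real.pi_gt_three
    exact ⟨by linarith [h2.1], by linarith [h2.2]⟩
  rw [e1, Measure.integral_comp_smul, finrank_euclideanSpace_fin, smul_eq_mul,
    abs_of_pos (by positivity)]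
  gcongr
  simp only [G]
  rw [integral_indicator Metric.isOpen_ball.measurableSet]
  refine (setIntegral_mono_set hci (Eventually.of_forall fun v => h0 _)
    (Eventually.of_forall hsub)).trans (le_of_eq ?_)
  have := setIntegral_cell_comp_add hper y
  simp only [add_comm _ y] at this
  exact this

/-- Hölder's inequality on the ball in the linearised form r ≤ σa (1 + (r / (σa))^p). The choice a =
l^{-2/p} cancels the l⁻² of the change of variables. The moment enters to the first power, which
suits expectations, and σ is free to be a power of the scale. -/
theorem norm_sum_mul_waveFT_le {g : Plane → ℝ} (hg : Continuous g) (hc : HasCompactSupport g)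
    (hg1 : ∀ x, |g x| ≤ 1) (hs : ∀ x, x ∉ Metric.ball (0 : Plane) 1 → g x = 0) {p : ℕ}
    (hp : p ≠ 0) (c : (Fin 2 → ℤ) → ℂ) (S : Finset (Fin 2 → ℤ)) (y : Plane) {l σ : ℝ}
    (hl : 0 < l) (hl1 : l ≤ 1) (hσ : 0 < σ) :
    ‖∑ k ∈ S, c k * (character k y * waveFT g k l)‖ ≤
      σ * l ^ (-(2 / p : ℝ)) * (discArea + (σ ^ p)⁻¹ * cellMoment p c S) := by
  set F := trigPoly c S
  have hF : Continuous F := continuous_trigPoly c S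
  set a := l ^ (-(2 / p : ℝ))
  have ha : 0 < a := by positivity
  have hap : a ^ p = (l ^ 2)⁻¹ := by
    have hp' : (p : ℝ) ≠ 0 := by exact_mod_cast hp
    rw [← Real.rpow_natCast, ← Real.rpow_mul hl.le, ← Real.rpow_natCast, ← Real.rpow_neg hl.le]
    congr 1
    push_cast
    field_simp
  set h : Plane → ℝ := fun x => ‖F x‖ ^ p
  have hh : Continuous h := hF.norm.pow p
  have hcw : Continuous fun w : Plane => y + l • w :=
    continuous_const.add (continuous_id.const_smul l)
  have hint : IntegrableOn (fun w => h (y + l • w)) (Metric.ball (0 : Plane) 1) :=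
    ((hh.comp hcw).continuousOn.integrableOn_compact
      (isCompact_closedBall (0 : Plane) 1)).mono_set Metric.ball_subset_closedBall
  have key : ∀ r : ℝ, 0 ≤ r → r ≤ σ * a * (1 + ((σ * a) ^ p)⁻¹ * r ^ p) := by
    intro r hr
    have hσa : 0 < σ * a := by positivity
    have e : ((σ * a) ^ p)⁻¹ * r ^ p = (r / (σ * a)) ^ p := by rw [div_pow]; ring
    rw [e]
    set t := r / (σ * a)
    have ht : 0 ≤ t := by positivity
    have e2 : r = σ * a * t := by simp only [t]; field_simp
    have h1 : t ≤ 1 + t ^ p := by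
      rcases le_total t 1 with h | h
      · exact h.trans (le_add_of_nonneg_right (by positivity))
      · exact (le_self_pow₀ h hp).trans (le_add_of_nonneg_left zero_le_one)
    calc r = σ * a * t := e2
      _ ≤ _ := by gcongr
  rw [sum_mul_waveFT_eq_integral hg hc]
  have e1 : ∫ w, (g w : ℂ) * F (y + l • w) =
      ∫ w in Metric.ball (0 : Plane) 1, (g w : ℂ) * F (y + l • w) := by
    rw [setIntegral_eq_integral_of_forall_compl_eq_zero]
    intro w hw
    rw [hs w hw]; simp
  rw [e1]
  have hconst : IntegrableOn (fun _ : Plane => (1 : ℝ)) (Metric.ball (0 : Plane) 1) :=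
    integrableOn_const measure_ball_lt_top.ne
  calc _ ≤ ∫ w in Metric.ball (0 : Plane) 1,
        σ * a * (1 + ((σ * a) ^ p)⁻¹ * h (y + l • w)) := by
        refine norm_integral_le_of_norm_le ((hconst.add (hint.const_mul _)).const_mul _)
          (Eventually.of_forall fun w => ?_)
        rw [norm_mul, Complex.norm_real, Real.norm_eq_abs]
        exact (mul_le_of_le_one_left (norm_nonneg _) (hg1 w)).trans (key _ (norm_nonneg _))
    _ = σ * a * (discArea + ((σ * a) ^ p)⁻¹ *
        ∫ w in Metric.ball (0 : Plane) 1, h (y + l • w)) := by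
        rw [integral_const_mul, integral_add hconst (hint.const_mul _), integral_const_mul]
        simp [discArea]
    _ ≤ σ * a * (discArea + ((σ * a) ^ p)⁻¹ * ((l ^ 2)⁻¹ * ∫ x in cell, h x)) := by
        gcongr
        refine setIntegral_ball_comp_smul_le hh (fun x => by positivity) (fun x n => ?_) y hl hl1
        simp only [h, F, trigPoly_add_latticePt]
    _ = _ := by
        rw [mul_pow, hap]
        have : (l ^ 2)⁻¹ ≠ 0 := by positivity
        congr 2
        rw [mul_inv, mul_assoc, ← mul_assoc (((l ^ 2)⁻¹)⁻¹), inv_mul_cancel₀ this, one_mul]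
        rfl

/-- The Fourier multiplier `k_i / |k|²`. -/
noncomputable def rieszMult (i : Fin 2) (k : Fin 2 → ℤ) : ℝ :=
  (k i : ℝ) / ((k 0 : ℝ) ^ 2 + (k 1 : ℝ) ^ 2)

theorem sum_rieszMult {k : Fin 2 → ℤ} (hk : k ≠ 0) : ∑ i, rieszMult i k * k i = 1 := by
  have h : (k 0 : ℝ) ^ 2 + (k 1 : ℝ) ^ 2 ≠ 0 := by
    intro h0
    refine hk (funext fun i => ?_)
    have h1 : (k 0 : ℝ) = 0 := by nlinarith [sq_nonneg (k 0 : ℝ), sq_nonneg (k 1 : ℝ)]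
    have h2 : (k 1 : ℝ) = 0 := by nlinarith [sq_nonneg (k 0 : ℝ), sq_nonneg (k 1 : ℝ)]
    fin_cases i
    · exact_mod_cast h1
    · exact_mod_cast h2
  rw [Fin.sum_univ_two, rieszMult, rieszMult]
  field_simp

theorem abs_rieszMult_le (i : Fin 2) (k : Fin 2 → ℤ) : |rieszMult i k| ≤ 2 * (wt k)⁻¹ := by
  by_cases hk : k = 0
  · rw [hk, rieszMult]
    simp only [Pi.zero_apply, Int.cast_zero, zero_div, abs_zero]
    exact mul_nonneg zero_le_two (inv_nonneg.mpr (wt_pos 0).le)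
  have hn := one_le_norm_of_ne_zero hk
  have hw := wt_le_two_mul_norm hk
  obtain ⟨j, hj⟩ := exists_norm_eq_norm_apply k
  have h1 : ‖k‖ ^ 2 ≤ (k 0 : ℝ) ^ 2 + (k 1 : ℝ) ^ 2 := by
    rw [hj, Int.norm_eq_abs, sq_abs]
    fin_cases j
    · simp only [Fin.zero_eta]; nlinarith [sq_nonneg (k 1 : ℝ)]
    · simp only [Fin.mk_one]; nlinarith [sq_nonneg (k 0 : ℝ)]
  have h2 : |(k i : ℝ)| ≤ ‖k‖ := by
    rw [← Int.norm_eq_abs]; exact norm_le_pi_norm k i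
  rw [rieszMult, abs_div, abs_of_nonneg (by positivity : 0 ≤ (k 0 : ℝ) ^ 2 + (k 1 : ℝ) ^ 2),
    ← div_eq_mul_inv, div_le_div_iff₀ (by nlinarith) (wt_pos k)]
  calc |(k i : ℝ)| * wt k ≤ ‖k‖ * (2 * ‖k‖) := by gcongr; exact (wt_pos k).le
    _ = 2 * ‖k‖ ^ 2 := by ring
    _ ≤ _ := by gcongr

/-- One integration by parts, written with 1 = Σ k_i · k_i / |k|²: at the cost of l⁻¹ the
coefficients gain the factor `rieszMult`, which is of order `(wt k)⁻¹`, and φ is replaced by its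
first derivatives. -/
theorem sum_mul_waveFT_eq {φ : Plane → ℝ} (hφ : ContDiff ℝ (⊤ : ℕ∞) φ) (hc : HasCompactSupport φ)
    (c : (Fin 2 → ℤ) → ℂ) (hc0 : c 0 = 0) (S : Finset (Fin 2 → ℤ)) (y : Plane) {l : ℝ}
    (hl : 0 < l) : ∑ k ∈ S, c k * (character k y * waveFT φ k l) =
      (Complex.I / l) * ∑ i : Fin 2, ∑ k ∈ S, ((rieszMult i k : ℂ) * c k) *
        (character k y * waveFT (partialDeriv i φ) k l) := by
  rw [Finset.sum_comm, Finset.mul_sum]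
  refine Finset.sum_congr rfl fun k _ => ?_
  by_cases hk : k = 0
  · subst hk; simp [hc0]
  have h1 : (∑ i, (rieszMult i k : ℂ) * (k i : ℂ)) = 1 := by exact_mod_cast sum_rieszMult hk
  have hl' : (l : ℂ) ≠ 0 := by exact_mod_cast hl.ne'
  simp only [waveFT_partialDeriv hφ hc]
  calc c k * (character k y * waveFT φ k l) = (∑ i, (rieszMult i k : ℂ) * (k i : ℂ)) *
        (c k * (character k y * waveFT φ k l)) := by rw [h1, one_mul]
    _ = _ := by
      rw [Fin.sum_univ_two, Fin.sum_univ_two]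
      field_simp
      rw [Complex.I_sq]
      ring

/-- Moment bounds of order `p` for linear combinations of random variables of size `|k|⁻¹`. -/
structure MomentBound {Ω : Type*} [MeasurableSpace Ω] (P : Measure Ω) (p : ℕ)
    (x : (Fin 2 → ℤ) → Ω → ℂ) (M : ℝ) : Prop where
  aemeasurable : ∀ k, AEMeasurable (x k) P
  integrable : ∀ (S : Finset (Fin 2 → ℤ)) (c : (Fin 2 → ℤ) → ℂ),
    Integrable (fun ω => ‖∑ k ∈ S, c k * x k ω‖ ^ p) P
  integral_le : ∀ (S : Finset (Fin 2 → ℤ)) (c : (Fin 2 → ℤ) → ℂ) (R : ℝ), 0 ≤ R →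
    ∑ k ∈ S, ‖c k‖ ^ 2 * wt k ^ (-2 : ℝ) ≤ R ^ 2 → ∫ ω, ‖∑ k ∈ S, c k * x k ω‖ ^ p ∂P ≤ M * R ^ p

namespace MomentBound

variable {Ω : Type*} [MeasurableSpace Ω] {P : Measure Ω} {p : ℕ} {x : (Fin 2 → ℤ) → Ω → ℂ} {M : ℝ}

theorem _root_.norm_mul_character (c : ℂ) (k : Fin 2 → ℤ) (y : Plane) : ‖c * character k y‖ = ‖c‖ := by
  rw [norm_mul, norm_character, mul_one]

/-- Fubini. At a fixed point the characters are unimodular factors of the coefficients, so the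
moment bound applies uniformly. -/
theorem integrable_cellMoment [SFinite P] (h : MomentBound P p x M) (c : (Fin 2 → ℤ) → ℂ)
    (S : Finset (Fin 2 → ℤ)) {R : ℝ} (hR : 0 ≤ R)
    (hc : ∑ k ∈ S, ‖c k‖ ^ 2 * wt k ^ (-2 : ℝ) ≤ R ^ 2) :
    Integrable (fun ω => cellMoment p (fun k => c k * x k ω) S) P ∧
      ∫ ω, cellMoment p (fun k => c k * x k ω) S ∂P ≤ M * R ^ p * volume.real cell := by
  have : IsFiniteMeasure (volume.restrict cell) :=
    ⟨by rw [Measure.restrict_apply_univ]; exact volume_cell_lt_top⟩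
  have e : ∀ ω y, ‖trigPoly (fun k => c k * x k ω) S y‖ ^ p =
      ‖∑ k ∈ S, (c k * character k y) * x k ω‖ ^ p := fun ω y => by
    simp only [trigPoly, mul_right_comm]
  have hle : ∀ y, ∫ ω, ‖∑ k ∈ S, (c k * character k y) * x k ω‖ ^ p ∂P ≤ M * R ^ p := fun y =>
    h.integral_le S (fun k => c k * character k y) R hR (by simpa only [norm_mul_character] using hc)
  have hm : AEStronglyMeasurable (fun q : Ω × Plane =>
      ‖∑ k ∈ S, (c k * character k q.2) * x k q.1‖ ^ p) (P.prod (volume.restrict cell)) := by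
    refine AEMeasurable.aestronglyMeasurable ?_
    refine AEMeasurable.pow_const (AEMeasurable.norm ?_) p
    refine Finset.aemeasurable_fun_sum _ fun k _ => AEMeasurable.mul ?_ ?_
    · exact (((continuous_character k).measurable.comp measurable_snd).const_mul _).aemeasurable
    · exact (h.aemeasurable k).comp_quasiMeasurePreserving Measure.quasiMeasurePreserving_fst
  have hint : Integrable (fun q : Ω × Plane =>
      ‖∑ k ∈ S, (c k * character k q.2) * x k q.1‖ ^ p) (P.prod (volume.restrict cell)) := by
    rw [integrable_prod_iff' hm]
    refine ⟨Eventually.of_forall fun y => h.integrable S fun k => c k * character k y, ?_⟩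
    have hsm := hm.prod_swap.integral_prod_right'
    simp only [norm_pow, norm_norm]
    refine Integrable.of_bound hsm (M * R ^ p) (Eventually.of_forall fun y => ?_)
    rw [Real.norm_of_nonneg (integral_nonneg fun _ => by positivity)]
    exact hle y
  simp only [cellMoment, e]
  refine ⟨hint.integral_prod_left, ?_⟩
  rw [integral_integral_swap hint]
  refine (integral_mono (hint.integral_prod_right) (integrable_const _) hle).trans
    (le_of_eq ?_)
  rw [integral_const, measureReal_restrict_apply_univ, smul_eq_mul, mul_comm]

end MomentBound

/-- The density of the quantity which controls the difference between a noise and its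
mollification, tested against rescaled test functions. -/
noncomputable def pairDensity (f : Plane → ℝ) (κ : ℝ) (p : ℕ) (z : (Fin 2 → ℤ) → ℂ)
    (S : Finset (Fin 2 → ℤ)) (s : ℝ) : ℝ :=
  s ^ (-1 + κ / 4) * (discArea +
    (s ^ (1 + κ / 8)) ^ p * cellMoment p (fun k => deriv (waveFT f k) s * z k) S +
    ∑ i : Fin 2, (discArea + (s ^ (κ / 8)) ^ p *
      cellMoment p (fun k => (rieszMult i k * deriv (waveFT f k) s) * z k) S))

theorem pairDensity_nonneg (f : Plane → ℝ) (κ : ℝ) (p : ℕ) (z : (Fin 2 → ℤ) → ℂ)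
    (S : Finset (Fin 2 → ℤ)) {s : ℝ} (hs : 0 < s) : 0 ≤ pairDensity f κ p z S s := by
  have h1 := discArea_nonneg
  have h2 := fun c => cellMoment_nonneg p c S
  unfold pairDensity
  have : ∀ i ∈ (Finset.univ : Finset (Fin 2)), 0 ≤ discArea + (s ^ (κ / 8)) ^ p *
      cellMoment p (fun k => (rieszMult i k * deriv (waveFT f k) s) * z k) S := fun i _ =>
    add_nonneg h1 (mul_nonneg (by positivity) (h2 _))
  exact mul_nonneg (by positivity) (add_nonneg (add_nonneg h1 (mul_nonneg (by positivity) (h2 _)))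
    (Finset.sum_nonneg this))

/-- The direct estimate is X ≤ N, and after one integration by parts X ≤ (s/l) N; hence X ≤
(s/l)^{κ/2} N. In N the factor l^{-2/p} is at most l^{-κ/2} since p ≥ 4/κ. This gives l^{-κ} in
total, and s^{κ/2 - (1 + κ/8)} = s^{κ/8} s^{-1+κ/4}. -/
theorem norm_sum_deriv_waveFT_le {f : Plane → ℝ} (h : IsKernel f) {κ : ℝ} (hκ : 0 < κ)
    (hκ1 : κ < 1 / 2) {p : ℕ} (hp : 4 / κ ≤ p) (z : (Fin 2 → ℤ) → ℂ) (S : Finset (Fin 2 → ℤ))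
    {s : ℝ} (hs : 0 < s) {φ : 𝓓(unitBall, ℝ)} (hφ : φ ∈ unitTests 1) (y : Plane) {l : ℝ}
    (hl : 0 < l) (hl1 : l ≤ 1) :
    ‖∑ k ∈ S, (deriv (waveFT f k) s * z k) * (character k y * waveFT φ k l)‖ ≤
      l ^ (-κ) * (s ^ (κ / 8) * pairDensity f κ p z S s) := by
  have hp0' : (0 : ℝ) < p := (by positivity : 0 < 4 / κ).trans_le hp
  have hp0 : p ≠ 0 := by rintro rfl; simp at hp0'
  have hV := discArea_nonneg
  set c : (Fin 2 → ℤ) → ℂ := fun k => deriv (waveFT f k) s * z k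
  have hc0 : c 0 = 0 := by
    have e : waveFT f 0 = fun _ => 1 := funext fun t => h.waveFT_zero t
    simp only [c, e, deriv_const, zero_mul]
  set A := discArea + (s ^ (1 + κ / 8)) ^ p * cellMoment p c S
  set b : Fin 2 → ℝ := fun i => discArea + (s ^ (κ / 8)) ^ p *
    cellMoment p (fun k => (rieszMult i k * deriv (waveFT f k) s) * z k) S
  have hA : 0 ≤ A := add_nonneg hV (mul_nonneg (by positivity) (cellMoment_nonneg _ _ _))
  have hb : ∀ i, 0 ≤ b i := fun i =>
    add_nonneg hV (mul_nonneg (by positivity) (cellMoment_nonneg _ _ _))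
  have hB : 0 ≤ ∑ i, b i := Finset.sum_nonneg fun i _ => hb i
  set v := l ^ (-(2 / p : ℝ))
  have hv : 0 < v := by positivity
  set X := ‖∑ k ∈ S, c k * (character k y * waveFT φ k l)‖
  have inv_eq : ∀ r : ℝ, ((s ^ (-r)) ^ p)⁻¹ = (s ^ r) ^ p := fun r => by
    rw [Real.rpow_neg hs.le, inv_pow, inv_inv]
  have h1 : X ≤ s ^ (-(1 + κ / 8)) * v * A := by
    have := norm_sum_mul_waveFT_le φ.contDiff.continuous φ.hasCompactSupport
      (abs_le_one_of_mem_unitTests hφ) (fun x hx => eq_zero_of_notMem_unitBall φ hx) hp0 c S y hl hl1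
      (Real.rpow_pos_of_pos hs (-(1 + κ / 8)))
    rwa [inv_eq] at this
  have h2 : X ≤ l⁻¹ * (s ^ (-(κ / 8)) * v * ∑ i, b i) := by
    simp only [X]
    rw [sum_mul_waveFT_eq φ.contDiff φ.hasCompactSupport c hc0 S y hl, norm_mul, norm_div,
      Complex.norm_I, Complex.norm_real, Real.norm_of_nonneg hl.le, one_div]
    gcongr
    rw [Finset.mul_sum]
    refine (norm_sum_le _ _).trans (Finset.sum_le_sum fun i _ => ?_)
    have hpd := φ.contDiff.partialDeriv i
    have := norm_sum_mul_waveFT_le hpd.continuous (φ.hasCompactSupport.partialDeriv i)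
      (abs_partialDeriv_le_one_of_mem_unitTests hφ i)
      (fun x hx => partialDeriv_eq_zero_of_notMem_unitBall φ i hx) hp0
      (fun k => (rieszMult i k * deriv (waveFT f k) s) * z k) S y hl hl1
      (Real.rpow_pos_of_pos hs (-(κ / 8)))
    rw [inv_eq] at this
    simpa only [c, ← mul_assoc] using this
  set t := s / l
  have ht : 0 < t := by positivity
  set N := s ^ (-(1 + κ / 8)) * v * (A + ∑ i, b i)
  have hN : 0 ≤ N := by positivity
  have h3 : X ≤ N := h1.trans (by simp only [N]; gcongr; linarith)
  have h4 : X ≤ t * N := by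
    refine h2.trans ?_
    have e : s ^ (-(κ / 8)) = s * s ^ (-(1 + κ / 8)) := by
      nth_rewrite 2 [← Real.rpow_one s]
      rw [← Real.rpow_add hs]; congr 1; ring
    rw [e]
    calc l⁻¹ * (s * s ^ (-(1 + κ / 8)) * v * ∑ i, b i) =
          t * (s ^ (-(1 + κ / 8)) * v * ∑ i, b i) := by simp only [t]; ring
      _ ≤ _ := by simp only [N]; gcongr; linarith
  have h5 : X ≤ t ^ (κ / 2) * N := by
    rcases le_total t 1 with ht1 | ht1
    · refine h4.trans (mul_le_mul_of_nonneg_right ?_ hN)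
      nth_rewrite 1 [← Real.rpow_one t]
      exact Real.rpow_le_rpow_of_exponent_ge ht ht1 (by linarith)
    · exact h3.trans (le_mul_of_one_le_left hN (Real.one_le_rpow ht1 (by linarith)))
  have hv2 : v ≤ l ^ (-(κ / 2)) := by
    refine Real.rpow_le_rpow_of_exponent_ge hl hl1 (neg_le_neg ?_)
    rw [div_le_iff₀ hp0']
    rw [div_le_iff₀ hκ] at hp
    linarith
  calc X ≤ t ^ (κ / 2) * N := h5
    _ ≤ t ^ (κ / 2) * (s ^ (-(1 + κ / 8)) * l ^ (-(κ / 2)) * (A + ∑ i, b i)) := by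
        simp only [N]; gcongr
    _ = (l ^ (-(κ / 2)) * l ^ (-(κ / 2))) * ((s ^ (κ / 2) * s ^ (-(1 + κ / 8))) *
        (A + ∑ i, b i)) := by
        simp only [t]
        rw [Real.div_rpow hs.le hl.le, Real.rpow_neg hl.le]
        ring
    _ = l ^ (-κ) * ((s ^ (κ / 8) * s ^ (-1 + κ / 4)) * (A + ∑ i, b i)) := by
        rw [← Real.rpow_add hl, ← Real.rpow_add hs, ← Real.rpow_add hs,
          show -(κ / 2) + -(κ / 2) = -κ by ring,
          show κ / 2 + -(1 + κ / 8) = κ / 8 + (-1 + κ / 4) by ring]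
    _ = _ := by rw [mul_assoc]; rfl

/-- Since `waveFT f k 0 = 1`, the difference is the integral over (0, ε] of the derivative in the
scale. There s^{κ/8} ≤ ε^{κ/8}, and what remains is a single integral over (0, 1] that does not
depend on the test function, its centre, l or ε. One random variable thus controls the whole
supremum. -/
theorem pairBound_mollSeq_sub {f : Plane → ℝ} (h : IsKernel f) {κ K : ℝ} (hκ : 0 < κ)
    (hκ1 : κ < 1 / 2) (hK : 0 ≤ K) {p : ℕ} (hp : 4 / κ ≤ p) {z : (Fin 2 → ℤ) → ℂ}
    (hz : DistSummable z)
    (hfr : ∃ᶠ n in atTop, ∫⁻ s in Set.Ioc (0 : ℝ) 1,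
      ENNReal.ofReal (pairDensity f κ p z (freqBox n) s) ≤ ENNReal.ofReal K)
    {ε : ℝ} (hε : 0 < ε) (hε1 : ε ≤ 1) :
    PairBound κ (fun k => mollSeq f ε z k - z k) (K * ε ^ (κ / 8)) := by
  intro φ hφ y l hl hl1
  have hsum : Summable fun k => (mollSeq f ε z k - z k) * (character k y * waveFT φ k l) := by
    have h1 : DistSummable (mollSeq f ε z) := by
      refine Summable.of_nonneg_of_le (fun k => mul_nonneg (Real.rpow_nonneg (wt_pos k).le _)
        (norm_nonneg _)) (fun k => ?_) hz
      rw [mollSeq, norm_mul]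
      exact mul_le_mul_of_nonneg_left
        (mul_le_of_le_one_left (norm_nonneg _) (h.norm_waveFT_le_one _ _))
        (Real.rpow_nonneg (wt_pos k).le _)
    have := (h1.sub hz).summable (rescaled φ l hl y)
    simpa only [torusFT_rescaled] using this
  have hT := (hsum.hasSum.comp tendsto_freqBox).norm
  refine le_of_tendsto_of_frequently hT (hfr.mono fun n hn => ?_)
  simp only [Function.comp]
  set S := freqBox n
  have h0 : ∀ k, waveFT f k 0 = 1 := fun k => by
    have := h.norm_waveFT_sub_one_le (β := 1) zero_le_one le_rfl k le_rfl
    simpa [sub_eq_zero] using this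
  set G : ℝ → ℂ := fun s =>
    ∑ k ∈ S, (deriv (waveFT f k) s * z k) * (character k y * waveFT φ k l)
  have e : ∑ k ∈ S, (mollSeq f ε z k - z k) * (character k y * waveFT φ k l) =
      ∫ s in (0 : ℝ)..ε, G s := by
    have hc : ∀ k, Continuous fun s =>
        (deriv (waveFT f k) s * z k) * (character k y * waveFT φ k l) := fun k =>
      ((h.continuous_deriv_waveFT k).mul continuous_const).mul continuous_const
    simp only [G]
    rw [intervalIntegral.integral_finsetSum fun k _ => (hc k).intervalIntegrable _ _]
    refine Finset.sum_congr rfl fun k _ => ?_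
    rw [intervalIntegral.integral_mul_const, intervalIntegral.integral_mul_const,
      intervalIntegral.integral_deriv_eq_sub (fun s _ => h.differentiable_waveFT k s)
        ((h.continuous_deriv_waveFT k).intervalIntegrable _ _), h0, mollSeq]
    ring
  rw [e, intervalIntegral.integral_of_le hε.le]
  have hD : 0 ≤ l ^ (-κ) * ε ^ (κ / 8) := by positivity
  have hb : ‖∫ s in Set.Ioc 0 ε, G s‖ₑ ≤ ENNReal.ofReal (l ^ (-κ) * ε ^ (κ / 8)) *
      ENNReal.ofReal K := by
    refine (enorm_integral_le_lintegral_enorm _).trans ?_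
    calc _ ≤ ∫⁻ s in Set.Ioc 0 ε, ENNReal.ofReal (l ^ (-κ) * ε ^ (κ / 8)) *
          ENNReal.ofReal (pairDensity f κ p z S s) := by
          refine setLIntegral_mono' measurableSet_Ioc fun s hs => ?_
          have hd := pairDensity_nonneg f κ p z S hs.1
          rw [← ENNReal.ofReal_mul hD, ← ofReal_norm]
          refine ENNReal.ofReal_le_ofReal ((norm_sum_deriv_waveFT_le h hκ hκ1 hp z S hs.1 hφ y hl
            hl1).trans ?_)
          rw [← mul_assoc]
          gcongr
          · exact hs.1.le
          · exact hs.2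
      _ = ENNReal.ofReal (l ^ (-κ) * ε ^ (κ / 8)) *
          ∫⁻ s in Set.Ioc 0 ε, ENNReal.ofReal (pairDensity f κ p z S s) :=
          lintegral_const_mul' _ _ ENNReal.ofReal_ne_top
      _ ≤ _ := by
          gcongr
          exact (lintegral_mono_set (Set.Ioc_subset_Ioc le_rfl hε1)).trans hn
  rw [← ENNReal.ofReal_mul hD, ← ofReal_norm,
    ENNReal.ofReal_le_ofReal_iff (by positivity)] at hb
  exact hb.trans (le_of_eq (by ring))

theorem aemeasurable_cellMoment {Ω : Type*} [MeasurableSpace Ω] {μ : Measure Ω} [SFinite μ]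
    {c : (Fin 2 → ℤ) → Ω → ℂ} (hc : ∀ k, AEMeasurable (c k) μ) (p : ℕ)
    (S : Finset (Fin 2 → ℤ)) : AEMeasurable (fun q => cellMoment p (fun k => c k q) S) μ := by
  have hm : AEStronglyMeasurable (fun q : Ω × Plane =>
      ‖trigPoly (fun k => c k q.1) S q.2‖ ^ p) (μ.prod (volume.restrict cell)) := by
    refine (AEMeasurable.pow_const (AEMeasurable.norm ?_) p).aestronglyMeasurable
    refine Finset.aemeasurable_fun_sum _ fun k _ => AEMeasurable.mul ?_ ?_
    · exact (hc k).comp_quasiMeasurePreserving Measure.quasiMeasurePreserving_fst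
    · exact ((continuous_character k).measurable.comp measurable_snd).aemeasurable
  exact hm.integral_prod_right'.aemeasurable

theorem sum_norm_sq_mul_wt_le {C a : ℝ} (ha : 0 < a) {d : (Fin 2 → ℤ) → ℂ} {s b : ℝ}
    (hd : ∀ k, ‖d k‖ ≤ C * s ^ (-b) * wt k ^ (-a)) (S : Finset (Fin 2 → ℤ)) :
    ∑ k ∈ S, ‖d k‖ ^ 2 * wt k ^ (-2 : ℝ) ≤ (C * √(wtSum (2 + 2 * a)) * s ^ (-b)) ^ 2 := by
  have hw := wtSum_nonneg (2 + 2 * a)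
  calc _ ≤ ∑ k ∈ S, (C * s ^ (-b)) ^ 2 * wt k ^ (-(2 + 2 * a)) := by
        refine Finset.sum_le_sum fun k _ => ?_
        have hk := wt_pos k
        have e : wt k ^ (-(2 + 2 * a)) = (wt k ^ (-a)) ^ 2 * wt k ^ (-2 : ℝ) := by
          rw [← Real.rpow_natCast, ← Real.rpow_mul hk.le, ← Real.rpow_add hk]
          congr 1; push_cast; ring
        rw [e, ← mul_assoc, ← mul_pow]
        gcongr
        exact hd k
    _ ≤ (C * s ^ (-b)) ^ 2 * wtSum (2 + 2 * a) := by
        rw [← Finset.mul_sum]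
        gcongr
        exact (summable_wt_rpow (by linarith)).sum_le_tsum S fun k _ =>
          Real.rpow_nonneg (wt_pos k).le _
    _ = _ := by rw [mul_pow, mul_pow, mul_pow, Real.sq_sqrt hw]; ring

/-- The decay exponents 1 + κ/8 for the derivative itself and κ/8 after the Riesz factor both leave
the summable exponent 2 + κ/4 in frequency. The resulting powers s^{-(1+κ/8)} and s^{-κ/8} are
cancelled by the factors built into `pairDensity`, whose mean is then O(s^{-1+κ/4}). -/
theorem MomentBound.boundedInProb_pairBound {Ω : Type*} [MeasurableSpace Ω] {P : Measure Ω}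
    [IsProbabilityMeasure P] {f : Plane → ℝ} (hf : IsKernel f) {κ : ℝ} (hκ : 0 < κ)
    (hκ1 : κ < 1 / 2) {p : ℕ} (hp : 4 / κ ≤ p) {x : (Fin 2 → ℤ) → Ω → ℂ} {M : ℝ}
    (h : MomentBound P p x M) : BoundedInProb P fun ω K =>
      DistSummable (fun k => x k ω) → ∀ ε, 0 < ε → ε ≤ 1 →
        PairBound κ (fun k => mollSeq f ε (fun k => x k ω) k - x k ω) (K * ε ^ (κ / 8)) := by
  have ha : 0 < κ / 8 := by linarith
  obtain ⟨C₁, hC₁, hd₁⟩ := hf.exists_norm_deriv_waveFT_le (q := 1 + κ / 8) (by linarith)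
  obtain ⟨C₂, hC₂, hd₂⟩ := hf.exists_norm_deriv_waveFT_le (q := κ / 8) ha.le
  set w := √(wtSum (2 + 2 * (κ / 8)))
  set V := volume.real cell
  have hs₁ : ∀ s, 0 < s → ∀ S : Finset (Fin 2 → ℤ),
      ∑ k ∈ S, ‖deriv (waveFT f k) s‖ ^ 2 * wt k ^ (-2 : ℝ) ≤
        (C₁ * w * s ^ (-(1 + κ / 8))) ^ 2 := fun s hs S => by
    refine sum_norm_sq_mul_wt_le ha (fun k => (hd₁ k s hs).trans (le_of_eq ?_)) S
    have hk := wt_pos k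
    rw [Real.mul_rpow hs.le hk.le]
    have e : wt k ^ (-(κ / 8)) = wt k * wt k ^ (-(1 + κ / 8)) := by
      nth_rewrite 2 [← Real.rpow_one (wt k)]
      rw [← Real.rpow_add hk]; congr 1; ring
    rw [e]; ring
  have hs₂ : ∀ i s, 0 < s → ∀ S : Finset (Fin 2 → ℤ),
      ∑ k ∈ S, ‖(rieszMult i k : ℂ) * deriv (waveFT f k) s‖ ^ 2 * wt k ^ (-2 : ℝ) ≤
        (2 * C₂ * w * s ^ (-(κ / 8))) ^ 2 := fun i s hs S => by
    refine sum_norm_sq_mul_wt_le ha (fun k => ?_) S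
    have hk := wt_pos k
    rw [norm_mul, Complex.norm_real, Real.norm_eq_abs]
    refine (mul_le_mul (abs_rieszMult_le i k) (hd₂ k s hs) (norm_nonneg _) (by positivity)).trans
      (le_of_eq ?_)
    rw [Real.mul_rpow hs.le hk.le]
    field_simp
  have hi₁ := fun s hs S => h.integrable_cellMoment (fun k => deriv (waveFT f k) s) S
    (R := C₁ * w * s ^ (-(1 + κ / 8))) (by have : 0 ≤ s := le_of_lt hs; positivity) (hs₁ s hs S)
  have hi₂ := fun i s hs S => h.integrable_cellMoment
    (fun k => (rieszMult i k : ℂ) * deriv (waveFT f k) s) S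
    (R := 2 * C₂ * w * s ^ (-(κ / 8))) (by have : 0 ≤ s := le_of_lt hs; positivity) (hs₂ i s hs S)
  have hF : ∀ S s, 0 < s → Integrable (fun ω => discArea +
      (s ^ (1 + κ / 8)) ^ p * cellMoment p (fun k => deriv (waveFT f k) s * x k ω) S +
      ∑ i : Fin 2, (discArea + (s ^ (κ / 8)) ^ p *
        cellMoment p (fun k => (rieszMult i k * deriv (waveFT f k) s) * x k ω) S)) P :=
    fun S s hs => ((integrable_const _).add ((hi₁ s hs S).1.const_mul _)).add
      (integrable_finsetSum _ fun i _ => (integrable_const _).add ((hi₂ i s hs S).1.const_mul _))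
  have hpow : ∀ s r : ℝ, 0 < s → (s ^ r) ^ p * (s ^ (-r)) ^ p = 1 := fun s r hs => by
    rw [← mul_pow, ← Real.rpow_add hs]; simp
  refine BoundedInProb.of_frequently_lintegral
    (B := discArea + M * (C₁ * w) ^ p * V + ∑ _i : Fin 2, (discArea + M * (2 * C₂ * w) ^ p * V))
    (r := -1 + κ / 4) (F := fun n ω => pairDensity f κ p (fun k => x k ω) (freqBox n))
    (fun n => ?_) (fun n ω s hs => pairDensity_nonneg _ _ _ _ _ hs)
    (fun n s hs => (hF _ s hs).const_mul _) (by linarith)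
    (fun n s hs hs1 => ?_) fun ω K hK hfr hz ε hε hε1 =>
      pairBound_mollSeq_sub hf hκ hκ1 hK hp hz hfr hε hε1
  · have hx : ∀ a, AEMeasurable (fun q : Ω × ℝ => x a q.1)
        (P.prod (volume.restrict (Set.Ioc (0 : ℝ) 1))) := fun a =>
      (h.aemeasurable a).comp_quasiMeasurePreserving Measure.quasiMeasurePreserving_fst
    have hs : ∀ r : ℝ, Measurable fun q : Ω × ℝ => q.2 ^ r := fun r =>
      measurable_snd.pow_const r
    have hd : ∀ k, Measurable fun q : Ω × ℝ => deriv (waveFT f k) q.2 := fun k =>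
      (hf.continuous_deriv_waveFT k).measurable.comp measurable_snd
    have hm₁ := aemeasurable_cellMoment (fun k => (hd k).aemeasurable.mul (hx k)) p (freqBox n)
    have hm₂ := fun i : Fin 2 => aemeasurable_cellMoment
      (fun k => ((hd k).const_mul (rieszMult i k : ℂ)).aemeasurable.mul (hx k)) p (freqBox n)
    refine (hs _).aemeasurable.mul (((aemeasurable_const).add
      (((hs _).pow_const p).aemeasurable.mul hm₁)).add
      (Finset.aemeasurable_fun_sum _ fun i _ => aemeasurable_const.add
        (((hs _).pow_const p).aemeasurable.mul (hm₂ i))))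
  · simp only [pairDensity]
    rw [integral_const_mul, mul_comm]
    refine mul_le_mul_of_nonneg_right ?_ (by positivity)
    have j₁ : Integrable (fun ω => discArea + (s ^ (1 + κ / 8)) ^ p *
        cellMoment p (fun k => deriv (waveFT f k) s * x k ω) (freqBox n)) P :=
      (integrable_const _).add ((hi₁ s hs (freqBox n)).1.const_mul _)
    have j₂ : ∀ i, Integrable (fun ω => discArea + (s ^ (κ / 8)) ^ p *
        cellMoment p (fun k => (rieszMult i k * deriv (waveFT f k) s) * x k ω) (freqBox n)) P :=
      fun i => (integrable_const _).add ((hi₂ i s hs (freqBox n)).1.const_mul _)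
    rw [integral_add j₁ (integrable_finsetSum _ fun i _ => j₂ i),
      integral_add (integrable_const _) ((hi₁ s hs (freqBox n)).1.const_mul _),
      integral_finsetSum _ fun i _ => j₂ i, integral_const_mul]
    simp only [integral_const, probReal_univ, one_smul]
    have key : ∀ {r D I : ℝ}, I ≤ M * (D * s ^ (-r)) ^ p * V →
        (s ^ r) ^ p * I ≤ M * D ^ p * V := fun {r D I} hI => by
      refine (mul_le_mul_of_nonneg_left hI (by positivity)).trans (le_of_eq ?_)
      calc _ = M * D ^ p * V * ((s ^ r) ^ p * (s ^ (-r)) ^ p) := by rw [mul_pow]; ring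
        _ = _ := by rw [hpow s r hs, mul_one]
    refine add_le_add (add_le_add le_rfl (key (hi₁ s hs _).2)) (Finset.sum_le_sum fun i _ => ?_)
    rw [integral_add (integrable_const _) ((hi₂ i s hs (freqBox n)).1.const_mul _),
      integral_const_mul]
    simp only [integral_const, probReal_univ, one_smul]
    exact add_le_add le_rfl (key (hi₂ i s hs _).2)

/-! ## Moments of Gaussian sums -/

/-- The absolute moment of order `p` of the standard Gaussian distribution. -/
noncomputable def gaussMoment (p : ℕ) : ℝ := ∫ x, |x| ^ p ∂gaussianReal 0 1

theorem gaussMoment_nonneg (p : ℕ) : 0 ≤ gaussMoment p := integral_nonneg fun _ => by positivity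

theorem integrable_abs_pow_gaussianReal (v : ℝ≥0) (p : ℕ) :
    Integrable (fun x => |x| ^ p) (gaussianReal 0 v) := by
  rcases eq_or_ne p 0 with rfl | hp
  · simp
  · exact (memLp_id_gaussianReal' (μ := 0) (v := v) p (by simp)).integrable_norm_pow hp

theorem integral_abs_pow_gaussianReal (v : ℝ≥0) (p : ℕ) :
    ∫ x, |x| ^ p ∂gaussianReal 0 v = √v ^ p * gaussMoment p := by
  have h : gaussianReal 0 v = (gaussianReal 0 1).map (√v * ·) := by
    rw [gaussianReal_map_const_mul, mul_zero, mul_one]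
    congr 1
    ext
    simp
  rw [h, integral_map (by fun_prop) (by fun_prop), gaussMoment, ← integral_const_mul]
  simp only [abs_mul, mul_pow, abs_of_nonneg (Real.sqrt_nonneg _)]

section

variable {Ω ι α : Type*} [MeasurableSpace Ω] {P : Measure Ω}

theorem hasLaw_sum_gaussianReal [IsProbabilityMeasure P] {g : ι → Ω → ℝ} {v : ι → ℝ≥0}
    (hg : iIndepFun g P) (hlaw : ∀ i, HasLaw (g i) (gaussianReal 0 (v i)) P) (b : ι → ℝ)
    (S : Finset ι) : HasLaw (fun ω => ∑ i ∈ S, b i * g i ω)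
      (gaussianReal 0 (∑ i ∈ S, NNReal.mk (b i ^ 2) (sq_nonneg _) * v i)) P := by
  classical
  have h1 : ∀ i, HasLaw (fun ω => b i * g i ω)
      (gaussianReal 0 (NNReal.mk (b i ^ 2) (sq_nonneg _) * v i)) P := fun i => by
    simpa using gaussianReal_const_mul (hlaw i) (b i)
  have h2 : iIndepFun (fun i ω => b i * g i ω) P :=
    hg.comp (fun i x => b i * x) fun i => measurable_const_mul _
  induction S using Finset.induction_on with
  | empty =>
    simp only [Finset.sum_empty, gaussianReal_zero_var]
    exact hasLaw_dirac_of_ae_eq (Eventually.of_forall fun _ => rfl)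
  | insert i S hi ih =>
    simp only [Finset.sum_insert hi]
    have h3 := (h2.indepFun_finsetSum_of_notMem₀ (fun i => (h1 i).aemeasurable) hi).symm
    have e : (∑ j ∈ S, fun ω => b j * g j ω) = fun ω => ∑ j ∈ S, b j * g j ω := by
      funext ω; simp
    rw [e] at h3
    have := gaussianReal_add_gaussianReal_of_indepFun h3 (h1 i).map_eq ih.map_eq
    rw [add_zero] at this
    exact ⟨(h1 i).aemeasurable.add ih.aemeasurable, this⟩

/-- The random variable `X` has an absolute moment of order `p` bounded by `D`. -/
structure MomentLe (P : Measure Ω) (p : ℕ) (X : Ω → ℂ) (D : ℝ) : Prop where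
  aemeasurable : AEMeasurable X P
  integrable : Integrable (fun ω => ‖X ω‖ ^ p) P
  integral_le : ∫ ω, ‖X ω‖ ^ p ∂P ≤ D

theorem MomentLe.add {p : ℕ} {X Y : Ω → ℂ} {D D' : ℝ} (hX : MomentLe P p X D)
    (hY : MomentLe P p Y D') : MomentLe P p (fun ω => X ω + Y ω) (2 ^ (p - 1) * (D + D')) := by
  have h : ∀ ω, ‖X ω + Y ω‖ ^ p ≤ 2 ^ (p - 1) * (‖X ω‖ ^ p + ‖Y ω‖ ^ p) := fun ω =>
    (pow_le_pow_left₀ (norm_nonneg _) (norm_add_le _ _) p).trans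
      (add_pow_le (norm_nonneg _) (norm_nonneg _) p)
  have hi := (hX.integrable.add hY.integrable).const_mul (2 ^ (p - 1) : ℝ)
  have hm := hX.aemeasurable.add hY.aemeasurable
  refine ⟨hm, hi.mono' (hm.norm.pow_const p).aestronglyMeasurable
    (Eventually.of_forall fun ω => ?_), ?_⟩
  · rw [Real.norm_of_nonneg (by positivity)]
    exact h ω
  · refine (integral_mono_of_nonneg (Eventually.of_forall fun ω => by positivity) hi
      (Eventually.of_forall h)).trans ?_
    simp only [Pi.add_apply]
    rw [integral_const_mul, integral_add hX.integrable hY.integrable]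
    gcongr
    · exact hX.integral_le
    · exact hY.integral_le

theorem MomentLe.mul_of_norm_eq_one {p : ℕ} {X : Ω → ℂ} {D : ℝ} (hX : MomentLe P p X D) {c : ℂ}
    (hc : ‖c‖ = 1) : MomentLe P p (fun ω => c * X ω) D := by
  have e : ∀ ω, ‖c * X ω‖ ^ p = ‖X ω‖ ^ p := fun ω => by rw [norm_mul, hc, one_mul]
  refine ⟨hX.aemeasurable.const_mul _, ?_, ?_⟩ <;> simp only [e]
  · exact hX.integrable
  · exact hX.integral_le

/-- The sum is a centred Gaussian of variance at most V R², so its moments are those of a standard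
Gaussian up to scaling. -/
theorem momentLe_sum_ofReal [IsProbabilityMeasure P] {g : ι → Ω → ℝ} {v : ι → ℝ≥0} {V : ℝ} (hV : 0 ≤ V)
    (hg : iIndepFun g P) (hlaw : ∀ i, HasLaw (g i) (gaussianReal 0 (v i)) P) (hv : ∀ i, v i ≤ V)
    {R : ℝ} (hR : 0 ≤ R) (b : ι → ℝ) (S : Finset ι) (hb : ∑ i ∈ S, b i ^ 2 ≤ R ^ 2) (p : ℕ) :
    MomentLe P p (fun ω => ∑ i ∈ S, (b i : ℂ) * (g i ω : ℂ)) ((√V * R) ^ p * gaussMoment p) := by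
  have h := hasLaw_sum_gaussianReal hg hlaw b S
  have e : ∀ ω, ‖∑ i ∈ S, (b i : ℂ) * (g i ω : ℂ)‖ ^ p = |∑ i ∈ S, b i * g i ω| ^ p := fun ω => by
    rw [← Real.norm_eq_abs, ← Complex.norm_real]
    push_cast
    rfl
  have hm : AEMeasurable (fun ω => ∑ i ∈ S, (b i : ℂ) * (g i ω : ℂ)) P := by
    have := Complex.measurable_ofReal.comp_aemeasurable h.aemeasurable
    refine this.congr (Eventually.of_forall fun ω => ?_)
    simp
  have hi := integrable_abs_pow_gaussianReal (∑ i ∈ S, NNReal.mk (b i ^ 2) (sq_nonneg _) * v i) p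
  have hI := integral_abs_pow_gaussianReal (∑ i ∈ S, NNReal.mk (b i ^ 2) (sq_nonneg _) * v i) p
  rw [← h.map_eq] at hi hI
  have hsm : AEStronglyMeasurable (fun x : ℝ => |x| ^ p) (P.map fun ω => ∑ i ∈ S, b i * g i ω) :=
    (by fun_prop : Measurable fun x : ℝ => |x| ^ p).aestronglyMeasurable
  rw [integral_map h.aemeasurable hsm] at hI
  refine ⟨hm, ?_, ?_⟩ <;> simp only [e]
  · exact (integrable_map_measure hsm h.aemeasurable).mp hi
  · rw [hI]
    have := gaussMoment_nonneg p
    gcongr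
    rw [← Real.sqrt_sq hR, mul_comm, ← Real.sqrt_mul (sq_nonneg R)]
    refine Real.sqrt_le_sqrt ?_
    push_cast
    calc ∑ i ∈ S, b i ^ 2 * (v i : ℝ) ≤ ∑ i ∈ S, b i ^ 2 * V := by
          gcongr with i _
          exact hv i
      _ = (∑ i ∈ S, b i ^ 2) * V := (Finset.sum_mul _ _ _).symm
      _ ≤ R ^ 2 * V := by
          gcongr

theorem momentLe_sum [IsProbabilityMeasure P] {g : ι → Ω → ℝ} {v : ι → ℝ≥0} {V : ℝ} (hV : 0 ≤ V)
    (hg : iIndepFun g P) (hlaw : ∀ i, HasLaw (g i) (gaussianReal 0 (v i)) P) (hv : ∀ i, v i ≤ V)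
    {R : ℝ} (hR : 0 ≤ R) (c : ι → ℂ) (S : Finset ι) (hc : ∑ i ∈ S, ‖c i‖ ^ 2 ≤ R ^ 2) (p : ℕ) :
    MomentLe P p (fun ω => ∑ i ∈ S, c i * (g i ω : ℂ))
      (2 ^ (p - 1) * ((√V * R) ^ p * gaussMoment p + (√V * R) ^ p * gaussMoment p)) := by
  have h1 := momentLe_sum_ofReal hV hg hlaw hv hR (fun i => (c i).re) S
    ((Finset.sum_le_sum fun i _ => by
      rw [← sq_abs]
      exact pow_le_pow_left₀ (abs_nonneg _) (Complex.abs_re_le_norm _) 2).trans hc) p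
  have h2 := momentLe_sum_ofReal hV hg hlaw hv hR (fun i => (c i).im) S
    ((Finset.sum_le_sum fun i _ => by
      rw [← sq_abs]
      exact pow_le_pow_left₀ (abs_nonneg _) (Complex.abs_im_le_norm _) 2).trans hc) p
  have e : (fun ω => ∑ i ∈ S, c i * (g i ω : ℂ)) = fun ω =>
      (∑ i ∈ S, ((c i).re : ℂ) * (g i ω : ℂ)) +
        Complex.I * ∑ i ∈ S, ((c i).im : ℂ) * (g i ω : ℂ) := by
    funext ω
    rw [Finset.mul_sum, ← Finset.sum_add_distrib]
    refine Finset.sum_congr rfl fun i _ => ?_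
    nth_rewrite 1 [← Complex.re_add_im (c i)]
    ring
  rw [e]
  exact h1.add (h2.mul_of_norm_eq_one Complex.norm_I)

/-- Complex random variables of size `|k|⁻¹` which are linear combinations of two real variables
out of an independent Gaussian family, different for different indices. -/
structure IsGaussianNoise (P : Measure Ω) (D : ℝ) (x : (Fin 2 → ℤ) × Fin 3 → Ω → ℂ) : Prop where
  exists_eq : ∃ (ι : Type) (g : ι → Ω → ℝ) (v : ι → ℝ≥0) (u w : (Fin 2 → ℤ) × Fin 3 → ι)
    (A B : (Fin 2 → ℤ) × Fin 3 → ℂ), iIndepFun g P ∧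
      (∀ i, HasLaw (g i) (gaussianReal 0 (v i)) P) ∧ (∀ i, v i ≤ D) ∧
      (∀ a b, a ≠ b → u a ≠ u b ∧ u a ≠ w b ∧ w a ≠ w b) ∧
      (∀ a, ‖A a‖ ≤ D * (wt a.1)⁻¹) ∧ (∀ a, ‖B a‖ ≤ D * (wt a.1)⁻¹) ∧
      ∀ a ω, x a ω = A a * g (u a) ω + B a * g (w a) ω

namespace IsGaussianNoise

variable {D : ℝ} {x : (Fin 2 → ℤ) × Fin 3 → Ω → ℂ}

/-- For fixed j the variables u(k, j) are distinct for different k, and so are the w(k, j); each of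
the two sums runs over an independent subfamily. The two sums are then added by convexity, which
requires no independence between them. -/
theorem exists_momentBound [IsProbabilityMeasure P] (hD : 0 ≤ D) (h : IsGaussianNoise P D x)
    (p : ℕ) : ∃ M, ∀ j, MomentBound P p (fun k => x (k, j)) M := by
  obtain ⟨ι, g, v, u, w, A, B, hg, hlaw, hv, hne, hA, hB, hx⟩ := h.exists_eq
  have key : ∀ (S : Finset (Fin 2 → ℤ)) (c E : (Fin 2 → ℤ) → ℂ) (R : ℝ), 0 ≤ R →
      (∀ k, ‖E k‖ ≤ D * (wt k)⁻¹) → ∑ k ∈ S, ‖c k‖ ^ 2 * wt k ^ (-2 : ℝ) ≤ R ^ 2 →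
      ∑ k ∈ S, ‖c k * E k‖ ^ 2 ≤ (D * R) ^ 2 := fun S c E R hR hE hS => by
    calc ∑ k ∈ S, ‖c k * E k‖ ^ 2 ≤ ∑ k ∈ S, D ^ 2 * (‖c k‖ ^ 2 * wt k ^ (-2 : ℝ)) := by
          refine Finset.sum_le_sum fun k _ => ?_
          have hw := wt_pos k
          have e : wt k ^ (-2 : ℝ) = ((wt k)⁻¹) ^ 2 := by
            rw [Real.rpow_neg hw.le, inv_pow]; norm_cast
          rw [norm_mul, e]
          calc (‖c k‖ * ‖E k‖) ^ 2 ≤ (‖c k‖ * (D * (wt k)⁻¹)) ^ 2 := by gcongr; exact hE k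
            _ = _ := by ring
      _ ≤ D ^ 2 * R ^ 2 := by rw [← Finset.mul_sum]; gcongr
      _ = _ := (mul_pow _ _ _).symm
  have hmom : ∀ j S (c : (Fin 2 → ℤ) → ℂ) R, 0 ≤ R →
      ∑ k ∈ S, ‖c k‖ ^ 2 * wt k ^ (-2 : ℝ) ≤ R ^ 2 →
      MomentLe P p (fun ω => ∑ k ∈ S, c k * x (k, j) ω)
        (4 * (2 ^ (p - 1) * 2 ^ (p - 1)) * (√D * D) ^ p * gaussMoment p * R ^ p) := by
    intro j S c R hR hS
    have hu : Function.Injective fun k => u (k, j) := fun k l hkl => by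
      by_contra hn
      exact (hne (k, j) (l, j) fun h => hn (Prod.ext_iff.mp h).1).1 hkl
    have hw : Function.Injective fun k => w (k, j) := fun k l hkl => by
      by_contra hn
      exact (hne (k, j) (l, j) fun h => hn (Prod.ext_iff.mp h).1).2.2 hkl
    have h1 := momentLe_sum hD (hg.precomp hu) (fun k => hlaw (u (k, j))) (fun k => hv _)
      (R := D * R) (by positivity) (fun k => c k * A (k, j)) S (key S c _ R hR (fun k => hA (k, j)) hS) p
    have h2 := momentLe_sum hD (hg.precomp hw) (fun k => hlaw (w (k, j))) (fun k => hv _)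
      (R := D * R) (by positivity) (fun k => c k * B (k, j)) S (key S c _ R hR (fun k => hB (k, j)) hS) p
    have h3 := h1.add h2
    have e : (fun ω => ∑ k ∈ S, c k * x (k, j) ω) = fun ω =>
        (∑ k ∈ S, c k * A (k, j) * (g (u (k, j)) ω : ℂ)) +
          ∑ k ∈ S, c k * B (k, j) * (g (w (k, j)) ω : ℂ) := by
      funext ω
      rw [← Finset.sum_add_distrib]
      refine Finset.sum_congr rfl fun k _ => ?_
      rw [hx]
      ring
    rw [e]
    convert h3 using 1
    rw [show √D * (D * R) = √D * D * R by ring, mul_pow _ R]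
    ring
  refine ⟨_, fun j => ⟨fun k => ?_, fun S c => ?_, fun S c R hR hS => (hmom j S c R hR hS).integral_le⟩⟩
  -- Only measurability is wanted, so R is chosen to make the hypothesis on R an equality.
  · have := (hmom j {k} (fun _ => 1) √(∑ k ∈ {k}, ‖(1 : ℂ)‖ ^ 2 * wt k ^ (-2 : ℝ))
      (Real.sqrt_nonneg _) (Real.sq_sqrt (Finset.sum_nonneg fun k _ =>
        mul_nonneg (sq_nonneg _) (Real.rpow_nonneg (wt_pos k).le _))).ge).aemeasurable
    simpa using this
  · exact (hmom j S c √(∑ k ∈ S, ‖c k‖ ^ 2 * wt k ^ (-2 : ℝ)) (Real.sqrt_nonneg _)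
      (Real.sq_sqrt (Finset.sum_nonneg fun k _ =>
        mul_nonneg (sq_nonneg _) (Real.rpow_nonneg (wt_pos k).le _))).ge).integrable

/-- If a differs from b, c and d, then `x a` is built from real variables that do not occur in the
other three factors. It is independent of their product and centred, so the fourth moment vanishes.
-/
theorem exists_noiseFamily [IsProbabilityMeasure P] (hD : 0 ≤ D) (h : IsGaussianNoise P D x) :
    ∃ C, NoiseFamily P x C := by
  classical
  obtain ⟨M, hM⟩ := h.exists_momentBound hD 4
  refine ⟨M, fun i => ?_, fun i => ?_, fun a b c d hab hac had => ?_⟩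
  · have h1 := (hM i.2).integrable {i.1} fun _ => 1
    simp only [Finset.sum_singleton, one_mul, Prod.mk.eta] at h1
    refine (integrable_norm_rpow_iff ((hM i.2).aemeasurable i.1).aestronglyMeasurable
      (by norm_num) (by norm_num)).mp ?_
    refine h1.congr (Eventually.of_forall fun ω => ?_)
    norm_num
  · have hw := wt_pos i.1
    have h1 := (hM i.2).integral_le {i.1} (fun _ => 1) (wt i.1)⁻¹ (by positivity) (by
      rw [Finset.sum_singleton, norm_one, one_pow, one_mul, Real.rpow_neg hw.le, inv_pow]
      norm_cast)
    simp only [Finset.sum_singleton, one_mul, Prod.mk.eta] at h1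
    refine h1.trans (le_of_eq ?_)
    rw [Real.rpow_neg hw.le, inv_pow]
    norm_cast
  · obtain ⟨ι, g, v, u, w, A, B, hg, hlaw, hv, hne, hA, hB, hx⟩ := h.exists_eq
    set S : Finset ι := {u a, w a}
    set T : Finset ι := {u b, w b, u c, w c, u d, w d}
    have hST : Disjoint S T := by
      rw [Finset.disjoint_left]
      intro i hi hiT
      simp only [S, T, Finset.mem_insert, Finset.mem_singleton] at hi hiT
      have n1 := hne a b hab
      have n2 := hne a c hac
      have n3 := hne a d had
      have n4 := (hne b a hab.symm).2.1
      have n5 := (hne c a hac.symm).2.1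
      have n6 := (hne d a had.symm).2.1
      grind
    have hind := hg.indepFun_finset₀ S T hST fun i => (hlaw i).aemeasurable
    have hS : ∀ i : S, Measurable fun q : S → ℝ => (q i : ℂ) := fun i =>
      Complex.measurable_ofReal.comp (measurable_pi_apply i)
    have hT : ∀ i : T, Measurable fun q : T → ℝ => (q i : ℂ) := fun i =>
      Complex.measurable_ofReal.comp (measurable_pi_apply i)
    have hst : Measurable (star : ℂ → ℂ) := continuous_star.measurable
    let φ : (S → ℝ) → ℂ := fun q => A a * q ⟨u a, by simp [S]⟩ + B a * q ⟨w a, by simp [S]⟩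
    have hφ : Measurable φ := ((hS _).const_mul _).add ((hS _).const_mul _)
    let ψ : (T → ℝ) → ℂ := fun q =>
      star (A b * q ⟨u b, by simp [T]⟩ + B b * q ⟨w b, by simp [T]⟩) *
      star (A c * q ⟨u c, by simp [T]⟩ + B c * q ⟨w c, by simp [T]⟩) *
      (A d * q ⟨u d, by simp [T]⟩ + B d * q ⟨w d, by simp [T]⟩)
    have hψ : Measurable ψ := ((hst.comp (((hT _).const_mul _).add ((hT _).const_mul _))).mul
      (hst.comp (((hT _).const_mul _).add ((hT _).const_mul _)))).mul
      (((hT _).const_mul _).add ((hT _).const_mul _))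
    have hi : IndepFun (x a) (fun ω => star (x b ω) * star (x c ω) * x d ω) P := by
      have := hind.comp hφ hψ
      convert this using 1
      · funext ω; exact hx a ω
      · funext ω; simp only [hx, ψ, Function.comp]
    have hm : ∀ a, AEMeasurable (x a) P := fun a => (hM a.2).aemeasurable a.1
    have h0 : ∀ i, Integrable (fun ω => (g i ω : ℂ)) P ∧ ∫ ω, (g i ω : ℂ) ∂P = 0 := fun i => by
      have h1 := (hlaw i).integral_eq
      have h2 : Integrable id (P.map (g i)) := by
        rw [(hlaw i).map_eq]
        exact (memLp_id_gaussianReal 1).integrable le_rfl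
      rw [integral_complex_ofReal, h1, integral_id_gaussianReal]
      exact ⟨((integrable_map_measure (by fun_prop) (hlaw i).aemeasurable).mp h2).ofReal, rfl⟩
    have hz : ∫ ω, x a ω ∂P = 0 := by
      simp only [hx]
      rw [integral_add ((h0 _).1.const_mul _) ((h0 _).1.const_mul _), integral_const_mul,
        integral_const_mul, (h0 _).2, (h0 _).2]
      simp
    have := hi.integral_fun_mul_eq_mul_integral (hm a).aestronglyMeasurable
      (((hst.comp_aemeasurable (hm b)).mul (hst.comp_aemeasurable (hm c))).mul
        (hm d)).aestronglyMeasurable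
    rw [hz, zero_mul] at this
    rw [← this]
    refine integral_congr_ae (Eventually.of_forall fun ω => ?_)
    simp only [mul_assoc]

end IsGaussianNoise

end

/-! ## Bounds for white noise -/

theorem dbarInv_add (ξ ξ' : (Fin 2 → ℤ) → ℂ) :
    dbarInv (fun k => ξ k + ξ' k) = fun k => dbarInv ξ k + dbarInv ξ' k := by
  funext k; simp only [dbarInv]; ring

theorem mollSeq_add (f : Plane → ℝ) (ε : ℝ) (z z' : (Fin 2 → ℤ) → ℂ) :
    mollSeq f ε (fun k => z k + z' k) = fun k => mollSeq f ε z k + mollSeq f ε z' k := by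
  funext k; simp only [mollSeq]; ring

theorem norm_dbarSymbol_le (k : Fin 2 → ℤ) : ‖dbarSymbol k‖ ≤ 2 * wt k := by
  have h : ∀ i, ‖(k i : ℂ)‖ ≤ wt k := fun i => by
    have h1 := norm_le_pi_norm k i
    rw [Complex.norm_intCast, ← Int.norm_eq_abs]
    unfold wt
    linarith
  have e : 2 * ‖dbarSymbol k‖ = ‖(k 0 : ℂ) + Complex.I * (k 1 : ℂ)‖ := by
    simp [dbarSymbol]
  have h1 := norm_add_le (k 0 : ℂ) (Complex.I * (k 1 : ℂ))
  rw [norm_mul, Complex.norm_I, one_mul] at h1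
  linarith [h 0, h 1, wt_pos k]

/-- Multiplication by the symbol recovers ξ except for its mean, which `dbarInv` forgets and which
is added back as a single coefficient. -/
theorem HsBound.of_dbarInv {s M : ℝ} {ξ : (Fin 2 → ℤ) → ℂ} (h : HsBound s (dbarInv ξ) M) :
    ∃ M', HsBound (s - 1) ξ M' := by
  obtain ⟨M', hM'⟩ := (wtSummable_single ⌈s - 1⌉₊ (ξ 0)).exists_hsBound (Nat.le_ceil (s - 1))
  have h1 : HsBound (s - 1) (fun k => dbarSymbol k * dbarInv ξ k) (2 * M) :=
    h.of_le zero_le_two fun k => by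
      have hw := wt_pos k
      rw [norm_mul, Real.rpow_sub_one hw.ne']
      calc _ ≤ wt k ^ s / wt k * (2 * wt k * ‖dbarInv ξ k‖) := by
            gcongr; exact norm_dbarSymbol_le k
        _ = _ := by field_simp
  refine ⟨_, ((h1.const_mul (-Complex.I)).add hM').of_le (g := ξ) zero_le_one fun k => ?_⟩
  rw [one_mul]
  refine le_of_eq ?_
  congr 2
  by_cases hk : k = 0
  · subst hk
    simp [dbarSymbol_zero]
  · have := dbarSymbol_ne_zero hk
    rw [Pi.single_eq_of_ne hk, add_zero, dbarInv]
    field_simp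
    rw [Complex.I_sq]
    ring

/-- The coefficients of `∂_{z̄}⁻¹ (i ζ)`, or of `∂_{z̄}⁻¹ (i ζ̄)`. -/
noncomputable def noiseHalf (ζ : (Fin 2 → ℤ) → ℂ) (t : Bool) : (Fin 2 → ℤ) → ℂ :=
  dbarInv (bif t then starSeq ζ else ζ)

/-- The constant in the bounds for a noise in terms of the bounds for its halves. -/
noncomputable def noiseConst (κ K : ℝ) : ℝ := 2 * K + 2 * √K + 2 * √(√K) + 4 * √(4 / κ * K)

/-- Linear quantities are sums of two halves, and a product of two noises expands into four products
of halves. `noiseConst` dominates all the resulting constants. -/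
theorem roughNoise_of_halves {f : Plane → ℝ} (h : IsKernel f) {κ K : ℝ} (hκ : 0 < κ)
    (hκ1 : κ < 1 / 2) (hK : 0 ≤ K) {ζ : Fin 3 → (Fin 2 → ℤ) → ℂ} (h0 : ∀ j, ‖ζ j 0‖ ≤ K)
    (h2 : ζ 2 0 = 0) (hH : ∀ j t, HsBound (-(3 * κ / 8)) (noiseHalf (ζ j) t) (√K))
    (hO : ∀ j t, OpBound (noiseHalf (ζ j) t) (1 - 5 * κ / 8) (3 * κ / 8) (√(√K)))
    (hP : ∀ j t, DistSummable (noiseHalf (ζ j) t) → ∀ ε, 0 < ε → ε ≤ 1 →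
      PairBound κ (fun k => mollSeq f ε (noiseHalf (ζ j) t) k - noiseHalf (ζ j) t k)
        (K * ε ^ (κ / 8)))
    (hC : ∀ j t t', (∀ ε, 0 < ε → WtSummable 0 (mollSeq f ε (noiseHalf (ζ (j + 1)) t))) →
      (∀ ε, 0 < ε → WtSummable 0 (mollSeq f ε (starSeq (noiseHalf (ζ (j + 2)) t')))) →
      ∀ ε ε', 0 < ε' → ε' ≤ ε → ε ≤ 1 → HsBound (-(κ / 2)) (fun k =>
        conv (mollSeq f ε (noiseHalf (ζ (j + 1)) t))
          (mollSeq f ε (starSeq (noiseHalf (ζ (j + 2)) t'))) k -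
        conv (mollSeq f ε' (noiseHalf (ζ (j + 1)) t))
          (mollSeq f ε' (starSeq (noiseHalf (ζ (j + 2)) t'))) k)
        (√(4 / κ * K) * ε ^ (κ / 8))) :
    RoughNoise f κ (noiseConst κ K) fun j k => ζ j k + starSeq (ζ j) k := by
  have q1 := Real.sqrt_nonneg K
  have q2 := Real.sqrt_nonneg √K
  have q3 := Real.sqrt_nonneg (4 / κ * K)
  have e : ∀ j, dbarInv (fun k => ζ j k + starSeq (ζ j) k) =
      fun k => noiseHalf (ζ j) false k + noiseHalf (ζ j) true k := fun j => dbarInv_add _ _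
  have hD : ∀ j t, DistSummable (noiseHalf (ζ j) t) := fun j t =>
    (hH j t).distSummable (by linarith)
  have hmD : ∀ ε j t, DistSummable (mollSeq f ε (noiseHalf (ζ j) t)) := fun ε j t =>
    (h.hsBound_mollSeq (hH j t) ε).distSummable (by linarith)
  have hz : ∀ j t ε, 0 < ε → WtSummable 0 (mollSeq f ε (noiseHalf (ζ j) t)) := fun j t ε hε =>
    h.wtSummable_mollSeq (hH j t) hε 0
  have hw : ∀ j t ε, 0 < ε → WtSummable 0 (mollSeq f ε (starSeq (noiseHalf (ζ j) t))) :=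
    fun j t ε hε => h.wtSummable_mollSeq (hH j t).starSeq hε 0
  have hHs : ∀ j, HsBound (-(3 * κ / 8)) (dbarInv fun k => ζ j k + starSeq (ζ j) k)
      (noiseConst κ K) := fun j => by
    rw [e]
    exact ((hH j false).add (hH j true)).mono (by unfold noiseConst; linarith)
  refine ⟨fun j k => ?_, fun j => ?_, ?_, fun j => ?_, ⟨hHs, fun j => ?_, ?_⟩, ?_⟩
  · simp only [starSeq, neg_neg, star_add, star_star]
    rw [add_comm]
  · refine (norm_add_le _ _).trans ?_
    rw [starSeq, norm_star, neg_zero]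
    have := h0 j
    unfold noiseConst
    linarith
  · simp [starSeq, h2]
  · obtain ⟨M, hM⟩ := (hHs j).of_dbarInv
    exact ⟨_, M, hM⟩
  · simp only [e]
    exact ((hO j false).add (hO j true)).mono (by unfold noiseConst; linarith)
  · intro j ε ε' hε' hle hε1
    have hε : 0 < ε := hε'.trans_le hle
    have hc : ∀ ε, 0 < ε → ∀ k, conv (mollSeq f ε (dbarInv fun k => ζ (j + 1) k + starSeq (ζ (j + 1)) k))
        (starSeq (mollSeq f ε (dbarInv fun k => ζ (j + 2) k + starSeq (ζ (j + 2)) k))) k =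
        (conv (mollSeq f ε (noiseHalf (ζ (j + 1)) false))
          (mollSeq f ε (starSeq (noiseHalf (ζ (j + 2)) false))) k +
        conv (mollSeq f ε (noiseHalf (ζ (j + 1)) false))
          (mollSeq f ε (starSeq (noiseHalf (ζ (j + 2)) true))) k) +
        (conv (mollSeq f ε (noiseHalf (ζ (j + 1)) true))
          (mollSeq f ε (starSeq (noiseHalf (ζ (j + 2)) false))) k +
        conv (mollSeq f ε (noiseHalf (ζ (j + 1)) true))
          (mollSeq f ε (starSeq (noiseHalf (ζ (j + 2)) true))) k) := fun ε hε k => by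
      have w := fun t => hw (j + 2) t ε hε
      have z := fun t => hz (j + 1) t ε hε
      rw [e, e, starSeq_mollSeq, mollSeq_add, starSeq_add, mollSeq_add,
        conv_add_left ((z false).convSummable ((w false).add (w true)) k)
          ((z true).convSummable ((w false).add (w true)) k),
        conv_add_right ((z false).convSummable (w false) k) ((z false).convSummable (w true) k),
        conv_add_right ((z true).convSummable (w false) k) ((z true).convSummable (w true) k)]
    have hb := fun t t' => hC j t t' (hz (j + 1) t) (hw (j + 2) t') ε ε' hε' hle hε1
    have hs := (((hb false false).add (hb false true)).add ((hb true false).add (hb true true)))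
    have hle' : √(4 / κ * K) * ε ^ (κ / 8) + √(4 / κ * K) * ε ^ (κ / 8) +
        (√(4 / κ * K) * ε ^ (κ / 8) + √(4 / κ * K) * ε ^ (κ / 8)) ≤
        noiseConst κ K * ε ^ (κ / 8) := by
      have : 0 ≤ ε ^ (κ / 8) := by positivity
      calc _ = (4 * √(4 / κ * K)) * ε ^ (κ / 8) := by ring
        _ ≤ _ := by gcongr; unfold noiseConst; linarith
    convert hs.mono hle' using 2 with k
    rw [hc ε hε, hc ε' hε']
    ring
  · intro j ε hε hε1
    have hb := fun t => hP j t (hD j t) ε hε hε1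
    have hs := (hb false).add (hb true) ((hmD ε j false).sub (hD j false))
      ((hmD ε j true).sub (hD j true))
    have hle' : K * ε ^ (κ / 8) + K * ε ^ (κ / 8) ≤ noiseConst κ K * ε ^ (κ / 8) := by
      have : 0 ≤ ε ^ (κ / 8) := by positivity
      calc _ = (2 * K) * ε ^ (κ / 8) := by ring
        _ ≤ _ := by gcongr; unfold noiseConst; linarith
    convert hs.mono hle' using 2 with k
    rw [e, mollSeq_add]
    ring

/-- Half of the coefficients of white noise: the noise has coefficients `ζ + ζ̄`. -/
noncomputable def whiteHalf (a : Fin 3 → ℝ) (c : Freq × Fin 3 → ℂ) (j : Fin 3) (k : Fin 2 → ℤ) : ℂ :=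
  if h : k ≠ 0 then c (⟨k, h⟩, j) / 2 else (a j : ℂ) / 2

theorem whiteHalf_zero (a : Fin 3 → ℝ) (c : Freq × Fin 3 → ℂ) (j : Fin 3) :
    whiteHalf a c j 0 = (a j : ℂ) / 2 := by simp [whiteHalf]

theorem whiteHalf_of_ne {a : Fin 3 → ℝ} {c : Freq × Fin 3 → ℂ} {j : Fin 3} {k : Fin 2 → ℤ}
    (h : k ≠ 0) : whiteHalf a c j k = c (⟨k, h⟩, j) / 2 := by simp [whiteHalf, h]

/-- The frequency whose variable enters the coefficient `k` of a half of the noise. -/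
def signFreq (t : Bool) (k : Freq) : Freq := ⟨bif t then -k.1 else k.1, by
  cases t
  · exact k.2
  · exact neg_ne_zero.mpr k.2⟩

theorem signFreq_injective (t : Bool) : Function.Injective (signFreq t) := by
  intro k l h
  have h1 : (bif t then -k.1 else k.1) = bif t then -l.1 else l.1 := congrArg Subtype.val h
  cases t
  · exact Subtype.ext h1
  · exact Subtype.ext (neg_injective h1)

/-- The index of the real variable which enters the coefficient `a` of a half of the noise, for an
embedding of the indices of the non-zero frequencies. -/
def varIndex (τ : Fin 3 → Bool) (F : Freq × Fin 3 → (Freq × Fin 3) ⊕ (Freq × Fin 3))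
    (a : (Fin 2 → ℤ) × Fin 3) : Fin 3 ⊕ ((Freq × Fin 3) ⊕ (Freq × Fin 3)) :=
  if h : a.1 ≠ 0 then Sum.inr (F (signFreq (τ a.2) ⟨a.1, h⟩, a.2)) else Sum.inl a.2

/-- For a fixed component, k ↦ ±k is injective, and the component is part of the index. Zero
frequencies have indices of their own. -/
theorem varIndex_ne (τ : Fin 3 → Bool) {F G : Freq × Fin 3 → (Freq × Fin 3) ⊕ (Freq × Fin 3)}
    (hFG : ∀ p q, F p = G q → p = q) {a b : (Fin 2 → ℤ) × Fin 3} (hab : a ≠ b) :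
    varIndex τ F a ≠ varIndex τ G b := by
  intro h
  apply hab
  obtain ⟨k, i⟩ := a
  obtain ⟨l, j⟩ := b
  simp only [varIndex] at h
  by_cases hk : k = 0 <;> by_cases hl : l = 0
  · simp only [hk, hl, ne_eq, not_true_eq_false, dite_false, Sum.inl.injEq] at h
    rw [hk, hl, h]
  · simp [hk, hl] at h
  · simp [hk, hl] at h
  · simp only [ne_eq, hk, hl, not_false_eq_true, dite_true, Sum.inr.injEq] at h
    have h1 := Prod.ext_iff.mp (hFG _ _ h)
    obtain ⟨h1, rfl⟩ := h1
    have := signFreq_injective _ h1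
    rw [Subtype.mk.injEq] at this
    exact Prod.ext this rfl

section

variable {Ω : Type*} [MeasurableSpace Ω] {P : Measure Ω}

/-- The conjugate half at k uses the variables of -k, with the sign of the imaginary part reversed.
The half is selected separately for every component by τ, so that products of any half of one
component with any half of another are covered. At k = 0 the coefficients vanish with the inverse
symbol. The constant 4 + s dominates both the size of the coefficients and the variances. -/
theorem isGaussianNoise_noiseHalf {s : ℝ≥0} {v₀ : Fin 3 → ℝ≥0} (hv₀ : ∀ j, v₀ j ≤ 1)
    {η₀ : Fin 3 → Ω → ℝ} {η : Freq × Fin 3 → Ω → ℂ}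
    (h₀ : ∀ j, HasLaw (η₀ j) (gaussianReal 0 (v₀ j)) P)
    (hre : ∀ p, HasLaw (fun ω => (η p ω).re) (gaussianReal 0 s) P)
    (him : ∀ p, HasLaw (fun ω => (η p ω).im) (gaussianReal 0 s) P)
    (hind : iIndepFun (Sum.elim η₀
      (Sum.elim (fun p ω => (η p ω).re) (fun p ω => (η p ω).im))) P) (τ : Fin 3 → Bool) :
    IsGaussianNoise P (4 + s) fun q ω =>
      noiseHalf (whiteHalf (fun j => η₀ j ω) (fun p => η p ω) q.2) (τ q.2) q.1 := by
  have hs := s.2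
  have hd : ∀ a : (Fin 2 → ℤ) × Fin 3, ‖(dbarSymbol a.1)⁻¹ * Complex.I / 2‖ ≤ (4 + s) * (wt a.1)⁻¹ := by
    intro a
    have h1 := norm_inv_dbarSymbol_le a.1
    have hw := inv_pos.mpr (wt_pos a.1)
    rw [norm_div, norm_mul, Complex.norm_I, mul_one, Complex.norm_ofNat]
    have : 0 ≤ (s : ℝ) * (wt a.1)⁻¹ := by positivity
    linarith
  refine ⟨_, _, Sum.elim v₀ fun _ => s, varIndex τ Sum.inl, varIndex τ Sum.inr,
    fun a => (dbarSymbol a.1)⁻¹ * Complex.I / 2, fun a => (dbarSymbol a.1)⁻¹ * Complex.I / 2 *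
      (bif τ a.2 then -Complex.I else Complex.I), hind, ?_, ?_, fun a b hab => ⟨?_, ?_, ?_⟩,
    hd, fun a => ?_, fun a ω => ?_⟩
  · rintro (j | p | p)
    · exact h₀ j
    · exact hre p
    · exact him p
  · rintro (j | p)
    · have : ((v₀ j : ℝ≥0) : ℝ) ≤ 1 := by exact_mod_cast hv₀ j
      simp only [Sum.elim_inl]
      linarith
    · simp
  · exact varIndex_ne τ (fun p q h => Sum.inl_injective h) hab
  · exact varIndex_ne τ (fun p q h => (Sum.inl_ne_inr h).elim) hab
  · exact varIndex_ne τ (fun p q h => Sum.inr_injective h) hab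
  · rw [norm_mul]
    refine (mul_le_of_le_one_right (norm_nonneg _) ?_).trans (hd a)
    cases τ a.2 <;> simp
  · obtain ⟨k, j⟩ := a
    by_cases hk : k = 0
    · subst hk
      simp [noiseHalf, dbarInv, dbarSymbol_zero]
    · have hk' : k ≠ 0 := hk
      simp only [noiseHalf, dbarInv, varIndex, dif_pos hk', Sum.elim_inr, Sum.elim_inl]
      cases hτ : τ j
      · have e := Complex.re_add_im (η (⟨k, hk'⟩, j) ω)
        simp only [cond_false, whiteHalf_of_ne hk', signFreq]
        nth_rewrite 1 [← e]
        ring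
      · have hn := neg_ne_zero.mpr hk'
        have e : (starRingEnd ℂ) (η (⟨-k, hn⟩, j) ω) =
            (η (⟨-k, hn⟩, j) ω).re - (η (⟨-k, hn⟩, j) ω).im * Complex.I := by
          apply Complex.ext <;> simp
        simp only [cond_true, starSeq, whiteHalf_of_ne hn, signFreq, Complex.star_def, map_div₀,
          Complex.conj_ofNat]
        rw [e]
        ring

theorem boundedInProb_abs_le [IsProbabilityMeasure P] {X : Ω → ℝ} {v : ℝ≥0}
    (h : HasLaw X (gaussianReal 0 v) P) : BoundedInProb P fun ω K => |X ω| ≤ K := by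
  have hm : AEStronglyMeasurable (fun x : ℝ => |x| ^ 1) (P.map X) :=
    (by fun_prop : Measurable fun x : ℝ => |x| ^ 1).aestronglyMeasurable
  have hi := integrable_abs_pow_gaussianReal v 1
  rw [← h.map_eq, integrable_map_measure hm h.aemeasurable] at hi
  refine BoundedInProb.of_frequently_real (Y := fun _ ω => |X ω|) (fun _ _ => abs_nonneg _)
    (fun _ => by simpa using! hi) (fun _ => le_rfl) fun ω K _ hfr => ?_
  obtain ⟨n, hn⟩ := hfr.exists
  exact hn

/-- There are finitely many components and choices of halves, so the bounds in probability hold on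
one common event. Monotonicity in K is what allows a common constant. -/
theorem boundedInProb_roughNoise [IsProbabilityMeasure P] {f : Plane → ℝ} (hf : IsKernel f)
    {κ : ℝ} (hκ : 0 < κ) (hκ1 : κ < 1 / 2) {s : ℝ≥0} {v₀ : Fin 3 → ℝ≥0} (hv₀ : ∀ j, v₀ j ≤ 1)
    {η₀ : Fin 3 → Ω → ℝ} {η : Freq × Fin 3 → Ω → ℂ}
    (h₀ : ∀ j, HasLaw (η₀ j) (gaussianReal 0 (v₀ j)) P) (h₂ : ∀ᵐ ω ∂P, η₀ 2 ω = 0)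
    (hre : ∀ p, HasLaw (fun ω => (η p ω).re) (gaussianReal 0 s) P)
    (him : ∀ p, HasLaw (fun ω => (η p ω).im) (gaussianReal 0 s) P)
    (hind : iIndepFun (Sum.elim η₀
      (Sum.elim (fun p ω => (η p ω).re) (fun p ω => (η p ω).im))) P) :
    BoundedInProb P fun ω K => RoughNoise f κ K fun j k =>
      whiteHalf (fun j => η₀ j ω) (fun p => η p ω) j k +
        starSeq (whiteHalf (fun j => η₀ j ω) (fun p => η p ω) j) k := by
  have hD : (0 : ℝ) ≤ 4 + s := by positivity
  have hG := isGaussianNoise_noiseHalf hv₀ h₀ hre him hind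
  set ζ : Ω → Fin 3 → (Fin 2 → ℤ) → ℂ := fun ω => whiteHalf (fun j => η₀ j ω) fun p => η p ω
  have hN := fun τ => (hG τ).exists_noiseFamily hD
  choose C hN using hN
  -- The least integer order allowed by the condition p ≥ 4/κ of the Hölder estimate.
  have hM := fun τ => (hG τ).exists_momentBound hD ⌈4 / κ⌉₊
  choose M hM using hM
  have bH : BoundedInProb P fun ω K =>
      ∀ q : Fin 3 × Bool, HsBound (-(3 * κ / 8)) (noiseHalf (ζ ω q.1) q.2) (√K) := by
    refine BoundedInProb.forall_finite (fun q => ?_) fun q ω K K' hK h => h.mono (Real.sqrt_le_sqrt hK)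
    exact (hN fun _ => q.2).boundedInProb_hsBound (by linarith) q.1
  have bO : BoundedInProb P fun ω K => ∀ q : Fin 3 × Bool,
      OpBound (noiseHalf (ζ ω q.1) q.2) (1 - 5 * κ / 8) (3 * κ / 8) (√(√K)) := by
    refine BoundedInProb.forall_finite (fun q => ?_) fun q ω K K' hK h =>
      h.mono (Real.sqrt_le_sqrt (Real.sqrt_le_sqrt hK))
    exact (hN fun _ => q.2).boundedInProb_opBound hκ hκ1 q.1
  have bP : BoundedInProb P fun ω K => ∀ q : Fin 3 × Bool,
      DistSummable (noiseHalf (ζ ω q.1) q.2) → ∀ ε, 0 < ε → ε ≤ 1 → PairBound κ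
        (fun k => mollSeq f ε (noiseHalf (ζ ω q.1) q.2) k - noiseHalf (ζ ω q.1) q.2 k)
        (K * ε ^ (κ / 8)) := by
    refine BoundedInProb.forall_finite (fun q => ?_) fun q ω K K' hK h hz ε hε hε1 =>
      (h hz ε hε hε1).mono (by gcongr)
    exact (hM (fun _ => q.2) q.1).boundedInProb_pairBound hf hκ hκ1 (Nat.le_ceil _)
  have bC : BoundedInProb P fun ω K => ∀ q : Fin 3 × Bool × Bool,
      (∀ ε, 0 < ε → WtSummable 0 (mollSeq f ε (noiseHalf (ζ ω (q.1 + 1)) q.2.1))) →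
      (∀ ε, 0 < ε → WtSummable 0 (mollSeq f ε (starSeq (noiseHalf (ζ ω (q.1 + 2)) q.2.2)))) →
      ∀ ε ε', 0 < ε' → ε' ≤ ε → ε ≤ 1 → HsBound (-(κ / 2)) (fun k =>
        conv (mollSeq f ε (noiseHalf (ζ ω (q.1 + 1)) q.2.1))
          (mollSeq f ε (starSeq (noiseHalf (ζ ω (q.1 + 2)) q.2.2))) k -
        conv (mollSeq f ε' (noiseHalf (ζ ω (q.1 + 1)) q.2.1))
          (mollSeq f ε' (starSeq (noiseHalf (ζ ω (q.1 + 2)) q.2.2))) k)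
        (√(4 / κ * K) * ε ^ (κ / 8)) := by
    refine BoundedInProb.forall_finite (fun q => ?_) fun q ω K K' hK h hz hw ε ε' hε' hle hε1 =>
      (h hz hw ε ε' hε' hle hε1).mono (by have := hε'.trans_le hle; gcongr)
    obtain ⟨j, t, t'⟩ := q
    have hj : j + 1 ≠ j + 2 := by fin_cases j <;> decide
    -- τ assigns the half t to one component of the product and t' to the other.
    have := (hN fun i => if i = j + 1 then t else t').boundedInProb_conv hf hκ hκ1 hj
    simpa only [if_true, hj.symm, if_false] using this
  have b0 : BoundedInProb P fun ω K => ∀ j, |η₀ j ω| ≤ K :=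
    BoundedInProb.forall_finite (fun j => boundedInProb_abs_le (h₀ j))
      fun j ω K K' hK h => h.trans hK
  have mH : ∀ ω K K', K ≤ K' →
      (∀ q : Fin 3 × Bool, HsBound (-(3 * κ / 8)) (noiseHalf (ζ ω q.1) q.2) (√K)) →
      ∀ q : Fin 3 × Bool, HsBound (-(3 * κ / 8)) (noiseHalf (ζ ω q.1) q.2) (√K') :=
    fun ω K K' hK h q => (h q).mono (Real.sqrt_le_sqrt hK)
  have m0 : ∀ ω K K', K ≤ K' → (∀ j, |η₀ j ω| ≤ K) → ∀ j, |η₀ j ω| ≤ K' :=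
    fun ω K K' hK h j => (h j).trans hK
  have bHO := (b0.and bH m0 mH).and bO
      (fun ω K K' hK h => ⟨m0 ω K K' hK h.1, mH ω K K' hK h.2⟩)
      fun ω K K' hK h q => (h q).mono (Real.sqrt_le_sqrt (Real.sqrt_le_sqrt hK))
  have bPC := bP.and bC (fun ω K K' hK h q hz ε hε hε1 => (h q hz ε hε hε1).mono (by gcongr))
    fun ω K K' hK h q hz hw ε ε' hε' hle hε1 =>
      (h q hz hw ε ε' hε' hle hε1).mono (by have := hε'.trans_le hle; gcongr)
  have bAll := bHO.and bPC
      (fun ω K K' hK h => ⟨⟨m0 ω K K' hK h.1.1, mH ω K K' hK h.1.2⟩,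
        fun q => (h.2 q).mono (Real.sqrt_le_sqrt (Real.sqrt_le_sqrt hK))⟩)
      fun ω K K' hK h => ⟨fun q hz ε hε hε1 => (h.1 q hz ε hε hε1).mono (by gcongr),
        fun q hz hw ε ε' hε' hle hε1 =>
          (h.2 q hz hw ε ε' hε' hle hε1).mono (by have := hε'.trans_le hle; gcongr)⟩
  refine (bAll.and_ae h₂).imp (g := noiseConst κ) (fun K hK => by unfold noiseConst; positivity)
    fun ω K hK h => ?_
  obtain ⟨⟨⟨⟨h0, hH⟩, hO⟩, hP, hC⟩, h2⟩ := h
  refine roughNoise_of_halves hf hκ hκ1 hK (fun j => ?_) ?_ (fun j t => hH (j, t))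
    (fun j t => hO (j, t)) (fun j t => hP (j, t)) fun j t t' => hC (j, t, t')
  · simp only [whiteHalf_zero, norm_div, Complex.norm_real, Real.norm_eq_abs,
      Complex.norm_ofNat]
    linarith [h0 j, abs_nonneg (η₀ j ω)]
  · simp only [whiteHalf_zero, h2]
    simp

end

/-! ## The mollified white noise -/

/-- Sums over ℤ² are invariant under k ↦ -k, so their value depends only on the even part of the
terms. -/
theorem HasSum.eq_of_add_neg {F H : (Fin 2 → ℤ) → ℂ} {a b : ℂ} (hF : HasSum F a) (hH : HasSum H b)
    (h : ∀ k, F k + F (-k) = H k + H (-k)) : a = b := by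
  have h1 := hF.add ((Equiv.neg _).hasSum_iff.mpr hF)
  have h2 := hH.add ((Equiv.neg _).hasSum_iff.mpr hH)
  have h3 := h1.unique (h2.congr_fun fun k => h k)
  linear_combination h3 / 2

theorem HasSum.of_freq {H : (Fin 2 → ℤ) → ℂ} {a : ℂ} (h : HasSum (fun k : Freq => H k) (a - H 0)) :
    HasSum H a := by
  have h1 := (hasSum_subtype_iff_indicator (f := H) (s := {k | k ≠ 0})).mp h
  have h2 := h1.add (hasSum_pi_single 0 (H 0))
  rw [sub_add_cancel] at h2
  refine h2.congr_fun fun k => ?_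
  by_cases hk : k = 0
  · subst hk; simp
  · simp [hk]

theorem setIntegral_cell_re_mul (c : ℂ) (k : Fin 2 → ℤ) (φ : TorusTest) :
    ∫ x in cell, (((c * character k x).re : ℝ) : ℂ) * (φ : Plane → ℂ) x =
      c / 2 * torusFT φ k + star (c / 2) * torusFT φ (-k) := by
  have hi : ∀ k, IntegrableOn (fun x => character k x * (φ : Plane → ℂ) x) cell := fun k =>
    ((continuous_character k).mul φ.2.1.continuous).integrableOn_cell
  have e : ∀ x, (((c * character k x).re : ℝ) : ℂ) * (φ : Plane → ℂ) x =
      c / 2 * (character k x * (φ : Plane → ℂ) x) +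
        star (c / 2) * (character (-k) x * (φ : Plane → ℂ) x) := fun x => by
    rw [Complex.re_eq_add_conj, map_mul, ← Complex.star_def, star_character,
      star_div₀]
    simp only [star_ofNat]
    ring
  simp only [e]
  rw [integral_add ((hi k).const_mul _) ((hi (-k)).const_mul _), integral_const_mul,
    integral_const_mul]
  rfl

/-- Taking real parts pairs the contributions of k and -k in the series for the distribution, while
the trigonometric series collects ζ and its conjugate at the same k. The terms differ but agree
after symmetrisation in k. -/
theorem mollify_eq_trigSeries {ρ : 𝓓((⊤ : TopologicalSpace.Opens Plane), ℝ)} (hρ : IsMollifier ρ)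
    {a : Fin 3 → ℝ} {c : Freq × Fin 3 → ℂ} {j : Fin 3} {T : TorusDistribution}
    (hT : ∀ φ : TorusTest, HasSum (fun k : Freq => ∫ x in cell,
        (((c (k, j) * character k x).re : ℝ) : ℂ) * (φ : Plane → ℂ) x)
      (pairing T φ - ∫ x in cell, ((a j : ℝ) : ℂ) * (φ : Plane → ℂ) x))
    {s M : ℝ} (hξ : HsBound s (fun k => whiteHalf a c j k + starSeq (whiteHalf a c j) k) M)
    {ε : ℝ} (hε : 0 < ε) (x : Plane) :
    mollify ρ ε hε T x = trigSeries (mollSeq (fun z => ρ (-z)) ε fun k =>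
      whiteHalf a c j k + starSeq (whiteHalf a c j) k) x := by
  have hf := hρ.isKernel
  set f : Plane → ℝ := fun z => ρ (-z)
  set ζ := whiteHalf a c j
  set Φ := mollifierKernel ρ ε hε x
  have hΦ : ∀ k, torusFT Φ k = character k x * waveFT f k ε := fun k =>
    torusFT_periodize_dilate k f hf.contDiff hf.hasCompactSupport ε hε x
  set H : (Fin 2 → ℤ) → ℂ := fun k => ζ k * torusFT Φ k + star (ζ k) * torusFT Φ (-k)
  have h1 : HasSum (fun k : Freq => H k) (pairing T Φ - H 0) := by
    have := hT Φ
    convert this using 1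
    · funext k
      rw [setIntegral_cell_re_mul]
      simp only [H, ζ, whiteHalf_of_ne k.2]
    · congr 1
      have e0 := setIntegral_cell_re_mul (a j : ℂ) 0 Φ
      simp only [character_zero_left, mul_one, Complex.ofReal_re] at e0
      rw [e0]
      simp only [H, ζ, whiteHalf_zero]
  have h2 : HasSum H (pairing T Φ) := h1.of_freq
  have h5 : HasSum (fun k => mollSeq f ε (fun k => ζ k + starSeq ζ k) k * character k x)
      (trigSeries (mollSeq f ε fun k => ζ k + starSeq ζ k) x) :=
    (summable_trigSeries (hf.wtSummable_mollSeq hξ hε 0).summable_norm x).hasSum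
  change pairing T Φ = _
  refine (HasSum.eq_of_add_neg h5 h2 fun k => ?_).symm
  simp only [H, hΦ, mollSeq, starSeq, neg_neg]
  ring

/-! ### The main theorem -/

theorem theorem1p3 {Ω : Type*} [MeasurableSpace Ω] (P : Measure Ω) [IsProbabilityMeasure P]
    (s : ℝ≥0) (hs : 0 < s)
    (Z : Set (Fin 3)) (hZ : (2 : Fin 3) ∈ Z)
    (W : Ω → Fin 3 → TorusDistribution) (hW : IsWhiteNoise3D P s Z W)
    (ρ : 𝓓((⊤ : TopologicalSpace.Opens Plane), ℝ)) (hρ : IsMollifier ρ)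
    (κ : ℝ) (hκ : κ ∈ Set.Ioo (0 : ℝ) (1 / 2))
    (δ : ℝ) (hδ : 0 < δ) :
    ∃ σ : ℝ, 0 < σ ∧ ∃ Ωδ : Set Ω, MeasurableSet Ωδ ∧ 1 - δ < P.real Ωδ ∧ ∃ C : ℝ,
      ∀ γ : EuclideanSpace ℝ (Fin 3), ‖γ‖ < σ →
        ∃ (rε : ℝ → Ω → Fin 3 → TorusTest) (r : Ω → Fin 3 → TorusDistribution),
          ∀ ω ∈ Ωδ,
            (∀ (ε : ℝ) (hε : 0 < ε),
              SolvesMollifiedCR γ (fun k => mollify ρ ε hε (W ω k)) (rε ε ω)) ∧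
            holderNorm (-κ) (r ω) < ∞ ∧
            Tendsto (fun ε => holderNorm (-κ) (fun k => toDistribution (rε ε ω k) - r ω k))
              (𝓝[>] 0) (𝓝 0) ∧
            ∀ ε : ℝ, 0 < ε →
              holderNorm (-κ) (fun k => toDistribution (rε ε ω k) - r ω k) ≤
                ENNReal.ofReal (C * ε ^ (κ / 8)) := by
  classical
  obtain ⟨η₀, η, hη₀, hη₀Z, hre, him, hind, hsum⟩ := hW
  have hf := hρ.isKernel
  -- A vanishing mean is a Gaussian of variance 0, so both kinds of components are treated alike.
  have h₀ : ∀ j, HasLaw (η₀ j) (gaussianReal 0 (if j ∈ Z then 0 else 1)) P := fun j => by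
    by_cases hj : j ∈ Z
    · rw [if_pos hj, gaussianReal_zero_var]
      exact hasLaw_dirac_of_ae_eq (hη₀Z j hj)
    · rw [if_neg hj]
      exact hη₀ j hj
  have hb := (boundedInProb_roughNoise hf hκ.1 hκ.2 (fun j => by split_ifs <;> simp) h₀
    (hη₀Z 2 hZ) hre him hind).and_ae hsum
  -- δ / 2 makes the final lower bound on the probability strict.
  obtain ⟨K, hK, A, hA, hPA, hH⟩ := hb (δ / 2) (half_pos hδ)
  obtain ⟨C, σ, hσ, hsol⟩ := hf.exists_rough_solution hκ.1 hκ.2 hK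
  refine ⟨σ, hσ, A, hA, ?_, C, fun γ hγ => ?_⟩
  · have h1 : P.real Aᶜ ≤ δ / 2 := ENNReal.toReal_le_of_le_ofReal (half_pos hδ).le hPA
    rw [probReal_compl_eq_one_sub hA] at h1
    linarith
  -- On A the noise obeys bounds with the deterministic constant K, which alone (with the kernel and
  -- κ) determines C and σ; the solution is then chosen for each ω separately.
  · choose! r R h using fun ω (hω : ω ∈ A) => hsol _ (hH ω hω).1 γ hγ
    refine ⟨fun ε ω => r ω ε, R, fun ω hω => ⟨fun ε hε => ?_, (h ω hω).2⟩⟩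
    have e : (fun k => mollify ρ ε hε (W ω k)) = fun j => trigSeries (mollSeq (fun z => ρ (-z)) ε
        fun k => whiteHalf (fun j => η₀ j ω) (fun p => η p ω) j k +
          starSeq (whiteHalf (fun j => η₀ j ω) (fun p => η p ω) j) k) := by
      funext j x
      obtain ⟨t, M, hM⟩ := (hH ω hω).1.exists_hsBound j
      exact mollify_eq_trigSeries hρ (a := fun j => η₀ j ω) (c := fun p => η p ω)
        ((hH ω hω).2 j) hM hε x
    rw [e]
    exact (h ω hω).1 ε hε
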